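/- Let $G$ be a compact Lie group with neutral element $e$, let $Y_1,\dots,Y_n$ be a basis of its Lie algebra, let $\partial_j$ be the left-invariant vector field given by $Y_j$, and put $\partial^\beta=\partial_1^{\beta_1}\cdots\partial_n^{\beta_n}$ for $\beta\in\mathbb N_0^n$. Fix a bi-invariant Riemannian metric on $G$ with Laplacian $\mathcal L$. For a continuous irreducible unitary matrix representation $\xi$ of $G$ let $\lambda_{[\xi]}\ge 0$ be the number with $-\mathcal L\xi_{ij}=\lambda_{[\xi]}\xi_{ij}$ for all $i,j$, and put $\langle\xi\rangle=(1+\lambda_{[\xi]})^{1/2}$. For a distribution $u$ on $G$ put $\widehat u(\xi)=\int_G u(y)\,\xi(y)^*\,dy$. The symbol of a continuous linear operator $A:C^\infty(G)\to C^\infty(G)$ is $\sigma_A(x,\xi)=\widehat{r_x}(\xi)$, where $r_x=R_A(x,\cdot)$ is the distribution with $Af(x)=\int_G f(xy^{-1})\,R_A(x,y)\,dy$ for all $f\in C^\infty(G)$. Call functions $q_1,\dots,q_r\in C^\infty(G)$ with $q_i(e)=0$, together with left-invariant differential operators $\partial_x^{(\alpha)}$ $(\alpha\in\mathbb N_0^r)$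 of order at most $|\alpha|$ with constant coefficients with respect to the $\partial^\beta$, a Taylor system if, with $q_\alpha=q_1^{\alpha_1}\cdots q_r^{\alpha_r}$, for every $u\in C^\infty(G)$ and every $N\ge 0$ there are $u_\alpha\in C^\infty(G)$ such that for all $x\in G$ $$u(x)=\sum_{|\alpha|\le N}\frac1{\alpha!}\,q_\alpha(x^{-1})\,\partial_x^{(\alpha)}u(e)+\sum_{|\alpha|=N+1}q_\alpha(x^{-1})\,u_\alpha(x).$$ For a Taylor system define difference operators by $\triangle_\xi^\alpha\widehat u(\xi)=\widehat{q_\alpha u}(\xi)$. Theorem. Taylor systems exist on $G$. Moreover, fix any Taylor system, let $m_1,m_2\in\mathbb R$, $\rho>\delta\ge 0$ and $\delta<1$, and let $A,B:C^\infty(G)\to C^\infty(G)$ be continuous and linear, with symbols satisfying, for all multi-indices $\alpha$ and $\beta$, $$\|\triangle_\xi^\alpha\sigma_A(x,\xi)\|_{op}\le C_\alpha\langle\xi\rangle^{m_1-\rho|\alpha|},\qquad \|\partial_x^\beta\sigma_B(x,\xi)\|_{op}\le C_\beta\langle\xi\rangle^{m_2+\delta|\beta|},$$ uniformly in $x\in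 G$ and $\xi$. Then $$\sigma_{AB}(x,\xi)\sim\sum_{\alpha\ge 0}\frac1{\alpha!}\,(\triangle_\xi^\alpha\sigma_A)(x,\xi)\,\partial_x^{(\alpha)}\sigma_B(x,\xi),$$ in the sense that for every $N\in\mathbb N_0$ there is a constant $C_N$ such that for all $x\in G$ and all $\xi$ $$\Bigl\|\sigma_{AB}(x,\xi)-\sum_{|\alpha|<N}\frac1{\alpha!}\,(\triangle_\xi^\alpha\sigma_A)(x,\xi)\,\partial_x^{(\alpha)}\sigma_B(x,\xi)\Bigr\|_{op}\le C_N\langle\xi\rangle^{m_1+m_2-(\rho-\delta)N}.$$ -/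

import Mathlib

open scoped Manifold ContDiff Topology

noncomputable section

namespace LieSymbol

section Smoothness

open MeasureTheory Set
open scoped Convolution

/-- A continuous homomorphism from a compact Lie group to the multiplicative monoid of a real
Banach algebra is smooth at the identity. -/
theorem contMDiffAt_one_of_hom {E : Type*} [NormedAddCommGroup E] [NormedSpace ℝ E]
    [FiniteDimensional ℝ E] {G : Type*} [TopologicalSpace G] [ChartedSpace E G] [Group G]
    [LieGroup 𝓘(ℝ, E) ∞ G] [CompactSpace G] [T2Space G]
    {R : Type*} [NormedRing R] [NormedAlgebra ℝ R] [CompleteSpace R]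
    (f : G →* R) (hf : Continuous f) : ContMDiffAt 𝓘(ℝ, E) 𝓘(ℝ, R) ∞ f 1 := by
  have : IsTopologicalGroup G := topologicalGroup_of_lieGroup 𝓘(ℝ, E) ∞
  borelize G
  borelize E
  let μ : Measure G := Measure.haar
  set φ := chartAt E (1 : G) with hφ
  -- a cut-off function supported in the chart
  let χ : SmoothBumpFunction 𝓘(ℝ, E) (1 : G) :=
    Classical.choice inferInstance
  have hχ1 : ∀ᶠ y in 𝓝 (1 : G), χ y = 1 := χ.eventuallyEq_one
  -- a neighbourhood on which everything is under control
  have hmul : Filter.Tendsto (fun p : G × G => p.1 * p.2) (𝓝 1 ×ˢ 𝓝 1) (𝓝 1) := by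
    have := (continuous_mul (M := G)).tendsto (1, 1)
    simpa [nhds_prod_eq] using this
  obtain ⟨W₀, hW₀, hW₀'⟩ : ∃ W ∈ 𝓝 (1 : G), ∀ a ∈ W, ∀ b ∈ W, χ (a * b) = 1 := by
    have := hmul.eventually hχ1
    obtain ⟨W, hW, h⟩ := Filter.mem_prod_same_iff.1 this
    exact ⟨W, hW, fun a ha b hb => h (mk_mem_prod ha hb)⟩
  obtain ⟨W, hWW₀, hWo, hW1⟩ := mem_nhds_iff.1 hW₀
  have hW : ∀ a ∈ W, ∀ b ∈ W, χ (a * b) = 1 := fun a ha b hb => hW₀' a (hWW₀ ha) b (hWW₀ hb)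
  have hnear : ∀ᶠ y in 𝓝 (1 : G), y ∈ W ∧ ‖f y - 1‖ < 1 / 2 := by
    refine Filter.Eventually.and (hWo.mem_nhds hW1) ?_
    have : Filter.Tendsto (fun y => ‖f y - 1‖) (𝓝 1) (𝓝 0) := by
      have h : Continuous fun y => ‖f y - 1‖ := by fun_prop
      simpa using h.tendsto 1
    exact this.eventually (gt_mem_nhds (by norm_num))
  obtain ⟨b, -, hb⟩ := ((SmoothBumpFunction.nhds_basis_support (I := 𝓘(ℝ, E)) (c := (1 : G))
    Filter.univ_mem).mem_iff).1 hnear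
  have hbW : ∀ y, b y ≠ 0 → y ∈ W := fun y hy => (hb hy).1
  have hbc : Continuous b := b.continuous
  have hint : ∀ {h : G → R}, Continuous h → Integrable h μ := fun hh =>
    hh.integrable_of_hasCompactSupport (HasCompactSupport.of_compactSpace _)
  have hintR : ∀ {h : G → ℝ}, Continuous h → Integrable h μ := fun hh =>
    hh.integrable_of_hasCompactSupport (HasCompactSupport.of_compactSpace _)
  -- the averaged operator is invertible
  set K : R := ∫ y, b y • f y ∂μ with hK
  set c : ℝ := ∫ y, b y ∂μ with hc
  have hcpos : 0 < c := by
    refine hbc.integral_pos_of_hasCompactSupport_nonneg_nonzero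
      (HasCompactSupport.of_compactSpace _) (fun y => b.nonneg) (x := 1) ?_
    simp
  have hKc : ‖c⁻¹ • K - 1‖ < 1 := by
    have h1 : K - c • (1 : R) = ∫ y, b y • (f y - 1) ∂μ := by
      rw [hK, hc, ← integral_smul_const, ← integral_sub]
      · simp [smul_sub]
      · exact hint (hbc.smul hf)
      · exact hint (hbc.smul continuous_const)
    have h2 : ‖K - c • (1 : R)‖ ≤ c * (1 / 2) := by
      rw [h1, hc, ← integral_mul_const]
      refine norm_integral_le_of_norm_le (hintR (hbc.mul continuous_const)) (.of_forall fun y => ?_)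
      rw [norm_smul, Real.norm_of_nonneg b.nonneg]
      by_cases hy : b y = 0
      · simp [hy]
      · exact mul_le_mul_of_nonneg_left (hb hy).2.le b.nonneg
    have h3 : c⁻¹ • K - 1 = c⁻¹ • (K - c • (1 : R)) := by
      rw [smul_sub, smul_smul, inv_mul_cancel₀ hcpos.ne', one_smul]
    rw [h3, norm_smul, Real.norm_of_nonneg (inv_nonneg.2 hcpos.le)]
    calc c⁻¹ * ‖K - c • (1 : R)‖ ≤ c⁻¹ * (c * (1 / 2)) := by gcongr
      _ = 1 / 2 := by field_simp
      _ < 1 := by norm_num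
  obtain ⟨u, hu⟩ : IsUnit (c⁻¹ • K) := by
    have := isUnit_one_sub_of_norm_lt_one (x := 1 - c⁻¹ • K) (by rwa [norm_sub_rev])
    simpa using this
  have hKu : K * (c⁻¹ • ((u⁻¹ : Rˣ) : R)) = 1 := by
    have : (c⁻¹ • K) * ((u⁻¹ : Rˣ) : R) = 1 := by rw [← hu]; simp
    rw [mul_smul_comm, ← smul_mul_assoc]; exact this
  -- convolution with the bump function
  have hconv : ∀ x, ∫ y, b (x⁻¹ * y) • f y ∂μ = f x * K := by
    intro x
    rw [← integral_mul_left_eq_self (μ := μ) _ x, hK, ← integral_const_mul_of_integrable]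
    · simp
    · exact hint (hbc.smul hf)
  -- the convolution read in the chart
  set ν : Measure E := (μ.restrict φ.source).map φ with hν
  have hφm : AEMeasurable φ (μ.restrict φ.source) :=
    φ.continuousOn.aemeasurable φ.open_source.measurableSet
  have : IsFiniteMeasure ν := by rw [hν]; infer_instance
  let f₀ : E → R := φ.target.indicator (f ∘ φ.symm)
  have hf₀m : AEStronglyMeasurable f₀ ν := by
    refine (aestronglyMeasurable_indicator_iff φ.open_target.measurableSet).2 ?_
    exact (hf.comp_continuousOn φ.continuousOn_symm).aestronglyMeasurable
      φ.open_target.measurableSet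
  obtain ⟨C, hC⟩ : ∃ C, ∀ y, ‖f y‖ ≤ C := by
    obtain ⟨C, hC⟩ := isCompact_univ.exists_bound_of_continuousOn hf.continuousOn
    exact ⟨C, fun y => hC y (mem_univ y)⟩
  have hC0 : 0 ≤ C := (norm_nonneg _).trans (hC 1)
  have hf₀ : LocallyIntegrable f₀ ν := by
    refine (Integrable.of_bound hf₀m C (.of_forall fun t => ?_)).locallyIntegrable
    by_cases ht : t ∈ φ.target
    · simpa [f₀, ht] using hC _
    · simpa [f₀, ht] using hC0
  let g₁ : E → E → ℝ := fun p v =>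
    φ.target.indicator (fun v => χ (φ.symm v) * b ((φ.symm p)⁻¹ * φ.symm v)) v
  let g : E → E → ℝ := fun p v => g₁ p (-v)
  let s : Set E := φ.target ∩ φ.symm ⁻¹' W
  have hs : IsOpen s := φ.symm.isOpen_inter_preimage hWo
  let k₁ : Set E := φ '' tsupport χ
  have hχs : tsupport χ ⊆ φ.source := χ.tsupport_subset_chartAt_source
  have hk₁ : IsCompact k₁ :=
    (χ.hasCompactSupport.isCompact).image_of_continuousOn (φ.continuousOn.mono hχs)
  have hk₁t : k₁ ⊆ φ.target := by
    rintro _ ⟨y, hy, rfl⟩; exact φ.map_source (hχs hy)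
  have hg₁0 : ∀ p v, v ∉ k₁ → g₁ p v = 0 := by
    intro p v hv
    by_cases ht : v ∈ φ.target
    · have : χ (φ.symm v) = 0 := by
        by_contra h0
        exact hv ⟨φ.symm v, subset_tsupport _ h0, φ.right_inv ht⟩
      simp [g₁, ht, this]
    · simp [g₁, ht]
  have hsymm : ContMDiffOn 𝓘(ℝ, E) 𝓘(ℝ, E) ∞ φ.symm φ.target := contMDiffOn_chart_symm
  have hg₁ : ContDiffOn ℝ ∞ (fun q : E × E => g₁ q.1 q.2) (s ×ˢ univ) := by
    intro q hq
    refine ContDiffAt.contDiffWithinAt ?_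
    by_cases hqk : q.2 ∈ k₁
    · have hqt := hk₁t hqk
      have hnb : (φ.target ×ˢ φ.target : Set (E × E)) ∈ 𝓝 q :=
        (φ.open_target.prod φ.open_target).mem_nhds ⟨hq.1.1, hqt⟩
      have h1 : ContMDiffAt 𝓘(ℝ, E × E) 𝓘(ℝ, E) ∞ (fun q : E × E => φ.symm q.1) q :=
        ((hsymm.contMDiffAt (φ.open_target.mem_nhds hq.1.1)).comp q
          contDiff_fst.contMDiff.contMDiffAt)
      have h2 : ContMDiffAt 𝓘(ℝ, E × E) 𝓘(ℝ, E) ∞ (fun q : E × E => φ.symm q.2) q :=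
        ((hsymm.contMDiffAt (φ.open_target.mem_nhds hqt)).comp q
          contDiff_snd.contMDiff.contMDiffAt)
      have h3 : ContMDiffAt 𝓘(ℝ, E × E) 𝓘(ℝ, ℝ) ∞ (fun q : E × E =>
          χ (φ.symm q.2) * b ((φ.symm q.1)⁻¹ * φ.symm q.2)) q :=
        (χ.contMDiff.contMDiffAt.comp q h2).mul (b.contMDiff.contMDiffAt.comp q (h1.inv.mul h2))
      refine h3.contDiffAt.congr_of_eventuallyEq ?_
      filter_upwards [hnb] with q' hq'
      simp [g₁, hq'.2]
    · have : (fun q : E × E => g₁ q.1 q.2) =ᶠ[𝓝 q] fun _ => 0 := by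
        have : Prod.snd ⁻¹' k₁ᶜ ∈ 𝓝 q :=
          (hk₁.isClosed.isOpen_compl.preimage continuous_snd).mem_nhds hqk
        filter_upwards [this] with q' hq' using hg₁0 _ _ hq'
      exact contDiffAt_const.congr_of_eventuallyEq this
  have hg : ContDiffOn ℝ ((⊤ : ℕ∞) : WithTop ℕ∞) (fun q : E × E => g q.1 q.2) (s ×ˢ univ) := by
    have : ContDiffOn ℝ ∞ (fun q : E × E => (q.1, -q.2)) (s ×ˢ univ) :=
      (contDiff_fst.prodMk contDiff_snd.neg).contDiffOn
    exact hg₁.comp this fun q hq => ⟨hq.1, mem_univ _⟩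
  have hsmooth := contDiffOn_convolution_right_with_param_comp (𝕜 := ℝ) (μ := ν)
    ((ContinuousLinearMap.lsmul ℝ ℝ : ℝ →L[ℝ] R →L[ℝ] R).flip) (s := s) (v := fun _ => (0 : E))
    contDiffOn_const (f := f₀) (g := g) (k := -k₁) hs hk₁.neg
    (fun p x _ hx => hg₁0 p (-x) (by simpa using hx)) hf₀ hg
  have heq : ∀ p ∈ s, (f₀ ⋆[(ContinuousLinearMap.lsmul ℝ ℝ : ℝ →L[ℝ] R →L[ℝ] R).flip, ν] g p) 0
      = f (φ.symm p) * K := by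
    intro p hp
    rw [← hconv, convolution_def]
    have e1 : ∀ t, ((ContinuousLinearMap.lsmul ℝ ℝ : ℝ →L[ℝ] R →L[ℝ] R).flip (f₀ t)) (g p (0 - t))
        = g₁ p t • f₀ t := fun t => by simp [g]
    simp only [e1]
    have hgc : Continuous (g₁ p) := by
      refine continuous_iff_continuousAt.2 fun v => ?_
      have := (hg₁.continuousOn.comp (f := fun v : E => (p, v)) (s := univ)
        (by fun_prop) (fun v _ => ⟨hp, mem_univ _⟩))
      exact (continuousOn_univ.1 this).continuousAt
    have hm : AEStronglyMeasurable (fun t => g₁ p t • f₀ t) ν :=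
      hgc.aestronglyMeasurable.smul hf₀m
    rw [hν, integral_map hφm hm]
    rw [← setIntegral_eq_integral_of_forall_compl_eq_zero (s := φ.source) (μ := μ)]
    · refine setIntegral_congr_fun φ.open_source.measurableSet fun y hy => ?_
      have hyt := φ.map_source hy
      simp only [g₁, f₀, indicator_of_mem hyt, Function.comp, φ.left_inv hy]
      by_cases h0 : b ((φ.symm p)⁻¹ * y) = 0
      · simp [h0]
      · have := hW _ hp.2 _ (hbW _ h0)
        rw [mul_inv_cancel_left] at this
        rw [this, one_mul]
    · intro y hy
      by_cases h0 : b ((φ.symm p)⁻¹ * y) = 0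
      · simp [h0]
      · have h1 := hW _ hp.2 _ (hbW _ h0)
        rw [mul_inv_cancel_left] at h1
        exact absurd (hχs (subset_tsupport _ (by simp [h1]))) hy
  -- conclusion
  have h1s : φ 1 ∈ s := ⟨φ.map_source (mem_chart_source E 1), by
    simpa [φ.left_inv (mem_chart_source E (1 : G))] using hW1⟩
  have hF : ContDiffAt ℝ ∞ (fun p => f (φ.symm p) * K) (φ 1) := by
    refine (hsmooth.contDiffAt (hs.mem_nhds h1s)).congr_of_eventuallyEq ?_
    filter_upwards [hs.mem_nhds h1s] with p hp using (heq p hp).symm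
  have hF2 : ContDiffAt ℝ ∞ (fun p => f (φ.symm p)) (φ 1) := by
    have := hF.mul (contDiffAt_const (c := c⁻¹ • ((u⁻¹ : Rˣ) : R)))
    refine this.congr_of_eventuallyEq (.of_forall fun p => ?_)
    simp only [mul_assoc, hKu, mul_one]
  have hch : ContMDiffAt 𝓘(ℝ, E) 𝓘(ℝ, E) ∞ φ 1 :=
    contMDiffOn_chart.contMDiffAt (φ.open_source.mem_nhds (mem_chart_source E 1))
  have := hF2.contMDiffAt.comp (1 : G) hch
  refine this.congr_of_eventuallyEq ?_
  filter_upwards [φ.open_source.mem_nhds (mem_chart_source E (1 : G))] with y hy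
  simp [φ.left_inv hy]

/-- A continuous homomorphism from a compact Lie group to the multiplicative monoid of a real
Banach algebra is automatically smooth. -/
theorem contMDiff_of_hom {E : Type*} [NormedAddCommGroup E] [NormedSpace ℝ E]
    [FiniteDimensional ℝ E] {G : Type*} [TopologicalSpace G] [ChartedSpace E G] [Group G]
    [LieGroup 𝓘(ℝ, E) ∞ G] [CompactSpace G] [T2Space G]
    {R : Type*} [NormedRing R] [NormedAlgebra ℝ R] [CompleteSpace R]
    (f : G →* R) (hf : Continuous f) : ContMDiff 𝓘(ℝ, E) 𝓘(ℝ, R) ∞ f := by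
  intro g
  have h1 : ContMDiffAt 𝓘(ℝ, E) 𝓘(ℝ, R) ∞ f (g⁻¹ * g) := by
    rw [inv_mul_cancel]; exact contMDiffAt_one_of_hom f hf
  have h2 : ContMDiffAt 𝓘(ℝ, E) 𝓘(ℝ, R) ∞ (fun x => f (g⁻¹ * x)) g :=
    h1.comp g (contMDiff_mul_left.contMDiffAt)
  have h3 : ContDiff ℝ ∞ (fun r : R => f g * r) := contDiff_const.mul contDiff_id
  have h4 := h3.contMDiff.contMDiffAt.comp g h2
  refine h4.congr_of_eventuallyEq (.of_forall fun x => ?_)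
  simp [← map_mul]

end Smoothness

section Definitions

variable (E : Type*) [NormedAddCommGroup E] [NormedSpace ℝ E]
  (G : Type*) [TopologicalSpace G] [ChartedSpace E G]

/-! ### Smooth functions on `G` and the test function topology -/

/-- The algebra of smooth complex-valued functions on `G`, inside the algebra of all functions. -/
def smoothSubalgebra : Subalgebra ℂ (G → ℂ) where
  carrier := {f | ContMDiff 𝓘(ℝ, E) 𝓘(ℝ, ℂ) ∞ f}
  mul_mem' {f g} hf hg := by
    have h : ContDiff ℝ ∞ (fun p : ℂ × ℂ => p.1 * p.2) := contDiff_fst.mul contDiff_snd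
    exact h.contMDiff.comp (hf.prodMk_space hg)
  add_mem' {f g} hf hg := by
    have h : ContDiff ℝ ∞ (fun p : ℂ × ℂ => p.1 + p.2) := contDiff_fst.add contDiff_snd
    exact h.contMDiff.comp (hf.prodMk_space hg)
  algebraMap_mem' r := contMDiff_const

/-- `C^∞(G)`. -/
def SmoothFun : Type _ := smoothSubalgebra E G

instance : CommRing (SmoothFun E G) := inferInstanceAs (CommRing (smoothSubalgebra E G))

instance : Algebra ℂ (SmoothFun E G) := inferInstanceAs (Algebra ℂ (smoothSubalgebra E G))

instance : CoeFun (SmoothFun E G) (fun _ => G → ℂ) := ⟨fun f => f.1⟩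

variable {E G} [Group G]

/-- The derivative of `f` along the left-invariant vector field with value `X` at the identity,
i.e. `(D_X f)(x) = d/dt f (x exp (t X))` at `t = 0`. -/
def leftDeriv (X : GroupLieAlgebra 𝓘(ℝ, E) G) (f : G → ℂ) (x : G) : ℂ :=
  mfderiv 𝓘(ℝ, E) 𝓘(ℝ, ℂ) f x (mulInvariantVectorField X x)

/-- `D_{X₁} D_{X₂} ⋯ D_{X_k} f` for a word `[X₁, …, X_k]` in the Lie algebra. -/
def wordDeriv (w : List (GroupLieAlgebra 𝓘(ℝ, E) G)) (f : G → ℂ) : G → ℂ :=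
  w.foldr leftDeriv f

/-- The usual test function topology of `C^∞(G)`: uniform convergence on `G` of all derivatives.
(Left-invariant vector fields span every tangent space, so it is enough to use these.) -/
instance : TopologicalSpace (SmoothFun E G) :=
  TopologicalSpace.induced
    (fun (f : SmoothFun E G) (w : List (GroupLieAlgebra 𝓘(ℝ, E) G)) =>
      UniformFun.ofFun (wordDeriv w f))
    inferInstance

/-! ### Differential operators -/

/-- `∂^β = ∂₁^{β₁} ⋯ ∂ₙ^{βₙ}`, where `∂ⱼ` is the left-invariant vector field given by the element
`Y j` of a basis of the Lie algebra. -/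
def partialDeriv {n : ℕ} (Y : Module.Basis (Fin n) ℝ (GroupLieAlgebra 𝓘(ℝ, E) G))
    (β : Fin n → ℕ) (f : G → ℂ) : G → ℂ :=
  (List.finRange n).foldr (fun j h => (leftDeriv (Y j))^[β j] h) f

/-- The finite set of multi-indices `α ∈ ℕ^r` of length `|α| = k`. -/
def multiIdx (r k : ℕ) : Finset (Fin r → ℕ) := Finset.piAntidiag Finset.univ k

/-- The left-invariant partial differential operator `∑_{|β| ≤ k} c_β ∂^β` of order at most `k`. -/
def leftInvOp {n : ℕ} (Y : Module.Basis (Fin n) ℝ (GroupLieAlgebra 𝓘(ℝ, E) G)) (k : ℕ)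
    (c : (Fin n → ℕ) → ℂ) (f : G → ℂ) (x : G) : ℂ :=
  ∑ i ∈ Finset.range (k + 1), ∑ β ∈ multiIdx n i, c β * partialDeriv Y β f x

/-! ### Bi-invariant metrics and the Laplacian -/

/-- The adjoint action of `g` on the Lie algebra: the derivative at `1` of `x ↦ g x g⁻¹`. -/
def adjointAction (g : G) (X : GroupLieAlgebra 𝓘(ℝ, E) G) : GroupLieAlgebra 𝓘(ℝ, E) G :=
  mfderiv 𝓘(ℝ, E) 𝓘(ℝ, E) (fun x : G => g * x * g⁻¹) 1 X

variable (E G) in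
/-- A bi-invariant Riemannian metric on `G`, given by its value at the identity: an inner product
on the Lie algebra that is invariant under the adjoint action. -/
structure BiInvariantMetric where
  form : LinearMap.BilinForm ℝ (GroupLieAlgebra 𝓘(ℝ, E) G)
  symm : ∀ X Z, form X Z = form Z X
  pos : ∀ X, X ≠ 0 → 0 < form X X
  invariant : ∀ g X Z, form (adjointAction g X) (adjointAction g Z) = form X Z

/-- The bi-invariant Laplacian `𝓛 = ∑_{i,j} g^{ij} ∂ᵢ ∂ⱼ`, where `(g^{ij})` is the inverse of the
Gram matrix of the basis `Y`. It does not depend on `Y`; for an orthonormal basis it is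
`∑ⱼ ∂ⱼ²`. -/
def laplacian (κ : BiInvariantMetric E G) {n : ℕ}
    (Y : Module.Basis (Fin n) ℝ (GroupLieAlgebra 𝓘(ℝ, E) G)) (f : G → ℂ) (x : G) : ℂ :=
  ∑ i, ∑ j, (((Matrix.of fun i j => κ.form (Y i) (Y j))⁻¹ i j : ℝ) : ℂ) *
    leftDeriv (Y i) (leftDeriv (Y j) f) x

/-! ### Irreducible unitary representations -/

variable (G) in
/-- `Rep(G)`: the continuous irreducible unitary (matrix) representations of `G`. -/
structure UnitaryRep where
  dim : ℕ
  toHom : G →* Matrix.unitaryGroup (Fin dim) ℂ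
  continuous : Continuous fun x => (toHom x : Matrix (Fin dim) (Fin dim) ℂ)
  dim_pos : 0 < dim
  irreducible : ∀ W : Submodule ℂ (Fin dim → ℂ),
    (∀ x, ∀ w ∈ W, (toHom x : Matrix (Fin dim) (Fin dim) ℂ).mulVec w ∈ W) → W = ⊥ ∨ W = ⊤

/-- The matrix coefficient `x ↦ ξ(x)_{ij}`. -/
def UnitaryRep.coeff (ξ : UnitaryRep G) (i j : Fin ξ.dim) (x : G) : ℂ :=
  (ξ.toHom x : Matrix (Fin ξ.dim) (Fin ξ.dim) ℂ) i j

/-- The number `λ_[ξ]` with `-𝓛 ξ_{ij} = λ_[ξ] ξ_{ij}` for all `i, j`. (The set below has exactly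
one element.) -/
def lapEigenvalue (κ : BiInvariantMetric E G) {n : ℕ}
    (Y : Module.Basis (Fin n) ℝ (GroupLieAlgebra 𝓘(ℝ, E) G)) (ξ : UnitaryRep G) : ℝ :=
  sSup {l : ℝ | ∀ i j x, -laplacian κ Y (ξ.coeff i j) x = (l : ℂ) * ξ.coeff i j x}

/-- `⟨ξ⟩ = (1 + λ_[ξ])^{1/2}`. -/
def bracket (κ : BiInvariantMetric E G) {n : ℕ}
    (Y : Module.Basis (Fin n) ℝ (GroupLieAlgebra 𝓘(ℝ, E) G)) (ξ : UnitaryRep G) : ℝ :=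
  Real.sqrt (1 + lapEigenvalue κ Y ξ)

/-- The operator norm of a complex matrix with respect to the Euclidean norm. -/
def opNorm {d : ℕ} (M : Matrix (Fin d) (Fin d) ℂ) : ℝ :=
  ‖Matrix.toEuclideanCLM (n := Fin d) (𝕜 := ℂ) M‖

variable [FiniteDimensional ℝ E] [LieGroup 𝓘(ℝ, E) ∞ G] [CompactSpace G] [T2Space G]

theorem UnitaryRep.contMDiff_coeff (ξ : UnitaryRep G) (i j : Fin ξ.dim) :
    ContMDiff 𝓘(ℝ, E) 𝓘(ℝ, ℂ) ∞ (ξ.coeff i j) := by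
  let _ : NormedRing (Matrix (Fin ξ.dim) (Fin ξ.dim) ℂ) := Matrix.linftyOpNormedRing
  let _ : NormedAlgebra ℝ (Matrix (Fin ξ.dim) (Fin ξ.dim) ℂ) := Matrix.linftyOpNormedAlgebra
  have h := contMDiff_of_hom (E := E)
    ((Matrix.unitaryGroup (Fin ξ.dim) ℂ).subtype.comp ξ.toHom) ξ.continuous
  let ev : Matrix (Fin ξ.dim) (Fin ξ.dim) ℂ →ₗ[ℝ] ℂ :=
    { toFun := fun M => M i j
      map_add' := fun _ _ => rfl
      map_smul' := fun _ _ => rfl }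
  have hev : ContDiff ℝ ∞ ev := ev.toContinuousLinearMap.contDiff
  exact hev.contMDiff.comp h

variable (E) in
/-- The smooth function `x ↦ (ξ(x)^*)_{ij}`. -/
def UnitaryRep.adjCoeff (ξ : UnitaryRep G) (i j : Fin ξ.dim) : SmoothFun E G :=
  ⟨fun x => (star (ξ.toHom x : Matrix (Fin ξ.dim) (Fin ξ.dim) ℂ)) i j, by
    have h : ContDiff ℝ ∞ (fun z : ℂ => star z) := Complex.conjCLE.contDiff
    exact h.contMDiff.comp (ξ.contMDiff_coeff j i)⟩

/-! ### Distributions, symbols, difference operators -/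

/-- The smooth function `z ↦ φ(z⁻¹ x)`. -/
def reflect (x : G) (φ : SmoothFun E G) : SmoothFun E G :=
  ⟨fun z => φ (z⁻¹ * x), by
    have h1 : ContMDiff 𝓘(ℝ, E) 𝓘(ℝ, E) ∞ (fun z : G => z⁻¹ * x) :=
      (contMDiff_inv 𝓘(ℝ, E) ∞).mul contMDiff_const
    exact ContMDiff.comp (I' := 𝓘(ℝ, E)) φ.2 h1⟩

/-- The right-convolution kernel `r_x = R_A(x, ·)` of `A`, a distribution acting on test
functions. It is determined by `A f (x) = ∫ f(y) R_A(x, y⁻¹ x) dy = ∫ f(x y⁻¹) R_A(x, y) dy`;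
with `f(z) = φ(z⁻¹ x)` this reads `⟨R_A(x, ·), φ⟩ = A f (x)`. -/
def kernel (A : SmoothFun E G →L[ℂ] SmoothFun E G) (x : G) : SmoothFun E G →ₗ[ℂ] ℂ where
  toFun φ := A (reflect x φ) x
  map_add' φ ψ := by
    have : reflect x (φ + ψ) = reflect x φ + reflect x ψ := rfl
    rw [this, map_add]; rfl
  map_smul' c φ := by
    have : reflect x (c • φ) = c • reflect x φ := rfl
    rw [this, map_smul]; rfl

/-- The product `q u` of a smooth function and a distribution. -/
def mulDist (q : SmoothFun E G) (u : SmoothFun E G →ₗ[ℂ] ℂ) : SmoothFun E G →ₗ[ℂ] ℂ :=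
  u.comp (LinearMap.mulLeft ℂ q)

/-- The Fourier coefficient `û(ξ) = ∫ u(y) ξ(y)^* dy` of a distribution. -/
def fourierCoeff (u : SmoothFun E G →ₗ[ℂ] ℂ) (ξ : UnitaryRep G) :
    Matrix (Fin ξ.dim) (Fin ξ.dim) ℂ :=
  Matrix.of fun i j => u (ξ.adjCoeff E i j)

/-- The symbol `σ_A(x, ξ) = ∫ R_A(x, y) ξ(y)^* dy`. -/
def symbol (A : SmoothFun E G →L[ℂ] SmoothFun E G) (x : G) (ξ : UnitaryRep G) :
    Matrix (Fin ξ.dim) (Fin ξ.dim) ℂ :=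
  fourierCoeff (kernel A x) ξ

/-- `q_α = q₁^{α₁} ⋯ q_r^{α_r}`. -/
def qPow {r : ℕ} (q : Fin r → SmoothFun E G) (α : Fin r → ℕ) : SmoothFun E G :=
  ∏ i, q i ^ α i

/-- `(△_ξ^α σ_A)(x, ξ)`: the difference operator `△_ξ^α û = (q_α u)^` applied to
`σ_A(x, ·) = (r_x)^`. -/
def diffSymbol {r : ℕ} (q : Fin r → SmoothFun E G) (α : Fin r → ℕ)
    (A : SmoothFun E G →L[ℂ] SmoothFun E G) (x : G) (ξ : UnitaryRep G) :
    Matrix (Fin ξ.dim) (Fin ξ.dim) ℂ :=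
  fourierCoeff (mulDist (qPow q α) (kernel A x)) ξ

/-- `D_x σ_B(x, ξ)` for a scalar differential operator `D` in the variable `x`, applied to each
matrix entry. -/
def derivSymbol (D : (G → ℂ) → G → ℂ) (B : SmoothFun E G →L[ℂ] SmoothFun E G) (x : G)
    (ξ : UnitaryRep G) : Matrix (Fin ξ.dim) (Fin ξ.dim) ℂ :=
  Matrix.of fun i j => D (fun x' => symbol B x' ξ i j) x

/-! ### Taylor expansions on `G` -/

/-- `α! = α₁! ⋯ α_r!`. -/
def multiFact {r : ℕ} (α : Fin r → ℕ) : ℕ := ∏ i, (α i).factorial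

/-- The functions `q₁, …, q_r ∈ C^∞(G)`, which vanish at the identity, and the left-invariant
differential operators `∂^{(α)} = ∑_{|β| ≤ |α|} c_{α β} ∂^β` of order at most `|α|` form a Taylor
system: every `u ∈ C^∞(G)` satisfies, for every `N`,
`u(x) = ∑_{|α| ≤ N} (1/α!) q_α(x⁻¹) ∂^{(α)}u(e) + ∑_{|α| = N+1} q_α(x⁻¹) u_α(x)` on `G`
with `u_α ∈ C^∞(G)`. -/
def IsTaylorSystem {n : ℕ} (Y : Module.Basis (Fin n) ℝ (GroupLieAlgebra 𝓘(ℝ, E) G)) {r : ℕ}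
    (q : Fin r → SmoothFun E G) (c : (Fin r → ℕ) → (Fin n → ℕ) → ℂ) : Prop :=
  (∀ i, q i 1 = 0) ∧
  ∀ (N : ℕ) (u : SmoothFun E G), ∃ v : (Fin r → ℕ) → SmoothFun E G, ∀ x : G,
    u x = ∑ k ∈ Finset.range (N + 1), ∑ α ∈ multiIdx r k,
        (multiFact α : ℂ)⁻¹ * qPow q α x⁻¹ * leftInvOp Y k (c α) u 1
      + ∑ α ∈ multiIdx r (N + 1), qPow q α x⁻¹ * v α x

end Definitions

end LieSymbol

end

open scoped Manifold ContDiff Topology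

noncomputable section

namespace LieSymbol

/-! The kernel of `A` is paired with the symbol of `B`. Since `B` applied to the matrix entries of
`ξ` is the matrix product `ξ σ_B`, one gets `σ_{AB}(x, ξ) = ∫ R_A(x, y) ξ(y)^* σ_B(x y⁻¹, ξ) dy`.
Taylor expansion of `σ_B(x ·, ξ)` at the identity produces factors `q_α`; moved onto the kernel,
they turn `σ_A` into `△_ξ^α σ_A`. This gives an exact identity (`symbol_comp_eq`): the expected
terms with `|α| ≤ L`, plus remainders that pair `q_α R_A(x, ·)`, `|α| = L + 1`, with `ξ` times a
Taylor remainder of `σ_B`.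

Two problems remain. First, a Taylor system only asserts that remainder functions exist, while the
estimate needs them linear in `u` and controlled by finitely many derivatives of `u`. Hadamard's
lemma gives such control for the coordinates at the identity and one cut-off function. The Taylor
property with `N = 0` writes these as combinations of the `q_i`, so the `q_i` inherit quotient
operators that lose one derivative, and iteration gives a controlled expansion. Its polynomial
differs from the prescribed one only by finitely many coefficients, and a linear choice on a
finite-dimensional space corrects this (`IsTaylorSystem.exists_remainder`). The same coordinates
prove that Taylor systems exist.

Second, no estimate on the `ξ`-differences of the remainder is available, so it is bounded by a
frequency splitting (`exists_norm_functional_le`). The functional `q_α R_A(x, ·)` has Fourier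
coefficients of size `⟨ζ⟩^{-σ}` with `σ = ρ (L + 1) - m₁`. It is cut at `⟨ζ⟩ = R = ⟨ξ⟩^θ`. High
frequencies are summed absolutely and give `R^{p - σ}`. Low frequencies have a smooth density each
of whose derivatives costs a factor `R`, while derivatives of `σ_B` cost `⟨ξ⟩^δ`; integration by
parts with `(1 - 𝓛)^K` against `ξ` gains `((R + ⟨ξ⟩^δ) / ⟨ξ⟩)^{2K}`. With `δ < θ < 1` and `θ ρ > δ`
both parts become as small as desired when `L`, and then `K`, is large. The excess terms `N ≤ |α| ≤
L` already have the required order.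

The splitting rests on harmonic analysis on `G`: the Casimir matrix is a scalar and controls the
derived representation (`exists_norm_deriv_le`), `∑ d_ξ² ⟨ξ⟩^{-p}` converges for some `p`
(`exists_sum_dim_sq_div_le`), and Fourier series of smooth functions converge with all derivatives
(`smoothNull_fourier`). The last fact uses the completeness of matrix coefficients, obtained from
compact convolution operators. -/

set_option linter.unusedSectionVars false

/-! ### Global smooth substitutes for a chart at the identity -/

section LocalParametrization

variable (E : Type*) [NormedAddCommGroup E] [NormedSpace ℝ E]
  (G : Type*) [TopologicalSpace G] [ChartedSpace E G] [Group G]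

/-- A globally defined smooth map `E → G` with a globally defined smooth local inverse at the
identity, whose derivative at `0` is the identification of `E` with the Lie algebra. -/
structure LocalParam where
  toFun : E → G
  inv : G → E
  smooth : ContMDiff 𝓘(ℝ, E) 𝓘(ℝ, E) ∞ toFun
  smooth_inv : ContMDiff 𝓘(ℝ, E) 𝓘(ℝ, E) ∞ inv
  map_zero : toFun 0 = 1
  inv_one : inv 1 = 0
  right_inv : ∀ᶠ y in 𝓝 (1 : G), toFun (inv y) = y
  left_inv : ∀ᶠ v in 𝓝 (0 : E), inv (toFun v) = v
  hasMFDerivAt : HasMFDerivAt 𝓘(ℝ, E) 𝓘(ℝ, E) toFun 0 (ContinuousLinearMap.id ℝ E)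

variable {E G} [FiniteDimensional ℝ E] [LieGroup 𝓘(ℝ, E) ∞ G] [T2Space G]

/-- The inverse chart is precomposed with `v ↦ φ 1 + χ v • v`, whose values stay in a ball inside
the chart's target, and the chart itself is multiplied by a bump function on `G`. Both maps become
global and still agree with the chart near the base point. Since tangent spaces are read in the
preferred chart, the derivative at `0` is the identity. -/
instance : Nonempty (LocalParam E G) := by
  set φ := chartAt E (1 : G) with hφ
  have h1s : (1 : G) ∈ φ.source := mem_chart_source E 1
  have h1t : φ 1 ∈ φ.target := φ.map_source h1s
  obtain ⟨r, hr, hrt⟩ := Metric.isOpen_iff.1 φ.open_target _ h1t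
  let χ : ContDiffBump (0 : E) := ⟨r / 2, r, by positivity, by linarith⟩
  let b : SmoothBumpFunction 𝓘(ℝ, E) (1 : G) := Classical.choice inferInstance
  have hχr : ∀ v, φ 1 + χ v • v ∈ φ.target := by
    intro v
    apply hrt
    rw [mem_ball_iff_norm, add_sub_cancel_left, norm_smul, Real.norm_of_nonneg χ.nonneg]
    by_cases hv : χ v = 0
    · simpa [hv] using hr
    · have : v ∈ Metric.ball (0 : E) r := by
        have := χ.support_eq
        rw [← show χ.rOut = r from rfl, ← this]; exact hv
      have hv' : ‖v‖ < r := by simpa using this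
      calc χ v * ‖v‖ ≤ 1 * ‖v‖ := by gcongr; exact χ.le_one
        _ < r := by simpa using hv'
  have hsm : ContMDiff 𝓘(ℝ, E) 𝓘(ℝ, E) ∞ (fun v : E => φ.symm (φ 1 + χ v • v)) := by
    have h1 : ContDiff ℝ ∞ (fun v : E => φ 1 + χ v • v) :=
      contDiff_const.add (χ.contDiff.smul contDiff_id)
    have h2 : ContMDiffOn 𝓘(ℝ, E) 𝓘(ℝ, E) ∞ φ.symm φ.target := contMDiffOn_chart_symm
    intro v
    exact (h2.contMDiffAt (φ.open_target.mem_nhds (hχr v))).comp v h1.contMDiff.contMDiffAt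
  have hχ1 : ∀ᶠ v in 𝓝 (0 : E), χ v = 1 := χ.eventuallyEq_one
  have hb1 : ∀ᶠ y in 𝓝 (1 : G), b y = 1 := b.eventuallyEq_one
  have hsmi : ContMDiff 𝓘(ℝ, E) 𝓘(ℝ, E) ∞ (fun y : G => b y • (φ y - φ 1)) := by
    refine b.contMDiff_smul ?_
    exact (contMDiffOn_chart (I := 𝓘(ℝ, E))).sub contMDiffOn_const
  have h0 : φ.symm (φ 1 + χ 0 • (0 : E)) = 1 := by simp [φ.left_inv h1s]
  have hi1 : b 1 • (φ 1 - φ 1) = 0 := by simp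
  refine ⟨⟨fun v => φ.symm (φ 1 + χ v • v), fun y => b y • (φ y - φ 1), hsm, hsmi, h0, hi1,
    ?_, ?_, ?_⟩⟩
  · have ht : Filter.Tendsto (fun y : G => b y • (φ y - φ 1)) (𝓝 1) (𝓝 0) := by
      have := hsmi.continuous.tendsto 1
      rwa [hi1] at this
    filter_upwards [hb1, ht.eventually hχ1, φ.open_source.mem_nhds h1s] with y hy hy2 hys
    rw [hy, one_smul] at hy2 ⊢
    rw [hy2, one_smul, add_sub_cancel, φ.left_inv hys]
  · have ht : Filter.Tendsto (fun v : E => φ.symm (φ 1 + χ v • v)) (𝓝 0) (𝓝 1) := by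
      have := hsm.continuous.tendsto 0
      rwa [h0] at this
    filter_upwards [hχ1, ht.eventually hb1] with v hv hv2
    rw [hv2, one_smul, φ.right_inv (hχr v), hv]; simp
  · refine ⟨hsm.continuous.continuousAt, ?_⟩
    have : HasFDerivAt (fun v : E => φ 1 + v) (ContinuousLinearMap.id ℝ E) 0 :=
      (hasFDerivAt_id (𝕜 := ℝ) (0 : E)).const_add _
    have h3 : writtenInExtChartAt 𝓘(ℝ, E) 𝓘(ℝ, E) (0 : E) (fun v : E => φ.symm (φ 1 + χ v • v))
        =ᶠ[𝓝 0] fun v => φ 1 + v := by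
      filter_upwards [hχ1] with v hv
      simp only [writtenInExtChartAt, Function.comp, h0, mfld_simps]
      change φ (φ.symm (φ 1 + χ v • v)) = φ 1 + v
      rw [φ.right_inv (hχr v), hv, one_smul]
    exact (this.congr_of_eventuallyEq h3).hasFDerivWithinAt

variable (E G) in
/-- A chosen local parametrization of `G` at the identity. -/
def param : LocalParam E G := Classical.choice inferInstance

end LocalParametrization

/-! ### Left-invariant derivatives as Fréchet derivatives on the model space -/

section LeftDerivatives

variable {E : Type*} [NormedAddCommGroup E] [NormedSpace ℝ E] [FiniteDimensional ℝ E]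
  {G : Type*} [TopologicalSpace G] [ChartedSpace E G] [Group G] [LieGroup 𝓘(ℝ, E) ∞ G] [T2Space G]

/-- The derivative of a smooth family of functions on `E` at the origin depends smoothly on the
parameter. -/
theorem contMDiff_fderiv_family {F : Type*} [NormedAddCommGroup F] [NormedSpace ℝ F]
    {H : Type*} [TopologicalSpace H] {J : ModelWithCorners ℝ F H}
    {N : Type*} [TopologicalSpace N] [ChartedSpace H N] [IsManifold J ∞ N]
    {V : Type*} [NormedAddCommGroup V] [NormedSpace ℝ V] {f : N → E → V}
    (hf : ContMDiff (J.prod 𝓘(ℝ, E)) 𝓘(ℝ, V) ∞ (Function.uncurry f)) (v : E) :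
    ContMDiff J 𝓘(ℝ, V) ∞ (fun p => fderiv ℝ (f p) 0 v) := by
  intro p₀
  have h := ContMDiffAt.mfderiv (I := 𝓘(ℝ, E)) (I' := 𝓘(ℝ, V)) (m := ∞) (n := ∞) (x₀ := p₀) f
    (fun _ => (0 : E)) hf.contMDiffAt contMDiffAt_const (by simp)
  have h' : ContMDiffAt J 𝓘(ℝ, E →L[ℝ] V) ∞ (fun p => fderiv ℝ (f p) 0) p₀ := by
    refine h.congr_of_eventuallyEq (.of_forall fun p => ?_)
    have := congrFun (inTangentCoordinates_model_space (I := 𝓘(ℝ, E)) (I' := 𝓘(ℝ, V)) (𝕜 := ℝ)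
      (fun _ : N => (0 : E)) (fun p => f p 0) (fun p => fderiv ℝ (f p) 0) p₀) p
    refine this.symm.trans ?_
    have e : (fun p => fderiv ℝ (f p) 0) =
        fun p => (mfderiv 𝓘(ℝ, E) 𝓘(ℝ, V) (f p) 0 : E →L[ℝ] V) :=
      funext fun p => mfderiv_eq_fderiv.symm
    exact congrArg (fun ψ : N → E →L[ℝ] V => inTangentCoordinates 𝓘(ℝ, E) 𝓘(ℝ, V)
      (fun _ : N => (0 : E)) (fun p => f p 0) ψ p₀ p) e
  exact h'.clm_apply (contMDiffAt_const (c := v))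

variable (E G) in
/-- The identification of the Lie algebra with the model space. -/
def toModel : GroupLieAlgebra 𝓘(ℝ, E) G ≃ₗ[ℝ] E := LinearEquiv.refl ℝ E

/-- The chain rule with the intermediate point known only up to an equation, which avoids rewriting
`toFun 0 = 1` inside the types of tangent spaces. -/
theorem hasMFDerivAt_comp_of_eq {E₁ E₂ E₃ : Type*} [NormedAddCommGroup E₁] [NormedSpace ℝ E₁]
    [NormedAddCommGroup E₂] [NormedSpace ℝ E₂] [NormedAddCommGroup E₃] [NormedSpace ℝ E₃]
    {M₁ M₂ M₃ : Type*} [TopologicalSpace M₁] [ChartedSpace E₁ M₁] [TopologicalSpace M₂]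
    [ChartedSpace E₂ M₂] [TopologicalSpace M₃] [ChartedSpace E₃ M₃] {f : M₁ → M₂} {g : M₂ → M₃}
    {x : M₁} {y : M₂} {f' : E₁ →L[ℝ] E₂} {g' : E₂ →L[ℝ] E₃}
    (hg : HasMFDerivAt 𝓘(ℝ, E₂) 𝓘(ℝ, E₃) g y g') (hf : HasMFDerivAt 𝓘(ℝ, E₁) 𝓘(ℝ, E₂) f x f')
    (hy : f x = y) : HasMFDerivAt 𝓘(ℝ, E₁) 𝓘(ℝ, E₃) (fun z => g (f z)) x (g'.comp f') := by
  subst hy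
  exact hg.comp x hf

theorem contMDiff_mul_param (x : G) :
    ContMDiff 𝓘(ℝ, E) 𝓘(ℝ, E) ∞ (fun v : E => x * (param E G).toFun v) :=
  contMDiff_const.mul (param E G).smooth

theorem contDiff_comp_mul_param {V : Type*} [NormedAddCommGroup V] [NormedSpace ℝ V] {f : G → V}
    (hf : ContMDiff 𝓘(ℝ, E) 𝓘(ℝ, V) ∞ f) (x : G) :
    ContDiff ℝ ∞ (fun v : E => f (x * (param E G).toFun v)) :=
  (hf.comp (contMDiff_mul_param x)).contDiff

/-- The left-invariant field at `x` is the differential of left translation applied to `X`, and the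
parametrization has derivative the identity at `0`. This is the bridge from manifold derivatives to
calculus on `E`. -/
theorem leftDeriv_eq_fderiv (X : GroupLieAlgebra 𝓘(ℝ, E) G) {f : G → ℂ}
    (hf : ContMDiff 𝓘(ℝ, E) 𝓘(ℝ, ℂ) ∞ f) (x : G) :
    leftDeriv X f x = fderiv ℝ (fun v : E => f (x * (param E G).toFun v)) 0 (toModel E G X) := by
  obtain ⟨L, hL⟩ : ∃ L : E →L[ℝ] E, L = mfderiv 𝓘(ℝ, E) 𝓘(ℝ, E) (fun y : G => x * y) 1 :=
    ⟨_, rfl⟩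
  obtain ⟨F, hF⟩ : ∃ F : E →L[ℝ] ℂ, F = mfderiv 𝓘(ℝ, E) 𝓘(ℝ, ℂ) f x := ⟨_, rfl⟩
  have h1 : HasMFDerivAt 𝓘(ℝ, E) 𝓘(ℝ, E) (fun y : G => x * y) 1 L := by
    rw [hL]
    exact ((contMDiff_mul_left (I := 𝓘(ℝ, E)) (n := ∞) (a := x)).mdifferentiable
      (by simp) 1).hasMFDerivAt
  have h2 : HasMFDerivAt 𝓘(ℝ, E) 𝓘(ℝ, ℂ) f x F := by
    rw [hF]
    exact (hf.mdifferentiable (by simp) x).hasMFDerivAt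
  have h3 := hasMFDerivAt_comp_of_eq h1 (param E G).hasMFDerivAt (param E G).map_zero
  have h4 := hasMFDerivAt_comp_of_eq h2 h3 (by simp [(param E G).map_zero])
  have h5 : HasFDerivAt (fun v : E => f (x * (param E G).toFun v))
      (F.comp (L.comp (ContinuousLinearMap.id ℝ E))) 0 := h4.hasFDerivAt
  rw [h5.fderiv]
  change mfderiv 𝓘(ℝ, E) 𝓘(ℝ, ℂ) f x (mfderiv 𝓘(ℝ, E) 𝓘(ℝ, E) (fun y : G => x * y) 1 X) =
    F (L (toModel E G X))
  rw [hF, hL]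
  rfl

theorem contMDiff_leftDeriv (X : GroupLieAlgebra 𝓘(ℝ, E) G) {f : G → ℂ}
    (hf : ContMDiff 𝓘(ℝ, E) 𝓘(ℝ, ℂ) ∞ f) : ContMDiff 𝓘(ℝ, E) 𝓘(ℝ, ℂ) ∞ (leftDeriv X f) := by
  have h : ContMDiff (𝓘(ℝ, E).prod 𝓘(ℝ, E)) 𝓘(ℝ, ℂ) ∞
      (Function.uncurry fun (x : G) (v : E) => f (x * (param E G).toFun v)) :=
    hf.comp (contMDiff_fst.mul ((param E G).smooth.comp contMDiff_snd))
  have h2 := contMDiff_fderiv_family (E := E) h (toModel E G X)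
  refine h2.congr fun x => ?_
  exact leftDeriv_eq_fderiv X hf x

theorem leftDeriv_add_left (X Z : GroupLieAlgebra 𝓘(ℝ, E) G) (f : G → ℂ) (x : G) :
    leftDeriv (X + Z) f x = leftDeriv X f x + leftDeriv Z f x := by
  unfold leftDeriv
  rw [mulInvariantVectorField_add]
  exact map_add _ _ _

theorem leftDeriv_smul_left (c : ℝ) (X : GroupLieAlgebra 𝓘(ℝ, E) G) (f : G → ℂ) (x : G) :
    leftDeriv (c • X) f x = c * leftDeriv X f x := by
  unfold leftDeriv
  rw [mulInvariantVectorField_smul]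
  exact (map_smul (mfderiv 𝓘(ℝ, E) 𝓘(ℝ, ℂ) f x) _ _).trans (Complex.real_smul)

theorem leftDeriv_mul_left (X : GroupLieAlgebra 𝓘(ℝ, E) G) {f : G → ℂ}
    (hf : ContMDiff 𝓘(ℝ, E) 𝓘(ℝ, ℂ) ∞ f) (g x : G) :
    leftDeriv X (fun y => f (g * y)) x = leftDeriv X f (g * x) := by
  rw [leftDeriv_eq_fderiv X hf, leftDeriv_eq_fderiv X (f := fun y => f (g * y))
    (hf.comp contMDiff_mul_left)]
  simp only [mul_assoc]

end LeftDerivatives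

/-! ### The algebra of smooth functions, derivations and left translations -/

section SmoothFunctions

variable {E : Type*} [NormedAddCommGroup E] [NormedSpace ℝ E]
  {G : Type*} [TopologicalSpace G] [ChartedSpace E G]

theorem SmoothFun.ext {f g : SmoothFun E G} (h : ∀ x, f x = g x) : f = g :=
  Subtype.ext (funext h)

theorem SmoothFun.continuous (f : SmoothFun E G) : Continuous f := f.2.continuous

@[simp] theorem SmoothFun.add_apply (f g : SmoothFun E G) (x : G) : (f + g) x = f x + g x := rfl
@[simp] theorem SmoothFun.sub_apply (f g : SmoothFun E G) (x : G) : (f - g) x = f x - g x := rfl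
@[simp] theorem SmoothFun.neg_apply (f : SmoothFun E G) (x : G) : (-f) x = -f x := rfl
@[simp] theorem SmoothFun.mul_apply (f g : SmoothFun E G) (x : G) : (f * g) x = f x * g x := rfl
@[simp] theorem SmoothFun.smul_apply (c : ℂ) (f : SmoothFun E G) (x : G) :
    (c • f) x = c * f x := rfl
@[simp] theorem SmoothFun.zero_apply (x : G) : (0 : SmoothFun E G) x = 0 := rfl
@[simp] theorem SmoothFun.one_apply (x : G) : (1 : SmoothFun E G) x = 1 := rfl

variable (E) in
/-- Evaluation at a point. -/
def evalAt (x : G) : SmoothFun E G →ₐ[ℂ] ℂ where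
  toFun f := f x
  map_one' := rfl
  map_mul' _ _ := rfl
  map_zero' := rfl
  map_add' _ _ := rfl
  commutes' _ := rfl

@[simp] theorem evalAt_apply (x : G) (f : SmoothFun E G) : evalAt E x f = f x := rfl

theorem SmoothFun.sum_apply {ι : Type*} (s : Finset ι) (f : ι → SmoothFun E G) (x : G) :
    (∑ i ∈ s, f i) x = ∑ i ∈ s, f i x := map_sum (evalAt E x) f s

theorem SmoothFun.prod_apply {ι : Type*} (s : Finset ι) (f : ι → SmoothFun E G) (x : G) :
    (∏ i ∈ s, f i) x = ∏ i ∈ s, f i x := map_prod (evalAt E x) f s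

theorem SmoothFun.pow_apply (f : SmoothFun E G) (k : ℕ) (x : G) :
    (f ^ k) x = f x ^ k := map_pow (evalAt E x) f k

variable [FiniteDimensional ℝ E] [Group G] [LieGroup 𝓘(ℝ, E) ∞ G] [T2Space G]

/-- The left-invariant vector field given by `X`, as a derivation of `C^∞(G)`. -/
def derivOp (X : GroupLieAlgebra 𝓘(ℝ, E) G) : SmoothFun E G →ₗ[ℂ] SmoothFun E G where
  toFun f := ⟨leftDeriv X f, contMDiff_leftDeriv X f.2⟩
  map_add' f g := by
    refine SmoothFun.ext fun x => ?_
    change leftDeriv X (f + g : SmoothFun E G) x = leftDeriv X f x + leftDeriv X g x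
    rw [leftDeriv_eq_fderiv X f.2, leftDeriv_eq_fderiv X g.2, leftDeriv_eq_fderiv X (f + g).2]
    have h1 := (contDiff_comp_mul_param f.2 x).differentiable (by simp) 0
    have h2 := (contDiff_comp_mul_param g.2 x).differentiable (by simp) 0
    exact DFunLike.congr_fun (fderiv_add h1 h2) _
  map_smul' c f := by
    refine SmoothFun.ext fun x => ?_
    change leftDeriv X (c • f : SmoothFun E G) x = c * leftDeriv X f x
    rw [leftDeriv_eq_fderiv X f.2, leftDeriv_eq_fderiv X (c • f).2]
    have h1 := (contDiff_comp_mul_param f.2 x).differentiable (by simp) 0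
    exact DFunLike.congr_fun (fderiv_const_smul h1 c) _

theorem derivOp_apply (X : GroupLieAlgebra 𝓘(ℝ, E) G) (f : SmoothFun E G) (x : G) :
    derivOp X f x = leftDeriv X f x := rfl

theorem derivOp_eq_fderiv (X : GroupLieAlgebra 𝓘(ℝ, E) G) (f : SmoothFun E G) (x : G) :
    derivOp X f x = fderiv ℝ (fun v : E => f (x * (param E G).toFun v)) 0 (toModel E G X) :=
  leftDeriv_eq_fderiv X f.2 x

theorem derivOp_mul (X : GroupLieAlgebra 𝓘(ℝ, E) G) (f g : SmoothFun E G) :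
    derivOp X (f * g) = derivOp X f * g + f * derivOp X g := by
  refine SmoothFun.ext fun x => ?_
  rw [SmoothFun.add_apply, SmoothFun.mul_apply, SmoothFun.mul_apply, derivOp_eq_fderiv,
    derivOp_eq_fderiv, derivOp_eq_fderiv]
  have h1 := (contDiff_comp_mul_param f.2 x).differentiable (by simp) 0
  have h2 := (contDiff_comp_mul_param g.2 x).differentiable (by simp) 0
  have := DFunLike.congr_fun (fderiv_mul h1 h2) (toModel E G X)
  simp only [(param E G).map_zero, mul_one] at this
  rw [mul_comm _ (g x), add_comm]
  exact this

/-- The smooth function `y ↦ f (g y)`. -/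
def translate (g : G) : SmoothFun E G →ₐ[ℂ] SmoothFun E G where
  toFun f := ⟨fun y => f (g * y), f.2.comp contMDiff_mul_left⟩
  map_one' := rfl
  map_mul' _ _ := rfl
  map_zero' := rfl
  map_add' _ _ := rfl
  commutes' _ := rfl

@[simp] theorem translate_apply (g : G) (f : SmoothFun E G) (x : G) :
    translate g f x = f (g * x) := rfl

theorem derivOp_translate (X : GroupLieAlgebra 𝓘(ℝ, E) G) (g : G) (f : SmoothFun E G) :
    derivOp X (translate g f) = translate g (derivOp X f) :=
  SmoothFun.ext fun x => leftDeriv_mul_left X f.2 g x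

theorem derivOp_add_left (X Z : GroupLieAlgebra 𝓘(ℝ, E) G) (f : SmoothFun E G) :
    derivOp (X + Z) f = derivOp X f + derivOp Z f :=
  SmoothFun.ext fun x => leftDeriv_add_left X Z f x

theorem derivOp_smul_left (c : ℝ) (X : GroupLieAlgebra 𝓘(ℝ, E) G) (f : SmoothFun E G) :
    derivOp (c • X) f = (c : ℂ) • derivOp X f :=
  SmoothFun.ext fun x => leftDeriv_smul_left c X f x

end SmoothFunctions

/-! ### Differentiation under the integral sign -/

section ParametricIntegrals

open MeasureTheory

/-- The derivative is bounded on the product of the compact space `K` with a closed ball around `v`,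
and this constant dominates. -/
theorem hasFDerivAt_integral_of_continuous {K : Type*} [TopologicalSpace K] [CompactSpace K]
    [SecondCountableTopology K] [MeasurableSpace K] [OpensMeasurableSpace K] (μ : Measure K)
    [IsFiniteMeasure μ] {E : Type*} [NormedAddCommGroup E] [NormedSpace ℝ E]
    [FiniteDimensional ℝ E] {F : K → E → ℂ} {F' : K → E → E →L[ℝ] ℂ}
    (hF : Continuous (Function.uncurry F)) (hF' : Continuous (Function.uncurry F'))
    (h : ∀ k v, HasFDerivAt (F k) (F' k v) v) (v : E) :
    HasFDerivAt (fun v => ∫ k, F k v ∂μ) (∫ k, F' k v ∂μ) v := by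
  obtain ⟨C, hC⟩ := (isCompact_univ.prod (isCompact_closedBall v 1)).exists_bound_of_continuousOn
    (hF'.continuousOn (s := (Set.univ : Set K) ×ˢ Metric.closedBall v 1))
  have hFc : ∀ v, Continuous fun k => F k v := fun v =>
    hF.comp (f := fun k => (k, v)) (by fun_prop)
  have hFc' : ∀ v, Continuous fun k => F' k v := fun v =>
    hF'.comp (f := fun k => (k, v)) (by fun_prop)
  refine hasFDerivAt_integral_of_dominated_of_fderiv_le (bound := fun _ => C)
    (F := fun v k => F k v) (F' := fun v k => F' k v)
    (Metric.closedBall_mem_nhds v one_pos)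
    (.of_forall fun v => (hFc v).aestronglyMeasurable) ?_ (hFc' v).aestronglyMeasurable
    (.of_forall fun k w hw => hC (k, w) ⟨Set.mem_univ _, hw⟩) (integrable_const _)
    (.of_forall fun k w _ => h k w)
  exact (hFc v).integrable_of_hasCompactSupport (HasCompactSupport.of_compactSpace _)

variable {E : Type*} [NormedAddCommGroup E] [NormedSpace ℝ E] [FiniteDimensional ℝ E]

theorem hasFDerivAt_unitInterval_integral {F : ℝ × E → ℂ} (hF : ContDiff ℝ ∞ F) (v : E) :
    HasFDerivAt (fun v => ∫ s : unitInterval, F (s, v))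
      (∫ s : unitInterval, fderiv ℝ (fun w => F (s, w)) v) v := by
  have h1 : ∀ (s : ℝ) (v : E), HasFDerivAt (fun w => F (s, w))
      ((fderiv ℝ F (s, v)).comp (ContinuousLinearMap.inr ℝ ℝ E)) v := fun s v =>
    HasFDerivAt.comp v (hF.differentiable (by simp) (s, v)).hasFDerivAt (hasFDerivAt_prodMk_right s v)
  have h2 := hasFDerivAt_integral_of_continuous (volume : Measure unitInterval)
    (F := fun s v => F (s, v))
    (F' := fun s v => (fderiv ℝ F (s, v)).comp (ContinuousLinearMap.inr ℝ ℝ E))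
    (hF.continuous.comp (by fun_prop))
    (((hF.continuous_fderiv (by simp)).comp
      (f := fun p : unitInterval × E => ((p.1 : ℝ), p.2)) (by fun_prop)).clm_comp continuous_const)
    (fun s v => h1 s v) v
  convert h2 using 3 with s
  exact (h1 s v).fderiv

/-- Each directional derivative is again the integral of a smooth function, so the induction on the
order runs over all `F` at once. -/
theorem contDiff_unitInterval_integral {F : ℝ × E → ℂ} (hF : ContDiff ℝ ∞ F) :
    ContDiff ℝ ∞ (fun v => ∫ s : unitInterval, F (s, v)) := by
  rw [contDiff_infty]
  intro k
  induction k generalizing F with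
  | zero =>
    have : Differentiable ℝ (fun v => ∫ s : unitInterval, F (s, v)) :=
      fun v => (hasFDerivAt_unitInterval_integral hF v).differentiableAt
    exact contDiff_zero.2 this.continuous
  | succ k ih =>
    push_cast
    refine contDiff_succ_iff_fderiv_apply.2
      ⟨fun v => (hasFDerivAt_unitInterval_integral hF v).differentiableAt, by simp, fun e => ?_⟩
    have hF2 : ContDiff ℝ ∞ (fun p : ℝ × E => fderiv ℝ F p (0, e)) :=
      (hF.fderiv_right (m := ∞) (by simp)).clm_apply contDiff_const
    convert ih hF2 using 2 with v
    rw [(hasFDerivAt_unitInterval_integral hF v).fderiv, ContinuousLinearMap.integral_apply]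
    · refine integral_congr_ae (.of_forall fun s => ?_)
      have : HasFDerivAt (fun w => F ((s : ℝ), w))
          ((fderiv ℝ F (s, v)).comp (ContinuousLinearMap.inr ℝ ℝ E)) v :=
        HasFDerivAt.comp v (hF.differentiable (by simp) ((s : ℝ), v)).hasFDerivAt
          (hasFDerivAt_prodMk_right _ v)
      simp only [this.fderiv]
      simp
    · refine Continuous.integrable_of_hasCompactSupport ?_ (HasCompactSupport.of_compactSpace _)
      have : ∀ s : unitInterval, fderiv ℝ (fun w => F ((s : ℝ), w)) v =
          (fderiv ℝ F (s, v)).comp (ContinuousLinearMap.inr ℝ ℝ E) := fun s =>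
        (HasFDerivAt.comp v (hF.differentiable (by simp) ((s : ℝ), v)).hasFDerivAt
          (hasFDerivAt_prodMk_right _ v)).fderiv
      simp only [this]
      exact ((hF.continuous_fderiv (by simp)).comp
        (f := fun s : unitInterval => ((s : ℝ), v)) (by fun_prop)).clm_comp continuous_const

end ParametricIntegrals

/-! ### The chain rule in the left-invariant frame and means of smooth families -/

section Pullback

open MeasureTheory

variable {E : Type*} [NormedAddCommGroup E] [NormedSpace ℝ E] [FiniteDimensional ℝ E]
  {G : Type*} [TopologicalSpace G] [ChartedSpace E G] [Group G] [LieGroup 𝓘(ℝ, E) ∞ G] [T2Space G]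

/-- The chain rule for a curve or surface in `G`, in terms of left-invariant derivatives. -/
theorem fderiv_comp_eq_leftDeriv {V : Type*} [NormedAddCommGroup V] [NormedSpace ℝ V]
    {c : V → G} (hc : ContMDiff 𝓘(ℝ, V) 𝓘(ℝ, E) ∞ c) (f : SmoothFun E G) (v e : V) :
    fderiv ℝ (fun w => f (c w)) v e = leftDeriv ((toModel E G).symm
      (fderiv ℝ (fun w => (param E G).inv ((c v)⁻¹ * c w)) v e)) f (c v) := by
  have hk : ContDiff ℝ ∞ (fun w => (param E G).inv ((c v)⁻¹ * c w)) :=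
    ((param E G).smooth_inv.comp (contMDiff_const.mul hc)).contDiff
  have hk0 : (param E G).inv ((c v)⁻¹ * c v) = 0 := by simp [(param E G).inv_one]
  -- Near `v` the point `c w` is `c v` times the parametrization of a vector in `E`. This puts the
  -- composite in the form handled by `leftDeriv_eq_fderiv`.
  have hev : (fun w => f (c w)) =ᶠ[𝓝 v]
      fun w => f (c v * (param E G).toFun ((param E G).inv ((c v)⁻¹ * c w))) := by
    have ht : Filter.Tendsto (fun w => (c v)⁻¹ * c w) (𝓝 v) (𝓝 1) := by
      have := (contMDiff_const (c := (c v)⁻¹) (I := 𝓘(ℝ, V)) (I' := 𝓘(ℝ, E)) (n := ∞)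
        |>.mul hc).continuous.tendsto v
      rw [Pi.mul_apply, inv_mul_cancel] at this
      exact this
    filter_upwards [ht.eventually (param E G).right_inv] with w hw
    rw [hw, mul_inv_cancel_left]
  rw [hev.fderiv_eq, leftDeriv_eq_fderiv _ f.2, LinearEquiv.apply_symm_apply]
  have h1 : DifferentiableAt ℝ (fun u : E => f (c v * (param E G).toFun u))
      ((param E G).inv ((c v)⁻¹ * c v)) :=
    (contDiff_comp_mul_param f.2 (c v)).differentiable (by simp) _
  have h2 := fderiv_comp v h1 (hk.differentiable (by simp) v)
  have h3 := DFunLike.congr_fun h2 e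
  rw [hk0] at h3
  exact h3

theorem leftDeriv_eq_sum {n : ℕ} (Y : Module.Basis (Fin n) ℝ (GroupLieAlgebra 𝓘(ℝ, E) G))
    (X : GroupLieAlgebra 𝓘(ℝ, E) G) (f : G → ℂ) (x : G) :
    leftDeriv X f x = ∑ l, (Y.repr X l : ℂ) * leftDeriv (Y l) f x := by
  let φ : GroupLieAlgebra 𝓘(ℝ, E) G →ₗ[ℝ] ℂ :=
    { toFun := fun X => leftDeriv X f x
      map_add' := fun X Z => leftDeriv_add_left X Z f x
      map_smul' := fun c X => by
        rw [leftDeriv_smul_left]; simp }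
  have := congrArg φ (Y.sum_repr X)
  rw [map_sum] at this
  simp only [map_smul, Complex.real_smul] at this
  exact this.symm

/-- The mean over the unit interval of a smooth family of functions. -/
def meanFun (F : ℝ × G → ℂ) (hF : ContMDiff (𝓘(ℝ, ℝ).prod 𝓘(ℝ, E)) 𝓘(ℝ, ℂ) ∞ F) :
    SmoothFun E G :=
  ⟨fun y => ∫ s : unitInterval, F (s, y), by
    intro y₀
    have h1 : ContDiff ℝ ∞ (fun p : ℝ × E => F (p.1, y₀ * (param E G).toFun p.2)) := by
      have h : ContMDiff (𝓘(ℝ, ℝ).prod 𝓘(ℝ, E)) 𝓘(ℝ, ℂ) ∞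
          (fun p : ℝ × E => F (p.1, y₀ * (param E G).toFun p.2)) :=
        hF.comp (contMDiff_fst.prodMk ((contMDiff_mul_param y₀).comp contMDiff_snd))
      rw [← contMDiff_iff_contDiff, modelWithCornersSelf_prod, ← chartedSpaceSelf_prod]
      exact h
    have h2 := contDiff_unitInterval_integral h1
    have h3 : ContMDiff 𝓘(ℝ, E) 𝓘(ℝ, E) ∞ (fun y : G => (param E G).inv (y₀⁻¹ * y)) :=
      (param E G).smooth_inv.comp contMDiff_mul_left
    have h4 := (h2.contMDiff.comp h3).contMDiffAt (x := y₀)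
    -- Near `y₀` every `y` is recovered from the local coordinate of `y₀⁻¹ y`, so smoothness of the
    -- integral on `E` transfers to `G`.
    refine h4.congr_of_eventuallyEq ?_
    have ht : Filter.Tendsto (fun y => y₀⁻¹ * y) (𝓝 y₀) (𝓝 1) := by
      have := (contMDiff_mul_left (I := 𝓘(ℝ, E)) (n := ∞) (a := y₀⁻¹)).continuous.tendsto y₀
      simpa using this
    filter_upwards [ht.eventually (param E G).right_inv] with y hy
    simp only [Function.comp]
    rw [hy, mul_inv_cancel_left]⟩

theorem meanFun_apply (F : ℝ × G → ℂ) (hF : ContMDiff (𝓘(ℝ, ℝ).prod 𝓘(ℝ, E)) 𝓘(ℝ, ℂ) ∞ F) (y : G) :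
    meanFun F hF y = ∫ s : unitInterval, F (s, y) := rfl

theorem contMDiff_slice {F : ℝ × G → ℂ} (hF : ContMDiff (𝓘(ℝ, ℝ).prod 𝓘(ℝ, E)) 𝓘(ℝ, ℂ) ∞ F)
    (s : ℝ) : ContMDiff 𝓘(ℝ, E) 𝓘(ℝ, ℂ) ∞ (fun y => F (s, y)) :=
  hF.comp (contMDiff_const.prodMk contMDiff_id)

theorem contMDiff_leftDeriv_slice (X : GroupLieAlgebra 𝓘(ℝ, E) G) {F : ℝ × G → ℂ}
    (hF : ContMDiff (𝓘(ℝ, ℝ).prod 𝓘(ℝ, E)) 𝓘(ℝ, ℂ) ∞ F) :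
    ContMDiff (𝓘(ℝ, ℝ).prod 𝓘(ℝ, E)) 𝓘(ℝ, ℂ) ∞
      (fun p : ℝ × G => leftDeriv X (fun y => F (p.1, y)) p.2) := by
  have h : ContMDiff ((𝓘(ℝ, ℝ).prod 𝓘(ℝ, E)).prod 𝓘(ℝ, E)) 𝓘(ℝ, ℂ) ∞
      (Function.uncurry fun (p : ℝ × G) (v : E) => F (p.1, p.2 * (param E G).toFun v)) :=
    hF.comp ((contMDiff_fst.comp contMDiff_fst).prodMk
      ((contMDiff_snd.comp contMDiff_fst).mul ((param E G).smooth.comp contMDiff_snd)))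
  refine (contMDiff_fderiv_family (E := E) h (toModel E G X)).congr fun p => ?_
  exact leftDeriv_eq_fderiv X (contMDiff_slice hF p.1) p.2

theorem leftDeriv_meanFun (X : GroupLieAlgebra 𝓘(ℝ, E) G) (F : ℝ × G → ℂ)
    (hF : ContMDiff (𝓘(ℝ, ℝ).prod 𝓘(ℝ, E)) 𝓘(ℝ, ℂ) ∞ F) :
    derivOp X (meanFun F hF) = meanFun _ (contMDiff_leftDeriv_slice X hF) := by
  refine SmoothFun.ext fun y => ?_
  rw [derivOp_eq_fderiv, meanFun_apply]
  have h1 : ContDiff ℝ ∞ (fun p : ℝ × E => F (p.1, y * (param E G).toFun p.2)) := by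
    have h : ContMDiff (𝓘(ℝ, ℝ).prod 𝓘(ℝ, E)) 𝓘(ℝ, ℂ) ∞
        (fun p : ℝ × E => F (p.1, y * (param E G).toFun p.2)) :=
      hF.comp (contMDiff_fst.prodMk ((contMDiff_mul_param y).comp contMDiff_snd))
    rw [← contMDiff_iff_contDiff, modelWithCornersSelf_prod, ← chartedSpaceSelf_prod]
    exact h
  have h2 := (hasFDerivAt_unitInterval_integral h1 0).fderiv
  simp only [meanFun_apply]
  rw [h2, ContinuousLinearMap.integral_apply]
  · refine integral_congr_ae (.of_forall fun s => ?_)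
    exact (leftDeriv_eq_fderiv X (contMDiff_slice hF s) y).symm
  · refine Continuous.integrable_of_hasCompactSupport ?_ (HasCompactSupport.of_compactSpace _)
    have : ∀ s : unitInterval, fderiv ℝ (fun w => F ((s : ℝ), y * (param E G).toFun w)) 0 =
        (fderiv ℝ (fun p : ℝ × E => F (p.1, y * (param E G).toFun p.2)) (s, 0)).comp
          (ContinuousLinearMap.inr ℝ ℝ E) := fun s =>
      (HasFDerivAt.comp (0 : E) (h1.differentiable (by simp) ((s : ℝ), 0)).hasFDerivAt
        (hasFDerivAt_prodMk_right _ _)).fderiv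
    simp only [this]
    exact ((h1.continuous_fderiv (by simp)).comp
      (f := fun s : unitInterval => ((s : ℝ), (0 : E))) (by fun_prop)).clm_comp continuous_const

end Pullback

/-! ### Operators on smooth functions that lose finitely many derivatives -/

section Order

open MeasureTheory

variable {E : Type*} [NormedAddCommGroup E] [NormedSpace ℝ E] [FiniteDimensional ℝ E]
  {G : Type*} [TopologicalSpace G] [ChartedSpace E G] [Group G] [LieGroup 𝓘(ℝ, E) ∞ G] [T2Space G]
  {n : ℕ} (Y : Module.Basis (Fin n) ℝ (GroupLieAlgebra 𝓘(ℝ, E) G))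

/-- The differential operator `∂_{j₁} ⋯ ∂_{j_k}` given by a word `[j₁, …, j_k]`. -/
def wordOp : List (Fin n) → SmoothFun E G →ₗ[ℂ] SmoothFun E G
  | [] => LinearMap.id
  | j :: w => derivOp (Y j) ∘ₗ wordOp w

@[simp] theorem wordOp_nil (f : SmoothFun E G) : wordOp Y [] f = f := rfl

@[simp] theorem wordOp_cons (j : Fin n) (w : List (Fin n)) (f : SmoothFun E G) :
    wordOp Y (j :: w) f = derivOp (Y j) (wordOp Y w f) := rfl

theorem wordOp_append (w w' : List (Fin n)) (f : SmoothFun E G) :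
    wordOp Y (w ++ w') f = wordOp Y w (wordOp Y w' f) := by
  induction w with
  | nil => rfl
  | cons j w ih => simp [ih]

theorem wordOp_translate (w : List (Fin n)) (g : G) (f : SmoothFun E G) :
    wordOp Y w (translate g f) = translate g (wordOp Y w f) := by
  induction w with
  | nil => rfl
  | cons j w ih => simp [ih, derivOp_translate]

/-- All derivatives of `f` of order at most `k` are bounded by `M`. -/
def BoundedBy (k : ℕ) (f : SmoothFun E G) (M : ℝ) : Prop :=
  ∀ w : List (Fin n), w.length ≤ k → ∀ x, ‖wordOp Y w f x‖ ≤ M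

/-- The linear operator `T` loses at most `l` derivatives. -/
def OrderLE (T : SmoothFun E G →ₗ[ℂ] SmoothFun E G) (l : ℕ) : Prop :=
  ∀ w : List (Fin n), ∃ C : ℝ, 0 ≤ C ∧ ∀ f M, BoundedBy Y (w.length + l) f M →
    ∀ x, ‖wordOp Y w (T f) x‖ ≤ C * M

variable {Y}

theorem BoundedBy.nonneg {k : ℕ} {f : SmoothFun E G} {M : ℝ} (h : BoundedBy Y k f M) : 0 ≤ M :=
  (norm_nonneg _).trans (h [] (by simp) 1)

theorem BoundedBy.mono {k l : ℕ} {f : SmoothFun E G} {M : ℝ} (h : BoundedBy Y l f M) (hk : k ≤ l) :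
    BoundedBy Y k f M := fun w hw => h w (hw.trans hk)

theorem BoundedBy.wordOp {k l : ℕ} {f : SmoothFun E G} {M : ℝ} (h : BoundedBy Y l f M)
    (w : List (Fin n)) (hk : k + w.length ≤ l) : BoundedBy Y k (wordOp Y w f) M := by
  intro w' hw' x
  rw [← wordOp_append]
  exact h _ (by simp; omega) x

theorem BoundedBy.translate {k : ℕ} {f : SmoothFun E G} {M : ℝ} (h : BoundedBy Y k f M) (g : G) :
    BoundedBy Y k (translate g f) M := by
  intro w hw x
  rw [wordOp_translate]
  exact h w hw _

theorem OrderLE.exists_boundedBy {T : SmoothFun E G →ₗ[ℂ] SmoothFun E G} {l : ℕ}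
    (hT : OrderLE Y T l) (k : ℕ) :
    ∃ C : ℝ, 0 ≤ C ∧ ∀ f M, BoundedBy Y (k + l) f M → BoundedBy Y k (T f) (C * M) := by
  choose C hC0 hC using hT
  have hfin := List.finite_length_le (Fin n) k
  refine ⟨∑ w ∈ hfin.toFinset, C w, Finset.sum_nonneg fun w _ => hC0 w, fun f M hf w hw x => ?_⟩
  refine (hC w f M (hf.mono (by omega)) x).trans ?_
  refine mul_le_mul_of_nonneg_right ?_ hf.nonneg
  exact Finset.single_le_sum (f := C) (fun w _ => hC0 w) (by simpa using hw)

theorem OrderLE.comp {S T : SmoothFun E G →ₗ[ℂ] SmoothFun E G} {k l : ℕ}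
    (hS : OrderLE Y S k) (hT : OrderLE Y T l) : OrderLE Y (S ∘ₗ T) (k + l) := by
  intro w
  obtain ⟨C, hC0, hC⟩ := hS w
  obtain ⟨C', hC'0, hC'⟩ := hT.exists_boundedBy (w.length + k)
  refine ⟨C * C', by positivity, fun f M hf x => ?_⟩
  rw [mul_assoc]
  exact hC _ _ (hC' f M (hf.mono (by omega))) x

theorem OrderLE.mono {T : SmoothFun E G →ₗ[ℂ] SmoothFun E G} {k l : ℕ}
    (hT : OrderLE Y T k) (h : k ≤ l) : OrderLE Y T l := fun w => by
  obtain ⟨C, hC0, hC⟩ := hT w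
  exact ⟨C, hC0, fun f M hf => hC f M (hf.mono (by omega))⟩

theorem OrderLE.add {S T : SmoothFun E G →ₗ[ℂ] SmoothFun E G} {k : ℕ}
    (hS : OrderLE Y S k) (hT : OrderLE Y T k) : OrderLE Y (S + T) k := fun w => by
  obtain ⟨C, hC0, hC⟩ := hS w
  obtain ⟨C', hC'0, hC'⟩ := hT w
  refine ⟨C + C', by positivity, fun f M hf x => ?_⟩
  rw [LinearMap.add_apply, map_add, SmoothFun.add_apply, add_mul]
  exact (norm_add_le _ _).trans (add_le_add (hC f M hf x) (hC' f M hf x))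

variable (Y) in
theorem orderLE_zero (k : ℕ) : OrderLE Y (0 : SmoothFun E G →ₗ[ℂ] SmoothFun E G) k := fun w =>
  ⟨0, le_rfl, fun f M _ x => by simp⟩

variable (Y) in
theorem orderLE_id : OrderLE Y (LinearMap.id : SmoothFun E G →ₗ[ℂ] SmoothFun E G) 0 := fun w =>
  ⟨1, zero_le_one, fun f M hf x => by simpa using hf w (by simp) x⟩

theorem OrderLE.sum {ι : Type*} (s : Finset ι) {T : ι → SmoothFun E G →ₗ[ℂ] SmoothFun E G} {k : ℕ}
    (hT : ∀ i ∈ s, OrderLE Y (T i) k) : OrderLE Y (∑ i ∈ s, T i) k := by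
  classical
  induction s using Finset.induction_on with
  | empty => simpa using orderLE_zero Y k
  | insert i s hi ih =>
    rw [Finset.sum_insert hi]
    exact (hT i (by simp)).add (ih fun j hj => hT j (by simp [hj]))

variable (Y) in
theorem orderLE_derivOp (j : Fin n) : OrderLE Y (derivOp (Y j)) 1 := fun w =>
  ⟨1, zero_le_one, fun f M hf x => by
    have := hf (w ++ [j]) (by simp) x
    rw [wordOp_append] at this
    simpa using this⟩

/-- A family of operators that is bounded in the sup norm and closed under commutation with the
left-invariant vector fields consists of operators that do not lose derivatives. -/
theorem orderLE_of_closed (𝒯 : Set (SmoothFun E G →ₗ[ℂ] SmoothFun E G))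
    (h0 : ∀ T ∈ 𝒯, ∃ C : ℝ, 0 ≤ C ∧ ∀ f M, (∀ x, ‖f x‖ ≤ M) → ∀ x, ‖T f x‖ ≤ C * M)
    (h1 : ∀ T ∈ 𝒯, ∀ j, ∃ S ∈ 𝒯, ∃ R : Fin n → SmoothFun E G →ₗ[ℂ] SmoothFun E G,
      (∀ l, R l ∈ 𝒯) ∧ ∀ f, derivOp (Y j) (T f) = S f + ∑ l, R l (derivOp (Y l) f)) :
    ∀ T ∈ 𝒯, OrderLE Y T 0 := by
  intro T hT w
  -- The innermost derivative is peeled off, because it is the one adjacent to `T`. Commuting it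
  -- past `T` leaves other members of the family and a shorter word.
  induction w using List.reverseRecOn generalizing T with
  | nil =>
    obtain ⟨C, hC0, hC⟩ := h0 T hT
    exact ⟨C, hC0, fun f M hf x => hC f M (hf [] (by simp)) x⟩
  | append_singleton w j ih =>
    obtain ⟨S, hS, R, hR, h⟩ := h1 T hT j
    obtain ⟨C, hC0, hC⟩ := ih S hS
    choose C' hC'0 hC' using fun l => ih (R l) (hR l)
    refine ⟨C + ∑ l, C' l, add_nonneg hC0 (Finset.sum_nonneg fun l _ => hC'0 l),
      fun f M hf x => ?_⟩
    rw [wordOp_append, wordOp_cons, wordOp_nil, h, map_add, map_sum, SmoothFun.add_apply,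
      SmoothFun.sum_apply, add_mul, Finset.sum_mul]
    refine (norm_add_le _ _).trans (add_le_add (hC f M (hf.mono (by simp)) x) ?_)
    refine (norm_sum_le _ _).trans (Finset.sum_le_sum fun l _ => ?_)
    refine hC' l _ M ?_ x
    have := hf.wordOp [l] (k := w.length) (by simp)
    simpa using this

end Order

/-! ### Averaged pullbacks lose no derivatives and preserve flatness -/

section PullbackOperators

open MeasureTheory

variable {E : Type*} [NormedAddCommGroup E] [NormedSpace ℝ E] [FiniteDimensional ℝ E]
  {G : Type*} [TopologicalSpace G] [ChartedSpace E G] [Group G] [LieGroup 𝓘(ℝ, E) ∞ G] [T2Space G]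
  [CompactSpace G]
  {n : ℕ} (Y : Module.Basis (Fin n) ℝ (GroupLieAlgebra 𝓘(ℝ, E) G))

theorem contMDiff_mul_comp {Θ : ℝ × G → G}
    (hΘ : ContMDiff (𝓘(ℝ, ℝ).prod 𝓘(ℝ, E)) 𝓘(ℝ, E) ∞ Θ) {a : ℝ × G → ℂ}
    (ha : ContMDiff (𝓘(ℝ, ℝ).prod 𝓘(ℝ, E)) 𝓘(ℝ, ℂ) ∞ a) (f : SmoothFun E G) :
    ContMDiff (𝓘(ℝ, ℝ).prod 𝓘(ℝ, E)) 𝓘(ℝ, ℂ) ∞ (fun p => a p * f (Θ p)) := by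
  have h : ContDiff ℝ ∞ (fun p : ℂ × ℂ => p.1 * p.2) := contDiff_fst.mul contDiff_snd
  exact h.contMDiff.comp (ha.prodMk_space (f.2.comp hΘ))

/-- The operator `f ↦ ∫₀¹ a(s, ·) f(Θ(s, ·)) ds`. -/
def pullInt {Θ : ℝ × G → G} (hΘ : ContMDiff (𝓘(ℝ, ℝ).prod 𝓘(ℝ, E)) 𝓘(ℝ, E) ∞ Θ) {a : ℝ × G → ℂ}
    (ha : ContMDiff (𝓘(ℝ, ℝ).prod 𝓘(ℝ, E)) 𝓘(ℝ, ℂ) ∞ a) :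
    SmoothFun E G →ₗ[ℂ] SmoothFun E G where
  toFun f := meanFun _ (contMDiff_mul_comp hΘ ha f)
  map_add' f g := by
    refine SmoothFun.ext fun y => ?_
    simp only [SmoothFun.add_apply, meanFun_apply, mul_add]
    have hInt : ∀ f : SmoothFun E G, Integrable fun s : unitInterval =>
        a ((s : ℝ), y) * f (Θ ((s : ℝ), y)) := fun f =>
      Continuous.integrable_of_hasCompactSupport
        ((contMDiff_mul_comp hΘ ha f).continuous.comp
          (f := fun s : unitInterval => ((s : ℝ), y)) (by fun_prop))
        (HasCompactSupport.of_compactSpace _)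
    exact integral_add (hInt f) (hInt g)
  map_smul' c f := by
    refine SmoothFun.ext fun y => ?_
    simp only [SmoothFun.smul_apply, meanFun_apply, RingHom.id_apply]
    rw [← integral_const_mul]
    congr 1; ext s; ring

theorem pullInt_apply {Θ : ℝ × G → G} (hΘ : ContMDiff (𝓘(ℝ, ℝ).prod 𝓘(ℝ, E)) 𝓘(ℝ, E) ∞ Θ)
    {a : ℝ × G → ℂ} (ha : ContMDiff (𝓘(ℝ, ℝ).prod 𝓘(ℝ, E)) 𝓘(ℝ, ℂ) ∞ a) (f : SmoothFun E G) (y : G) :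
    pullInt hΘ ha f y = ∫ s : unitInterval, a (s, y) * f (Θ (s, y)) := rfl

/-- The coefficients of the derivative of `Θ(s, ·)` with respect to the left-invariant frame. -/
def frameCoeff (Θ : ℝ × G → G) (j l : Fin n) (p : ℝ × G) : ℂ :=
  ((Y.repr ((toModel E G).symm (fderiv ℝ (fun v : E => (param E G).inv
    ((Θ p)⁻¹ * Θ (p.1, p.2 * (param E G).toFun v))) 0 (toModel E G (Y j)))) l : ℝ) : ℂ)

theorem contMDiff_frameCoeff {Θ : ℝ × G → G}
    (hΘ : ContMDiff (𝓘(ℝ, ℝ).prod 𝓘(ℝ, E)) 𝓘(ℝ, E) ∞ Θ) (j l : Fin n) :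
    ContMDiff (𝓘(ℝ, ℝ).prod 𝓘(ℝ, E)) 𝓘(ℝ, ℂ) ∞ (frameCoeff Y Θ j l) := by
  have h : ContMDiff ((𝓘(ℝ, ℝ).prod 𝓘(ℝ, E)).prod 𝓘(ℝ, E)) 𝓘(ℝ, E) ∞
      (Function.uncurry fun (p : ℝ × G) (v : E) => (param E G).inv
        ((Θ p)⁻¹ * Θ (p.1, p.2 * (param E G).toFun v))) := by
    refine (param E G).smooth_inv.comp (ContMDiff.mul (hΘ.comp contMDiff_fst).inv (hΘ.comp ?_))
    exact (contMDiff_fst.comp contMDiff_fst).prodMk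
      ((contMDiff_snd.comp contMDiff_fst).mul ((param E G).smooth.comp contMDiff_snd))
  have h2 := contMDiff_fderiv_family (E := E) h (toModel E G (Y j))
  let ℓ : E →ₗ[ℝ] ℂ :=
    { toFun := fun v => ((Y.repr ((toModel E G).symm v) l : ℝ) : ℂ)
      map_add' := fun v w => by simp
      map_smul' := fun c v => by simp }
  have hℓ : ContDiff ℝ ∞ ℓ := (LinearMap.toContinuousLinearMap ℓ).contDiff
  exact hℓ.contMDiff.comp h2

theorem leftDeriv_comp_slice {Θ : ℝ × G → G}
    (hΘ : ContMDiff (𝓘(ℝ, ℝ).prod 𝓘(ℝ, E)) 𝓘(ℝ, E) ∞ Θ) (f : SmoothFun E G) (j : Fin n)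
    (s : ℝ) (y : G) :
    leftDeriv (Y j) (fun y => f (Θ (s, y))) y =
      ∑ l, frameCoeff Y Θ j l (s, y) * derivOp (Y l) f (Θ (s, y)) := by
  have hs : ContMDiff 𝓘(ℝ, E) 𝓘(ℝ, E) ∞ (fun y : G => Θ (s, y)) :=
    hΘ.comp (contMDiff_const.prodMk contMDiff_id)
  rw [leftDeriv_eq_fderiv (Y j) (f := fun y => f (Θ (s, y))) (f.2.comp hs),
    fderiv_comp_eq_leftDeriv (c := fun v : E => Θ (s, y * (param E G).toFun v))
      (hs.comp (contMDiff_mul_param y)) f, leftDeriv_eq_sum Y]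
  simp only [(param E G).map_zero, mul_one]
  rfl

theorem contMDiff_mul_complex {b c : ℝ × G → ℂ}
    (hb : ContMDiff (𝓘(ℝ, ℝ).prod 𝓘(ℝ, E)) 𝓘(ℝ, ℂ) ∞ b)
    (hc : ContMDiff (𝓘(ℝ, ℝ).prod 𝓘(ℝ, E)) 𝓘(ℝ, ℂ) ∞ c) :
    ContMDiff (𝓘(ℝ, ℝ).prod 𝓘(ℝ, E)) 𝓘(ℝ, ℂ) ∞ (fun p => b p * c p) := by
  have h : ContDiff ℝ ∞ (fun p : ℂ × ℂ => p.1 * p.2) := contDiff_fst.mul contDiff_snd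
  exact h.contMDiff.comp (hb.prodMk_space hc)

theorem derivOp_pullInt {Θ : ℝ × G → G}
    (hΘ : ContMDiff (𝓘(ℝ, ℝ).prod 𝓘(ℝ, E)) 𝓘(ℝ, E) ∞ Θ) {b : ℝ × G → ℂ}
    (hb : ContMDiff (𝓘(ℝ, ℝ).prod 𝓘(ℝ, E)) 𝓘(ℝ, ℂ) ∞ b) (j : Fin n) (f : SmoothFun E G) :
    derivOp (Y j) (pullInt hΘ hb f) = pullInt hΘ (contMDiff_leftDeriv_slice (Y j) hb) f +
      ∑ l, pullInt hΘ (contMDiff_mul_complex hb (contMDiff_frameCoeff Y hΘ j l))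
        (derivOp (Y l) f) := by
  have hInt : ∀ {b : ℝ × G → ℂ} (_ : Continuous b) (y : G),
      Integrable fun s : unitInterval => b ((s : ℝ), y) := fun hb y =>
    Continuous.integrable_of_hasCompactSupport
      (hb.comp (f := fun s : unitInterval => ((s : ℝ), y)) (by fun_prop))
      (HasCompactSupport.of_compactSpace _)
  have h1 := leftDeriv_meanFun (Y j) _ (contMDiff_mul_comp hΘ hb f)
  refine SmoothFun.ext fun y => ?_
  have h2 := congrArg (fun g : SmoothFun E G => g y) h1
  refine h2.trans ?_
  have hInt2 := fun l => hInt (b := fun p => b p * frameCoeff Y Θ j l p * derivOp (Y l) f (Θ p))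
    (contMDiff_mul_comp hΘ (contMDiff_mul_complex hb (contMDiff_frameCoeff Y hΘ j l))
      (derivOp (Y l) f)).continuous y
  simp only [meanFun_apply, SmoothFun.add_apply, SmoothFun.sum_apply, pullInt_apply]
  rw [← integral_finsetSum _ fun l _ => hInt2 l, ← integral_add]
  · refine integral_congr_ae (.of_forall fun s => ?_)
    have hs : ContMDiff 𝓘(ℝ, E) 𝓘(ℝ, E) ∞ (fun y : G => Θ ((s : ℝ), y)) :=
      hΘ.comp (contMDiff_const.prodMk contMDiff_id)
    have h3 := derivOp_mul (Y j) ⟨_, contMDiff_slice hb (s : ℝ)⟩ ⟨_, f.2.comp hs⟩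
    have h4 := congrArg (fun g : SmoothFun E G => g y) h3
    refine h4.trans ?_
    have h5 := leftDeriv_comp_slice Y hΘ f j s y
    change _ * f (Θ ((s : ℝ), y)) + b ((s : ℝ), y) * leftDeriv (Y j) (fun y => f (Θ (s, y))) y = _
    rw [h5, Finset.mul_sum]
    simp only [mul_assoc]
    rfl
  · exact hInt (b := fun p => leftDeriv (Y j) (fun y => b (p.1, y)) p.2 * f (Θ p))
      (contMDiff_mul_comp hΘ (contMDiff_leftDeriv_slice (Y j) hb) f).continuous y
  · exact integrable_finsetSum _ fun l _ => hInt2 l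

/-- For fixed `Θ`, consider all smooth amplitudes at once. A derivative falls either on the
amplitude or, by the chain rule, on `f` with a new amplitude, so this family satisfies the closure
condition of `orderLE_of_closed`. -/
theorem orderLE_pullInt {Θ : ℝ × G → G}
    (hΘ : ContMDiff (𝓘(ℝ, ℝ).prod 𝓘(ℝ, E)) 𝓘(ℝ, E) ∞ Θ) {a : ℝ × G → ℂ}
    (ha : ContMDiff (𝓘(ℝ, ℝ).prod 𝓘(ℝ, E)) 𝓘(ℝ, ℂ) ∞ a) : OrderLE Y (pullInt hΘ ha) 0 := by
  refine orderLE_of_closed (Set.range fun b : {b : ℝ × G → ℂ //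
    ContMDiff (𝓘(ℝ, ℝ).prod 𝓘(ℝ, E)) 𝓘(ℝ, ℂ) ∞ b} => pullInt hΘ b.2) ?_ ?_ _ ⟨⟨a, ha⟩, rfl⟩
  · rintro _ ⟨⟨b, hb⟩, rfl⟩
    obtain ⟨C, hC⟩ := ((isCompact_Icc (a := (0 : ℝ)) (b := 1)).prod
      (isCompact_univ (X := G))).exists_bound_of_continuousOn hb.continuous.continuousOn
    refine ⟨C, (norm_nonneg _).trans (hC (0, 1) (by simp)), fun f M hf y => ?_⟩
    rw [pullInt_apply]
    have : ∀ s : unitInterval, ‖b ((s : ℝ), y) * f (Θ ((s : ℝ), y))‖ ≤ C * M := fun s => by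
      rw [norm_mul]
      exact mul_le_mul (hC _ ⟨s.2, Set.mem_univ _⟩) (hf _) (norm_nonneg _)
        ((norm_nonneg _).trans (hC (0, 1) (by simp)))
    simpa using norm_integral_le_of_norm_le_const (μ := (volume : Measure unitInterval))
      (.of_forall this)
  · rintro _ ⟨⟨b, hb⟩, rfl⟩ j
    exact ⟨_, ⟨⟨_, contMDiff_leftDeriv_slice (Y j) hb⟩, rfl⟩, _, 
      fun l => ⟨⟨_, contMDiff_mul_complex hb (contMDiff_frameCoeff Y hΘ j l)⟩, rfl⟩,
      derivOp_pullInt Y hΘ hb j⟩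

/-- All derivatives of `f` at the identity of order less than `k` vanish. -/
def IsFlat (k : ℕ) (f : SmoothFun E G) : Prop :=
  ∀ w : List (Fin n), w.length < k → wordOp Y w f 1 = 0

variable {Y} in
theorem IsFlat.mono {k l : ℕ} {f : SmoothFun E G} (h : IsFlat Y l f) (hk : k ≤ l) : IsFlat Y k f :=
  fun w hw => h w (by omega)

variable {Y} in
theorem IsFlat.derivOp {k : ℕ} {f : SmoothFun E G} (h : IsFlat Y (k + 1) f) (j : Fin n) :
    IsFlat Y k (derivOp (Y j) f) := fun w hw => by
  have := h (w ++ [j]) (by simpa using hw)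
  rwa [wordOp_append] at this

variable {Y} in
theorem IsFlat.sub {k : ℕ} {f g : SmoothFun E G} (hf : IsFlat Y k f) (hg : IsFlat Y k g) :
    IsFlat Y k (f - g) := fun w hw => by
  rw [map_sub, SmoothFun.sub_apply, hf w hw, hg w hw, sub_zero]

variable {Y} in
theorem IsFlat.sum {ι : Type*} (s : Finset ι) {k : ℕ} {f : ι → SmoothFun E G}
    (hf : ∀ i ∈ s, IsFlat Y k (f i)) : IsFlat Y k (∑ i ∈ s, f i) := fun w hw => by
  rw [map_sum, SmoothFun.sum_apply]
  exact Finset.sum_eq_zero fun i hi => hf i hi w hw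

-- Derivatives are commuted past the operator one by one and produce derivatives of `f` of no higher
-- order. As `Θ(s, ·)` fixes the identity, these are evaluated at the identity, where they vanish.
variable {Y} in
theorem IsFlat.pullInt {Θ : ℝ × G → G}
    (hΘ : ContMDiff (𝓘(ℝ, ℝ).prod 𝓘(ℝ, E)) 𝓘(ℝ, E) ∞ Θ) (hΘ1 : ∀ s, Θ (s, 1) = 1) {a : ℝ × G → ℂ}
    (ha : ContMDiff (𝓘(ℝ, ℝ).prod 𝓘(ℝ, E)) 𝓘(ℝ, ℂ) ∞ a) {k : ℕ} {f : SmoothFun E G}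
    (hf : IsFlat Y k f) : IsFlat Y k (pullInt hΘ ha f) := by
  intro w hw
  induction w using List.reverseRecOn generalizing a k f with
  | nil =>
    rw [wordOp_nil, pullInt_apply]
    have : f 1 = 0 := hf [] hw
    simp [hΘ1, this]
  | append_singleton w j ih =>
    obtain ⟨k, rfl⟩ : ∃ k', k = k' + 1 := ⟨k - 1, by simp at hw; omega⟩
    have hw' : w.length < k := by simpa using hw
    rw [wordOp_append, wordOp_cons, wordOp_nil, derivOp_pullInt, map_add, map_sum,
      SmoothFun.add_apply, SmoothFun.sum_apply, ih _ (hf.mono (Nat.le_succ k)) hw', zero_add]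
    exact Finset.sum_eq_zero fun l _ => ih _ (hf.derivOp l) hw'

theorem orderLE_mulLeft (q : SmoothFun E G) : OrderLE Y (LinearMap.mulLeft ℂ q) 0 := by
  have h : LinearMap.mulLeft ℂ q = pullInt (Θ := Prod.snd) (contMDiff_snd)
      (a := fun p : ℝ × G => q p.2) (q.2.comp contMDiff_snd) := by
    refine LinearMap.ext fun f => SmoothFun.ext fun y => ?_
    rw [pullInt_apply]; simp
  rw [h]
  exact orderLE_pullInt Y _ _

/-- The operator of composition with a smooth map. -/
def compOp {θ : G → G} (hθ : ContMDiff 𝓘(ℝ, E) 𝓘(ℝ, E) ∞ θ) :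
    SmoothFun E G →ₗ[ℂ] SmoothFun E G where
  toFun f := ⟨fun y => f (θ y), f.2.comp hθ⟩
  map_add' _ _ := rfl
  map_smul' _ _ := rfl

theorem compOp_eq_pullInt {θ : G → G} (hθ : ContMDiff 𝓘(ℝ, E) 𝓘(ℝ, E) ∞ θ) :
    compOp hθ = pullInt (Θ := fun p : ℝ × G => θ p.2) (hθ.comp contMDiff_snd)
      (a := fun _ => 1) contMDiff_const := by
  refine LinearMap.ext fun f => SmoothFun.ext fun y => ?_
  rw [pullInt_apply]; simp; rfl

theorem orderLE_compOp {θ : G → G} (hθ : ContMDiff 𝓘(ℝ, E) 𝓘(ℝ, E) ∞ θ) :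
    OrderLE Y (compOp hθ) 0 := by
  rw [compOp_eq_pullInt]
  exact orderLE_pullInt Y _ _

end PullbackOperators

/-! ### Hadamard's lemma on the group -/

section Hadamard

open MeasureTheory

variable {E : Type*} [NormedAddCommGroup E] [NormedSpace ℝ E] [FiniteDimensional ℝ E]
  {G : Type*} [TopologicalSpace G] [ChartedSpace E G] [Group G] [LieGroup 𝓘(ℝ, E) ∞ G] [T2Space G]
  [CompactSpace G]
  {n : ℕ} (Y : Module.Basis (Fin n) ℝ (GroupLieAlgebra 𝓘(ℝ, E) G))

theorem integral_unitInterval (F : ℝ → ℂ) :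
    ∫ s : unitInterval, F s = ∫ s in (0 : ℝ)..1, F s := by
  rw [intervalIntegral.integral_of_le zero_le_one, ← integral_Icc_eq_integral_Ioc]
  exact integral_subtype measurableSet_Icc F

/-- The `i`-th coordinate of `v` with respect to the basis `Y`. -/
def coordMap (i : Fin n) : E →ₗ[ℝ] ℂ where
  toFun v := ((Y.repr ((toModel E G).symm v) i : ℝ) : ℂ)
  map_add' v w := by simp
  map_smul' c v := by simp

theorem contDiff_coordMap (i : Fin n) : ContDiff ℝ ∞ (coordMap Y i) :=
  (LinearMap.toContinuousLinearMap (coordMap Y i)).contDiff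

/-- The coordinates near the identity, extended to `G`. -/
def coordFun (i : Fin n) : SmoothFun E G :=
  ⟨fun y => coordMap Y i ((param E G).inv y), (contDiff_coordMap Y i).contMDiff.comp
    (param E G).smooth_inv⟩

/-- The contraction `(s, y) ↦ Ψ (s Φ(y))`. -/
def contraction (p : ℝ × G) : G := (param E G).toFun (p.1 • (param E G).inv p.2)

theorem contMDiff_smul_inv : ContMDiff (𝓘(ℝ, ℝ).prod 𝓘(ℝ, E)) 𝓘(ℝ, E) ∞
    (fun p : ℝ × G => p.1 • (param E G).inv p.2) :=
  contMDiff_fst.smul ((param E G).smooth_inv.comp contMDiff_snd)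

theorem contMDiff_contraction : ContMDiff (𝓘(ℝ, ℝ).prod 𝓘(ℝ, E)) 𝓘(ℝ, E) ∞
    (contraction (E := E) (G := G)) :=
  (param E G).smooth.comp contMDiff_smul_inv

/-- The coefficients of the coordinate vector fields with respect to the left-invariant frame. -/
def chartCoeff (i l : Fin n) (p : ℝ × G) : ℂ :=
  coordMap Y l (fderiv ℝ (fun v : E => (param E G).inv ((contraction (E := E) p)⁻¹ *
    (param E G).toFun (p.1 • (param E G).inv p.2 + v))) 0 (toModel E G (Y i)))

theorem contMDiff_chartCoeff (i l : Fin n) :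
    ContMDiff (𝓘(ℝ, ℝ).prod 𝓘(ℝ, E)) 𝓘(ℝ, ℂ) ∞ (chartCoeff Y i l) := by
  have h : ContMDiff ((𝓘(ℝ, ℝ).prod 𝓘(ℝ, E)).prod 𝓘(ℝ, E)) 𝓘(ℝ, E) ∞
      (Function.uncurry fun (p : ℝ × G) (v : E) => (param E G).inv ((contraction (E := E) p)⁻¹ *
        (param E G).toFun (p.1 • (param E G).inv p.2 + v))) := by
    refine (param E G).smooth_inv.comp (ContMDiff.mul (contMDiff_contraction.comp contMDiff_fst).inv
      ((param E G).smooth.comp ?_))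
    exact ContMDiff.add (contMDiff_smul_inv.comp contMDiff_fst) contMDiff_snd
  exact (contDiff_coordMap Y l).contMDiff.comp
    (contMDiff_fderiv_family (E := E) h (toModel E G (Y i)))

/-- The quotient operators in Hadamard's lemma. -/
def hadamardOp (i : Fin n) : SmoothFun E G →ₗ[ℂ] SmoothFun E G :=
  ∑ l, pullInt contMDiff_contraction (contMDiff_chartCoeff Y i l) ∘ₗ derivOp (Y l)

theorem orderLE_hadamardOp (i : Fin n) : OrderLE Y (hadamardOp Y i) 1 :=
  OrderLE.sum _ fun l _ => by
    simpa using (orderLE_pullInt Y contMDiff_contraction (contMDiff_chartCoeff Y i l)).comp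
      (orderLE_derivOp Y l)

theorem fderiv_comp_param (f : SmoothFun E G) (i : Fin n) (s : ℝ) (y : G) :
    fderiv ℝ (fun v : E => f ((param E G).toFun v)) (s • (param E G).inv y) (toModel E G (Y i)) =
      ∑ l, chartCoeff Y i l (s, y) * derivOp (Y l) f (contraction (E := E) (s, y)) := by
  set t := s • (param E G).inv y with ht
  have h1 : fderiv ℝ (fun v : E => f ((param E G).toFun v)) t =
      fderiv ℝ (fun v : E => f ((param E G).toFun (t + v))) 0 := by
    have := fderiv_comp_add_left (𝕜 := ℝ) (f := fun v : E => f ((param E G).toFun v)) (x := 0) t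
    simpa using this.symm
  have hc : ContMDiff 𝓘(ℝ, E) 𝓘(ℝ, E) ∞ (fun v : E => (param E G).toFun (t + v)) :=
    (param E G).smooth.comp (contDiff_const.add contDiff_id).contMDiff
  rw [h1, fderiv_comp_eq_leftDeriv hc f, leftDeriv_eq_sum Y]
  simp only [add_zero]
  rfl

theorem sum_coordMap_mul (L : E →L[ℝ] ℂ) (v : E) :
    L v = ∑ i, coordMap Y i v * L (toModel E G (Y i)) := by
  have h := congrArg (fun X => L (toModel E G X)) (Y.sum_repr ((toModel E G).symm v))
  simp only [map_sum, map_smul, LinearEquiv.apply_symm_apply, Complex.real_smul] at h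
  exact h.symm

/-- The fundamental theorem of calculus along the ray `s ↦ Ψ(s Φ(y))`, with the velocity expanded in
the basis `Y`. It holds for every `y`, at the price of the point `contraction (1, y)`, which equals
`y` only near the identity. -/
theorem comp_contraction_one (f : SmoothFun E G) (y : G) :
    f (contraction (E := E) (1, y)) = f 1 + ∑ i, coordFun Y i y * hadamardOp Y i f y := by
  set F : E → ℂ := fun v => f ((param E G).toFun v) with hF
  have hFs : ContDiff ℝ ∞ F := (f.2.comp (param E G).smooth).contDiff
  set v := (param E G).inv y with hv
  have h1 : ∀ s : ℝ, HasDerivAt (fun s : ℝ => F (s • v)) (fderiv ℝ F (s • v) v) s := fun s => by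
    have h := (hFs.differentiable (by simp) (s • v)).hasFDerivAt.comp_hasDerivAt s
      ((hasDerivAt_id s).smul_const v)
    rw [one_smul] at h
    exact h
  have hcont : Continuous fun s : ℝ => fderiv ℝ F (s • v) v :=
    ((hFs.continuous_fderiv (by simp)).comp (by fun_prop : Continuous fun s : ℝ => s • v)).clm_apply
      continuous_const
  have h2 := intervalIntegral.integral_eq_sub_of_hasDerivAt (fun s _ => h1 s)
    (hcont.intervalIntegrable 0 1)
  have h3 : F ((1 : ℝ) • v) = f (contraction (E := E) (1, y)) := rfl
  have h4 : F ((0 : ℝ) • v) = f 1 := by simp [hF, (param E G).map_zero]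
  rw [h3, h4] at h2
  rw [← sub_eq_iff_eq_add', ← h2, ← integral_unitInterval]
  have hInt : ∀ i l, Integrable fun s : unitInterval => chartCoeff Y i l ((s : ℝ), y) *
      derivOp (Y l) f (contraction (E := E) ((s : ℝ), y)) := fun i l =>
    Continuous.integrable_of_hasCompactSupport
      ((contMDiff_mul_comp contMDiff_contraction (contMDiff_chartCoeff Y i l)
        (derivOp (Y l) f)).continuous.comp
        (f := fun s : unitInterval => ((s : ℝ), y)) (by fun_prop))
      (HasCompactSupport.of_compactSpace _)
  have h5 : ∀ i, hadamardOp Y i f y =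
      ∫ s : unitInterval, fderiv ℝ F ((s : ℝ) • v) (toModel E G (Y i)) := fun i => by
    rw [hadamardOp, LinearMap.sum_apply, SmoothFun.sum_apply]
    simp only [LinearMap.comp_apply, pullInt_apply]
    rw [← integral_finsetSum _ fun l _ => hInt i l]
    refine integral_congr_ae (.of_forall fun s => ?_)
    exact (fderiv_comp_param Y f i s y).symm
  simp only [h5, ← integral_const_mul]
  rw [← integral_finsetSum]
  · refine integral_congr_ae (.of_forall fun s => ?_)
    exact sum_coordMap_mul Y (fderiv ℝ F ((s : ℝ) • v)) v
  · intro i _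
    refine Integrable.const_mul ?_ _
    refine Continuous.integrable_of_hasCompactSupport ?_ (HasCompactSupport.of_compactSpace _)
    exact ((hFs.continuous_fderiv (by simp)).comp
      (by fun_prop : Continuous fun s : unitInterval => (s : ℝ) • v)).clm_apply continuous_const

theorem contMDiff_contraction_one :
    ContMDiff 𝓘(ℝ, E) 𝓘(ℝ, E) ∞ (fun y : G => contraction (E := E) (1, y)) :=
  contMDiff_contraction.comp (contMDiff_const.prodMk contMDiff_id)

theorem contraction_one_eventually : ∀ᶠ y : G in 𝓝 1, contraction (E := E) (1, y) = y := by
  filter_upwards [(param E G).right_inv] with y hy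
  simpa [contraction] using hy

/-- The error operator in Hadamard's lemma; its values vanish near the identity. -/
def hadamardErr : SmoothFun E G →ₗ[ℂ] SmoothFun E G :=
  LinearMap.id - compOp contMDiff_contraction_one

theorem hadamardErr_apply (f : SmoothFun E G) (y : G) :
    hadamardErr f y = f y - f (contraction (E := E) (1, y)) := rfl

-- Take `1 - b` for a bump function `b` supported where `contraction (1, y) = y`. Away from the
-- identity the coordinates may have other common zeros; this function takes over there.
variable (E G) in
theorem exists_cutoff : ∃ s : SmoothFun E G, (∀ᶠ y in 𝓝 1, s y = 0) ∧
    ∀ y, contraction (E := E) (1, y) ≠ y → s y = 1 := by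
  obtain ⟨b, -, hb⟩ := ((SmoothBumpFunction.nhds_basis_support (I := 𝓘(ℝ, E)) (c := (1 : G))
    Filter.univ_mem).mem_iff).1 (contraction_one_eventually (E := E) (G := G))
  have h : ContMDiff 𝓘(ℝ, E) 𝓘(ℝ, ℂ) ∞ (fun y : G => (1 - (b y : ℂ))) := by
    have h1 : ContDiff ℝ ∞ (fun t : ℝ => (1 - (t : ℂ))) :=
      contDiff_const.sub Complex.ofRealCLM.contDiff
    exact h1.contMDiff.comp b.contMDiff
  refine ⟨⟨_, h⟩, ?_, fun y hy => ?_⟩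
  · filter_upwards [b.eventuallyEq_one] with y hy
    have hy' : b y = 1 := hy
    simp [hy']
  · have : b y = 0 := by
      by_contra h0
      exact hy (hb h0)
    simp [this]

variable (E G) in
/-- A smooth function that vanishes near the identity and is `1` away from it. -/
def cutoff : SmoothFun E G := (exists_cutoff E G).choose

theorem cutoff_eventually : ∀ᶠ y in 𝓝 (1 : G), cutoff E G y = 0 :=
  (exists_cutoff E G).choose_spec.1

/-- **Hadamard's lemma** on `G`. -/
theorem hadamard (f : SmoothFun E G) (y : G) :
    f y = f 1 + (cutoff E G y * hadamardErr f y + ∑ i, coordFun Y i y * hadamardOp Y i f y) := by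
  have h := comp_contraction_one Y f y
  -- Wherever the error is nonzero the cut-off is `1`, so the factor changes nothing. It gives the
  -- error term the shape of all the others: a function vanishing at the identity times an operator
  -- applied to `f`.
  have h2 : cutoff E G y * hadamardErr f y = f y - f (contraction (E := E) (1, y)) := by
    rw [hadamardErr_apply]
    by_cases hy : contraction (E := E) (1, y) = y
    · rw [hy]; simp
    · rw [show cutoff E G y = 1 from (exists_cutoff E G).choose_spec.2 y hy, one_mul]
  rw [h2, h]; ring

theorem derivOp_coordFun (i j : Fin n) :
    derivOp (Y j) (coordFun Y i) 1 = if i = j then 1 else 0 := by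
  rw [derivOp_eq_fderiv]
  have : (fun v : E => coordFun Y i (1 * (param E G).toFun v)) =ᶠ[𝓝 0]
      fun v => LinearMap.toContinuousLinearMap (coordMap Y i) v := by
    filter_upwards [(param E G).left_inv] with v hv
    simp [coordFun, hv]
  rw [this.fderiv_eq, ContinuousLinearMap.fderiv]
  simp [coordMap, Finsupp.single_apply, eq_comm]
  split_ifs <;> simp

@[simp] theorem coordFun_one (i : Fin n) : coordFun Y i 1 = 0 := by
  simp [coordFun, (param E G).inv_one]

end Hadamard

/-! ### Reordering words of left-invariant derivatives -/

section Ordering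

variable {E : Type*} [NormedAddCommGroup E] [NormedSpace ℝ E] [FiniteDimensional ℝ E]
  {G : Type*} [TopologicalSpace G] [ChartedSpace E G] [Group G] [LieGroup 𝓘(ℝ, E) ∞ G] [T2Space G]
  [CompactSpace G]
  {n : ℕ} (Y : Module.Basis (Fin n) ℝ (GroupLieAlgebra 𝓘(ℝ, E) G))

theorem hadamard_eq (f : SmoothFun E G) :
    f = f 1 • 1 + (cutoff E G * hadamardErr f + ∑ i, coordFun Y i * hadamardOp Y i f) := by
  refine SmoothFun.ext fun y => ?_
  simpa [SmoothFun.sum_apply] using hadamard Y f y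

theorem contraction_one (s : ℝ) : contraction (E := E) (s, (1 : G)) = 1 := by
  simp [contraction, (param E G).inv_one, (param E G).map_zero]

theorem hadamardErr_one (f : SmoothFun E G) : hadamardErr f 1 = 0 := by
  rw [hadamardErr_apply, contraction_one, sub_self]

/-- Apply `L` to Hadamard's formula. It kills constants, and it kills the cut-off term because both
factors vanish at the identity. -/
theorem pointDerivation_eq (L : SmoothFun E G →ₗ[ℂ] ℂ)
    (hL : ∀ f g : SmoothFun E G, L (f * g) = L f * g 1 + f 1 * L g) (f : SmoothFun E G) :
    L f = ∑ i, L (coordFun Y i) * hadamardOp Y i f 1 := by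
  have h1 : L 1 = 0 := by
    have := hL 1 1
    simpa using this
  have hc : cutoff E G 1 = 0 := cutoff_eventually.self_of_nhds
  conv_lhs => rw [hadamard_eq Y f]
  rw [map_add, map_add, map_smul, h1, hL, hadamardErr_one, hc, map_sum]
  simp [hL]

theorem hadamardOp_one (i : Fin n) (f : SmoothFun E G) :
    hadamardOp Y i f 1 = derivOp (Y i) f 1 := by
  have := pointDerivation_eq Y ((evalAt E (1 : G)).toLinearMap ∘ₗ derivOp (Y i))
    (fun f g => by simp [derivOp_mul]) f
  simp only [LinearMap.comp_apply, AlgHom.toLinearMap_apply, evalAt_apply] at this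
  rw [this]
  simp [derivOp_coordFun]

/-- In a commutator the mixed first-order products cancel, so its value at the identity is a point
derivation and hence a combination of the `∂_m`. Left translation carries the same coefficients to
every point. -/
theorem exists_commutator (j l : Fin n) : ∃ c : Fin n → ℂ, ∀ f : SmoothFun E G,
    derivOp (Y j) (derivOp (Y l) f) - derivOp (Y l) (derivOp (Y j) f) =
      ∑ m, c m • derivOp (Y m) f := by
  let L : SmoothFun E G →ₗ[ℂ] ℂ := (evalAt E (1 : G)).toLinearMap ∘ₗ
    (derivOp (Y j) ∘ₗ derivOp (Y l) - derivOp (Y l) ∘ₗ derivOp (Y j))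
  have hL : ∀ f, L f = derivOp (Y j) (derivOp (Y l) f) 1 - derivOp (Y l) (derivOp (Y j) f) 1 :=
    fun f => rfl
  refine ⟨fun m => L (coordFun Y m), fun f => SmoothFun.ext fun x => ?_⟩
  have h := pointDerivation_eq Y L (fun f g => by
    simp only [hL, derivOp_mul, map_add, SmoothFun.add_apply, SmoothFun.mul_apply]; ring)
    (translate x f)
  rw [hL] at h
  simp only [derivOp_translate, hadamardOp_one, translate_apply, mul_one] at h
  rw [SmoothFun.sub_apply, h, SmoothFun.sum_apply]
  rfl

/-- The word of the ordered monomial `∂^β`. -/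
def ordWord (β : Fin n → ℕ) : List (Fin n) :=
  (List.finRange n).flatMap fun j => List.replicate (β j) j

theorem length_ordWord (β : Fin n → ℕ) : (ordWord β).length = ∑ j, β j := by
  simp [ordWord, List.length_flatMap, Fin.sum_univ_def]

theorem count_ordWord (β : Fin n → ℕ) (j : Fin n) : (ordWord β).count j = β j := by
  rw [ordWord, List.count_flatMap]
  have h : (List.count j ∘ fun j : Fin n => List.replicate (β j) j) =
      fun i => if i = j then β j else 0 := by
    funext i
    simp only [Function.comp, List.count_replicate]
    by_cases h : i = j <;> simp [h]
  rw [h, ← Fin.sum_univ_def]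
  simp

theorem partialDeriv_eq_wordOp (β : Fin n → ℕ) (f : SmoothFun E G) :
    partialDeriv Y β f = wordOp Y (ordWord β) f := by
  unfold partialDeriv ordWord
  induction List.finRange n with
  | nil => rfl
  | cons j L ih =>
    rw [List.foldr_cons, ih, List.flatMap_cons, wordOp_append]
    induction β j with
    | zero => rfl
    | succ k ihk =>
      rw [Function.iterate_succ', Function.comp_apply, ihk, List.replicate_succ, wordOp_cons]
      rfl

/-- The differential operators spanned by words of length less than `k`. -/
def wordSpan (k : ℕ) : Submodule ℂ (SmoothFun E G →ₗ[ℂ] SmoothFun E G) :=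
  Submodule.span ℂ {T | ∃ w : List (Fin n), w.length < k ∧ T = wordOp Y w}

theorem derivOp_comp_mem_wordSpan {k : ℕ} (j : Fin n) {T : SmoothFun E G →ₗ[ℂ] SmoothFun E G}
    (hT : T ∈ wordSpan Y k) : derivOp (Y j) ∘ₗ T ∈ wordSpan Y (k + 1) := by
  induction hT using Submodule.span_induction with
  | mem T h =>
    obtain ⟨w, hw, rfl⟩ := h
    exact Submodule.subset_span ⟨j :: w, by simpa using hw, rfl⟩
  | zero => simp
  | add S T _ _ hS hT => rw [LinearMap.comp_add]; exact add_mem hS hT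
  | smul c T _ hT => rw [LinearMap.comp_smul]; exact Submodule.smul_mem _ _ hT

/-- Exchanging two adjacent letters costs a commutator, which is a combination of words with one
letter fewer. -/
theorem wordOp_sub_mem_of_perm {w w' : List (Fin n)} (h : w.Perm w') :
    wordOp Y w - wordOp Y w' ∈ wordSpan Y w.length := by
  induction h with
  | nil => simp
  | cons j _ ih =>
    have := derivOp_comp_mem_wordSpan Y j ih
    rwa [LinearMap.comp_sub] at this
  | swap j l w =>
    obtain ⟨c, hc⟩ := exists_commutator Y l j
    have : wordOp Y (l :: j :: w) - wordOp Y (j :: l :: w) = ∑ m, c m • wordOp Y (m :: w) := by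
      refine LinearMap.ext fun f => ?_
      simpa using hc (wordOp Y w f)
    rw [this]
    exact Submodule.sum_mem _ fun m _ => Submodule.smul_mem _ _
      (Submodule.subset_span ⟨m :: w, by simp, rfl⟩)
  | trans h₁ h₂ ih₁ ih₂ =>
    rw [← h₁.length_eq] at ih₂
    have := add_mem ih₁ ih₂
    rwa [sub_add_sub_cancel] at this

/-- Every word in the left-invariant vector fields is a combination of ordered monomials. -/
theorem wordOp_mem_span_ordWord (w : List (Fin n)) :
    wordOp Y w ∈ Submodule.span ℂ
      {T | ∃ β : Fin n → ℕ, ∑ j, β j ≤ w.length ∧ T = wordOp Y (ordWord β)} := by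
  -- Sorting the letters changes the operator only by shorter words, to which the induction
  -- hypothesis applies.
  induction hk : w.length using Nat.strong_induction_on generalizing w with
  | _ k ih =>
    subst hk
    have hp : w.Perm (ordWord fun j => w.count j) := by
      rw [List.perm_iff_count]
      intro j
      rw [count_ordWord]
    have hlen : ∑ j, w.count j = w.length := by
      rw [← length_ordWord (fun j => w.count j), ← hp.length_eq]
    have h1 := wordOp_sub_mem_of_perm Y hp
    have h2 : wordSpan Y w.length ≤ Submodule.span ℂ
        {T | ∃ β : Fin n → ℕ, ∑ j, β j ≤ w.length ∧ T = wordOp Y (ordWord β)} := by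
      refine Submodule.span_le.2 ?_
      rintro _ ⟨v, hv, rfl⟩
      refine Submodule.span_mono ?_ (ih _ hv v rfl)
      rintro _ ⟨β, hβ, rfl⟩
      exact ⟨β, hβ.trans hv.le, rfl⟩
    have h3 : wordOp Y (ordWord fun j => w.count j) ∈ Submodule.span ℂ
        {T | ∃ β : Fin n → ℕ, ∑ j, β j ≤ w.length ∧ T = wordOp Y (ordWord β)} :=
      Submodule.subset_span ⟨_, hlen.le, rfl⟩
    have := add_mem (h2 h1) h3
    rwa [sub_add_cancel] at this

theorem mem_multiIdx {r k : ℕ} {α : Fin r → ℕ} : α ∈ multiIdx r k ↔ ∑ i, α i = k := by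
  simp [multiIdx]

/-- Every word is a left-invariant operator of the form used for Taylor systems. -/
theorem exists_leftInvOp_of_mem_span {k : ℕ} {φ : SmoothFun E G →ₗ[ℂ] ℂ}
    (hφ : φ ∈ Submodule.span ℂ {ψ : SmoothFun E G →ₗ[ℂ] ℂ | ∃ w : List (Fin n), w.length ≤ k ∧
      ψ = (evalAt E (1 : G)).toLinearMap ∘ₗ wordOp Y w}) :
    ∃ c : (Fin n → ℕ) → ℂ, ∀ f : SmoothFun E G, φ f = leftInvOp Y k c f 1 := by
  have hadd : ∀ c d f, leftInvOp Y k (c + d) (f : SmoothFun E G) 1 =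
      leftInvOp Y k c f 1 + leftInvOp Y k d f 1 := fun c d f => by
    simp [leftInvOp, add_mul, Finset.sum_add_distrib]
  have hsmul : ∀ (a : ℂ) c f, leftInvOp Y k (a • c) (f : SmoothFun E G) 1 =
      a * leftInvOp Y k c f 1 := fun a c f => by
    simp [leftInvOp, Finset.mul_sum, mul_assoc]
  induction hφ using Submodule.span_induction with
  | zero => exact ⟨0, fun f => by simp [leftInvOp]⟩
  | add φ ψ _ _ h1 h2 =>
    obtain ⟨c, hc⟩ := h1
    obtain ⟨d, hd⟩ := h2
    exact ⟨c + d, fun f => by rw [hadd, LinearMap.add_apply, hc, hd]⟩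
  | smul a φ _ h =>
    obtain ⟨c, hc⟩ := h
    exact ⟨a • c, fun f => by rw [hsmul, LinearMap.smul_apply, hc, smul_eq_mul]⟩
  | mem ψ h =>
    obtain ⟨w, hw, rfl⟩ := h
    have := wordOp_mem_span_ordWord Y w
    simp only [LinearMap.comp_apply, AlgHom.toLinearMap_apply, evalAt_apply]
    generalize wordOp Y w = T at this
    induction this using Submodule.span_induction with
    | zero => exact ⟨0, fun f => by simp [leftInvOp]⟩
    | add φ ψ _ _ h1 h2 =>
      obtain ⟨c, hc⟩ := h1
      obtain ⟨d, hd⟩ := h2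
      exact ⟨c + d, fun f => by rw [hadd, LinearMap.add_apply, SmoothFun.add_apply, hc, hd]⟩
    | smul a φ _ h =>
      obtain ⟨c, hc⟩ := h
      exact ⟨a • c, fun f => by rw [hsmul, LinearMap.smul_apply, SmoothFun.smul_apply, hc]⟩
    | mem T h =>
      obtain ⟨β, hβ, rfl⟩ := h
      classical
      refine ⟨Pi.single β 1, fun f => ?_⟩
      unfold leftInvOp
      rw [Finset.sum_eq_single (∑ j, β j), Finset.sum_eq_single β]
      · rw [partialDeriv_eq_wordOp]; simp
      · intro γ _ hγ
        simp [hγ]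
      · intro h; exact absurd (mem_multiIdx.2 rfl) h
      · intro i _ hi
        refine Finset.sum_eq_zero fun γ hγ => ?_
        have : γ ≠ β := by
          rintro rfl
          exact hi (mem_multiIdx.1 hγ).symm
        simp [this]
      · intro h
        exact absurd (Finset.mem_range.2 (by omega)) h

end Ordering

/-! ### Iterated Hadamard quotients and the existence of Taylor systems -/

section Taylor

theorem sub_single_add_single {r : ℕ} {β : Fin r → ℕ} {i : Fin r} (hβ : β i ≠ 0) :
    β - Pi.single i 1 + Pi.single i 1 = β := by
  funext j
  by_cases hj : j = i
  · subst hj; simp; omega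
  · simp [hj]

/-- The bijection `(α, i) ↦ (α + e_i, i)` onto pairs with `β i ≠ 0`. The guard is needed because
subtraction in `ℕ` truncates. -/
theorem sum_multiIdx_succ {M : Type*} [AddCommMonoid M] {r k : ℕ} (F : (Fin r → ℕ) → Fin r → M) :
    ∑ β ∈ multiIdx r (k + 1), ∑ i, (if β i = 0 then 0 else F (β - Pi.single i 1) i) =
      ∑ α ∈ multiIdx r k, ∑ i, F α i := by
  rw [Finset.sum_comm, Finset.sum_comm (s := multiIdx r k)]
  refine Finset.sum_congr rfl fun i _ => ?_
  have hsum : ∀ α : Fin r → ℕ, ∑ j, (α + Pi.single i 1 : Fin r → ℕ) j = ∑ j, α j + 1 := fun α => by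
    simp [Finset.sum_add_distrib]
  rw [Finset.sum_ite, Finset.sum_const_zero, zero_add]
  refine Finset.sum_nbij' (fun β => β - Pi.single i 1) (fun α => α + Pi.single i 1) ?_ ?_ ?_ ?_ ?_
  · intro β hβ
    simp only [Finset.mem_filter, mem_multiIdx] at hβ ⊢
    have := hsum (β - Pi.single i 1)
    rw [sub_single_add_single hβ.2] at this
    omega
  · intro α hα
    simp only [Finset.mem_filter, mem_multiIdx] at hα ⊢
    exact ⟨by rw [hsum, hα], by simp⟩
  · intro β hβ
    exact sub_single_add_single (Finset.mem_filter.1 hβ).2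
  · intro α _
    simp
  · intro β _
    rfl

theorem multiIdx_zero (r : ℕ) : multiIdx r 0 = {0} := by
  ext α
  rw [mem_multiIdx, Finset.mem_singleton, Finset.sum_eq_zero_iff]
  exact ⟨fun h => funext fun i => h i (Finset.mem_univ i), fun h => by simp [h]⟩

theorem sum_multiIdx_one {M : Type*} [AddCommMonoid M] {r : ℕ} (F : (Fin r → ℕ) → M) :
    ∑ β ∈ multiIdx r 1, F β = ∑ i, F (Pi.single i 1) := by
  have h := sum_multiIdx_succ (r := r) (k := 0) fun _ i => F (Pi.single i 1)
  rw [multiIdx_zero, Finset.sum_singleton] at h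
  rw [← h]
  refine Finset.sum_congr rfl fun β hβ => ?_
  rw [mem_multiIdx] at hβ
  obtain ⟨i, hi⟩ : ∃ i, β i ≠ 0 := by
    by_contra hcon
    push Not at hcon
    simp [hcon] at hβ
  have hb : β = Pi.single i 1 := by
    have h1 := Finset.add_sum_erase Finset.univ β (Finset.mem_univ i)
    have h2 : ∑ j ∈ Finset.univ.erase i, β j = 0 := by omega
    have h3 : β i = 1 := by omega
    funext j
    by_cases hj : j = i
    · subst hj; simpa using h3
    · have := Finset.sum_eq_zero_iff.1 h2 j (by simp [hj])
      simpa [hj] using this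
  subst hb
  rw [Finset.sum_eq_single i] <;> simp +contextual

variable {E : Type*} [NormedAddCommGroup E] [NormedSpace ℝ E] [FiniteDimensional ℝ E]
  {G : Type*} [TopologicalSpace G] [ChartedSpace E G] [Group G] [LieGroup 𝓘(ℝ, E) ∞ G] [T2Space G]
  [CompactSpace G]
  {n : ℕ} (Y : Module.Basis (Fin n) ℝ (GroupLieAlgebra 𝓘(ℝ, E) G))

theorem qPow_add_single {r : ℕ} (p : Fin r → SmoothFun E G) (α : Fin r → ℕ) (i : Fin r) :
    qPow p (α + Pi.single i 1) = qPow p α * p i := by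
  unfold qPow
  simp only [Pi.add_apply, pow_add, Finset.prod_mul_distrib]
  congr 1
  rw [Finset.prod_eq_single i]
  · simp
  · intro j _ hj; simp [hj]
  · simp

/-- The iterated quotient operators attached to a family of Hadamard quotients `H`. -/
def taylorOp {r : ℕ} (H : Fin r → SmoothFun E G →ₗ[ℂ] SmoothFun E G) :
    ℕ → (Fin r → ℕ) → SmoothFun E G →ₗ[ℂ] SmoothFun E G
  | 0, _ => LinearMap.id
  | k + 1, β => ∑ i, if β i = 0 then 0 else H i ∘ₗ taylorOp H k (β - Pi.single i 1)

theorem orderLE_taylorOp {r : ℕ} {H : Fin r → SmoothFun E G →ₗ[ℂ] SmoothFun E G}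
    (hH : ∀ i, OrderLE Y (H i) 1) (k : ℕ) (α : Fin r → ℕ) : OrderLE Y (taylorOp H k α) k := by
  induction k generalizing α with
  | zero => exact orderLE_id Y
  | succ k ih =>
    refine OrderLE.sum _ fun i _ => ?_
    split_ifs
    · exact orderLE_zero Y _
    · rw [add_comm]
      exact (hH i).comp (ih _)

/-- Hadamard's formula is applied to each coefficient function of level `k`; collecting the products
`q_α p_i` by `β = α + e_i` yields exactly the recursion that defines level `k + 1`. No factorials
occur, as multiplicities are absorbed in the operators. -/
theorem sum_qPow_mul_taylorOp {r : ℕ} {p : Fin r → SmoothFun E G}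
    {H : Fin r → SmoothFun E G →ₗ[ℂ] SmoothFun E G}
    (hH : ∀ f, f = f 1 • 1 + ∑ i, p i * H i f) (k : ℕ) (f : SmoothFun E G) :
    ∑ α ∈ multiIdx r k, qPow p α * taylorOp H k α f =
      ∑ α ∈ multiIdx r k, taylorOp H k α f 1 • qPow p α +
        ∑ α ∈ multiIdx r (k + 1), qPow p α * taylorOp H (k + 1) α f := by
  have h1 : ∀ β : Fin r → ℕ, qPow p β * taylorOp H (k + 1) β f = ∑ i, if β i = 0 then 0 else
      qPow p ((β - Pi.single i 1) + Pi.single i 1) *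
        H i (taylorOp H k (β - Pi.single i 1) f) := fun β => by
    rw [taylorOp, LinearMap.sum_apply, Finset.mul_sum]
    refine Finset.sum_congr rfl fun i _ => ?_
    split_ifs with h
    · simp
    · rw [sub_single_add_single h]; rfl
  have h2 : ∑ β ∈ multiIdx r (k + 1), qPow p β * taylorOp H (k + 1) β f =
      ∑ α ∈ multiIdx r k, ∑ i, qPow p (α + Pi.single i 1) * H i (taylorOp H k α f) := by
    refine Eq.trans ?_ (sum_multiIdx_succ (M := SmoothFun E G) (k := k)
      (fun (α : Fin r → ℕ) i => qPow p (α + Pi.single i 1) * H i (taylorOp H k α f)))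
    exact Finset.sum_congr rfl fun β _ => h1 β
  rw [h2, ← Finset.sum_add_distrib]
  refine Finset.sum_congr rfl fun α _ => ?_
  conv_lhs => rw [hH (taylorOp H k α f)]
  simp only [qPow_add_single, mul_add, Finset.mul_sum, mul_smul_comm, mul_one, mul_assoc]

theorem taylor_expansion {r : ℕ} {p : Fin r → SmoothFun E G}
    {H : Fin r → SmoothFun E G →ₗ[ℂ] SmoothFun E G}
    (hH : ∀ f, f = f 1 • 1 + ∑ i, p i * H i f) (N : ℕ) (f : SmoothFun E G) :
    f = ∑ k ∈ Finset.range (N + 1), ∑ α ∈ multiIdx r k, taylorOp H k α f 1 • qPow p α +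
        ∑ α ∈ multiIdx r (N + 1), qPow p α * taylorOp H (N + 1) α f := by
  have h0 : f = ∑ α ∈ multiIdx r 0, qPow p α * taylorOp H 0 α f := by
    rw [multiIdx_zero, Finset.sum_singleton]
    simp [qPow, taylorOp]
  induction N with
  | zero =>
    conv_lhs => rw [h0, sum_qPow_mul_taylorOp hH]
    simp
  | succ N ih =>
    conv_lhs => rw [ih, sum_qPow_mul_taylorOp hH, ← add_assoc, ← Finset.sum_range_succ]

/-- The smooth function `x ↦ f (x⁻¹)`. -/
def invOp : SmoothFun E G →ₐ[ℂ] SmoothFun E G where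
  toFun f := ⟨fun y => f y⁻¹, f.2.comp (contMDiff_inv 𝓘(ℝ, E) ∞)⟩
  map_one' := rfl
  map_mul' _ _ := rfl
  map_zero' := rfl
  map_add' _ _ := rfl
  commutes' _ := rfl

@[simp] theorem invOp_apply (f : SmoothFun E G) (x : G) : invOp f x = f x⁻¹ := rfl

theorem qPow_apply_inv {r : ℕ} (q : Fin r → SmoothFun E G) (α : Fin r → ℕ) (x : G) :
    qPow q α x⁻¹ = qPow (fun i => invOp (q i)) α x := by
  simp [qPow, SmoothFun.prod_apply, SmoothFun.pow_apply]

/-- The coordinates at the identity, completed by a cut-off function. -/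
def stdCoord : Fin (n + 1) → SmoothFun E G := Fin.cons (cutoff E G) (coordFun Y)

/-- The Hadamard quotients of the functions `stdCoord`. -/
def stdQuot : Fin (n + 1) → SmoothFun E G →ₗ[ℂ] SmoothFun E G :=
  Fin.cons hadamardErr (hadamardOp Y)

theorem stdQuot_spec (f : SmoothFun E G) : f = f 1 • 1 + ∑ i, stdCoord Y i * stdQuot Y i f := by
  rw [Fin.sum_univ_succ]
  exact hadamard_eq Y f

theorem stdCoord_one (i : Fin (n + 1)) : stdCoord Y i 1 = 0 := by
  refine Fin.cases ?_ (fun i => ?_) i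
  · exact cutoff_eventually.self_of_nhds
  · exact coordFun_one Y i

theorem orderLE_stdQuot (i : Fin (n + 1)) : OrderLE Y (stdQuot Y i) 1 := by
  refine Fin.cases ?_ (fun i => ?_) i
  · have h : (stdQuot Y 0 : SmoothFun E G →ₗ[ℂ] SmoothFun E G) =
        LinearMap.id + LinearMap.mulLeft ℂ (-1) ∘ₗ compOp contMDiff_contraction_one := by
      refine LinearMap.ext fun f => SmoothFun.ext fun y => ?_
      change f y - f _ = f y + (-1) * f _
      ring
    rw [h]
    exact ((orderLE_id Y).add ((orderLE_mulLeft Y _).comp (orderLE_compOp Y _))).mono (by simp)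
  · exact orderLE_hadamardOp Y i

/-- A quotient is an averaged pullback along maps fixing the identity, composed with at most one
derivative, so it lowers the order of vanishing by at most one. -/
theorem IsFlat.stdQuot {k : ℕ} {f : SmoothFun E G} (hf : IsFlat Y (k + 1) f) (i : Fin (n + 1)) :
    IsFlat Y k (stdQuot Y i f) := by
  refine Fin.cases ?_ (fun i => ?_) i
  · change IsFlat Y k (f - compOp contMDiff_contraction_one f)
    rw [compOp_eq_pullInt]
    exact (hf.mono (Nat.le_succ k)).sub
      (IsFlat.pullInt _ (fun s => contraction_one 1) _ (hf.mono (Nat.le_succ k)))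
  · change IsFlat Y k (hadamardOp Y i f)
    rw [hadamardOp, LinearMap.sum_apply]
    exact IsFlat.sum _ fun l _ => IsFlat.pullInt contMDiff_contraction contraction_one
      (contMDiff_chartCoeff Y i l) (hf.derivOp l)

theorem IsFlat.taylorOp {k l : ℕ} {f : SmoothFun E G} (hf : IsFlat Y (k + l) f)
    (α : Fin (n + 1) → ℕ) : IsFlat Y l (taylorOp (LieSymbol.stdQuot Y) k α f) := by
  induction k generalizing α l with
  | zero => simpa [LieSymbol.taylorOp] using hf
  | succ k ih =>
    rw [LieSymbol.taylorOp, LinearMap.sum_apply]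
    refine IsFlat.sum _ fun i _ => ?_
    split_ifs
    · intro w _; simp
    · exact (ih (l := l + 1) (by rwa [add_assoc, add_comm 1 l] at hf) _).stdQuot Y i

/-- A functional that vanishes on the common kernel of finitely many functionals lies in their span.
If all words of length at most `k` vanish at the identity, then `k` quotients still leave a function
vanishing there. -/
theorem taylorOp_one_mem_span (k : ℕ) (α : Fin (n + 1) → ℕ) :
    (evalAt E (1 : G)).toLinearMap ∘ₗ taylorOp (stdQuot Y) k α ∈
      Submodule.span ℂ {ψ : SmoothFun E G →ₗ[ℂ] ℂ | ∃ w : List (Fin n), w.length ≤ k ∧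
        ψ = (evalAt E (1 : G)).toLinearMap ∘ₗ wordOp Y w} := by
  have : Finite {w : List (Fin n) // w.length ≤ k} := List.finite_length_le (Fin n) k
  have h := mem_span_of_iInf_ker_le_ker
    (L := fun w : {w : List (Fin n) // w.length ≤ k} =>
      (evalAt E (1 : G)).toLinearMap ∘ₗ wordOp Y w.1)
    (K := (evalAt E (1 : G)).toLinearMap ∘ₗ taylorOp (stdQuot Y) k α) ?_
  · refine Submodule.span_mono ?_ h
    rintro _ ⟨w, rfl⟩
    exact ⟨w.1, w.2, rfl⟩
  · intro f hf
    simp only [Submodule.mem_iInf, LinearMap.mem_ker] at hf ⊢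
    have hflat : IsFlat Y (k + 1) f := fun w hw => hf ⟨w, by omega⟩
    exact hflat.taylorOp Y α [] (by simp)

/-- The coordinates are composed with inversion because Taylor systems use `q_α(x⁻¹)`, and the
operators are multiplied by `α!` to offset the factor `1/α!`. -/
theorem exists_taylorSystem : ∃ (r : ℕ) (q : Fin r → SmoothFun E G)
    (c : (Fin r → ℕ) → (Fin n → ℕ) → ℂ), IsTaylorSystem Y q c := by
  have hc : ∀ α : Fin (n + 1) → ℕ, ∃ c : (Fin n → ℕ) → ℂ, ∀ f : SmoothFun E G,
      (multiFact α : ℂ) * taylorOp (stdQuot Y) (∑ i, α i) α f 1 =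
        leftInvOp Y (∑ i, α i) c f 1 := fun α =>
    exists_leftInvOp_of_mem_span Y
      (Submodule.smul_mem _ (multiFact α : ℂ) (taylorOp_one_mem_span Y (∑ i, α i) α))
  choose c hc using hc
  refine ⟨n + 1, fun i => invOp (stdCoord Y i), c, fun i => by simp [stdCoord_one], fun N u => ?_⟩
  refine ⟨fun α => taylorOp (stdQuot Y) (N + 1) α u, fun x => ?_⟩
  have h := congrArg (fun g : SmoothFun E G => g x) (taylor_expansion (stdQuot_spec Y) N u)
  refine h.trans ?_
  have hinv : (fun i => invOp (invOp (stdCoord Y i))) = stdCoord Y := by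
    funext i; exact SmoothFun.ext fun y => by simp
  simp only [SmoothFun.add_apply, SmoothFun.sum_apply, SmoothFun.mul_apply, SmoothFun.smul_apply,
    qPow_apply_inv, hinv]
  congr 1
  refine Finset.sum_congr rfl fun k _ => Finset.sum_congr rfl fun α hα => ?_
  have hk := mem_multiIdx.1 hα
  subst hk
  rw [← hc]
  have : (multiFact α : ℂ) ≠ 0 := by
    simp [multiFact, Finset.prod_eq_zero_iff, Nat.factorial_ne_zero]
  field_simp

end Taylor

/-! ### Linear and controlled remainders for an arbitrary Taylor system -/

section TaylorRemainder

variable {E : Type*} [NormedAddCommGroup E] [NormedSpace ℝ E] [FiniteDimensional ℝ E]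
  {G : Type*} [TopologicalSpace G] [ChartedSpace E G] [Group G] [LieGroup 𝓘(ℝ, E) ∞ G] [T2Space G]
  [CompactSpace G]
  {n : ℕ} (Y : Module.Basis (Fin n) ℝ (GroupLieAlgebra 𝓘(ℝ, E) G))

theorem SmoothFun.exists_bound (f : SmoothFun E G) : ∃ C, 0 ≤ C ∧ ∀ x, ‖f x‖ ≤ C := by
  obtain ⟨C, hC⟩ := isCompact_univ.exists_bound_of_continuousOn f.continuous.continuousOn
  exact ⟨C, (norm_nonneg _).trans (hC 1 (Set.mem_univ 1)), fun x => hC x (Set.mem_univ x)⟩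

/-- The functional `ℓ` is bounded by derivatives of order at most `l`. -/
def FunctionalLE (ℓ : SmoothFun E G →ₗ[ℂ] ℂ) (l : ℕ) : Prop :=
  ∃ C : ℝ, 0 ≤ C ∧ ∀ f M, BoundedBy Y l f M → ‖ℓ f‖ ≤ C * M

variable {Y}

theorem FunctionalLE.mono {ℓ : SmoothFun E G →ₗ[ℂ] ℂ} {k l : ℕ} (h : FunctionalLE Y ℓ k)
    (hk : k ≤ l) : FunctionalLE Y ℓ l := by
  obtain ⟨C, hC0, hC⟩ := h
  exact ⟨C, hC0, fun f M hf => hC f M (hf.mono hk)⟩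

theorem FunctionalLE.add {ℓ ℓ' : SmoothFun E G →ₗ[ℂ] ℂ} {l : ℕ} (h : FunctionalLE Y ℓ l)
    (h' : FunctionalLE Y ℓ' l) : FunctionalLE Y (ℓ + ℓ') l := by
  obtain ⟨C, hC0, hC⟩ := h
  obtain ⟨C', hC'0, hC'⟩ := h'
  refine ⟨C + C', by positivity, fun f M hf => ?_⟩
  rw [add_mul]
  exact (norm_add_le _ _).trans (add_le_add (hC f M hf) (hC' f M hf))

theorem FunctionalLE.smul {ℓ : SmoothFun E G →ₗ[ℂ] ℂ} {l : ℕ} (h : FunctionalLE Y ℓ l) (a : ℂ) :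
    FunctionalLE Y (a • ℓ) l := by
  obtain ⟨C, hC0, hC⟩ := h
  refine ⟨‖a‖ * C, by positivity, fun f M hf => ?_⟩
  rw [LinearMap.smul_apply, norm_smul, mul_assoc]
  exact mul_le_mul_of_nonneg_left (hC f M hf) (norm_nonneg _)

theorem FunctionalLE.sum {ι : Type*} (s : Finset ι) {ℓ : ι → SmoothFun E G →ₗ[ℂ] ℂ} {l : ℕ}
    (h : ∀ i ∈ s, FunctionalLE Y (ℓ i) l) : FunctionalLE Y (∑ i ∈ s, ℓ i) l := by
  classical
  induction s using Finset.induction_on with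
  | empty => exact ⟨0, le_rfl, fun f M _ => by simp⟩
  | insert i s hi ih =>
    rw [Finset.sum_insert hi]
    exact (h i (by simp)).add (ih fun j hj => h j (by simp [hj]))

theorem OrderLE.functionalLE {T : SmoothFun E G →ₗ[ℂ] SmoothFun E G} {l : ℕ} (hT : OrderLE Y T l)
    (x : G) : FunctionalLE Y ((evalAt E x).toLinearMap ∘ₗ T) l := by
  obtain ⟨C, hC0, hC⟩ := hT []
  exact ⟨C, hC0, fun f M hf => hC f M (hf.mono (by simp)) x⟩

theorem FunctionalLE.smulRight {ℓ : SmoothFun E G →ₗ[ℂ] ℂ} {l : ℕ} (h : FunctionalLE Y ℓ l)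
    (g : SmoothFun E G) : OrderLE Y (ℓ.smulRight g) l := by
  intro w
  obtain ⟨C, hC0, hC⟩ := h
  obtain ⟨C', hC'0, hC'⟩ := (wordOp Y w g).exists_bound
  refine ⟨C * C', by positivity, fun f M hf x => ?_⟩
  rw [LinearMap.smulRight_apply, map_smul, SmoothFun.smul_apply, norm_mul, mul_right_comm]
  exact mul_le_mul (hC f M (hf.mono (by simp))) (hC' x) (norm_nonneg _) (mul_nonneg hC0 hf.nonneg)

variable (Y) in
/-- The functional `f ↦ (∑_{|β| ≤ k} c_β ∂^β f)(1)`. -/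
def leftInvFunctional (k : ℕ) (c : (Fin n → ℕ) → ℂ) : SmoothFun E G →ₗ[ℂ] ℂ :=
  ∑ i ∈ Finset.range (k + 1), ∑ β ∈ multiIdx n i,
    c β • ((evalAt E (1 : G)).toLinearMap ∘ₗ wordOp Y (ordWord β))

theorem leftInvFunctional_apply (k : ℕ) (c : (Fin n → ℕ) → ℂ) (f : SmoothFun E G) :
    leftInvFunctional Y k c f = leftInvOp Y k c f 1 := by
  simp only [leftInvFunctional, leftInvOp, LinearMap.sum_apply, LinearMap.smul_apply,
    LinearMap.comp_apply, AlgHom.toLinearMap_apply, evalAt_apply, smul_eq_mul,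
    partialDeriv_eq_wordOp]

theorem functionalLE_leftInvFunctional (k : ℕ) (c : (Fin n → ℕ) → ℂ) :
    FunctionalLE Y (leftInvFunctional Y k c : SmoothFun E G →ₗ[ℂ] ℂ) k := by
  refine FunctionalLE.sum _ fun i hi => FunctionalLE.sum _ fun β hβ => FunctionalLE.smul ?_ _
  refine ⟨1, zero_le_one, fun f M hf => ?_⟩
  rw [one_mul]
  refine hf _ ?_ 1
  rw [length_ordWord, mem_multiIdx.1 hβ]
  exact Nat.lt_succ_iff.1 (Finset.mem_range.1 hi)

theorem qPow_single {r : ℕ} (p : Fin r → SmoothFun E G) (i : Fin r) :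
    qPow p (Pi.single i 1) = p i := by
  have := qPow_add_single p 0 i
  rw [zero_add] at this
  rw [this]
  simp [qPow]

/-- The functions of a Taylor system admit Hadamard quotients that lose one derivative. -/
theorem IsTaylorSystem.exists_quotients {r : ℕ} {q : Fin r → SmoothFun E G}
    {c : (Fin r → ℕ) → (Fin n → ℕ) → ℂ} (h : IsTaylorSystem Y q c) :
    ∃ H : Fin r → SmoothFun E G →ₗ[ℂ] SmoothFun E G, (∀ i, OrderLE Y (H i) 1) ∧
      ∀ f : SmoothFun E G, f = f 1 • 1 + ∑ i, invOp (q i) * H i f := by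
  have h1 : ∀ j : Fin (n + 1), ∃ a : Fin r → SmoothFun E G,
      stdCoord Y j = ∑ i, invOp (q i) * a i := by
    intro j
    -- For `N = 0` the Taylor property of a function vanishing at the identity says that it lies in
    -- the ideal generated by the functions `q_i(x⁻¹)`. No uniformity is needed, since only the `n +
    -- 1` functions `stdCoord` are expanded.
    obtain ⟨v, hv⟩ := h.2 0 (stdCoord Y j)
    refine ⟨fun i => v (Pi.single i 1), SmoothFun.ext fun x => ?_⟩
    have hzero : leftInvOp Y 0 (c 0) (stdCoord Y j) 1 = 0 := by
      have h0 : partialDeriv Y 0 (stdCoord Y j) 1 = 0 := by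
        rw [partialDeriv_eq_wordOp]
        have : ordWord (0 : Fin n → ℕ) = [] := by
          rw [← List.length_eq_zero_iff, length_ordWord]; simp
        rw [this]
        exact stdCoord_one Y j
      simp [leftInvOp, multiIdx_zero, h0]
    rw [hv x, SmoothFun.sum_apply]
    simp only [zero_add, Finset.range_one, Finset.sum_singleton, multiIdx_zero, hzero, mul_zero,
      sum_multiIdx_one, SmoothFun.mul_apply, invOp_apply, qPow_single]
  choose a ha using h1
  refine ⟨fun i => ∑ j, LinearMap.mulLeft ℂ (a j i) ∘ₗ stdQuot Y j, fun i =>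
    OrderLE.sum _ fun j _ => ?_, fun f => ?_⟩
  · simpa using (orderLE_mulLeft Y (a j i)).comp (orderLE_stdQuot Y j)
  · conv_lhs => rw [stdQuot_spec Y f]
    congr 1
    calc ∑ j, stdCoord Y j * stdQuot Y j f = ∑ j, ∑ i, invOp (q i) * (a j i * stdQuot Y j f) := by
          refine Finset.sum_congr rfl fun j _ => ?_
          conv_lhs => rw [ha j]
          rw [Finset.sum_mul]
          simp only [mul_assoc]
      _ = _ := by
          rw [Finset.sum_comm]
          refine Finset.sum_congr rfl fun i _ => ?_
          rw [LinearMap.sum_apply, Finset.mul_sum]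
          rfl

/-- The remainder terms of a Taylor system can be chosen linearly and with control of the
derivatives. -/
theorem IsTaylorSystem.exists_remainder {r : ℕ} {q : Fin r → SmoothFun E G}
    {c : (Fin r → ℕ) → (Fin n → ℕ) → ℂ} (h : IsTaylorSystem Y q c) (N : ℕ) :
    ∃ V : (Fin r → ℕ) → SmoothFun E G →ₗ[ℂ] SmoothFun E G, (∀ α, OrderLE Y (V α) (N + 1)) ∧
      ∀ (u : SmoothFun E G) (x : G), u x = ∑ k ∈ Finset.range (N + 1), ∑ α ∈ multiIdx r k,
        (multiFact α : ℂ)⁻¹ * qPow q α x⁻¹ * leftInvOp Y k (c α) u 1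
      + ∑ α ∈ multiIdx r (N + 1), qPow q α x⁻¹ * V α u x := by
  obtain ⟨H, hH1, hH⟩ := h.exists_quotients
  set p : Fin r → SmoothFun E G := fun i => invOp (q i) with hp
  let I : Finset (Σ _ : ℕ, Fin r → ℕ) := (Finset.range (N + 1)).sigma fun k => multiIdx r k
  -- The prescribed Taylor coefficients minus those given by the iterated quotients: finitely many
  -- functionals, each bounded by derivatives of order at most `N`.
  let d : I → SmoothFun E G →ₗ[ℂ] ℂ := fun i =>
    (multiFact i.1.2 : ℂ)⁻¹ • leftInvFunctional Y i.1.1 (c i.1.2) +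
      (-1 : ℂ) • ((evalAt E (1 : G)).toLinearMap ∘ₗ taylorOp H i.1.1 i.1.2)
  have hd : ∀ i, FunctionalLE Y (d i) (N + 1) := fun i => by
    have hi : i.1.1 ≤ N + 1 := by
      have := (Finset.mem_sigma.1 i.2).1
      exact (Finset.mem_range.1 this).le
    exact (((functionalLE_leftInvFunctional _ _).smul _).add
      (((orderLE_taylorOp Y hH1 _ _).functionalLE 1).smul _)).mono hi
  let Λ : ((Fin r → ℕ) → SmoothFun E G) →ₗ[ℂ] SmoothFun E G :=
    ∑ α ∈ multiIdx r (N + 1), LinearMap.mulLeft ℂ (qPow p α) ∘ₗ LinearMap.proj α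
  have hΛ : ∀ v, Λ v = ∑ α ∈ multiIdx r (N + 1), qPow p α * v α := fun v => by
    simp [Λ, LinearMap.sum_apply]
  let Γ : (I → ℂ) →ₗ[ℂ] SmoothFun E G :=
    ∑ i : I, (LinearMap.proj i : (I → ℂ) →ₗ[ℂ] ℂ).smulRight (qPow p i.1.2)
  have hΓ : ∀ a, Γ a = ∑ i : I, a i • qPow p i.1.2 := fun a => by
    simp [Γ, LinearMap.sum_apply]
  -- the two Taylor polynomials differ by an element of the range of `Λ`
  have hsum : ∀ F : ℕ → (Fin r → ℕ) → SmoothFun E G,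
      ∑ k ∈ Finset.range (N + 1), ∑ α ∈ multiIdx r k, F k α = ∑ i : I, F i.1.1 i.1.2 := fun F => by
    rw [Finset.sum_coe_sort I fun i => F i.1 i.2, Finset.sum_sigma]
  have hpoly : ∀ u, Γ (fun i => d i u) + ∑ k ∈ Finset.range (N + 1), ∑ α ∈ multiIdx r k,
      taylorOp H k α u 1 • qPow p α = ∑ k ∈ Finset.range (N + 1), ∑ α ∈ multiIdx r k,
        ((multiFact α : ℂ)⁻¹ * leftInvOp Y k (c α) u 1) • qPow p α := fun u => by
    rw [hΓ, hsum, hsum, ← Finset.sum_add_distrib]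
    refine Finset.sum_congr rfl fun i _ => ?_
    rw [← add_smul]
    congr 1
    simp [d, leftInvFunctional_apply]
  -- Here the uncontrolled remainders `v` are used, but only to see that the difference of the
  -- polynomials lies in the range of `Λ`.
  have hrange : ∀ u, Γ (fun i => d i u) ∈ LinearMap.range Λ := fun u => by
    obtain ⟨v, hv⟩ := h.2 N u
    refine ⟨fun α => taylorOp H (N + 1) α u - v α, ?_⟩
    have h1 := taylor_expansion hH N u
    have h2 : u = ∑ k ∈ Finset.range (N + 1), ∑ α ∈ multiIdx r k,
        ((multiFact α : ℂ)⁻¹ * leftInvOp Y k (c α) u 1) • qPow p α +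
          ∑ α ∈ multiIdx r (N + 1), qPow p α * v α := by
      refine SmoothFun.ext fun x => ?_
      rw [hv x]
      simp only [SmoothFun.add_apply, SmoothFun.sum_apply, SmoothFun.smul_apply,
        SmoothFun.mul_apply, qPow_apply_inv]
      congr 1
      refine Finset.sum_congr rfl fun k _ => Finset.sum_congr rfl fun α _ => ?_
      ring
    rw [← hpoly u] at h2
    rw [hΛ]
    simp only [mul_sub, Finset.sum_sub_distrib]
    have h3 := h1.symm.trans h2
    rw [add_comm (Γ _), add_assoc] at h3
    have h4 := add_left_cancel h3
    exact sub_eq_of_eq_add h4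
  -- A purely algebraic section of `Λ`, composed with `Γ` and extended from `W` to all of `I → ℂ`.
  -- No continuity is required, because `I → ℂ` is finite-dimensional and only the images of its
  -- unit vectors enter.
  obtain ⟨R, hR⟩ := Λ.rangeRestrict.exists_rightInverse_of_surjective (LinearMap.range_rangeRestrict Λ)
  let W : Submodule ℂ (I → ℂ) := (LinearMap.range Λ).comap Γ
  obtain ⟨S, hS⟩ := LinearMap.exists_extend (p := W)
    (R ∘ₗ (Γ.restrict (p := W) (q := LinearMap.range Λ) fun a ha => ha))
  have hSΛ : ∀ u, Λ (S fun i => d i u) = Γ fun i => d i u := fun u => by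
    have h1 := DFunLike.congr_fun hS (⟨fun i => d i u, hrange u⟩ : W)
    have h2 : S (fun i => d i u) = R ⟨Γ fun i => d i u, hrange u⟩ := h1
    rw [h2]
    exact congrArg Subtype.val (DFunLike.congr_fun hR ⟨Γ fun i => d i u, hrange u⟩)
  -- The remainder of the iterated expansion minus the chosen correction. The latter is a finite sum
  -- of bounded functionals times fixed smooth functions, so it costs no further derivatives.
  refine ⟨fun α => taylorOp H (N + 1) α + LinearMap.mulLeft ℂ (-1) ∘ₗ
    ∑ i : I, (d i).smulRight (S (Pi.single i 1) α), fun α => ?_, fun u x => ?_⟩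
  · refine (orderLE_taylorOp Y hH1 _ _).add ?_
    have := (orderLE_mulLeft Y (-1 : SmoothFun E G)).comp
      (OrderLE.sum Finset.univ fun i _ => (hd i).smulRight (S (Pi.single i 1) α))
    simpa using this
  · have hS' : ∀ α, (∑ i : I, (d i).smulRight (S (Pi.single i 1) α)) u = S (fun i => d i u) α := by
      intro α
      have h1 : (fun i => d i u) = ∑ i : I, d i u • (Pi.single i 1 : I → ℂ) := by
        funext i
        simp [Finset.sum_apply, Pi.single_apply]
      rw [h1, map_sum, LinearMap.sum_apply, Finset.sum_apply]
      simp
    have h1 := taylor_expansion hH N u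
    have h2 : u = ∑ k ∈ Finset.range (N + 1), ∑ α ∈ multiIdx r k,
        ((multiFact α : ℂ)⁻¹ * leftInvOp Y k (c α) u 1) • qPow p α +
          ∑ α ∈ multiIdx r (N + 1), qPow p α * (taylorOp H (N + 1) α u - S (fun i => d i u) α) := by
      rw [← hpoly u]
      simp only [mul_sub, Finset.sum_sub_distrib]
      rw [← hΛ (S fun i => d i u), hSΛ]
      conv_lhs => rw [h1]
      abel
    have h3 := congrArg (fun g : SmoothFun E G => g x) h2
    refine h3.trans ?_
    simp only [SmoothFun.add_apply, SmoothFun.sum_apply, SmoothFun.smul_apply,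
      SmoothFun.mul_apply, qPow_apply_inv, LinearMap.add_apply, LinearMap.comp_apply, hS',
      LinearMap.mulLeft_apply, SmoothFun.sub_apply, SmoothFun.neg_apply, SmoothFun.one_apply]
    congr 1
    · refine Finset.sum_congr rfl fun k _ => Finset.sum_congr rfl fun α _ => ?_
      ring
    · refine Finset.sum_congr rfl fun α _ => ?_
      ring

end TaylorRemainder

/-! ### Schur's lemma and the derived representation -/

section Representations

open scoped Matrix Matrix.Norms.L2Operator

theorem opNorm_eq_norm {d : ℕ} (M : Matrix (Fin d) (Fin d) ℂ) : opNorm M = ‖M‖ := rfl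

section Schur

variable {G : Type*} [TopologicalSpace G] [Group G]

namespace UnitaryRep

/-- The matrix `ξ(x)`. -/
def mat (ξ : UnitaryRep G) (x : G) : Matrix (Fin ξ.dim) (Fin ξ.dim) ℂ := ξ.toHom x

variable (ξ η : UnitaryRep G)

theorem coeff_eq_mat (i j : Fin ξ.dim) (x : G) : ξ.coeff i j x = ξ.mat x i j := rfl

@[simp] theorem mat_one : ξ.mat 1 = 1 := by simp [mat]

theorem mat_mul (x y : G) : ξ.mat (x * y) = ξ.mat x * ξ.mat y := by simp [mat]

theorem conjTranspose_mat_mul (x : G) : (ξ.mat x)ᴴ * ξ.mat x = 1 :=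
  Unitary.coe_star_mul_self (ξ.toHom x)

theorem mat_mul_conjTranspose (x : G) : ξ.mat x * (ξ.mat x)ᴴ = 1 :=
  Unitary.coe_mul_star_self (ξ.toHom x)

theorem mat_inv (x : G) : ξ.mat x⁻¹ = (ξ.mat x)ᴴ := by
  have h : ξ.mat x⁻¹ * ξ.mat x = 1 := by rw [← mat_mul]; simp
  calc ξ.mat x⁻¹ = ξ.mat x⁻¹ * (ξ.mat x * (ξ.mat x)ᴴ) := by rw [mat_mul_conjTranspose, mul_one]
    _ = (ξ.mat x)ᴴ := by rw [← mul_assoc, h, one_mul]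

theorem continuous_mat : Continuous ξ.mat := ξ.continuous

theorem nonempty_fin : Nonempty (Fin ξ.dim) := ⟨⟨0, ξ.dim_pos⟩⟩

theorem norm_mat_le (x : G) : ‖ξ.mat x‖ ≤ 1 := by
  have := ξ.nonempty_fin
  have h := Matrix.l2_opNorm_conjTranspose_mul_self (ξ.mat x)
  rw [conjTranspose_mat_mul, norm_one] at h
  nlinarith [norm_nonneg (ξ.mat x)]

/-- Equivalence of representations. -/
def Equivalent : Prop :=
  ∃ (M : Matrix (Fin ξ.dim) (Fin η.dim) ℂ) (N : Matrix (Fin η.dim) (Fin ξ.dim) ℂ),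
    M * N = 1 ∧ N * M = 1 ∧ ∀ x, ξ.mat x * M = M * η.mat x

theorem Equivalent.refl : ξ.Equivalent ξ := ⟨1, 1, by simp, by simp, by simp⟩

variable {ξ η}

theorem Equivalent.symm (h : ξ.Equivalent η) : η.Equivalent ξ := by
  obtain ⟨M, N, h1, h2, h3⟩ := h
  refine ⟨N, M, h2, h1, fun x => ?_⟩
  calc η.mat x * N = (N * M) * η.mat x * N := by rw [h2, one_mul]
    _ = N * (M * η.mat x) * N := by simp only [Matrix.mul_assoc]
    _ = N * ξ.mat x * (M * N) := by rw [← h3]; simp only [Matrix.mul_assoc]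
    _ = N * ξ.mat x := by rw [h1, Matrix.mul_one]

theorem Equivalent.trans {ζ : UnitaryRep G} (h : ξ.Equivalent η) (h' : η.Equivalent ζ) :
    ξ.Equivalent ζ := by
  obtain ⟨M, N, h1, h2, h3⟩ := h
  obtain ⟨M', N', h1', h2', h3'⟩ := h'
  refine ⟨M * M', N' * N, ?_, ?_, fun x => ?_⟩
  · rw [Matrix.mul_assoc, ← Matrix.mul_assoc M', h1', Matrix.one_mul, h1]
  · rw [Matrix.mul_assoc, ← Matrix.mul_assoc N, h2, Matrix.one_mul, h2']
  · rw [← Matrix.mul_assoc, h3, Matrix.mul_assoc, h3', Matrix.mul_assoc]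

/-- An intertwining matrix of irreducible representations is zero or invertible. -/
theorem eq_zero_or_equivalent (M : Matrix (Fin ξ.dim) (Fin η.dim) ℂ)
    (hM : ∀ x, ξ.mat x * M = M * η.mat x) : M = 0 ∨ ξ.Equivalent η := by
  have hk := η.irreducible (LinearMap.ker M.mulVecLin) fun x w hw => by
    have hw' : M *ᵥ w = 0 := hw
    change M *ᵥ (η.mat x *ᵥ w) = 0
    rw [Matrix.mulVec_mulVec, ← hM, ← Matrix.mulVec_mulVec, hw', Matrix.mulVec_zero]
  have hr := ξ.irreducible (LinearMap.range M.mulVecLin) fun x w hw => by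
    obtain ⟨v, rfl⟩ := hw
    refine ⟨η.mat x *ᵥ v, ?_⟩
    change M *ᵥ (η.mat x *ᵥ v) = ξ.mat x *ᵥ (M *ᵥ v)
    rw [Matrix.mulVec_mulVec, Matrix.mulVec_mulVec, hM]
  have hzero : (∀ w, M *ᵥ w = 0) → M = 0 := fun h => by
    ext i j
    have := congrFun (h (Pi.single j 1)) i
    simpa using this
  rcases hk with hk | hk
  swap
  · exact Or.inl (hzero fun w => by
      have : w ∈ LinearMap.ker M.mulVecLin := by rw [hk]; trivial
      exact this)
  rcases hr with hr | hr
  · refine Or.inl (hzero fun w => ?_)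
    have : M.mulVecLin w ∈ LinearMap.range M.mulVecLin := ⟨w, rfl⟩
    rw [hr] at this
    exact this
  right
  let e := LinearEquiv.ofBijective M.mulVecLin ⟨LinearMap.ker_eq_bot.1 hk, LinearMap.range_eq_top.1 hr⟩
  have hN : ∀ v, LinearMap.toMatrix' (e.symm : _ →ₗ[ℂ] _) *ᵥ v = e.symm v := fun v =>
    LinearMap.toMatrix'_mulVec _ _
  refine ⟨M, LinearMap.toMatrix' (e.symm : _ →ₗ[ℂ] _), ?_, ?_, hM⟩
  · refine Matrix.toLin'.injective (LinearMap.ext fun v => ?_)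
    rw [Matrix.toLin'_apply, ← Matrix.mulVec_mulVec, hN, Matrix.toLin'_one]
    exact e.apply_symm_apply v
  · refine Matrix.toLin'.injective (LinearMap.ext fun v => ?_)
    rw [Matrix.toLin'_apply, ← Matrix.mulVec_mulVec, hN, Matrix.toLin'_one]
    exact e.symm_apply_apply v

/-- Schur's lemma: a matrix commuting with an irreducible representation is scalar. -/
theorem exists_eq_smul_one (M : Matrix (Fin ξ.dim) (Fin ξ.dim) ℂ)
    (hM : ∀ x, ξ.mat x * M = M * ξ.mat x) : ∃ c : ℂ, M = c • 1 := by
  have := ξ.nonempty_fin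
  obtain ⟨c, hc⟩ := Module.End.exists_eigenvalue (K := ℂ) M.mulVecLin
  refine ⟨c, ?_⟩
  have hk := ξ.irreducible (Module.End.eigenspace M.mulVecLin c) fun x w hw => by
    rw [Module.End.mem_eigenspace_iff] at hw ⊢
    have hw' : M *ᵥ w = c • w := hw
    change M *ᵥ (ξ.mat x *ᵥ w) = c • (ξ.mat x *ᵥ w)
    rw [Matrix.mulVec_mulVec, ← hM, ← Matrix.mulVec_mulVec, hw', Matrix.mulVec_smul]
  rcases hk with hk | hk
  · exact absurd hk hc
  · ext i j
    have : Pi.single j 1 ∈ Module.End.eigenspace M.mulVecLin c := by rw [hk]; trivial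
    rw [Module.End.mem_eigenspace_iff] at this
    have := congrFun this i
    simpa [Matrix.one_apply, Pi.single_apply] using this

end UnitaryRep

end Schur

variable {E : Type*} [NormedAddCommGroup E] [NormedSpace ℝ E] [FiniteDimensional ℝ E]
  {G : Type*} [TopologicalSpace G] [ChartedSpace E G] [Group G] [LieGroup 𝓘(ℝ, E) ∞ G]
  [T2Space G]

/-- The complex conjugate of a smooth function. -/
def conjFun (f : SmoothFun E G) : SmoothFun E G :=
  ⟨fun x => star (f x), (Complex.conjCLE.contDiff (n := ∞)).contMDiff.comp f.2⟩

@[simp] theorem conjFun_apply (f : SmoothFun E G) (x : G) : conjFun f x = star (f x) := rfl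

theorem derivOp_conjFun (X : GroupLieAlgebra 𝓘(ℝ, E) G) (f : SmoothFun E G) :
    derivOp X (conjFun f) = conjFun (derivOp X f) := by
  refine SmoothFun.ext fun x => ?_
  rw [conjFun_apply, derivOp_eq_fderiv, derivOp_eq_fderiv]
  have h1 := (contDiff_comp_mul_param f.2 x).differentiable (by simp) 0
  have := (Complex.conjCLE.toContinuousLinearMap.hasFDerivAt.comp (0 : E) h1.hasFDerivAt).fderiv
  exact DFunLike.congr_fun this _

theorem leftDeriv_adjointAction (g : G) (X : GroupLieAlgebra 𝓘(ℝ, E) G) {f : G → ℂ}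
    (hf : ContMDiff 𝓘(ℝ, E) 𝓘(ℝ, ℂ) ∞ f) :
    leftDeriv (adjointAction g X) f 1 = leftDeriv X (fun y => f (g * y * g⁻¹)) 1 := by
  have hc : ContMDiff 𝓘(ℝ, E) 𝓘(ℝ, E) ∞ (fun y : G => g * y * g⁻¹) :=
    (contMDiff_const.mul contMDiff_id).mul contMDiff_const
  obtain ⟨L, hL⟩ : ∃ L : E →L[ℝ] E, L = mfderiv 𝓘(ℝ, E) 𝓘(ℝ, E) (fun y : G => g * y * g⁻¹) 1 :=
    ⟨_, rfl⟩
  obtain ⟨F, hF⟩ : ∃ F : E →L[ℝ] ℂ, F = mfderiv 𝓘(ℝ, E) 𝓘(ℝ, ℂ) f 1 := ⟨_, rfl⟩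
  have h1 : HasMFDerivAt 𝓘(ℝ, E) 𝓘(ℝ, E) (fun y : G => g * y * g⁻¹) 1 L := by
    rw [hL]
    exact (hc.mdifferentiable (by simp) 1).hasMFDerivAt
  have h2 : HasMFDerivAt 𝓘(ℝ, E) 𝓘(ℝ, ℂ) f 1 F := by
    rw [hF]
    exact (hf.mdifferentiable (by simp) 1).hasMFDerivAt
  have h3 := hasMFDerivAt_comp_of_eq h2 (param E G).hasMFDerivAt (param E G).map_zero
  have h4 := hasMFDerivAt_comp_of_eq (hasMFDerivAt_comp_of_eq h2 h1 (by simp))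
    (param E G).hasMFDerivAt (param E G).map_zero
  have h3' : HasFDerivAt (fun v : E => f ((param E G).toFun v))
      (F.comp (ContinuousLinearMap.id ℝ E)) 0 := h3.hasFDerivAt
  have h4' : HasFDerivAt (fun v : E => f (g * (param E G).toFun v * g⁻¹))
      ((F.comp L).comp (ContinuousLinearMap.id ℝ E)) 0 := h4.hasFDerivAt
  rw [leftDeriv_eq_fderiv _ hf, leftDeriv_eq_fderiv (f := fun y => f (g * y * g⁻¹)) _ (hf.comp hc)]
  simp only [one_mul]
  rw [h3'.fderiv, h4'.fderiv]
  change F (toModel E G (adjointAction g X)) = F (L (toModel E G X))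
  rw [hL]
  rfl

variable [CompactSpace G]

variable (E) in
/-- The smooth function `x ↦ ξ(x)_{ij}`. -/
def UnitaryRep.coeffFun (ξ : UnitaryRep G) (i j : Fin ξ.dim) : SmoothFun E G :=
  ⟨ξ.coeff i j, ξ.contMDiff_coeff i j⟩

@[simp] theorem UnitaryRep.coeffFun_apply (ξ : UnitaryRep G) (i j : Fin ξ.dim) (x : G) :
    ξ.coeffFun E i j x = ξ.mat x i j := rfl

theorem UnitaryRep.adjCoeff_apply (ξ : UnitaryRep G) (i j : Fin ξ.dim) (x : G) :
    ξ.adjCoeff E i j x = (ξ.mat x)ᴴ i j := rfl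

theorem UnitaryRep.adjCoeff_eq (ξ : UnitaryRep G) (i j : Fin ξ.dim) :
    ξ.adjCoeff E i j = conjFun (ξ.coeffFun E j i) := rfl

/-- The derived representation `dξ(X)`. -/
def UnitaryRep.deriv (ξ : UnitaryRep G) (X : GroupLieAlgebra 𝓘(ℝ, E) G) :
    Matrix (Fin ξ.dim) (Fin ξ.dim) ℂ := Matrix.of fun i j => derivOp X (ξ.coeffFun E i j) 1

theorem UnitaryRep.derivOp_coeffFun_apply (ξ : UnitaryRep G) (X : GroupLieAlgebra 𝓘(ℝ, E) G)
    (i j : Fin ξ.dim) (x : G) :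
    derivOp X (ξ.coeffFun E i j) x = (ξ.mat x * ξ.deriv X) i j := by
  have h : translate x (ξ.coeffFun E i j) = ∑ k, ξ.mat x i k • ξ.coeffFun E k j := by
    refine SmoothFun.ext fun y => ?_
    rw [SmoothFun.sum_apply]
    simp [UnitaryRep.mat_mul, Matrix.mul_apply]
  have h1 : derivOp X (ξ.coeffFun E i j) x = derivOp X (translate x (ξ.coeffFun E i j)) 1 := by
    rw [derivOp_translate]; simp
  rw [h1, h, map_sum, SmoothFun.sum_apply, Matrix.mul_apply]
  simp [UnitaryRep.deriv]

/-- Differentiate `ξ^* ξ = 1` at the identity. -/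
theorem UnitaryRep.conjTranspose_deriv (ξ : UnitaryRep G) (X : GroupLieAlgebra 𝓘(ℝ, E) G) :
    (ξ.deriv X)ᴴ = -ξ.deriv X := by
  ext i j
  have h : ∑ k, ξ.adjCoeff E i k * ξ.coeffFun E k j = if i = j then 1 else 0 := by
    refine SmoothFun.ext fun x => ?_
    rw [SmoothFun.sum_apply]
    have := congrFun (congrFun (ξ.conjTranspose_mat_mul x) i) j
    rw [Matrix.mul_apply, Matrix.one_apply] at this
    simp only [SmoothFun.mul_apply, adjCoeff_apply, coeffFun_apply, this]
    split_ifs <;> rfl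
  have h2 := congrArg (fun f => derivOp X f 1) h
  have hone : derivOp X (1 : SmoothFun E G) = 0 := by
    have := derivOp_mul X (1 : SmoothFun E G) 1
    simpa using this
  have h0 : derivOp X (if i = j then (1 : SmoothFun E G) else 0) 1 = 0 := by
    split_ifs
    · rw [hone]; rfl
    · rw [map_zero]; rfl
  simp only [h0, map_sum, SmoothFun.sum_apply, derivOp_mul, SmoothFun.add_apply,
    SmoothFun.mul_apply, adjCoeff_eq, derivOp_conjFun, conjFun_apply, coeffFun_apply, mat_one,
    Matrix.one_apply, Finset.sum_add_distrib] at h2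
  have e1 : ∑ x, star (derivOp X (ξ.coeffFun E x i) 1) * (if x = j then (1 : ℂ) else 0) =
      (ξ.deriv X)ᴴ i j := by simp [UnitaryRep.deriv, Matrix.conjTranspose_apply]
  have e2 : ∑ x, star (if x = i then (1 : ℂ) else 0) * derivOp X (ξ.coeffFun E x j) 1 =
      ξ.deriv X i j := by
    rw [Finset.sum_eq_single i (by intro b _ hb; simp [hb]) (by simp)]
    simp [UnitaryRep.deriv]
  rw [e1, e2] at h2
  simpa using eq_neg_of_add_eq_zero_left h2

theorem UnitaryRep.deriv_adjointAction (ξ : UnitaryRep G) (g : G)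
    (X : GroupLieAlgebra 𝓘(ℝ, E) G) :
    ξ.deriv (adjointAction g X) = ξ.mat g * ξ.deriv X * (ξ.mat g)ᴴ := by
  ext i j
  have h : leftDeriv (adjointAction g X) (ξ.coeffFun E i j) 1 =
      derivOp X (∑ k, ∑ l, (ξ.mat g i k * (ξ.mat g)ᴴ l j) • ξ.coeffFun E k l) 1 := by
    rw [leftDeriv_adjointAction g X (ξ.coeffFun E i j).2, derivOp_apply]
    congr 1
    funext y
    simp only [SmoothFun.sum_apply, SmoothFun.smul_apply, coeffFun_apply, mat_mul, mat_inv]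
    rw [Matrix.mul_apply]
    simp only [Matrix.mul_apply, Finset.sum_mul]
    rw [Finset.sum_comm]
    exact Finset.sum_congr rfl fun k _ => Finset.sum_congr rfl fun l _ => by ring
  change leftDeriv (adjointAction g X) (ξ.coeffFun E i j) 1 = _
  rw [h]
  simp only [map_sum, map_smul, SmoothFun.sum_apply, SmoothFun.smul_apply]
  rw [Matrix.mul_apply]
  simp only [Matrix.mul_apply, Finset.sum_mul]
  rw [Finset.sum_comm]
  exact Finset.sum_congr rfl fun k _ => Finset.sum_congr rfl fun l _ => by
    simp only [UnitaryRep.deriv, Matrix.of_apply]; ring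

/-- The derived representation is linear. -/
def UnitaryRep.derivLin (ξ : UnitaryRep G) :
    GroupLieAlgebra 𝓘(ℝ, E) G →ₗ[ℝ] Matrix (Fin ξ.dim) (Fin ξ.dim) ℂ where
  toFun := ξ.deriv
  map_add' X Z := by
    ext i j
    simp [UnitaryRep.deriv, derivOp_add_left]
  map_smul' c X := by
    ext i j
    simp only [UnitaryRep.deriv, derivOp_smul_left, Matrix.of_apply, SmoothFun.smul_apply]
    exact Complex.real_smul.symm

theorem UnitaryRep.derivLin_apply (ξ : UnitaryRep G) (X : GroupLieAlgebra 𝓘(ℝ, E) G) :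
    ξ.derivLin X = ξ.deriv X := rfl

end Representations

/-! ### The Casimir matrix, the eigenvalue of the Laplacian and the size of derivatives -/

section Casimir

open scoped Matrix Matrix.Norms.L2Operator MatrixOrder ComplexOrder

variable {E : Type*} [NormedAddCommGroup E] [NormedSpace ℝ E] [FiniteDimensional ℝ E]
  {G : Type*} [TopologicalSpace G] [ChartedSpace E G] [Group G] [LieGroup 𝓘(ℝ, E) ∞ G]
  [T2Space G] (κ : BiInvariantMetric E G)
  {n : ℕ} (Y : Module.Basis (Fin n) ℝ (GroupLieAlgebra 𝓘(ℝ, E) G))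

/-- The Gram matrix of the basis `Y`. -/
def gramMatrix : Matrix (Fin n) (Fin n) ℝ := Matrix.of fun i j => κ.form (Y i) (Y j)

theorem dotProduct_gramMatrix_mulVec (v : Fin n → ℝ) :
    v ⬝ᵥ (gramMatrix κ Y *ᵥ v) = κ.form (∑ i, v i • Y i) (∑ i, v i • Y i) := by
  simp only [dotProduct, Matrix.mulVec, map_sum, LinearMap.sum_apply, map_smul,
    LinearMap.smul_apply, smul_eq_mul, gramMatrix, Matrix.of_apply, Finset.mul_sum]
  rw [Finset.sum_comm]
  refine Finset.sum_congr rfl fun i _ => Finset.sum_congr rfl fun j _ => ?_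
  ring

theorem posDef_gramMatrix : (gramMatrix κ Y).PosDef := by
  refine Matrix.PosDef.of_dotProduct_mulVec_pos ?_ fun v hv => ?_
  · ext i j
    simp [gramMatrix, κ.symm (Y j) (Y i)]
  · rw [star_trivial, dotProduct_gramMatrix_mulVec]
    refine κ.pos _ fun h => hv ?_
    have := Fintype.linearIndependent_iff.1 Y.linearIndependent v h
    exact funext this

/-- The matrix of the adjoint action in the basis `Y`. -/
def adMatrix (g : G) : Matrix (Fin n) (Fin n) ℝ :=
  Matrix.of fun l i => Y.repr (adjointAction g (Y i)) l

theorem adjointAction_eq_sum (g : G) (i : Fin n) :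
    adjointAction g (Y i) = ∑ l, adMatrix Y g l i • Y l := (Y.sum_repr _).symm

theorem adMatrix_transpose_mul (g : G) :
    (adMatrix Y g)ᵀ * gramMatrix κ Y * adMatrix Y g = gramMatrix κ Y := by
  ext i j
  have h := κ.invariant g (Y i) (Y j)
  rw [adjointAction_eq_sum, adjointAction_eq_sum] at h
  simp only [map_sum, LinearMap.sum_apply, map_smul, LinearMap.smul_apply, smul_eq_mul] at h
  rw [Matrix.mul_apply]
  simp only [Matrix.mul_apply, Matrix.transpose_apply, Finset.sum_mul]
  refine Eq.trans ?_ h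
  refine Finset.sum_congr rfl fun k _ => ?_
  rw [Finset.mul_sum]
  refine Finset.sum_congr rfl fun l _ => ?_
  simp only [gramMatrix, Matrix.of_apply]
  ring

/-- Invert the relation `aᵀ Γ a = Γ`, which expresses the invariance of the metric; taking
determinants shows that `a` is invertible. -/
theorem adMatrix_mul_inv_gram (g : G) :
    adMatrix Y g * (gramMatrix κ Y)⁻¹ * (adMatrix Y g)ᵀ = (gramMatrix κ Y)⁻¹ := by
  have h := adMatrix_transpose_mul κ Y g
  have hΓ : IsUnit (gramMatrix κ Y).det :=
    (Matrix.isUnit_iff_isUnit_det _).1 (posDef_gramMatrix κ Y).isUnit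
  have ha : IsUnit (adMatrix Y g).det := by
    have h' := congrArg Matrix.det h
    rw [Matrix.det_mul, Matrix.det_mul] at h'
    rw [← h'] at hΓ
    exact isUnit_of_mul_isUnit_right hΓ
  have hat : IsUnit ((adMatrix Y g)ᵀ).det := by rwa [Matrix.det_transpose]
  conv_lhs => rw [← h, Matrix.mul_inv_rev, Matrix.mul_inv_rev]
  rw [Matrix.mul_nonsing_inv_cancel_left _ _ ha, Matrix.mul_assoc, Matrix.nonsing_inv_mul _ hat,
    Matrix.mul_one]

/-- The Laplacian as an operator on smooth functions. -/
def lapOp : SmoothFun E G →ₗ[ℂ] SmoothFun E G :=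
  ∑ i, ∑ j, (((gramMatrix κ Y)⁻¹ i j : ℝ) : ℂ) • (derivOp (Y i) ∘ₗ derivOp (Y j))

theorem lapOp_apply (f : SmoothFun E G) (x : G) : lapOp κ Y f x = laplacian κ Y f x := by
  simp only [lapOp, LinearMap.sum_apply, SmoothFun.sum_apply, LinearMap.smul_apply,
    SmoothFun.smul_apply, LinearMap.comp_apply, laplacian]
  rfl

variable [CompactSpace G]

/-- The matrix `∂_{j₁} ⋯ ∂_{j_k} ξ (1)`. -/
def UnitaryRep.wordMat (ξ : UnitaryRep G) : List (Fin n) → Matrix (Fin ξ.dim) (Fin ξ.dim) ℂ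
  | [] => 1
  | j :: w => ξ.deriv (Y j) * wordMat ξ w

theorem UnitaryRep.wordOp_coeffFun (ξ : UnitaryRep G) (w : List (Fin n)) (i j : Fin ξ.dim) :
    wordOp Y w (ξ.coeffFun E i j) = ∑ k, ξ.wordMat Y w k j • ξ.coeffFun E i k := by
  induction w with
  | nil =>
    refine SmoothFun.ext fun x => ?_
    rw [SmoothFun.sum_apply, Finset.sum_eq_single j]
    · simp [UnitaryRep.wordMat]
    · intro b _ hb
      simp [UnitaryRep.wordMat, hb]
    · simp
  | cons l w ih =>
    rw [wordOp_cons, ih, map_sum]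
    refine SmoothFun.ext fun x => ?_
    simp only [map_smul, SmoothFun.sum_apply, SmoothFun.smul_apply, derivOp_coeffFun_apply,
      UnitaryRep.wordMat, Matrix.mul_apply, coeffFun_apply, Finset.mul_sum, Finset.sum_mul]
    rw [Finset.sum_comm]
    exact Finset.sum_congr rfl fun k _ => Finset.sum_congr rfl fun m _ => by ring

theorem UnitaryRep.wordOp_coeffFun_apply (ξ : UnitaryRep G) (w : List (Fin n)) (i j : Fin ξ.dim)
    (x : G) : wordOp Y w (ξ.coeffFun E i j) x = (ξ.mat x * ξ.wordMat Y w) i j := by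
  rw [wordOp_coeffFun, SmoothFun.sum_apply, Matrix.mul_apply]
  exact Finset.sum_congr rfl fun k _ => by simp [mul_comm]

/-- The Casimir matrix of a representation. -/
def UnitaryRep.casimir (ξ : UnitaryRep G) : Matrix (Fin ξ.dim) (Fin ξ.dim) ℂ :=
  ∑ i, ∑ j, (((gramMatrix κ Y)⁻¹ i j : ℝ) : ℂ) • (ξ.deriv (Y i) * ξ.deriv (Y j))

theorem UnitaryRep.lapOp_coeffFun_apply (ξ : UnitaryRep G) (a b : Fin ξ.dim) (x : G) :
    lapOp κ Y (ξ.coeffFun E a b) x = (ξ.mat x * ξ.casimir κ Y) a b := by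
  have h : ∀ i j, derivOp (Y i) (derivOp (Y j) (ξ.coeffFun E a b)) x =
      (ξ.mat x * (ξ.deriv (Y i) * ξ.deriv (Y j))) a b := fun i j => by
    have := ξ.wordOp_coeffFun_apply Y [i, j] a b x
    simpa [UnitaryRep.wordMat] using this
  simp only [lapOp, LinearMap.sum_apply, SmoothFun.sum_apply, LinearMap.smul_apply,
    SmoothFun.smul_apply, LinearMap.comp_apply, h, UnitaryRep.casimir, Finset.mul_sum,
    Matrix.sum_apply, Matrix.mul_smul, Matrix.smul_apply, smul_eq_mul]

/-- Conjugation by `ξ(g)` replaces `dξ(Y_i)` by `dξ(Ad_g Y_i)`, and the inverse Gram matrix is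
invariant under the matrix of `Ad_g`. -/
theorem UnitaryRep.mat_mul_casimir (ξ : UnitaryRep G) (g : G) :
    ξ.mat g * ξ.casimir κ Y = ξ.casimir κ Y * ξ.mat g := by
  have h1 : ξ.mat g * ξ.casimir κ Y * (ξ.mat g)ᴴ = ξ.casimir κ Y := by
    have h2 : ∀ i j, ξ.mat g * (ξ.deriv (Y i) * ξ.deriv (Y j)) * (ξ.mat g)ᴴ =
        ∑ l, ∑ m, ((adMatrix Y g l i * adMatrix Y g m j : ℝ) : ℂ) •
          (ξ.deriv (Y l) * ξ.deriv (Y m)) := by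
      intro i j
      have h3 : ξ.mat g * (ξ.deriv (Y i) * ξ.deriv (Y j)) * (ξ.mat g)ᴴ =
          ξ.derivLin (adjointAction g (Y i)) * ξ.derivLin (adjointAction g (Y j)) := by
        rw [derivLin_apply, derivLin_apply, deriv_adjointAction, deriv_adjointAction]
        calc _ = ξ.mat g * ξ.deriv (Y i) * 1 * ξ.deriv (Y j) * (ξ.mat g)ᴴ := by
              simp only [Matrix.mul_assoc, Matrix.one_mul]
          _ = _ := by rw [← ξ.conjTranspose_mat_mul g]; simp only [Matrix.mul_assoc]
      rw [h3, adjointAction_eq_sum, adjointAction_eq_sum, map_sum, map_sum, Finset.sum_mul_sum]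
      refine Finset.sum_congr rfl fun l _ => Finset.sum_congr rfl fun m _ => ?_
      rw [map_smul, map_smul, smul_mul_smul_comm, derivLin_apply, derivLin_apply]
      exact (Complex.coe_smul _ _).symm
    unfold UnitaryRep.casimir
    simp only [Finset.mul_sum, Finset.sum_mul, Matrix.mul_smul, Matrix.smul_mul, h2,
      Finset.smul_sum, smul_smul]
    have e : ∀ l m, ∑ i, ∑ j, (((gramMatrix κ Y)⁻¹ i j : ℝ) : ℂ) *
        ((adMatrix Y g l i * adMatrix Y g m j : ℝ) : ℂ) = (((gramMatrix κ Y)⁻¹ l m : ℝ) : ℂ) := by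
      intro l m
      have := congrFun (congrFun (adMatrix_mul_inv_gram κ Y g) l) m
      rw [← this, Matrix.mul_apply]
      simp only [Matrix.mul_apply, Matrix.transpose_apply, Finset.sum_mul]
      rw [Finset.sum_comm]
      push_cast
      exact Finset.sum_congr rfl fun i _ => Finset.sum_congr rfl fun j _ => by ring
    refine Eq.trans ?_ (Finset.sum_congr rfl fun l _ => Finset.sum_congr rfl fun m _ =>
      congrArg (fun c : ℂ => c • (ξ.deriv (Y l) * ξ.deriv (Y m))) (e l m))
    simp only [Finset.sum_smul]
    calc _ = ∑ i, ∑ l, ∑ j, ∑ m, ((((gramMatrix κ Y)⁻¹ i j : ℝ) : ℂ) *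
        ((adMatrix Y g l i * adMatrix Y g m j : ℝ) : ℂ)) • (ξ.deriv (Y l) * ξ.deriv (Y m)) :=
          Finset.sum_congr rfl fun i _ => Finset.sum_comm
      _ = ∑ l, ∑ i, ∑ m, ∑ j, ((((gramMatrix κ Y)⁻¹ i j : ℝ) : ℂ) *
        ((adMatrix Y g l i * adMatrix Y g m j : ℝ) : ℂ)) • (ξ.deriv (Y l) * ξ.deriv (Y m)) := by
          rw [Finset.sum_comm]
          exact Finset.sum_congr rfl fun l _ => Finset.sum_congr rfl fun i _ => Finset.sum_comm
      _ = _ := Finset.sum_congr rfl fun l _ => Finset.sum_comm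
  calc ξ.mat g * ξ.casimir κ Y = ξ.mat g * ξ.casimir κ Y * ((ξ.mat g)ᴴ * ξ.mat g) := by
        rw [conjTranspose_mat_mul, Matrix.mul_one]
    _ = (ξ.mat g * ξ.casimir κ Y * (ξ.mat g)ᴴ) * ξ.mat g := by simp only [Matrix.mul_assoc]
    _ = _ := by rw [h1]

/-- The rows of `B` are the coordinates of an orthonormal basis with respect to `Y`; in that basis
the Casimir matrix becomes a sum of squares. -/
theorem exists_gram_inv_eq : ∃ B : Matrix (Fin n) (Fin n) ℝ, IsUnit B.det ∧
    (gramMatrix κ Y)⁻¹ = Bᵀ * B := by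
  have hp := (posDef_gramMatrix κ Y).inv
  obtain ⟨B, hB⟩ := CStarAlgebra.nonneg_iff_eq_star_mul_self.mp hp.posSemidef.nonneg
  have hB' : (gramMatrix κ Y)⁻¹ = Bᵀ * B := by
    rw [hB, Matrix.star_eq_conjTranspose, Matrix.conjTranspose_eq_transpose_of_trivial]
  refine ⟨B, ?_, hB'⟩
  have h1 : IsUnit ((gramMatrix κ Y)⁻¹).det := (Matrix.isUnit_iff_isUnit_det _).1 hp.isUnit
  rw [hB', Matrix.det_mul] at h1
  exact isUnit_of_mul_isUnit_right h1

theorem UnitaryRep.casimir_eq (ξ : UnitaryRep G) {B : Matrix (Fin n) (Fin n) ℝ}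
    (hB : (gramMatrix κ Y)⁻¹ = Bᵀ * B) :
    -ξ.casimir κ Y = ∑ k, (∑ i, (B k i : ℂ) • ξ.deriv (Y i))ᴴ * ∑ i, (B k i : ℂ) • ξ.deriv (Y i) := by
  have h : ∀ k, (∑ i, (B k i : ℂ) • ξ.deriv (Y i))ᴴ * ∑ i, (B k i : ℂ) • ξ.deriv (Y i) =
      ∑ i, ∑ j, -(((B k i * B k j : ℝ) : ℂ) • (ξ.deriv (Y i) * ξ.deriv (Y j))) := by
    intro k
    rw [Matrix.conjTranspose_sum, Finset.sum_mul_sum]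
    refine Finset.sum_congr rfl fun i _ => Finset.sum_congr rfl fun j _ => ?_
    rw [Matrix.conjTranspose_smul, conjTranspose_deriv, smul_mul_smul_comm, neg_mul, smul_neg]
    simp
  simp only [h, UnitaryRep.casimir, hB, Matrix.mul_apply, Matrix.transpose_apply,
    Complex.ofReal_sum, Finset.sum_smul, ← Finset.sum_neg_distrib]
  calc _ = ∑ i, ∑ k, ∑ j, -(((B k i * B k j : ℝ) : ℂ) • (ξ.deriv (Y i) * ξ.deriv (Y j))) :=
        Finset.sum_congr rfl fun i _ => Finset.sum_comm
    _ = _ := Finset.sum_comm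

/-- Schur's lemma makes the Casimir matrix a scalar. Its negative is a sum of matrices `Z^* Z`, so
the scalar `-c`, read off from a diagonal entry, is real and nonnegative. -/
theorem UnitaryRep.exists_casimir (ξ : UnitaryRep G) : ∃ l : ℝ, 0 ≤ l ∧
    ξ.casimir κ Y = -((l : ℂ) • (1 : Matrix (Fin ξ.dim) (Fin ξ.dim) ℂ)) := by
  obtain ⟨c, hc⟩ := ξ.exists_eq_smul_one _ (ξ.mat_mul_casimir κ Y)
  obtain ⟨B, -, hB⟩ := exists_gram_inv_eq κ Y
  have h := ξ.casimir_eq κ Y hB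
  have hpos : (-ξ.casimir κ Y).PosSemidef := by
    rw [h]
    exact Matrix.posSemidef_sum _ fun k _ => Matrix.posSemidef_conjTranspose_mul_self _
  have := hpos.diag_nonneg (i := ⟨0, ξ.dim_pos⟩)
  rw [hc] at this
  simp only [Matrix.neg_apply, Matrix.smul_apply, Matrix.one_apply_eq, smul_eq_mul, mul_one] at this
  rw [Complex.nonneg_iff] at this
  refine ⟨(-c).re, this.1, ?_⟩
  have h2 : (((-c).re : ℝ) : ℂ) = -c := Complex.ext rfl this.2
  rw [h2, hc, neg_smul, neg_neg]

/-- The set under the supremum is a singleton: a diagonal coefficient equals `1` at the identity and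
determines the eigenvalue. -/
theorem UnitaryRep.setOf_laplacian_eq {ξ : UnitaryRep G} {l : ℝ}
    (hl : ξ.casimir κ Y = -((l : ℂ) • (1 : Matrix (Fin ξ.dim) (Fin ξ.dim) ℂ))) :
    lapEigenvalue κ Y ξ = l := by
  have h : ∀ i j x, -laplacian κ Y (ξ.coeff i j) x = (l : ℂ) * ξ.coeff i j x := by
    intro i j x
    have := lapOp_apply κ Y (ξ.coeffFun E i j) x
    rw [lapOp_coeffFun_apply, hl] at this
    change _ = laplacian κ Y (ξ.coeff i j) x at this
    rw [← this, coeff_eq_mat]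
    simp
  have hs : {l : ℝ | ∀ i j x, -laplacian κ Y (ξ.coeff i j) x = (l : ℂ) * ξ.coeff i j x} = {l} := by
    ext m
    refine ⟨fun hm => ?_, fun hm => by rw [Set.mem_singleton_iff.1 hm]; exact h⟩
    have h1 := (hm ⟨0, ξ.dim_pos⟩ ⟨0, ξ.dim_pos⟩ 1).symm.trans (h _ _ 1)
    simp only [coeff_eq_mat, mat_one, Matrix.one_apply_eq, mul_one] at h1
    exact_mod_cast h1
  rw [lapEigenvalue, hs, csSup_singleton]

theorem lapEigenvalue_nonneg (ξ : UnitaryRep G) : 0 ≤ lapEigenvalue κ Y ξ := by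
  obtain ⟨l, hl0, hl⟩ := ξ.exists_casimir κ Y
  rwa [UnitaryRep.setOf_laplacian_eq κ Y hl]

theorem UnitaryRep.casimir_eq_lapEigenvalue (ξ : UnitaryRep G) :
    ξ.casimir κ Y = -((lapEigenvalue κ Y ξ : ℂ) • (1 : Matrix (Fin ξ.dim) (Fin ξ.dim) ℂ)) := by
  obtain ⟨l, hl0, hl⟩ := ξ.exists_casimir κ Y
  rwa [UnitaryRep.setOf_laplacian_eq κ Y hl]

theorem one_le_bracket (ξ : UnitaryRep G) : 1 ≤ bracket κ Y ξ := by
  rw [bracket, Real.one_le_sqrt]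
  linarith [lapEigenvalue_nonneg κ Y ξ]

theorem bracket_pos (ξ : UnitaryRep G) : 0 < bracket κ Y ξ :=
  zero_lt_one.trans_le (one_le_bracket κ Y ξ)

theorem bracket_sq (ξ : UnitaryRep G) : bracket κ Y ξ ^ 2 = 1 + lapEigenvalue κ Y ξ :=
  Real.sq_sqrt (by linarith [lapEigenvalue_nonneg κ Y ξ])

theorem UnitaryRep.lapOp_coeffFun (ξ : UnitaryRep G) (i j : Fin ξ.dim) :
    lapOp κ Y (ξ.coeffFun E i j) = (-lapEigenvalue κ Y ξ : ℂ) • ξ.coeffFun E i j := by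
  refine SmoothFun.ext fun x => ?_
  rw [lapOp_coeffFun_apply, casimir_eq_lapEigenvalue, SmoothFun.smul_apply, coeffFun_apply]
  simp

theorem lapOp_conjFun (f : SmoothFun E G) : lapOp κ Y (conjFun f) = conjFun (lapOp κ Y f) := by
  refine SmoothFun.ext fun x => ?_
  simp only [lapOp, LinearMap.sum_apply, SmoothFun.sum_apply, LinearMap.smul_apply,
    SmoothFun.smul_apply, LinearMap.comp_apply, derivOp_conjFun, conjFun_apply, star_sum, star_mul',
    Complex.star_def, Complex.conj_ofReal]

theorem UnitaryRep.lapOp_adjCoeff (ξ : UnitaryRep G) (i j : Fin ξ.dim) :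
    lapOp κ Y (ξ.adjCoeff E i j) = (-lapEigenvalue κ Y ξ : ℂ) • ξ.adjCoeff E i j := by
  rw [adjCoeff_eq, lapOp_conjFun, lapOp_coeffFun]
  refine SmoothFun.ext fun x => ?_
  rw [conjFun_apply, SmoothFun.smul_apply, SmoothFun.smul_apply, conjFun_apply]
  simp

/-- `dξ(Y_j)` grows at most like `⟨ξ⟩`. -/
theorem exists_norm_deriv_le : ∃ C : ℝ, 1 ≤ C ∧ ∀ (ξ : UnitaryRep G) (j : Fin n),
    ‖ξ.deriv (Y j)‖ ≤ C * bracket κ Y ξ := by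
  obtain ⟨B, hBu, hB⟩ := exists_gram_inv_eq κ Y
  refine ⟨1 + ∑ j, ∑ k, |B⁻¹ j k|, by
    linarith [Finset.sum_nonneg fun (j : Fin n) (_ : j ∈ Finset.univ) =>
      Finset.sum_nonneg fun (k : Fin n) (_ : k ∈ Finset.univ) => abs_nonneg (B⁻¹ j k)],
    fun ξ j => ?_⟩
  have := ξ.nonempty_fin
  set Z : Fin n → Matrix (Fin ξ.dim) (Fin ξ.dim) ℂ := fun k => ∑ i, (B k i : ℂ) • ξ.deriv (Y i)
    with hZ
  have hZle : ∀ k, ‖Z k‖ ≤ bracket κ Y ξ := by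
    intro k
    -- One summand is at most the whole sum, which is `λ_[ξ]` times the identity matrix. Hence
    -- `‖Z_k‖² ≤ λ_[ξ] ≤ ⟨ξ⟩²`.
    have h1 : (Z k)ᴴ * Z k ≤ ∑ k, (Z k)ᴴ * Z k := by
      refine Finset.single_le_sum (f := fun k => (Z k)ᴴ * Z k) (fun k _ => ?_) (Finset.mem_univ k)
      exact (Matrix.posSemidef_conjTranspose_mul_self _).nonneg
    rw [← ξ.casimir_eq κ Y hB, UnitaryRep.casimir_eq_lapEigenvalue, neg_neg] at h1
    have h2 := CStarAlgebra.norm_le_norm_of_nonneg_of_le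
      (Matrix.posSemidef_conjTranspose_mul_self (Z k)).nonneg h1
    rw [Matrix.l2_opNorm_conjTranspose_mul_self, norm_smul, norm_one, mul_one,
      Complex.norm_real, Real.norm_of_nonneg (lapEigenvalue_nonneg κ Y ξ)] at h2
    refine abs_le_of_sq_le_sq' ?_ (bracket_pos κ Y ξ).le |>.2
    rw [bracket_sq]
    nlinarith
  -- Inverting `B` returns from the orthonormal frame to `Y`, with coefficients independent of `ξ`.
  have hY : ξ.deriv (Y j) = ∑ k, (B⁻¹ j k : ℂ) • Z k := by
    simp only [hZ, Finset.smul_sum, smul_smul]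
    rw [Finset.sum_comm]
    simp only [← Finset.sum_smul]
    have e : ∀ i, ∑ k, (B⁻¹ j k : ℂ) * (B k i : ℂ) = if j = i then 1 else 0 := by
      intro i
      have := congrFun (congrFun (Matrix.nonsing_inv_mul B hBu) j) i
      rw [Matrix.mul_apply, Matrix.one_apply] at this
      have h := congrArg (fun t : ℝ => (t : ℂ)) this
      simp only [Complex.ofReal_sum, Complex.ofReal_mul] at h
      rw [h]
      split_ifs <;> simp
    simp [e]
  rw [hY]
  calc ‖∑ k, (B⁻¹ j k : ℂ) • Z k‖ ≤ ∑ k, |B⁻¹ j k| * bracket κ Y ξ := by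
        refine (norm_sum_le _ _).trans (Finset.sum_le_sum fun k _ => ?_)
        rw [norm_smul, Complex.norm_real, Real.norm_eq_abs]
        exact mul_le_mul_of_nonneg_left (hZle k) (abs_nonneg _)
    _ = (∑ k, |B⁻¹ j k|) * bracket κ Y ξ := by rw [Finset.sum_mul]
    _ ≤ _ := by
        refine mul_le_mul_of_nonneg_right ?_ (bracket_pos κ Y ξ).le
        have := Finset.single_le_sum (f := fun j => ∑ k, |B⁻¹ j k|)
          (fun j _ => Finset.sum_nonneg fun k _ => abs_nonneg _) (Finset.mem_univ j)
        linarith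

theorem UnitaryRep.norm_wordMat_le {C : ℝ} (hC : 1 ≤ C) {ξ : UnitaryRep G}
    (h : ∀ j : Fin n, ‖ξ.deriv (Y j)‖ ≤ C * bracket κ Y ξ) (w : List (Fin n)) :
    ‖ξ.wordMat Y w‖ ≤ (C * bracket κ Y ξ) ^ w.length := by
  have := ξ.nonempty_fin
  have hC0 : 0 ≤ C * bracket κ Y ξ := mul_nonneg (by linarith) (bracket_pos κ Y ξ).le
  induction w with
  | nil => simp [UnitaryRep.wordMat]
  | cons j w ih =>
    rw [UnitaryRep.wordMat, List.length_cons, pow_succ']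
    exact (norm_mul_le _ _).trans (mul_le_mul (h j) ih (norm_nonneg _) hC0)

end Casimir

/-! ### Haar measure, Schur orthogonality and integration by parts -/

section Haar

open MeasureTheory Measure
open scoped Matrix

section CompactGroup

variable {G : Type*} [TopologicalSpace G] [Group G] [IsTopologicalGroup G] [CompactSpace G]
  [MeasurableSpace G] [BorelSpace G] (μ : Measure G) [IsProbabilityMeasure μ] [μ.IsHaarMeasure]

/-- A right translate of a Haar probability measure is a Haar probability measure, and there is only
one. -/
theorem isMulRightInvariant_of_compactSpace : μ.IsMulRightInvariant where
  map_mul_right_eq_self g := by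
    have : IsProbabilityMeasure (μ.map (· * g)) :=
      isProbabilityMeasure_map (measurable_mul_const g).aemeasurable
    exact isHaarMeasure_eq_of_isProbabilityMeasure _ _

theorem isInvInvariant_of_compactSpace : μ.IsInvInvariant where
  inv_eq_self := by
    have := isMulRightInvariant_of_compactSpace μ
    have : IsProbabilityMeasure μ.inv :=
      isProbabilityMeasure_map measurable_inv.aemeasurable
    have : IsHaarMeasure μ.inv := by
      have h : IsMulLeftInvariant μ.inv := inferInstance
      have h2 : IsOpenPosMeasure μ.inv :=
        continuous_inv.isOpenPosMeasure_map (Equiv.inv G).surjective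
      exact { toIsMulLeftInvariant := h, toIsOpenPosMeasure := h2,
              toIsFiniteMeasureOnCompacts := inferInstance }
    exact isHaarMeasure_eq_of_isProbabilityMeasure _ _

variable {μ} in
theorem integrable_of_continuous [SecondCountableTopology G] {V : Type*} [NormedAddCommGroup V]
    {f : G → V} (hf : Continuous f) : Integrable f μ :=
  hf.integrable_of_hasCompactSupport (HasCompactSupport.of_compactSpace _)

end CompactGroup

section Orthogonality

variable {G : Type*} [TopologicalSpace G] [Group G] [IsTopologicalGroup G] [CompactSpace G]
  [SecondCountableTopology G]
  [MeasurableSpace G] [BorelSpace G] {μ : Measure G} [IsProbabilityMeasure μ] [μ.IsHaarMeasure]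

namespace UnitaryRep

variable {ξ η : UnitaryRep G}

theorem continuous_mat_apply (ξ : UnitaryRep G) (i j : Fin ξ.dim) :
    Continuous fun x => ξ.mat x i j := ξ.continuous_mat.matrix_elem i j

variable (μ ξ η) in
/-- The matrix of integrals `∫ ξ_{ij} \bar η_{kl}` for fixed columns `j, l`. -/
def coeffIntegral (j : Fin ξ.dim) (l : Fin η.dim) : Matrix (Fin ξ.dim) (Fin η.dim) ℂ :=
  Matrix.of fun i k => ∫ x, ξ.mat x i j * star (η.mat x k l) ∂μ

theorem integrable_coeff (i j : Fin ξ.dim) (k l : Fin η.dim) :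
    Integrable (fun x => ξ.mat x i j * star (η.mat x k l)) μ :=
  integrable_of_continuous ((ξ.continuous_mat_apply i j).mul (η.continuous_mat_apply k l).star)

/-- Left invariance of the integral: substituting `g⁻¹ x` moves `ξ(g)` across as `η(g)`. Schur's
lemma then applies to the matrix of integrals. -/
theorem mat_mul_coeffIntegral (j : Fin ξ.dim) (l : Fin η.dim) (g : G) :
    ξ.mat g * coeffIntegral μ ξ η j l = coeffIntegral μ ξ η j l * η.mat g := by
  ext i k
  have h1 : (ξ.mat g * coeffIntegral μ ξ η j l) i k =
      ∫ x, ξ.mat (g * x) i j * star (η.mat x k l) ∂μ := by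
    simp only [Matrix.mul_apply, coeffIntegral, Matrix.of_apply, ← integral_const_mul]
    rw [← integral_finsetSum _ fun a _ => (integrable_coeff a j k l).const_mul _]
    refine integral_congr_ae (.of_forall fun x => ?_)
    simp only [mat_mul, Matrix.mul_apply, Finset.sum_mul, mul_assoc]
  have h2 : (coeffIntegral μ ξ η j l * η.mat g) i k =
      ∫ x, ξ.mat x i j * star (η.mat (g⁻¹ * x) k l) ∂μ := by
    simp only [Matrix.mul_apply, coeffIntegral, Matrix.of_apply, ← integral_mul_const]
    rw [← integral_finsetSum _ fun a _ => (integrable_coeff i j a l).mul_const _]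
    refine integral_congr_ae (.of_forall fun x => ?_)
    simp only [mat_mul, mat_inv, Matrix.mul_apply, star_sum, star_mul', Matrix.conjTranspose_apply,
      star_star, Finset.mul_sum]
    exact Finset.sum_congr rfl fun a _ => by ring
  rw [h1, h2, ← integral_mul_left_eq_self _ g⁻¹]
  simp

theorem integral_coeff_mul_eq_zero (h : ¬ ξ.Equivalent η) (i j : Fin ξ.dim) (k l : Fin η.dim) :
    ∫ x, ξ.mat x i j * star (η.mat x k l) ∂μ = 0 := by
  have h1 := (eq_zero_or_equivalent (coeffIntegral μ ξ η j l)
    (mat_mul_coeffIntegral j l)).resolve_right h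
  exact congrFun (congrFun h1 i) k

/-- The scalar from Schur's lemma is found by taking the trace, since `∑_a ξ_{aj} \bar ξ_{al} =
δ_{jl}` pointwise. -/
theorem integral_coeff_mul_self (i j k l : Fin ξ.dim) :
    ∫ x, ξ.mat x i j * star (ξ.mat x k l) ∂μ =
      if i = k ∧ j = l then (ξ.dim : ℂ)⁻¹ else 0 := by
  obtain ⟨c, hc⟩ := exists_eq_smul_one (coeffIntegral μ ξ ξ j l) (mat_mul_coeffIntegral j l)
  have htr : (coeffIntegral μ ξ ξ j l).trace = if j = l then 1 else 0 := by
    simp only [Matrix.trace, Matrix.diag, coeffIntegral, Matrix.of_apply]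
    rw [← integral_finsetSum _ fun a _ => integrable_coeff a j a l]
    have : ∀ x, ∑ a, ξ.mat x a j * star (ξ.mat x a l) = if j = l then 1 else 0 := by
      intro x
      have := congrFun (congrFun (ξ.conjTranspose_mat_mul x) l) j
      rw [Matrix.mul_apply, Matrix.one_apply] at this
      simp only [Matrix.conjTranspose_apply] at this
      simp only [eq_comm (a := j), ← this, mul_comm]
    rw [integral_congr_ae (.of_forall this), integral_const]
    simp
  rw [hc, Matrix.trace_smul, Matrix.trace_one, Fintype.card_fin, smul_eq_mul] at htr
  have hd : (ξ.dim : ℂ) ≠ 0 := Nat.cast_ne_zero.2 ξ.dim_pos.ne'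
  have hM : ∫ x, ξ.mat x i j * star (ξ.mat x k l) ∂μ = c * if i = k then 1 else 0 := by
    exact (congrFun (congrFun hc i) k).trans (by simp [Matrix.one_apply])
  have hc' : c = (if j = l then 1 else 0) * (ξ.dim : ℂ)⁻¹ := by
    rw [← htr, mul_assoc, mul_inv_cancel₀ hd, mul_one]
  rw [hM, hc']
  by_cases h1 : i = k <;> by_cases h2 : j = l <;> simp [h1, h2]

end UnitaryRep

end Orthogonality

section Parts

variable {E : Type*} [NormedAddCommGroup E] [NormedSpace ℝ E] [FiniteDimensional ℝ E]
  {G : Type*} [TopologicalSpace G] [ChartedSpace E G] [Group G] [LieGroup 𝓘(ℝ, E) ∞ G]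
  [T2Space G] [CompactSpace G] [IsTopologicalGroup G] [SecondCountableTopology G]
  [MeasurableSpace G] [BorelSpace G] {μ : Measure G} [IsProbabilityMeasure μ] [μ.IsHaarMeasure]

theorem SmoothFun.integrable (f : SmoothFun E G) : Integrable f μ :=
  integrable_of_continuous f.continuous

/-- The base point of the derivative is moved into the parameter, because `contMDiff_fderiv_family`
differentiates at the origin only. -/
theorem continuous_fderiv_mul_param (f : SmoothFun E G) :
    Continuous fun p : G × E => fderiv ℝ (fun v => f (p.1 * (param E G).toFun v)) p.2 := by
  rw [continuous_clm_apply]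
  intro e
  have h : ContMDiff ((𝓘(ℝ, E).prod 𝓘(ℝ, E)).prod 𝓘(ℝ, E)) 𝓘(ℝ, ℂ) ∞
      (Function.uncurry fun (p : G × E) (u : E) => f (p.1 * (param E G).toFun (p.2 + u))) := by
    have h1 : ContMDiff ((𝓘(ℝ, E).prod 𝓘(ℝ, E)).prod 𝓘(ℝ, E)) 𝓘(ℝ, E) ∞
        (fun q : (G × E) × E => q.1.2 + q.2) :=
      (contMDiff_snd.comp contMDiff_fst).add contMDiff_snd
    exact f.2.comp ((contMDiff_fst.comp contMDiff_fst).mul ((param E G).smooth.comp h1))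
  refine (contMDiff_fderiv_family h e).continuous.congr fun p => ?_
  have := fderiv_comp_add_left (𝕜 := ℝ) (f := fun v => f (p.1 * (param E G).toFun v)) (x := 0) p.2
  rw [this, add_zero]

/-- By right invariance `v ↦ ∫ f(x Ψ(v)) dx` is constant; its derivative at `0` is the integral in
question. -/
theorem integral_derivOp (X : GroupLieAlgebra 𝓘(ℝ, E) G) (f : SmoothFun E G) :
    ∫ x, derivOp X f x ∂μ = 0 := by
  have := isMulRightInvariant_of_compactSpace μ
  have h := hasFDerivAt_integral_of_continuous μ
    (F := fun x v => f (x * (param E G).toFun v))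
    (F' := fun x v => fderiv ℝ (fun v => f (x * (param E G).toFun v)) v)
    (f.continuous.comp (continuous_fst.mul ((param E G).smooth.continuous.comp continuous_snd)))
    (continuous_fderiv_mul_param f)
    (fun x v => ((contDiff_comp_mul_param f.2 x).differentiable (by simp) v).hasFDerivAt) 0
  simp only [integral_mul_right_eq_self] at h
  have h0 := h.unique (hasFDerivAt_const _ _)
  have h1 : (∫ x, fderiv ℝ (fun v => f (x * (param E G).toFun v)) 0 ∂μ) (toModel E G X) =
      ∫ x, derivOp X f x ∂μ := by
    rw [ContinuousLinearMap.integral_apply]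
    · simp only [derivOp_eq_fderiv]
    · exact integrable_of_continuous ((continuous_fderiv_mul_param f).comp
        (continuous_id.prodMk continuous_const))
  rw [← h1, h0]
  rfl

theorem integral_derivOp_mul (X : GroupLieAlgebra 𝓘(ℝ, E) G) (f g : SmoothFun E G) :
    ∫ x, derivOp X f x * g x ∂μ = -∫ x, f x * derivOp X g x ∂μ := by
  have h := integral_derivOp (μ := μ) X (f * g)
  simp only [derivOp_mul, SmoothFun.add_apply, SmoothFun.mul_apply] at h
  have h2 := integral_add (μ := μ) (SmoothFun.integrable (derivOp X f * g))
    (SmoothFun.integrable (f * derivOp X g))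
  exact eq_neg_of_add_eq_zero_left (h2.symm.trans h)

variable (κ : BiInvariantMetric E G)
  {n : ℕ} (Y : Module.Basis (Fin n) ℝ (GroupLieAlgebra 𝓘(ℝ, E) G))

theorem integral_lapOp_mul (f g : SmoothFun E G) :
    ∫ x, lapOp κ Y f x * g x ∂μ = ∫ x, f x * lapOp κ Y g x ∂μ := by
  have h1 : ∀ f g : SmoothFun E G, ∫ x, lapOp κ Y f x * g x ∂μ = ∑ i, ∑ j,
      (((gramMatrix κ Y)⁻¹ i j : ℝ) : ℂ) * ∫ x, derivOp (Y i) (derivOp (Y j) f) x * g x ∂μ := by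
    intro f g
    simp only [← integral_const_mul]
    have hi : ∀ i j, Integrable (fun x => (((gramMatrix κ Y)⁻¹ i j : ℝ) : ℂ) *
        (derivOp (Y i) (derivOp (Y j) f) x * g x)) μ := fun i j =>
      (SmoothFun.integrable (derivOp (Y i) (derivOp (Y j) f) * g)).const_mul _
    simp only [← integral_finsetSum _ fun j _ => hi _ j]
    rw [← integral_finsetSum _ fun i _ => integrable_finsetSum _ fun j _ => hi i j]
    refine integral_congr_ae (.of_forall fun x => ?_)
    simp only [lapOp, LinearMap.sum_apply, SmoothFun.sum_apply, LinearMap.smul_apply,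
      SmoothFun.smul_apply, LinearMap.comp_apply, Finset.sum_mul, mul_assoc]
  have h2 : ∀ i j, (gramMatrix κ Y)⁻¹ i j = (gramMatrix κ Y)⁻¹ j i := fun i j => by
    have := (posDef_gramMatrix κ Y).inv.isHermitian.apply i j
    simpa using this.symm
  have h3 : ∀ x, f x * lapOp κ Y g x = lapOp κ Y g x * f x := fun x => mul_comm _ _
  simp only [h3]
  rw [h1, h1, Finset.sum_comm]
  refine Finset.sum_congr rfl fun j _ => Finset.sum_congr rfl fun i _ => ?_
  rw [h2 i j, integral_derivOp_mul, integral_derivOp_mul, neg_neg]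
  exact congrArg (fun t : ℂ => (((gramMatrix κ Y)⁻¹ j i : ℝ) : ℂ) * t)
    (integral_congr_ae (.of_forall fun x => mul_comm _ _))

end Parts

end Haar

/-! ### Convolution operators: compactness, symmetry, commutation with translations -/

section PeterWeyl

open MeasureTheory Measure
open scoped Matrix InnerProductSpace

variable {G : Type*} [TopologicalSpace G] [Group G] [IsTopologicalGroup G] [CompactSpace G]
  [SecondCountableTopology G]
  [MeasurableSpace G] [BorelSpace G] (μ : Measure G) [IsProbabilityMeasure μ] [μ.IsHaarMeasure]

/-- The inclusion of `C(G)` into `L²(G)`. -/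
def toL2 : C(G, ℂ) →L[ℂ] Lp ℂ 2 μ := ContinuousMap.toLp 2 μ ℂ

theorem toL2_injective : Function.Injective (toL2 μ) := ContinuousMap.toLp_injective μ

theorem inner_toL2 (f g : C(G, ℂ)) : ⟪toL2 μ f, toL2 μ g⟫_ℂ = ∫ x, g x * star (f x) ∂μ :=
  ContinuousMap.inner_toLp μ f g

/-- The rows `y ↦ conj f(x y⁻¹)` of the convolution kernel of `f`. -/
def convRow (f : C(G, ℂ)) : C(G, C(G, ℂ)) :=
  ContinuousMap.curry ⟨fun p : G × G => star (f (p.1 * p.2⁻¹)), by fun_prop⟩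

@[simp] theorem convRow_apply (f : C(G, ℂ)) (x y : G) : convRow f x y = star (f (x * y⁻¹)) := rfl

/-- The convolution operator `(S a)(x) = ∫ a(y) f(x y⁻¹) dy` from `L²(G)` to `C(G)`. -/
def convMap (f : C(G, ℂ)) : Lp ℂ 2 μ →ₗ[ℂ] C(G, ℂ) where
  toFun a := ⟨fun x => ⟪toL2 μ (convRow f x), a⟫_ℂ, by
    have := (toL2 μ).continuous.comp (convRow f).continuous
    exact this.inner continuous_const⟩
  map_add' a b := by ext x; simp [inner_add_right]
  map_smul' c a := by ext x; simp [inner_smul_right]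

theorem convMap_apply (f : C(G, ℂ)) (a : Lp ℂ 2 μ) (x : G) :
    convMap μ f a x = ⟪toL2 μ (convRow f x), a⟫_ℂ := rfl

theorem convMap_toL2 (f a : C(G, ℂ)) (x : G) :
    convMap μ f (toL2 μ a) x = ∫ y, a y * f (x * y⁻¹) ∂μ := by
  rw [convMap_apply, inner_toL2]
  simp [convRow_apply]

/-- The rows of the kernel depend continuously on `x` in `L²`. By Cauchy–Schwarz the image of the
unit ball in `C(G)` is bounded and equicontinuous, hence relatively compact by Arzelà–Ascoli. -/
theorem isCompactOperator_convMap (f : C(G, ℂ)) :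
    IsCompactOperator (toL2 μ ∘ convMap μ f) := by
  have hΦ : Continuous fun x => toL2 μ (convRow f x) :=
    (toL2 μ).continuous.comp (convRow f).continuous
  obtain ⟨M, hM⟩ : ∃ M, ∀ x, ‖toL2 μ (convRow f x)‖ ≤ M := by
    obtain ⟨M, hM⟩ := isCompact_univ.exists_bound_of_continuousOn hΦ.continuousOn
    exact ⟨M, fun x => hM x (Set.mem_univ x)⟩
  let J : BoundedContinuousFunction G ℂ → Lp ℂ 2 μ := BoundedContinuousFunction.toLp 2 μ ℂ
  have hJ : Continuous J := (BoundedContinuousFunction.toLp 2 μ ℂ).continuous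
  let A : Set (BoundedContinuousFunction G ℂ) :=
    (fun a => BoundedContinuousFunction.mkOfCompact (convMap μ f a)) '' Metric.closedBall 0 1
  have hA : IsCompact (closure A) := by
    refine BoundedContinuousFunction.arzela_ascoli (Metric.closedBall 0 M)
      (isCompact_closedBall 0 M) A ?_ ?_
    · rintro _ x ⟨a, ha, rfl⟩
      rw [mem_closedBall_zero_iff] at ha ⊢
      change ‖⟪toL2 μ (convRow f x), a⟫_ℂ‖ ≤ M
      calc _ ≤ ‖toL2 μ (convRow f x)‖ * ‖a‖ := norm_inner_le_norm _ _
        _ ≤ M * 1 := mul_le_mul (hM x) ha (norm_nonneg _) ((norm_nonneg _).trans (hM x))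
        _ = M := mul_one M
    · intro x₀
      refine Metric.equicontinuousAt_of_continuity_modulus
        (fun x => ‖toL2 μ (convRow f x₀) - toL2 μ (convRow f x)‖) ?_ _ ?_
      · have : Continuous fun x => ‖toL2 μ (convRow f x₀) - toL2 μ (convRow f x)‖ :=
          (continuous_const.sub hΦ).norm
        simpa using this.tendsto x₀
      · refine .of_forall fun x => ?_
        rintro ⟨_, a, ha, rfl⟩
        rw [mem_closedBall_zero_iff] at ha
        rw [dist_eq_norm]
        change ‖⟪toL2 μ (convRow f x₀), a⟫_ℂ - ⟪toL2 μ (convRow f x), a⟫_ℂ‖ ≤ _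
        rw [← inner_sub_left]
        exact (norm_inner_le_norm _ _).trans (mul_le_of_le_one_right (norm_nonneg _) ha)
  refine ⟨J '' closure A, hA.image hJ, ?_⟩
  refine Filter.mem_of_superset (Metric.closedBall_mem_nhds 0 zero_lt_one) fun a ha => ?_
  exact ⟨_, subset_closure ⟨a, ha, rfl⟩, rfl⟩

/-- The convolution operator on `L²(G)`. -/
def convOp (f : C(G, ℂ)) : Lp ℂ 2 μ →L[ℂ] Lp ℂ 2 μ :=
  ContinuousLinearMap.mkOfIsCompactOperator
    (f := (toL2 μ).toLinearMap ∘ₗ convMap μ f) (isCompactOperator_convMap μ f)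

theorem convOp_apply (f : C(G, ℂ)) (a : Lp ℂ 2 μ) : convOp μ f a = toL2 μ (convMap μ f a) := rfl

theorem isSymmetric_convOp {f : C(G, ℂ)} (hf : ∀ x, star (f x) = f x⁻¹) :
    (convOp μ f).IsSymmetric := by
  have hd : DenseRange (toL2 (G := G) μ) := ContinuousMap.toLp_denseRange ℂ μ ℂ (by norm_num)
  intro a b
  change ⟪convOp μ f a, b⟫_ℂ = ⟪a, convOp μ f b⟫_ℂ
  refine hd.induction_on₂ (p := fun a b => ⟪convOp μ f a, b⟫_ℂ = ⟪a, convOp μ f b⟫_ℂ) ?_ ?_ a b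
  · exact isClosed_eq (by fun_prop) (by fun_prop)
  · intro a b
    rw [convOp_apply, convOp_apply, inner_toL2, inner_toL2]
    simp only [convMap_toL2]
    have h1 : ∀ x, b x * star (∫ y, a y * f (x * y⁻¹) ∂μ) =
        ∫ y, b x * (star (a y) * f (y * x⁻¹)) ∂μ := by
      intro x
      rw [integral_const_mul]
      congr 1
      rw [Complex.star_def, ← integral_conj]
      refine integral_congr_ae (.of_forall fun y => ?_)
      simp only [map_mul]
      congr 1
      have := hf (x * y⁻¹)
      simpa using this
    have h2 : ∀ y, (∫ x, b x * f (y * x⁻¹) ∂μ) * star (a y) =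
        ∫ x, b x * (star (a y) * f (y * x⁻¹)) ∂μ := by
      intro y
      rw [← integral_mul_const]
      exact integral_congr_ae (.of_forall fun x => by simp only []; ring)
    simp only [h1, h2]
    refine integral_integral_swap ?_
    refine Continuous.integrable_of_hasCompactSupport ?_ (HasCompactSupport.of_compactSpace _)
    fun_prop

/-- Right translation `(R_g c)(x) = c(x g)` on `C(G)`. -/
def rightTranslate (g : G) : C(G, ℂ) →ₗ[ℂ] C(G, ℂ) where
  toFun c := ⟨fun x => c (x * g), by fun_prop⟩
  map_add' _ _ := rfl
  map_smul' _ _ := rfl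

@[simp] theorem rightTranslate_apply (g : G) (c : C(G, ℂ)) (x : G) :
    rightTranslate g c x = c (x * g) := rfl

/-- Consequently the eigenspaces are invariant under right translations, which makes them
representations of `G`. -/
theorem convMap_rightTranslate (f c : C(G, ℂ)) (g : G) :
    convMap μ f (toL2 μ (rightTranslate g c)) = rightTranslate g (convMap μ f (toL2 μ c)) := by
  have := isMulRightInvariant_of_compactSpace μ
  ext x
  rw [rightTranslate_apply, convMap_toL2, convMap_toL2,
    ← integral_mul_right_eq_self (fun y => c y * f (x * g * y⁻¹)) g]
  refine integral_congr_ae (.of_forall fun y => ?_)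
  simp [mul_assoc]

end PeterWeyl

/-! ### A continuous function is determined by its Fourier coefficients -/

section PeterWeylUniqueness

open MeasureTheory
open scoped Matrix InnerProductSpace

variable {G : Type*} [TopologicalSpace G] [Group G] [IsTopologicalGroup G] [CompactSpace G]
  [SecondCountableTopology G]
  [MeasurableSpace G] [BorelSpace G] (μ : Measure G) [IsProbabilityMeasure μ] [μ.IsHaarMeasure]

theorem rightTranslate_mul (g h : G) (c : C(G, ℂ)) :
    rightTranslate (g * h) c = rightTranslate g (rightTranslate h c) := by
  ext x; simp [mul_assoc]

theorem inner_rightTranslate (g : G) (a b : C(G, ℂ)) :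
    ⟪toL2 μ (rightTranslate g a), toL2 μ (rightTranslate g b)⟫_ℂ = ⟪toL2 μ a, toL2 μ b⟫_ℂ := by
  have := isMulRightInvariant_of_compactSpace μ
  rw [inner_toL2, inner_toL2]
  exact integral_mul_right_eq_self (fun x => b x * star (a x)) g

theorem continuous_rightTranslate (c : C(G, ℂ)) : Continuous fun g : G => rightTranslate g c :=
  (ContinuousMap.curry ⟨fun p : G × G => c (p.2 * p.1), by fun_prop⟩).continuous

/-- A finite-dimensional nonzero space of continuous functions invariant under right translations
contains the functions of an irreducible unitary representation. -/
theorem exists_unitaryRep_of_invariant (μ : Measure G) [IsProbabilityMeasure μ] [μ.IsHaarMeasure]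
    (V : Submodule ℂ C(G, ℂ)) [FiniteDimensional ℂ V]
    (hV : V ≠ ⊥) (hinv : ∀ g, ∀ c ∈ V, rightTranslate g c ∈ V) :
    ∃ (ζ : UnitaryRep G) (c : Fin ζ.dim → C(G, ℂ)), (∀ j, c j ∈ V ∧ c j ≠ 0) ∧
      ∀ j g x, c j (x * g) = ∑ i, ζ.mat g i j * c i x := by
  -- A nonzero invariant subspace of least dimension; minimality will give irreducibility.
  obtain ⟨W, ⟨hWV, hW0, hWinv⟩, hmin⟩ := WellFounded.has_min
    (measure fun W : Submodule ℂ C(G, ℂ) => Module.finrank ℂ W).wf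
    {W | W ≤ V ∧ W ≠ ⊥ ∧ ∀ g, ∀ c ∈ W, rightTranslate g c ∈ W} ⟨V, le_rfl, hV, hinv⟩
  have hWfin : FiniteDimensional ℂ W := Submodule.finiteDimensional_of_le hWV
  have hminimal : ∀ U : Submodule ℂ C(G, ℂ), U ≤ W → U ≠ ⊥ →
      (∀ g, ∀ c ∈ U, rightTranslate g c ∈ U) → U = W := by
    intro U hU hU0 hUinv
    have : ¬ Module.finrank ℂ U < Module.finrank ℂ W := hmin U ⟨hU.trans hWV, hU0, hUinv⟩
    exact Submodule.eq_of_le_of_finrank_le hU (not_lt.1 this)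
  let W' : Submodule ℂ (Lp ℂ 2 μ) := W.map (toL2 μ).toLinearMap
  have hW'fin : FiniteDimensional ℂ W' := inferInstance
  let b := stdOrthonormalBasis ℂ W'
  set d := Module.finrank ℂ W' with hd
  have hb : ∀ j, ∃ c ∈ W, toL2 μ c = (b j : Lp ℂ 2 μ) := fun j => (b j).2
  choose c hcW hcb using hb
  have horth : ∀ i j, ⟪toL2 μ (c i), toL2 μ (c j)⟫_ℂ = if i = j then 1 else 0 := by
    intro i j
    rw [hcb, hcb]
    exact orthonormal_iff_ite.1 b.orthonormal i j
  have hsum : ∀ w ∈ W, w = ∑ i, ⟪toL2 μ (c i), toL2 μ w⟫_ℂ • c i := by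
    intro w hw
    apply toL2_injective μ
    let w' : W' := ⟨toL2 μ w, w, hw, rfl⟩
    have h := congrArg (fun v : W' => (v : Lp ℂ 2 μ)) (b.sum_repr' w')
    simp only [Submodule.coe_sum, Submodule.coe_smul, Submodule.coe_inner] at h
    rw [map_sum]
    simp only [map_smul, hcb]
    exact h.symm
  -- Right translation in a basis that is orthonormal in `L²`. The matrices are unitary because
  -- right translation preserves the `L²` product.
  let π : G → Matrix (Fin d) (Fin d) ℂ := fun g =>
    Matrix.of fun i j => ⟪toL2 μ (c i), toL2 μ (rightTranslate g (c j))⟫_ℂ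
  have hπ : ∀ g j, rightTranslate g (c j) = ∑ i, π g i j • c i := fun g j =>
    hsum _ (hWinv g _ (hcW j))
  have hone : π 1 = 1 := by
    ext i j
    have : rightTranslate (1 : G) (c j) = c j := by ext x; simp
    simp only [π, Matrix.of_apply, this, horth, Matrix.one_apply]
  have hmul : ∀ g h, π (g * h) = π g * π h := by
    intro g h
    ext i j
    simp only [π, Matrix.of_apply, Matrix.mul_apply]
    rw [rightTranslate_mul, hπ h j, map_sum, map_sum, inner_sum]
    refine Finset.sum_congr rfl fun k _ => ?_
    rw [map_smul, map_smul, inner_smul_right, mul_comm, ← hπ h j]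
    rfl
  have hunit : ∀ g, star (π g) * π g = 1 := by
    intro g
    ext j k
    have h1 := inner_rightTranslate μ g (c j) (c k)
    rw [horth] at h1
    rw [Matrix.one_apply, ← h1, hπ g k, map_sum, inner_sum, Matrix.mul_apply]
    refine Finset.sum_congr rfl fun i _ => ?_
    rw [map_smul, inner_smul_right, mul_comm, Matrix.star_apply]
    congr 1
    exact inner_conj_symm (toL2 μ (rightTranslate g (c j))) (toL2 μ (c i))
  let φ : G →* Matrix.unitaryGroup (Fin d) ℂ :=
    { toFun := fun g => ⟨π g, Matrix.mem_unitaryGroup_iff'.2 (hunit g)⟩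
      map_one' := Subtype.ext hone
      map_mul' := fun g h => Subtype.ext (hmul g h) }
  let L : (Fin d → ℂ) →ₗ[ℂ] C(G, ℂ) :=
    { toFun := fun u => ∑ i, u i • c i
      map_add' := fun u v => by simp [add_smul, Finset.sum_add_distrib]
      map_smul' := fun r u => by simp [Finset.smul_sum, smul_smul] }
  have hLW : ∀ u, L u ∈ W := fun u =>
    show ∑ i, u i • c i ∈ W from W.sum_mem fun i _ => W.smul_mem _ (hcW i)
  have hLinner : ∀ u i, ⟪toL2 μ (c i), toL2 μ (L u)⟫_ℂ = u i := by
    intro u i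
    simp only [L, LinearMap.coe_mk, AddHom.coe_mk, map_sum, inner_sum, map_smul, inner_smul_right,
      horth]
    simp
  have hLinj : Function.Injective L := fun u v h => funext fun i => by
    rw [← hLinner u i, h, hLinner]
  have hLR : ∀ g u, L (π g *ᵥ u) = rightTranslate g (L u) := by
    intro g u
    simp only [L, LinearMap.coe_mk, AddHom.coe_mk, map_sum, map_smul, hπ g, Matrix.mulVec,
      dotProduct, Finset.sum_smul, Finset.smul_sum, smul_smul]
    rw [Finset.sum_comm]
    refine Finset.sum_congr rfl fun i _ => Finset.sum_congr rfl fun j _ => ?_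
    rw [mul_comm]
  have hdpos : 0 < d := by
    rw [Nat.pos_iff_ne_zero]
    intro h0
    apply hW0
    rw [Submodule.eq_bot_iff]
    intro w hw
    have h1 := hsum w hw
    have : IsEmpty (Fin d) := by rw [h0]; infer_instance
    simpa using h1
  refine ⟨⟨d, φ, ?_, hdpos, ?_⟩, c, fun j => ⟨hWV (hcW j), fun h0 => ?_⟩, fun j g x => ?_⟩
  · refine continuous_matrix fun i j => ?_
    exact continuous_const.inner ((toL2 μ).continuous.comp (continuous_rightTranslate (c j)))
  · intro U hU
    by_cases hU0 : U = ⊥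
    · exact Or.inl hU0
    right
    have hUW : U.map L = W := by
      refine hminimal _ ?_ ?_ ?_
      · rintro _ ⟨u, -, rfl⟩
        exact hLW u
      · intro h
        exact hU0 (Submodule.map_injective_of_injective hLinj (h.trans (Submodule.map_bot L).symm))
      · rintro g _ ⟨u, hu, rfl⟩
        exact ⟨π g *ᵥ u, hU g u hu, hLR g u⟩
    rw [Submodule.eq_top_iff']
    intro u
    have h1 : L u ∈ U.map L := by rw [hUW]; exact hLW u
    obtain ⟨v, hv, hvu⟩ := h1
    rwa [← hLinj hvu]
  · have := horth j j
    rw [h0] at this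
    simp at this
  · have h1 := congrArg (fun f : C(G, ℂ) => f x) (hπ g j)
    simp only [rightTranslate_apply] at h1
    rw [h1, ContinuousMap.sum_apply]
    rfl

/-- The convolution operator of `f` is compact and symmetric. If it had a nonzero eigenvalue, the
finite-dimensional eigenspace would contain functions spanned by coefficients of an irreducible
representation; but convolution with `f` annihilates those. So the operator is zero, and applying it
to `f` gives `f = 0`. -/
theorem eq_zero_of_hermitian {f : C(G, ℂ)} (hf : ∀ x, star (f x) = f x⁻¹)
    (h : ∀ (ζ : UnitaryRep G) i j, ∫ x, f x * star (ζ.mat x i j) ∂μ = 0) : f = 0 := by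
  have := isMulRightInvariant_of_compactSpace μ
  have := isInvInvariant_of_compactSpace μ
  have hT : convOp μ f = 0 := by
    refine (ContinuousLinearMap.eq_zero_of_forall_hasEigenvalue_eq_zero
      (isCompactOperator_convMap μ f) (isSymmetric_convOp μ hf)).1 fun l hl => ?_
    by_contra hl0
    have hfin := ContinuousLinearMap.finite_dimensional_eigenspace
      (T := convOp μ f) (isCompactOperator_convMap μ f) l hl0
    let V : Submodule ℂ C(G, ℂ) :=
      (Module.End.eigenspace (convOp μ f).toLinearMap l).comap (toL2 μ).toLinearMap
    have hVmem : ∀ c, c ∈ V ↔ convMap μ f (toL2 μ c) = l • c := by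
      intro c
      rw [Submodule.mem_comap, Module.End.mem_eigenspace_iff]
      change toL2 μ (convMap μ f (toL2 μ c)) = l • toL2 μ c ↔ _
      rw [← map_smul]
      exact (toL2_injective μ).eq_iff
    have hVfin : FiniteDimensional ℂ V := by
      let r : V →ₗ[ℂ] Module.End.eigenspace (convOp μ f).toLinearMap l :=
        (toL2 μ).toLinearMap.restrict fun c hc => hc
      refine FiniteDimensional.of_injective r fun a b hab => ?_
      exact Subtype.ext (toL2_injective μ (congrArg Subtype.val hab))
    have hV0 : V ≠ ⊥ := by
      obtain ⟨e, he⟩ := hl.exists_hasEigenvector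
      have he1 : convOp μ f e = l • e := Module.End.mem_eigenspace_iff.1 he.1
      rw [Submodule.ne_bot_iff]
      -- An `L²` eigenvector has a continuous representative, since the operator takes values in
      -- `C(G)`.
      refine ⟨l⁻¹ • convMap μ f e, ?_, fun h0 => he.2 ?_⟩
      · rw [hVmem, map_smul, ← convOp_apply, he1, smul_smul, inv_mul_cancel₀ hl0, one_smul,
          smul_smul, mul_inv_cancel₀ hl0, one_smul]
      · have h1 : toL2 μ (l⁻¹ • convMap μ f e) = e := by
          rw [map_smul, ← convOp_apply, he1, smul_smul, inv_mul_cancel₀ hl0, one_smul]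
        rw [← h1, h0, map_zero]
    obtain ⟨ζ, c, hc, hrep⟩ := exists_unitaryRep_of_invariant μ V hV0 fun g c hc => by
      rw [hVmem] at hc ⊢
      rw [convMap_rightTranslate, hc, map_smul]
    let j : Fin ζ.dim := ⟨0, ζ.dim_pos⟩
    refine (hc j).2 ?_
    have h1 := (hVmem _).1 (hc j).1
    have h2 : convMap μ f (toL2 μ (c j)) = 0 := by
      ext x
      rw [convMap_toL2, ContinuousMap.zero_apply]
      have h3 : ∀ y, c j y = ∑ i, ζ.mat y i j * c i 1 := fun y => by
        have := hrep j y 1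
        rwa [one_mul] at this
      calc ∫ y, c j y * f (x * y⁻¹) ∂μ = ∫ y, c j (y * x) * f y⁻¹ ∂μ := by
            rw [← integral_mul_right_eq_self (fun y => c j y * f (x * y⁻¹)) x]
            simp
        _ = ∫ y, c j (y⁻¹ * x) * f y ∂μ := by
            rw [← integral_inv_eq_self (fun y => c j (y * x) * f y⁻¹)]
            simp
        _ = ∫ y, ∑ i, ∑ k, (ζ.mat x k j * c i 1) * (f y * star (ζ.mat y k i)) ∂μ := by
            refine integral_congr_ae (.of_forall fun y => ?_)
            simp only [h3, UnitaryRep.mat_mul, UnitaryRep.mat_inv, Matrix.mul_apply,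
              Finset.sum_mul, Matrix.conjTranspose_apply]
            exact Finset.sum_congr rfl fun i _ => Finset.sum_congr rfl fun k _ => by ring
        _ = 0 := by
            have hi : ∀ k i, Integrable (fun y => f y * star (ζ.mat y k i)) μ := fun k i =>
              integrable_of_continuous (f.continuous.mul (ζ.continuous_mat_apply k i).star)
            rw [integral_finsetSum _ fun i _ => integrable_finsetSum _ fun k _ =>
              (hi k i).const_mul _]
            refine Finset.sum_eq_zero fun i _ => ?_
            rw [integral_finsetSum _ fun k _ => (hi k i).const_mul _]
            refine Finset.sum_eq_zero fun k _ => ?_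
            rw [integral_const_mul, h, mul_zero]
    rw [h2] at h1
    exact (smul_eq_zero.1 h1.symm).resolve_left hl0
  -- Evaluated at the identity, the convolution of `f` with itself is `∫ f(y) f(y⁻¹) dy = ∫ |f|²`.
  have h1 : convMap μ f (toL2 μ f) = 0 := by
    apply toL2_injective μ
    rw [← convOp_apply, hT, map_zero]
    rfl
  have h2 := congrArg (fun g : C(G, ℂ) => g 1) h1
  simp only [convMap_toL2, one_mul, ContinuousMap.zero_apply] at h2
  apply toL2_injective μ
  rw [map_zero, ← inner_self_eq_zero (𝕜 := ℂ), inner_toL2, ← h2]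
  exact integral_congr_ae (.of_forall fun y => by simp only [hf])

/-- A continuous function all of whose Fourier coefficients vanish is zero. -/
theorem eq_zero_of_fourier_eq_zero {f : G → ℂ} (hf : Continuous f)
    (h : ∀ (ζ : UnitaryRep G) i j, ∫ x, f x * star (ζ.mat x i j) ∂μ = 0) : f = 0 := by
  have := isInvInvariant_of_compactSpace μ
  have hs : ∀ (ζ : UnitaryRep G) i j, ∫ x, star (f x⁻¹) * star (ζ.mat x i j) ∂μ = 0 := by
    intro ζ i j
    rw [← integral_inv_eq_self, ← star_zero, ← h ζ j i]
    rw [Complex.star_def, ← integral_conj]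
    refine integral_congr_ae (.of_forall fun y => ?_)
    simp [UnitaryRep.mat_inv, Matrix.conjTranspose_apply]
  have hi : ∀ (ζ : UnitaryRep G) i j, Integrable (fun x => f x * star (ζ.mat x i j)) μ :=
    fun ζ i j => integrable_of_continuous (hf.mul (ζ.continuous_mat_apply i j).star)
  have hi' : ∀ (ζ : UnitaryRep G) i j,
      Integrable (fun x => star (f x⁻¹) * star (ζ.mat x i j)) μ := fun ζ i j =>
    integrable_of_continuous ((hf.comp continuous_inv).star.mul (ζ.continuous_mat_apply i j).star)
  -- The hermitian part and `i` times the antihermitian part both satisfy the symmetry `\bar f(x) =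
  -- f(x⁻¹)`.
  let f₁ : C(G, ℂ) := ⟨fun x => f x + star (f x⁻¹), by fun_prop⟩
  let f₂ : C(G, ℂ) := ⟨fun x => Complex.I * (f x - star (f x⁻¹)), by fun_prop⟩
  have h1 : f₁ = 0 := by
    refine eq_zero_of_hermitian μ (fun x => by simp [f₁, add_comm]) fun ζ i j => ?_
    simp only [f₁, ContinuousMap.coe_mk, add_mul]
    rw [integral_add (hi ζ i j) (hi' ζ i j), h, hs, add_zero]
  have h2 : f₂ = 0 := by
    refine eq_zero_of_hermitian μ (fun x => by simp [f₂]; ring) fun ζ i j => ?_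
    simp only [f₂, ContinuousMap.coe_mk, mul_assoc, sub_mul]
    rw [integral_const_mul, integral_sub (hi ζ i j) (hi' ζ i j), h, hs, sub_zero, mul_zero]
  funext x
  have e1 : f x + star (f x⁻¹) = 0 := congrArg (fun g : C(G, ℂ) => g x) h1
  have e2 : Complex.I * (f x - star (f x⁻¹)) = 0 := congrArg (fun g : C(G, ℂ) => g x) h2
  have e3 := (mul_eq_zero.1 e2).resolve_left Complex.I_ne_zero
  have : 2 * f x = 0 := by linear_combination e1 + e3
  simpa using this

end PeterWeylUniqueness

/-! ### Operator norms through sesquilinear forms -/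

section Sesquilinear

open scoped Matrix Matrix.Norms.L2Operator

/-- The sesquilinear form of a matrix. -/
def sesq {d : ℕ} (M : Matrix (Fin d) (Fin d) ℂ) (a b : EuclideanSpace ℂ (Fin d)) : ℂ :=
  ∑ i, ∑ j, star (a i) * b j * M i j

variable {d : ℕ} (M N : Matrix (Fin d) (Fin d) ℂ) (a b : EuclideanSpace ℂ (Fin d))

theorem sesq_eq_inner : sesq M a b = inner ℂ a (Matrix.toEuclideanCLM (n := Fin d) (𝕜 := ℂ) M b) := by
  rw [PiLp.inner_apply]
  refine Finset.sum_congr rfl fun i _ => ?_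
  have : (Matrix.toEuclideanCLM (n := Fin d) (𝕜 := ℂ) M b) i = ∑ j, M i j * b j := by
    change (M *ᵥ b.ofLp) i = _
    simp [Matrix.mulVec, dotProduct]
  rw [this, RCLike.inner_apply, Finset.sum_mul]
  exact Finset.sum_congr rfl fun j _ => by simp; ring

theorem norm_sesq_le : ‖sesq M a b‖ ≤ ‖M‖ * ‖a‖ * ‖b‖ := by
  rw [sesq_eq_inner]
  calc _ ≤ ‖a‖ * ‖Matrix.toEuclideanCLM (n := Fin d) (𝕜 := ℂ) M b‖ := norm_inner_le_norm _ _
    _ ≤ ‖a‖ * (‖M‖ * ‖b‖) := by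
        refine mul_le_mul_of_nonneg_left ?_ (norm_nonneg _)
        exact ContinuousLinearMap.le_opNorm _ _
    _ = _ := by ring

variable {M} in
theorem norm_le_of_sesq {C : ℝ} (hC : 0 ≤ C) (h : ∀ a b, ‖sesq M a b‖ ≤ C * ‖a‖ * ‖b‖) :
    ‖M‖ ≤ C := by
  refine ContinuousLinearMap.opNorm_le_bound
    (Matrix.toEuclideanCLM (n := Fin d) (𝕜 := ℂ) M) hC fun b => ?_
  set c := Matrix.toEuclideanCLM (n := Fin d) (𝕜 := ℂ) M b with hc
  -- The form is tested with `a = M b`, which gives `‖M b‖² ≤ C ‖M b‖ ‖b‖`.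
  have h1 := h c b
  rw [sesq_eq_inner, ← hc, inner_self_eq_norm_sq_to_K] at h1
  have h2 : ‖c‖ ^ 2 ≤ C * ‖c‖ * ‖b‖ := by simpa using h1
  rcases (norm_nonneg c).eq_or_lt with h0 | h0
  · rw [← h0]; positivity
  · nlinarith

theorem sesq_sub : sesq (M - N) a b = sesq M a b - sesq N a b := by
  simp [sesq, mul_sub, Finset.sum_sub_distrib]

/-- Every column is the image of a unit vector, so its square norm is at most `‖M‖²`. -/
theorem sum_sq_norm_le : ∑ i, ∑ j, ‖M i j‖ ^ 2 ≤ d * ‖M‖ ^ 2 := by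
  rw [Finset.sum_comm]
  calc ∑ j, ∑ i, ‖M i j‖ ^ 2 ≤ ∑ _j : Fin d, ‖M‖ ^ 2 := by
        refine Finset.sum_le_sum fun j _ => ?_
        have h1 := ContinuousLinearMap.le_opNorm (Matrix.toEuclideanCLM (n := Fin d) (𝕜 := ℂ) M)
          (EuclideanSpace.single j 1)
        rw [PiLp.norm_single, norm_one, mul_one] at h1
        have h2 : ‖Matrix.toEuclideanCLM (n := Fin d) (𝕜 := ℂ) M (EuclideanSpace.single j 1)‖ ^ 2 =
            ∑ i, ‖M i j‖ ^ 2 := by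
          rw [EuclideanSpace.norm_sq_eq]
          refine Finset.sum_congr rfl fun i _ => ?_
          change ‖(M *ᵥ (EuclideanSpace.single j (1 : ℂ)).ofLp) i‖ ^ 2 = _
          simp
        rw [← h2]
        exact pow_le_pow_left₀ (norm_nonneg _) h1 2
    _ = d * ‖M‖ ^ 2 := by simp

end Sesquilinear

/-! ### Lipschitz bounds for representations -/

section Covering

open scoped Matrix Matrix.Norms.L2Operator

variable {E : Type*} [NormedAddCommGroup E] [NormedSpace ℝ E] [FiniteDimensional ℝ E]
  {G : Type*} [TopologicalSpace G] [ChartedSpace E G] [Group G] [LieGroup 𝓘(ℝ, E) ∞ G]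
  [T2Space G] [CompactSpace G] (κ : BiInvariantMetric E G)
  {n : ℕ} (Y : Module.Basis (Fin n) ℝ (GroupLieAlgebra 𝓘(ℝ, E) G))

/-- The matrix coefficient `x ↦ ⟨a, ξ(x) b⟩`. -/
def UnitaryRep.sesqFun (ξ : UnitaryRep G) (a b : EuclideanSpace ℂ (Fin ξ.dim)) : SmoothFun E G :=
  ∑ i, ∑ j, (star (a i) * b j) • ξ.coeffFun E i j

theorem UnitaryRep.sesqFun_apply (ξ : UnitaryRep G) (a b : EuclideanSpace ℂ (Fin ξ.dim)) (x : G) :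
    ξ.sesqFun (E := E) a b x = sesq (ξ.mat x) a b := by
  simp only [UnitaryRep.sesqFun, SmoothFun.sum_apply, sesq, SmoothFun.smul_apply, coeffFun_apply]

theorem UnitaryRep.derivOp_sesqFun (ξ : UnitaryRep G) (X : GroupLieAlgebra 𝓘(ℝ, E) G)
    (a b : EuclideanSpace ℂ (Fin ξ.dim)) (x : G) :
    derivOp X (ξ.sesqFun (E := E) a b) x = sesq (ξ.mat x * ξ.deriv X) a b := by
  simp only [UnitaryRep.sesqFun, map_sum, map_smul, SmoothFun.sum_apply, sesq,
    SmoothFun.smul_apply, derivOp_coeffFun_apply]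

theorem exists_norm_deriv_le_norm : ∃ C : ℝ, 0 ≤ C ∧ ∀ (ξ : UnitaryRep G) (v : E),
    ‖ξ.deriv ((toModel E G).symm v)‖ ≤ C * bracket κ Y ξ * ‖v‖ := by
  obtain ⟨C, hC1, hC⟩ := exists_norm_deriv_le κ Y
  let φ : Fin n → E →L[ℝ] ℝ := fun l =>
    LinearMap.toContinuousLinearMap ((Y.coord l) ∘ₗ (toModel E G).symm.toLinearMap)
  refine ⟨∑ l, ‖φ l‖ * C, Finset.sum_nonneg fun l _ => by positivity, fun ξ v => ?_⟩
  have h : ξ.deriv ((toModel E G).symm v) = ∑ l, φ l v • ξ.deriv (Y l) := by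
    rw [← UnitaryRep.derivLin_apply]
    conv_lhs => rw [← Y.sum_repr ((toModel E G).symm v)]
    rw [map_sum]
    exact Finset.sum_congr rfl fun l _ => map_smul _ _ _
  rw [h, mul_assoc, Finset.sum_mul]
  refine (norm_sum_le _ _).trans (Finset.sum_le_sum fun l _ => ?_)
  rw [norm_smul]
  calc _ ≤ (‖φ l‖ * ‖v‖) * (C * bracket κ Y ξ) :=
        mul_le_mul ((φ l).le_opNorm v) (hC ξ l) (norm_nonneg _) (by positivity)
    _ = _ := by ring

/-- Representations are Lipschitz in the local parametrization, with constant of size `⟨ξ⟩`. -/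
theorem exists_lipschitz_param : ∃ C : ℝ, 0 ≤ C ∧ ∀ (ξ : UnitaryRep G) (x : G) (v w : E),
    ‖v‖ ≤ 1 → ‖w‖ ≤ 1 →
    ‖ξ.mat (x * (param E G).toFun v) - ξ.mat (x * (param E G).toFun w)‖ ≤
      C * bracket κ Y ξ * ‖v - w‖ := by
  obtain ⟨C, hC0, hC⟩ := exists_norm_deriv_le_norm κ Y
  -- The derivative of the parametrization in the left-invariant frame. It does not involve `ξ`, so
  -- its bound `K` on the unit ball is uniform and only `dξ` contributes the factor `⟨ξ⟩`.
  let Θ : E → E →L[ℝ] E := fun v =>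
    fderiv ℝ (fun w => (param E G).inv (((param E G).toFun v)⁻¹ * (param E G).toFun w)) v
  have hΘ : Continuous Θ := by
    rw [continuous_clm_apply]
    intro e
    have h : ContMDiff (𝓘(ℝ, E).prod 𝓘(ℝ, E)) 𝓘(ℝ, E) ∞ (Function.uncurry fun (v u : E) =>
        (param E G).inv (((param E G).toFun v)⁻¹ * (param E G).toFun (v + u))) := by
      have h1 : ContMDiff (𝓘(ℝ, E).prod 𝓘(ℝ, E)) 𝓘(ℝ, E) ∞ (fun q : E × E => q.1 + q.2) :=
        contMDiff_fst.add contMDiff_snd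
      exact (param E G).smooth_inv.comp
        (((param E G).smooth.comp contMDiff_fst).inv.mul ((param E G).smooth.comp h1))
    refine (contMDiff_fderiv_family h e).continuous.congr fun v => ?_
    have := fderiv_comp_add_left (𝕜 := ℝ)
      (f := fun w => (param E G).inv (((param E G).toFun v)⁻¹ * (param E G).toFun w)) (x := 0) v
    rw [this, add_zero]
  obtain ⟨K, hK⟩ := (isCompact_closedBall (0 : E) 1).exists_bound_of_continuousOn hΘ.continuousOn
  have hK0 : 0 ≤ K := (norm_nonneg _).trans (hK 0 (by simp))
  refine ⟨C * K, by positivity, fun ξ x v w hv hw => ?_⟩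
  have hbr := (bracket_pos κ Y ξ).le
  have hlip : ‖ξ.mat ((param E G).toFun v) - ξ.mat ((param E G).toFun w)‖ ≤
      C * K * bracket κ Y ξ * ‖v - w‖ := by
    refine norm_le_of_sesq (by positivity) fun a b => ?_
    rw [sesq_sub, ← UnitaryRep.sesqFun_apply (E := E), ← UnitaryRep.sesqFun_apply (E := E)]
    have hd : ∀ u ∈ Metric.closedBall (0 : E) 1, DifferentiableAt ℝ
        (fun u => ξ.sesqFun (E := E) a b ((param E G).toFun u)) u := fun u _ =>
      ((ξ.sesqFun (E := E) a b).2.comp (param E G).smooth).contDiff.differentiable (by simp) u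
    have hb : ∀ u ∈ Metric.closedBall (0 : E) 1,
        ‖fderiv ℝ (fun u => ξ.sesqFun (E := E) a b ((param E G).toFun u)) u‖ ≤
          C * K * bracket κ Y ξ * ‖a‖ * ‖b‖ := by
      intro u hu
      refine ContinuousLinearMap.opNorm_le_bound _ (by positivity) fun e => ?_
      rw [fderiv_comp_eq_leftDeriv (param E G).smooth, ← derivOp_apply,
        UnitaryRep.derivOp_sesqFun]
      refine (norm_sesq_le _ _ _).trans ?_
      have h1 : ‖ξ.mat ((param E G).toFun u) * ξ.deriv ((toModel E G).symm (Θ u e))‖ ≤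
          C * bracket κ Y ξ * (K * ‖e‖) := by
        refine (norm_mul_le _ _).trans ?_
        refine (mul_le_of_le_one_left (norm_nonneg _) (ξ.norm_mat_le _)).trans ?_
        refine (hC ξ _).trans (mul_le_mul_of_nonneg_left ?_ (by positivity))
        exact ((Θ u).le_opNorm e).trans (mul_le_mul_of_nonneg_right (hK u hu) (norm_nonneg _))
      calc _ ≤ C * bracket κ Y ξ * (K * ‖e‖) * ‖a‖ * ‖b‖ := by gcongr
        _ = _ := by ring
    have := (convex_closedBall (0 : E) 1).norm_image_sub_le_of_norm_fderiv_le hd hb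
      (by simpa using hw) (by simpa using hv)
    calc _ ≤ _ := this
      _ = _ := by ring
  rw [UnitaryRep.mat_mul, UnitaryRep.mat_mul, ← mul_sub]
  refine (norm_mul_le _ _).trans ?_
  exact (mul_le_of_le_one_left (norm_nonneg _) (ξ.norm_mat_le _)).trans hlip

end Covering

/-! ### Nets in the group of polynomial size -/

section Counting

open MeasureTheory
open scoped Matrix Matrix.Norms.L2Operator

variable {E : Type*} [NormedAddCommGroup E] [NormedSpace ℝ E] [FiniteDimensional ℝ E]
  {G : Type*} [TopologicalSpace G] [ChartedSpace E G] [Group G] [LieGroup 𝓘(ℝ, E) ∞ G]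
  [T2Space G] [CompactSpace G] [IsTopologicalGroup G] (κ : BiInvariantMetric E G)
  {n : ℕ} (Y : Module.Basis (Fin n) ℝ (GroupLieAlgebra 𝓘(ℝ, E) G))

variable (E G) in
theorem exists_finite_cover_param : ∃ t : Finset G, ∀ x : G, ∃ y ∈ t, ∃ v : E, ‖v‖ ≤ 1 ∧
    x = y * (param E G).toFun v := by
  let U : Set G := {z | ‖(param E G).inv z‖ < 1 ∧ (param E G).toFun ((param E G).inv z) = z}
  have hU : U ∈ 𝓝 (1 : G) := by
    refine Filter.inter_mem ?_ (param E G).right_inv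
    have h : Continuous fun z => ‖(param E G).inv z‖ := (param E G).smooth_inv.continuous.norm
    exact h.continuousAt.eventually_lt_const (by simp [(param E G).inv_one])
  have hU' : ∀ x : G, (fun z => x⁻¹ * z) ⁻¹' U ∈ 𝓝 x := fun x => by
    have h : Continuous fun z : G => x⁻¹ * z := continuous_const_mul x⁻¹
    exact h.continuousAt.preimage_mem_nhds (by simpa using hU)
  obtain ⟨t, -, ht⟩ := isCompact_univ.elim_nhds_subcover (fun x : G => (fun z => x⁻¹ * z) ⁻¹' U)
    fun x _ => hU' x
  refine ⟨t, fun x => ?_⟩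
  obtain ⟨y, hy, hxy⟩ := Set.mem_iUnion₂.1 (ht (Set.mem_univ x))
  exact ⟨y, hy, (param E G).inv (y⁻¹ * x), hxy.1.le, by rw [hxy.2]; simp⟩

/-- The group is covered by polynomially many cells on which `ξ` oscillates by at most
`C ⟨ξ⟩ / N`. -/
theorem exists_net : ∃ (C : ℝ) (p : ℕ), 0 ≤ C ∧ ∀ N : ℕ, 0 < N → ∃ P : Finset G,
    (P.card : ℝ) ≤ C * (N : ℝ) ^ p ∧ ∀ x, ∃ y ∈ P, ∀ ξ : UnitaryRep G,
      ‖ξ.mat x - ξ.mat y‖ ≤ C * bracket κ Y ξ / N := by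
  classical
  obtain ⟨L, hL0, hL⟩ := exists_lipschitz_param κ Y
  obtain ⟨t, ht⟩ := exists_finite_cover_param E G
  choose y hy v hv hxy using ht
  obtain ⟨m, ⟨φ⟩⟩ : ∃ m, Nonempty (E ≃L[ℝ] (Fin m → ℝ)) :=
    ⟨Module.finrank ℝ E, ⟨ContinuousLinearEquiv.ofFinrankEq (by simp)⟩⟩
  obtain ⟨M, hM⟩ := exists_nat_ge (‖φ.toContinuousLinearMap‖ + 1)
  have hM1 : 1 ≤ M := by
    have : (1 : ℝ) ≤ M := by linarith [norm_nonneg φ.toContinuousLinearMap]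
    exact_mod_cast this
  set K := ‖φ.symm.toContinuousLinearMap‖ with hK
  have hK0 : 0 ≤ K := norm_nonneg _
  obtain ⟨T, hT⟩ : ∃ T : ℕ, t.card = T := ⟨_, rfl⟩
  refine ⟨L * K + T * (3 * M : ℝ) ^ m, m, by positivity, fun N hN => ?_⟩
  have hN' : (0 : ℝ) < N := by exact_mod_cast hN
  -- A cell is labelled by a centre of the finite cover and the integer parts of `N` times the
  -- linear coordinates; points with the same label have coordinates within `1/N`.
  let cell : G → G × (Fin m → ℤ) := fun x => (y x, fun l => ⌊(N : ℝ) * φ (v x) l⌋)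
  let B : Finset (G × (Fin m → ℤ)) :=
    t ×ˢ Fintype.piFinset fun _ => Finset.Icc (-(N * M : ℤ)) (N * M)
  have hcell : ∀ x, cell x ∈ B := by
    intro x
    refine Finset.mem_product.2 ⟨hy x, Fintype.mem_piFinset.2 fun l => Finset.mem_Icc.2 ?_⟩
    have h1 : |φ (v x) l| ≤ M := by
      calc |φ (v x) l| ≤ ‖φ (v x)‖ := norm_le_pi_norm (φ (v x)) l
        _ ≤ ‖φ.toContinuousLinearMap‖ * ‖v x‖ := φ.toContinuousLinearMap.le_opNorm _
        _ ≤ ‖φ.toContinuousLinearMap‖ * 1 := by gcongr; exact hv x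
        _ ≤ M := by linarith
    obtain ⟨h2, h3⟩ := abs_le.1 h1
    constructor
    · rw [Int.le_floor]
      push_cast
      nlinarith
    · refine Int.floor_le_iff.2 ?_
      push_cast
      nlinarith
  have hclose : ∀ x x', cell x = cell x' → ∀ ξ : UnitaryRep G,
      ‖ξ.mat x - ξ.mat x'‖ ≤ L * K * bracket κ Y ξ / N := by
    intro x x' h ξ
    have h1 : y x = y x' := congrArg Prod.fst h
    have h2 : ‖v x - v x'‖ ≤ K * (1 / N) := by
      have h3 : ‖φ (v x) - φ (v x')‖ ≤ 1 / N := by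
        refine (pi_norm_le_iff_of_nonneg (by positivity)).2 fun l => ?_
        have h4 : ⌊(N : ℝ) * φ (v x) l⌋ = ⌊(N : ℝ) * φ (v x') l⌋ :=
          congrFun (congrArg Prod.snd h) l
        have h5 := Int.abs_sub_lt_one_of_floor_eq_floor h4
        rw [← mul_sub, abs_mul, abs_of_pos hN'] at h5
        rw [Real.norm_eq_abs, le_div_iff₀ hN', mul_comm]
        exact h5.le
      calc ‖v x - v x'‖ = ‖φ.symm (φ (v x) - φ (v x'))‖ := by simp
        _ ≤ K * ‖φ (v x) - φ (v x')‖ := φ.symm.toContinuousLinearMap.le_opNorm _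
        _ ≤ _ := by gcongr
    have h3 := hL ξ (y x) (v x) (v x') (hv x) (hv x')
    have e1 : ξ.mat x = ξ.mat (y x * (param E G).toFun (v x)) := by rw [← hxy]
    have e2 : ξ.mat x' = ξ.mat (y x * (param E G).toFun (v x')) := by rw [h1, ← hxy]
    rw [e1, e2]
    refine h3.trans ?_
    have := (bracket_pos κ Y ξ).le
    calc _ ≤ L * bracket κ Y ξ * (K * (1 / N)) := by gcongr
      _ = _ := by ring
  -- One representative per occupied cell; the values on empty cells are arbitrary and harmless.
  let s : G × (Fin m → ℤ) → G := Function.invFun cell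
  have hs : ∀ x, cell (s (cell x)) = cell x := fun x => Function.invFun_eq ⟨x, rfl⟩
  refine ⟨B.image s, ?_, fun x => ⟨s (cell x), Finset.mem_image_of_mem _ (hcell x), fun ξ => ?_⟩⟩
  · have h1 : ((B.image s).card : ℝ) ≤ B.card := by exact_mod_cast Finset.card_image_le
    have h2 : (B.card : ℝ) = T * (2 * (N * M) + 1) ^ m := by
      simp only [B, Finset.card_product, hT, Fintype.card_piFinset_const, Int.card_Icc]
      have : (N * M + 1 - -(N * M : ℤ)).toNat = 2 * (N * M) + 1 := by
        have : (N * M + 1 - -(N * M : ℤ)) = ((2 * (N * M) + 1 : ℕ) : ℤ) := by push_cast; ring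
        rw [this, Int.toNat_natCast]
      rw [this]
      push_cast
      simp
    have h3 : (2 * ((N : ℝ) * M) + 1) ^ m ≤ (3 * M * N) ^ m := by
      refine pow_le_pow_left₀ (by positivity) ?_ m
      have : (1 : ℝ) ≤ N * M := by
        have : 1 ≤ N * M := Nat.mul_pos hN hM1
        exact_mod_cast this
      linarith
    calc _ ≤ (T : ℝ) * (3 * M * N) ^ m := h1.trans (by rw [h2]; gcongr)
      _ = (T : ℝ) * (3 * M) ^ m * N ^ m := by rw [mul_pow]; ring
      _ ≤ _ := by
        gcongr
        exact le_add_of_nonneg_left (by positivity)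
  · refine (hclose x _ (hs x).symm ξ).trans ?_
    have := (bracket_pos κ Y ξ).le
    gcongr
    exact le_add_of_nonneg_right (by positivity)

end Counting

/-! ### A dimension bound from a resolution of the identity -/

section Frames

open MeasureTheory
open scoped Matrix Matrix.Norms.L2Operator InnerProductSpace

/-- If the vectors `k x` resolve the identity and are close to a set of `|P|` of them, then the
dimension is at most `2 |P|`. -/
theorem finrank_le_of_frame {G : Type*} [TopologicalSpace G] [CompactSpace G]
    [SecondCountableTopology G] [MeasurableSpace G] [BorelSpace G] (μ : Measure G)
    [IsProbabilityMeasure μ] {H : Type*} [NormedAddCommGroup H] [InnerProductSpace ℂ H]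
    [FiniteDimensional ℂ H] {k : G → H} (hk : Continuous k)
    (hres : ∀ e : H, ∫ x, ‖⟪e, k x⟫_ℂ‖ ^ 2 ∂μ = ‖e‖ ^ 2) (P : Finset G)
    (hP : ∀ x, ∃ y ∈ P, ‖k x - k y‖ ^ 2 ≤ (Module.finrank ℂ H : ℝ) / 2) :
    Module.finrank ℂ H ≤ 2 * P.card := by
  classical
  let W : Submodule ℂ H := Submodule.span ℂ (P.image k : Set H)
  let e := stdOrthonormalBasis ℂ Wᗮ
  -- Vectors orthogonal to the span of the net see only the difference `k x - k y`, so Bessel's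
  -- inequality bounds the sum by its square norm.
  have h1 : ∀ x, ∑ i, ‖⟪(e i : H), k x⟫_ℂ‖ ^ 2 ≤ (Module.finrank ℂ H : ℝ) / 2 := by
    intro x
    obtain ⟨y, hy, hxy⟩ := hP x
    have ho : Orthonormal ℂ fun i => (e i : H) := e.orthonormal.comp_linearIsometry Wᗮ.subtypeₗᵢ
    refine le_trans ?_ ((ho.sum_inner_products_le (k x - k y) (s := Finset.univ)).trans hxy)
    refine Finset.sum_le_sum fun i _ => ?_
    have h2 : ⟪(e i : H), k y⟫_ℂ = 0 := by
      refine Submodule.inner_left_of_mem_orthogonal (K := W) ?_ (e i).2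
      exact Submodule.subset_span (by simpa using ⟨y, hy, rfl⟩)
    rw [inner_sub_right, h2, sub_zero]
  have hcont : ∀ i, Continuous fun x => ‖⟪(e i : H), k x⟫_ℂ‖ ^ 2 := fun i =>
    (continuous_const.inner hk).norm.pow 2
  have hInt : ∀ i, Integrable (fun x => ‖⟪(e i : H), k x⟫_ℂ‖ ^ 2) μ := fun i =>
    (hcont i).integrable_of_hasCompactSupport (HasCompactSupport.of_compactSpace _)
  -- Integrating over `G`, the resolution of the identity turns the left-hand side into `dim Wᗮ`.
  -- Thus at least half of the dimension is spanned by the net.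
  have h2 : (Module.finrank ℂ Wᗮ : ℝ) ≤ (Module.finrank ℂ H : ℝ) / 2 := by
    calc (Module.finrank ℂ Wᗮ : ℝ) = ∑ i, ∫ x, ‖⟪(e i : H), k x⟫_ℂ‖ ^ 2 ∂μ := by
          have : ∀ i, ‖(e i : H)‖ = 1 := fun i => e.orthonormal.1 i
          simp [hres, this]
      _ = ∫ x, ∑ i, ‖⟪(e i : H), k x⟫_ℂ‖ ^ 2 ∂μ := (integral_finsetSum _ fun i _ => hInt i).symm
      _ ≤ ∫ _x, (Module.finrank ℂ H : ℝ) / 2 ∂μ :=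
          integral_mono (integrable_finsetSum _ fun i _ => hInt i) (integrable_const _) h1
      _ = _ := by simp
  have h3 : Module.finrank ℂ W ≤ P.card :=
    (finrank_span_finset_le_card _).trans Finset.card_image_le
  have h4 := Submodule.finrank_add_finrank_orthogonal W
  have h5 : (Module.finrank ℂ W : ℝ) + Module.finrank ℂ Wᗮ = Module.finrank ℂ H := by
    exact_mod_cast h4
  have h6 : (Module.finrank ℂ W : ℝ) ≤ P.card := by exact_mod_cast h3
  have : (Module.finrank ℂ H : ℝ) ≤ 2 * P.card := by linarith
  exact_mod_cast this

variable {G : Type*} [TopologicalSpace G] [Group G] [IsTopologicalGroup G] [CompactSpace G]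
  [SecondCountableTopology G]
  [MeasurableSpace G] [BorelSpace G] (μ : Measure G) [IsProbabilityMeasure μ] [μ.IsHaarMeasure]

/-- The index set of the matrix coefficients of a finite set of representations. -/
abbrev CoeffIndex (S : Finset (UnitaryRep G)) : Type _ := Σ ξ : S, Fin ξ.1.dim × Fin ξ.1.dim

/-- The vector of normalized matrix coefficients at `x`. -/
def coeffVec (S : Finset (UnitaryRep G)) (x : G) : EuclideanSpace ℂ (CoeffIndex S) :=
  WithLp.toLp 2 fun I => (Real.sqrt I.1.1.dim : ℂ) * I.1.1.mat x I.2.1 I.2.2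

theorem coeffVec_apply (S : Finset (UnitaryRep G)) (x : G) (I : CoeffIndex S) :
    coeffVec S x I = (Real.sqrt I.1.1.dim : ℂ) * I.1.1.mat x I.2.1 I.2.2 := rfl

theorem continuous_coeffVec_apply (S : Finset (UnitaryRep G)) (I : CoeffIndex S) :
    Continuous fun x => coeffVec S x I :=
  continuous_const.mul (I.1.1.continuous_mat_apply I.2.1 I.2.2)

theorem continuous_coeffVec (S : Finset (UnitaryRep G)) : Continuous (coeffVec S) :=
  (PiLp.continuous_toLp 2 _).comp (continuous_pi fun I => continuous_coeffVec_apply S I)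

theorem sum_coeffIndex {M : Type*} [AddCommMonoid M] (S : Finset (UnitaryRep G))
    (f : (ξ : UnitaryRep G) → Fin ξ.dim → Fin ξ.dim → M) :
    ∑ I : CoeffIndex S, f I.1.1 I.2.1 I.2.2 = ∑ ξ ∈ S, ∑ i, ∑ j, f ξ i j := by
  rw [← Finset.univ_sigma_univ, Finset.sum_sigma, ← Finset.sum_coe_sort S]
  refine Finset.sum_congr rfl fun ξ _ => ?_
  rw [← Finset.univ_product_univ, Finset.sum_product]

theorem integral_coeffVec_mul {S : Finset (UnitaryRep G)}
    (hS : ∀ ξ ∈ S, ∀ η ∈ S, ξ.Equivalent η → ξ = η) (I J : CoeffIndex S) [Decidable (I = J)] :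
    ∫ x, coeffVec S x I * star (coeffVec S x J) ∂μ = if I = J then 1 else 0 := by
  obtain ⟨⟨ξ, hξ⟩, i, j⟩ := I
  obtain ⟨⟨η, hη⟩, k, l⟩ := J
  have h : ∀ x, coeffVec S x ⟨⟨ξ, hξ⟩, i, j⟩ * star (coeffVec S x ⟨⟨η, hη⟩, k, l⟩) =
      ((Real.sqrt ξ.dim : ℂ) * (Real.sqrt η.dim : ℂ)) * (ξ.mat x i j * star (η.mat x k l)) := by
    intro x
    simp only [coeffVec_apply, star_mul', Complex.star_def, Complex.conj_ofReal]
    ring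
  rw [integral_congr_ae (.of_forall h), integral_const_mul]
  by_cases hne : ξ = η
  · subst hne
    rw [UnitaryRep.integral_coeff_mul_self, ← Complex.ofReal_mul,
      Real.mul_self_sqrt (Nat.cast_nonneg _)]
    have hd : (ξ.dim : ℂ) ≠ 0 := Nat.cast_ne_zero.2 ξ.dim_pos.ne'
    by_cases h' : i = k ∧ j = l
    · obtain ⟨rfl, rfl⟩ := h'
      simp [hd]
    · rw [if_neg h', if_neg, mul_zero]
      intro h2
      apply h'
      simpa using h2
  · rw [UnitaryRep.integral_coeff_mul_eq_zero (fun h' => hne (hS ξ hξ η hη h')), if_neg, mul_zero]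
    intro h2
    apply hne
    have := congrArg (fun I : CoeffIndex S => I.1.1) h2
    exact this

theorem integral_norm_inner_coeffVec {S : Finset (UnitaryRep G)}
    (hS : ∀ ξ ∈ S, ∀ η ∈ S, ξ.Equivalent η → ξ = η) (e : EuclideanSpace ℂ (CoeffIndex S)) :
    ∫ x, ‖⟪e, coeffVec S x⟫_ℂ‖ ^ 2 ∂μ = ‖e‖ ^ 2 := by
  classical
  have hz : ∀ x, ((‖⟪e, coeffVec S x⟫_ℂ‖ ^ 2 : ℝ) : ℂ) =
      ∑ I, ∑ J, (star (e I) * e J) * (coeffVec S x I * star (coeffVec S x J)) := by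
    intro x
    have h1 : ⟪e, coeffVec S x⟫_ℂ = ∑ I, star (e I) * coeffVec S x I := by
      rw [PiLp.inner_apply]
      exact Finset.sum_congr rfl fun I _ => by rw [RCLike.inner_apply, mul_comm]; rfl
    have h2 : ((‖⟪e, coeffVec S x⟫_ℂ‖ ^ 2 : ℝ) : ℂ) =
        ⟪e, coeffVec S x⟫_ℂ * star ⟪e, coeffVec S x⟫_ℂ := by
      rw [Complex.star_def, Complex.mul_conj, Complex.normSq_eq_norm_sq]
    rw [h2, h1, star_sum, Finset.sum_mul_sum]
    refine Finset.sum_congr rfl fun I _ => Finset.sum_congr rfl fun J _ => ?_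
    rw [star_mul', star_star]
    ring
  have hi : ∀ I J, Integrable
      (fun x => (star (e I) * e J) * (coeffVec S x I * star (coeffVec S x J))) μ := fun I J =>
    (integrable_of_continuous ((continuous_coeffVec_apply S I).mul
      (continuous_coeffVec_apply S J).star)).const_mul _
  have : ((∫ x, ‖⟪e, coeffVec S x⟫_ℂ‖ ^ 2 ∂μ : ℝ) : ℂ) = ((‖e‖ ^ 2 : ℝ) : ℂ) := by
    rw [← integral_complex_ofReal, integral_congr_ae (.of_forall hz),
      integral_finsetSum _ fun I _ => integrable_finsetSum _ fun J _ => hi I J]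
    simp only [integral_finsetSum _ fun J _ => hi _ J, integral_const_mul,
      integral_coeffVec_mul μ hS]
    rw [EuclideanSpace.norm_sq_eq, Complex.ofReal_sum]
    refine Finset.sum_congr rfl fun I _ => ?_
    rw [Finset.sum_eq_single I (fun J _ hJ => by simp [hJ.symm]) (by simp), if_pos rfl, mul_one,
      mul_comm, Complex.star_def, Complex.mul_conj, Complex.normSq_eq_norm_sq]
  exact_mod_cast this

theorem norm_coeffVec_sub_le (S : Finset (UnitaryRep G)) {x y : G} {ε : ℝ}
    (h : ∀ ξ ∈ S, ‖ξ.mat x - ξ.mat y‖ ≤ ε) :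
    ‖coeffVec S x - coeffVec S y‖ ^ 2 ≤ (∑ ξ ∈ S, (ξ.dim : ℝ) ^ 2) * ε ^ 2 := by
  rw [EuclideanSpace.norm_sq_eq]
  have h1 : ∀ I : CoeffIndex S, ‖(coeffVec S x - coeffVec S y) I‖ ^ 2 =
      (I.1.1.dim : ℝ) * ‖(I.1.1.mat x - I.1.1.mat y) I.2.1 I.2.2‖ ^ 2 := by
    intro I
    rw [PiLp.sub_apply, coeffVec_apply, coeffVec_apply, ← mul_sub, norm_mul, mul_pow,
      Complex.norm_real, Real.norm_of_nonneg (Real.sqrt_nonneg _),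
      Real.sq_sqrt (Nat.cast_nonneg _), Matrix.sub_apply]
  simp only [h1]
  rw [sum_coeffIndex S fun ξ i j => (ξ.dim : ℝ) * ‖(ξ.mat x - ξ.mat y) i j‖ ^ 2, Finset.sum_mul]
  refine Finset.sum_le_sum fun ξ hξ => ?_
  simp only [← Finset.mul_sum]
  calc (ξ.dim : ℝ) * ∑ i, ∑ j, ‖(ξ.mat x - ξ.mat y) i j‖ ^ 2
      ≤ ξ.dim * (ξ.dim * ‖ξ.mat x - ξ.mat y‖ ^ 2) :=
        mul_le_mul_of_nonneg_left (sum_sq_norm_le _) (Nat.cast_nonneg _)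
    _ ≤ ξ.dim * (ξ.dim * ε ^ 2) := by
        have := h ξ hξ
        gcongr
    _ = _ := by ring

end Frames

/-! ### Polynomial growth of `∑ d_ξ²` and convergence of `∑ d_ξ² ⟨ξ⟩^{-p}` -/

section Summability

open MeasureTheory
open scoped Matrix Matrix.Norms.L2Operator

variable {E : Type*} [NormedAddCommGroup E] [NormedSpace ℝ E] [FiniteDimensional ℝ E]
  {G : Type*} [TopologicalSpace G] [ChartedSpace E G] [Group G] [LieGroup 𝓘(ℝ, E) ∞ G]
  [T2Space G] [CompactSpace G] [IsTopologicalGroup G] [SecondCountableTopology G]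
  (κ : BiInvariantMetric E G)
  {n : ℕ} (Y : Module.Basis (Fin n) ℝ (GroupLieAlgebra 𝓘(ℝ, E) G))

/-- By Schur orthogonality the normalized coefficients of the representations in `S` resolve the
identity in dimension `∑ d_ξ²`. A net of size polynomial in `R` moves none of them by more than
`1/2` in norm, so the dimension is at most twice the size of the net. -/
theorem exists_sum_dim_sq_le : ∃ (C : ℝ) (p : ℕ), 0 ≤ C ∧ ∀ S : Finset (UnitaryRep G),
    (∀ ξ ∈ S, ∀ η ∈ S, ξ.Equivalent η → ξ = η) → ∀ R : ℝ, 1 ≤ R →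
    (∀ ξ ∈ S, bracket κ Y ξ ≤ R) → ∑ ξ ∈ S, (ξ.dim : ℝ) ^ 2 ≤ C * R ^ p := by
  borelize G
  let μ : Measure G := Measure.haarMeasure ⊤
  have hμ : IsProbabilityMeasure μ := ⟨by
    have := Measure.haarMeasure_self (K₀ := (⊤ : TopologicalSpace.PositiveCompacts G))
    simpa using this⟩
  obtain ⟨C, p, hC0, hC⟩ := exists_net κ Y
  refine ⟨2 * (C * (2 * C + 2) ^ p), p, by positivity, fun S hS R hR hSR => ?_⟩
  -- Large enough that the oscillation `C ⟨ξ⟩ / N` is at most `1/2`; the added `1` keeps `N`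
  -- positive.
  set N := ⌈2 * C * R⌉₊ + 1 with hN
  have hN1 : 2 * C * R ≤ N := (Nat.le_ceil _).trans (by simp [hN])
  have hN2 : (N : ℝ) ≤ (2 * C + 2) * R := by
    have := Nat.ceil_lt_add_one (a := 2 * C * R) (by positivity)
    rw [hN]
    push_cast
    nlinarith
  have hN0 : (0 : ℝ) < N := by exact_mod_cast Nat.succ_pos _
  obtain ⟨P, hPcard, hP⟩ := hC N (Nat.succ_pos _)
  have hfr : (Module.finrank ℂ (EuclideanSpace ℂ (CoeffIndex S)) : ℝ) =
      ∑ ξ ∈ S, (ξ.dim : ℝ) ^ 2 := by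
    rw [finrank_euclideanSpace]
    have := sum_coeffIndex S fun ξ _ _ => (1 : ℝ)
    simp only [Finset.sum_const, Finset.card_univ, nsmul_eq_mul, mul_one, Fintype.card_fin] at this
    rw [this]
    exact Finset.sum_congr rfl fun ξ _ => by ring
  have h := finrank_le_of_frame μ (continuous_coeffVec S) (integral_norm_inner_coeffVec μ hS) P
    fun x => by
      obtain ⟨y, hy, hxy⟩ := hP x
      refine ⟨y, hy, ?_⟩
      have h1 := norm_coeffVec_sub_le S (x := x) (y := y) (ε := 1 / 2) fun ξ hξ => by
        refine (hxy ξ).trans ?_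
        rw [div_le_iff₀ hN0]
        have := mul_le_mul_of_nonneg_left (hSR ξ hξ) hC0
        linarith
      rw [hfr]
      have h2 : 0 ≤ ∑ ξ ∈ S, (ξ.dim : ℝ) ^ 2 := Finset.sum_nonneg fun ξ _ => by positivity
      linarith
  rw [← hfr]
  calc (Module.finrank ℂ (EuclideanSpace ℂ (CoeffIndex S)) : ℝ) ≤ 2 * P.card := by exact_mod_cast h
    _ ≤ 2 * (C * (N : ℝ) ^ p) := by gcongr
    _ ≤ 2 * (C * ((2 * C + 2) * R) ^ p) := by gcongr
    _ = _ := by rw [mul_pow]; ring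

/-- The series `∑ d_ξ² ⟨ξ⟩^{-p}` over the unitary dual converges for some `p`. -/
theorem exists_sum_dim_sq_div_le : ∃ (C : ℝ) (p : ℕ), 0 ≤ C ∧ ∀ S : Finset (UnitaryRep G),
    (∀ ξ ∈ S, ∀ η ∈ S, ξ.Equivalent η → ξ = η) →
    ∑ ξ ∈ S, (ξ.dim : ℝ) ^ 2 * (bracket κ Y ξ ^ p)⁻¹ ≤ C := by
  classical
  obtain ⟨C, p, hC0, hC⟩ := exists_sum_dim_sq_le κ Y
  have hsum : Summable fun k : ℕ => ((k : ℝ) ^ 2)⁻¹ := Real.summable_nat_pow_inv.2 (by norm_num)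
  refine ⟨2 ^ (p + 2) * (C * ∑' k : ℕ, ((k : ℝ) ^ 2)⁻¹), p + 2,
    mul_nonneg (by positivity) (mul_nonneg hC0 (tsum_nonneg fun k => by positivity)),
    fun S hS => ?_⟩
  -- Representations are grouped by `k = ⌈⟨ξ⟩⌉`. A group contributes at most `C k^p k^{-(p+2)} = C
  -- k^{-2}`, which is summable.
  let m : UnitaryRep G → ℕ := fun ξ => ⌈bracket κ Y ξ⌉₊
  have hm1 : ∀ ξ, bracket κ Y ξ ≤ m ξ := fun ξ => Nat.le_ceil _
  have hm2 : ∀ ξ, (m ξ : ℝ) ≤ 2 * bracket κ Y ξ := fun ξ => by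
    have := Nat.ceil_lt_add_one (bracket_pos κ Y ξ).le
    have := one_le_bracket κ Y ξ
    simp only [m]
    linarith
  have hm0 : ∀ ξ, (0 : ℝ) < m ξ := fun ξ => (bracket_pos κ Y ξ).trans_le (hm1 ξ)
  calc ∑ ξ ∈ S, (ξ.dim : ℝ) ^ 2 * (bracket κ Y ξ ^ (p + 2))⁻¹
      ≤ ∑ ξ ∈ S, 2 ^ (p + 2) * ((ξ.dim : ℝ) ^ 2 * ((m ξ : ℝ) ^ (p + 2))⁻¹) := by
        refine Finset.sum_le_sum fun ξ _ => ?_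
        have h1 : (bracket κ Y ξ ^ (p + 2))⁻¹ ≤ 2 ^ (p + 2) * ((m ξ : ℝ) ^ (p + 2))⁻¹ := by
          rw [← div_eq_mul_inv, le_div_iff₀ (pow_pos (hm0 ξ) _), inv_mul_le_iff₀
            (pow_pos (bracket_pos κ Y ξ) _), ← mul_pow, mul_comm (bracket κ Y ξ)]
          exact pow_le_pow_left₀ (hm0 ξ).le (hm2 ξ) _
        calc _ ≤ (ξ.dim : ℝ) ^ 2 * (2 ^ (p + 2) * ((m ξ : ℝ) ^ (p + 2))⁻¹) := by gcongr
          _ = _ := by ring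
    _ = 2 ^ (p + 2) * ∑ k ∈ S.image m, ∑ ξ ∈ S with m ξ = k,
          (ξ.dim : ℝ) ^ 2 * ((m ξ : ℝ) ^ (p + 2))⁻¹ := by
        rw [← Finset.mul_sum, Finset.sum_fiberwise_of_maps_to fun ξ hξ =>
          Finset.mem_image_of_mem m hξ]
    _ ≤ 2 ^ (p + 2) * ∑ k ∈ S.image m, C * ((k : ℝ) ^ 2)⁻¹ := by
        refine mul_le_mul_of_nonneg_left (Finset.sum_le_sum fun k hk => ?_) (by positivity)
        obtain ⟨ξ₀, -, rfl⟩ := Finset.mem_image.1 hk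
        have hk0 := hm0 ξ₀
        have hk1 : (1 : ℝ) ≤ m ξ₀ := (one_le_bracket κ Y ξ₀).trans (hm1 ξ₀)
        have h1 : ∑ ξ ∈ S with m ξ = m ξ₀, (ξ.dim : ℝ) ^ 2 * ((m ξ : ℝ) ^ (p + 2))⁻¹ =
            (∑ ξ ∈ S with m ξ = m ξ₀, (ξ.dim : ℝ) ^ 2) * ((m ξ₀ : ℝ) ^ (p + 2))⁻¹ := by
          rw [Finset.sum_mul]
          refine Finset.sum_congr rfl fun ξ hξ => ?_
          rw [(Finset.mem_filter.1 hξ).2]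
        rw [h1]
        have h2 := hC (S.filter fun ξ => m ξ = m ξ₀)
          (fun ξ hξ η hη => hS ξ (Finset.mem_filter.1 hξ).1 η (Finset.mem_filter.1 hη).1)
          (m ξ₀) hk1 fun ξ hξ => by
            rw [← (Finset.mem_filter.1 hξ).2]
            exact hm1 ξ
        calc _ ≤ C * (m ξ₀ : ℝ) ^ p * ((m ξ₀ : ℝ) ^ (p + 2))⁻¹ := by gcongr
          _ = _ := by field_simp; ring
    _ ≤ _ := by
        rw [← Finset.mul_sum]
        gcongr
        exact hsum.sum_le_tsum _ fun k _ => by positivity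

end Summability

/-! ### The unitary dual -/

section DualSet

variable (G : Type*) [TopologicalSpace G] [Group G]

/-- Equivalence of representations as a setoid. -/
def repSetoid : Setoid (UnitaryRep G) where
  r := UnitaryRep.Equivalent
  iseqv := ⟨UnitaryRep.Equivalent.refl, UnitaryRep.Equivalent.symm, UnitaryRep.Equivalent.trans⟩

/-- The unitary dual: equivalence classes of irreducible unitary representations. -/
def UnitaryDual : Type _ := Quotient (repSetoid G)

variable {G}

/-- A representative of a class in the unitary dual. -/
def UnitaryDual.rep (c : UnitaryDual G) : UnitaryRep G := Quotient.out (s := repSetoid G) c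

theorem UnitaryDual.exists_equivalent (ξ : UnitaryRep G) :
    ∃ c : UnitaryDual G, ξ.Equivalent c.rep :=
  ⟨Quotient.mk (repSetoid G) ξ,
    UnitaryRep.Equivalent.symm (Quotient.mk_out (s := repSetoid G) ξ)⟩

theorem UnitaryDual.eq_of_equivalent {c c' : UnitaryDual G} (h : c.rep.Equivalent c'.rep) :
    c = c' := Quotient.out_equiv_out.1 h

theorem UnitaryDual.rep_injective : Function.Injective (UnitaryDual.rep (G := G)) := fun _ _ h =>
  eq_of_equivalent (h ▸ UnitaryRep.Equivalent.refl _)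

end DualSet

/-! ### Isotypic projections and decay of Fourier coefficients -/

section Fourier

open MeasureTheory
open scoped Matrix Matrix.Norms.L2Operator

variable {E : Type*} [NormedAddCommGroup E] [NormedSpace ℝ E] [FiniteDimensional ℝ E]
  {G : Type*} [TopologicalSpace G] [ChartedSpace E G] [Group G] [LieGroup 𝓘(ℝ, E) ∞ G]
  [T2Space G] [CompactSpace G] [IsTopologicalGroup G] [SecondCountableTopology G]
  [MeasurableSpace G] [BorelSpace G] (μ : Measure G) [IsProbabilityMeasure μ] [μ.IsHaarMeasure]

/-- The integrals `∫ f \bar ξ_{ij}`. -/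
def coeffInt (ξ : UnitaryRep G) (i j : Fin ξ.dim) : SmoothFun E G →ₗ[ℂ] ℂ where
  toFun f := ∫ x, f x * star (ξ.mat x i j) ∂μ
  map_add' f g := by
    have h : ∀ f : SmoothFun E G, Integrable (fun x => f x * star (ξ.mat x i j)) μ := fun f =>
      integrable_of_continuous (f.continuous.mul (ξ.continuous_mat_apply i j).star)
    rw [← integral_add (h f) (h g)]
    exact integral_congr_ae (.of_forall fun x => add_mul _ _ _)
  map_smul' c f := by
    rw [RingHom.id_apply, smul_eq_mul, ← integral_const_mul]
    exact integral_congr_ae (.of_forall fun x => mul_assoc _ _ _)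

theorem coeffInt_apply (ξ : UnitaryRep G) (i j : Fin ξ.dim) (f : SmoothFun E G) :
    coeffInt μ ξ i j f = ∫ x, f x * star (ξ.mat x i j) ∂μ := rfl

/-- The projection of a smooth function to the matrix coefficients of `ξ`. -/
def proj (ξ : UnitaryRep G) : SmoothFun E G →ₗ[ℂ] SmoothFun E G :=
  (ξ.dim : ℂ) • ∑ i, ∑ j, (coeffInt μ ξ i j).smulRight (ξ.coeffFun E i j)

theorem proj_apply (ξ : UnitaryRep G) (f : SmoothFun E G) :
    proj μ ξ f = (ξ.dim : ℂ) • ∑ i, ∑ j, coeffInt μ ξ i j f • ξ.coeffFun E i j := by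
  simp [proj]

theorem proj_apply_apply (ξ : UnitaryRep G) (f : SmoothFun E G) (x : G) :
    proj μ ξ f x = ξ.dim * ∑ i, ∑ j, coeffInt μ ξ i j f * ξ.mat x i j := by
  rw [proj_apply]
  simp only [SmoothFun.smul_apply, SmoothFun.sum_apply, UnitaryRep.coeffFun_apply]

theorem coeffInt_derivOp (ξ : UnitaryRep G) (i j : Fin ξ.dim) (X : GroupLieAlgebra 𝓘(ℝ, E) G)
    (f : SmoothFun E G) :
    coeffInt μ ξ i j (derivOp X f) = ∑ k, ξ.deriv X j k * coeffInt μ ξ i k f := by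
  have h1 : coeffInt μ ξ i j (derivOp X f) =
      -∫ x, f x * derivOp X (conjFun (ξ.coeffFun E i j)) x ∂μ :=
    integral_derivOp_mul X f (conjFun (ξ.coeffFun E i j))
  have h2 : ∀ k, star (ξ.deriv X k j) = -ξ.deriv X j k := fun k => by
    have := congrFun (congrFun (ξ.conjTranspose_deriv X) j) k
    simpa [Matrix.conjTranspose_apply] using this
  have h3 : ∀ x, f x * derivOp X (conjFun (ξ.coeffFun E i j)) x =
      ∑ k, -ξ.deriv X j k * (f x * star (ξ.mat x i k)) := by
    intro x
    rw [derivOp_conjFun, conjFun_apply, UnitaryRep.derivOp_coeffFun_apply, Matrix.mul_apply,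
      star_sum, Finset.mul_sum]
    refine Finset.sum_congr rfl fun k _ => ?_
    rw [star_mul', h2]
    ring
  have h4 : ∀ k, Integrable (fun x => -ξ.deriv X j k * (f x * star (ξ.mat x i k))) μ := fun k =>
    (integrable_of_continuous (f.continuous.mul (ξ.continuous_mat_apply i k).star)).const_mul _
  rw [h1, integral_congr_ae (.of_forall h3), integral_finsetSum _ fun k _ => h4 k,
    ← Finset.sum_neg_distrib]
  refine Finset.sum_congr rfl fun k _ => ?_
  rw [integral_const_mul, neg_mul, neg_neg]
  rfl

/-- Because of this commutation, convergence of Fourier series with all derivatives reduces to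
uniform convergence. -/
theorem derivOp_proj (ξ : UnitaryRep G) (X : GroupLieAlgebra 𝓘(ℝ, E) G) (f : SmoothFun E G) :
    derivOp X (proj μ ξ f) = proj μ ξ (derivOp X f) := by
  refine SmoothFun.ext fun x => ?_
  rw [proj_apply_apply, proj_apply, map_smul, map_sum, SmoothFun.smul_apply, SmoothFun.sum_apply]
  congr 1
  refine Finset.sum_congr rfl fun i _ => ?_
  simp only [map_sum, map_smul, SmoothFun.sum_apply, SmoothFun.smul_apply,
    UnitaryRep.derivOp_coeffFun_apply, Matrix.mul_apply, coeffInt_derivOp, Finset.mul_sum,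
    Finset.sum_mul]
  rw [Finset.sum_comm]
  exact Finset.sum_congr rfl fun k _ => Finset.sum_congr rfl fun l _ => by ring

variable (κ : BiInvariantMetric E G)
  {n : ℕ} (Y : Module.Basis (Fin n) ℝ (GroupLieAlgebra 𝓘(ℝ, E) G))

/-- The operator `1 - 𝓛`. -/
def bessel : SmoothFun E G →ₗ[ℂ] SmoothFun E G := LinearMap.id - lapOp κ Y

theorem bessel_apply (f : SmoothFun E G) (x : G) : bessel κ Y f x = f x - lapOp κ Y f x := rfl

theorem integral_bessel_mul (f g : SmoothFun E G) :
    ∫ x, bessel κ Y f x * g x ∂μ = ∫ x, f x * bessel κ Y g x ∂μ := by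
  have h1 : ∀ x, bessel κ Y f x * g x = f x * g x - lapOp κ Y f x * g x := fun x => sub_mul _ _ _
  have h2 : ∀ x, f x * bessel κ Y g x = f x * g x - f x * lapOp κ Y g x := fun x => mul_sub _ _ _
  rw [integral_congr_ae (.of_forall h1), integral_congr_ae (.of_forall h2)]
  have i1 : Integrable (fun x => f x * g x) μ := SmoothFun.integrable (f * g)
  have i2 : Integrable (fun x => lapOp κ Y f x * g x) μ := SmoothFun.integrable (lapOp κ Y f * g)
  have i3 : Integrable (fun x => f x * lapOp κ Y g x) μ := SmoothFun.integrable (f * lapOp κ Y g)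
  rw [integral_sub i1 i2, integral_sub i1 i3, integral_lapOp_mul]

theorem bessel_eq_of_lapOp {f : SmoothFun E G} (ξ : UnitaryRep G)
    (h : lapOp κ Y f = (-lapEigenvalue κ Y ξ : ℂ) • f) :
    bessel κ Y f = ((bracket κ Y ξ ^ 2 : ℝ) : ℂ) • f := by
  refine SmoothFun.ext fun x => ?_
  rw [bessel_apply, h, bracket_sq, SmoothFun.smul_apply, SmoothFun.smul_apply]
  push_cast
  ring

/-- The operator `1 - 𝓛` is symmetric and acts on `f` as `⟨ξ⟩²`. -/
theorem integral_mul_bessel_pow {f : SmoothFun E G} (ξ : UnitaryRep G)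
    (h : lapOp κ Y f = (-lapEigenvalue κ Y ξ : ℂ) • f) (K : ℕ) (g : SmoothFun E G) :
    ∫ x, f x * ((bessel κ Y)^[K] g) x ∂μ =
      ((bracket κ Y ξ ^ (2 * K) : ℝ) : ℂ) * ∫ x, f x * g x ∂μ := by
  induction K generalizing g with
  | zero => simp
  | succ K ih =>
    rw [Function.iterate_succ_apply, ih, ← integral_bessel_mul, bessel_eq_of_lapOp κ Y ξ h]
    have : ∀ x, (((bracket κ Y ξ ^ 2 : ℝ) : ℂ) • f) x * g x =
      ((bracket κ Y ξ ^ 2 : ℝ) : ℂ) * (f x * g x) := fun x => mul_assoc _ _ _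
    rw [integral_congr_ae (.of_forall this), integral_const_mul, ← mul_assoc, ← Complex.ofReal_mul]
    congr 2
    ring

theorem norm_coeffInt_le (ξ : UnitaryRep G) (i j : Fin ξ.dim) (K : ℕ) (f : SmoothFun E G) {M : ℝ}
    (hM : ∀ x, ‖((bessel κ Y)^[K] f) x‖ ≤ M) :
    ‖coeffInt μ ξ i j f‖ ≤ M * (bracket κ Y ξ ^ (2 * K))⁻¹ := by
  have hb : 0 < bracket κ Y ξ ^ (2 * K) := pow_pos (bracket_pos κ Y ξ) _
  have h := integral_mul_bessel_pow μ κ Y ξ (ξ.lapOp_adjCoeff κ Y j i) K f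
  have h1 : ∫ x, ξ.adjCoeff E j i x * f x ∂μ = coeffInt μ ξ i j f :=
    integral_congr_ae (.of_forall fun x => mul_comm _ _)
  rw [h1] at h
  rw [← div_eq_mul_inv, le_div_iff₀ hb, mul_comm]
  have h2 : bracket κ Y ξ ^ (2 * K) * ‖coeffInt μ ξ i j f‖ =
      ‖∫ x, ξ.adjCoeff E j i x * ((bessel κ Y)^[K] f) x ∂μ‖ := by
    rw [h, norm_mul, Complex.norm_real, Real.norm_of_nonneg hb.le]
  rw [h2]
  have h3 : ∀ᵐ x ∂μ, ‖ξ.adjCoeff E j i x * ((bessel κ Y)^[K] f) x‖ ≤ M := by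
    refine .of_forall fun x => ?_
    rw [norm_mul]
    have h4 : ‖ξ.adjCoeff E j i x‖ ≤ 1 := by
      rw [UnitaryRep.adjCoeff_apply, Matrix.conjTranspose_apply, norm_star]
      exact entry_norm_bound_of_unitary (ξ.toHom x).2 i j
    exact (mul_le_of_le_one_left (norm_nonneg _) h4).trans (hM x)
  have := norm_integral_le_of_norm_le_const h3
  simpa using this

theorem norm_proj_le (ξ : UnitaryRep G) (K : ℕ) (f : SmoothFun E G) {M : ℝ}
    (hM : ∀ x, ‖((bessel κ Y)^[K] f) x‖ ≤ M) (x : G) :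
    ‖proj μ ξ f x‖ ≤ (ξ.dim : ℝ) ^ 3 * (M * (bracket κ Y ξ ^ (2 * K))⁻¹) := by
  rw [proj_apply_apply, norm_mul, Complex.norm_natCast]
  have h : ‖∑ i, ∑ j, coeffInt μ ξ i j f * ξ.mat x i j‖ ≤
      ∑ _i : Fin ξ.dim, ∑ _j : Fin ξ.dim, M * (bracket κ Y ξ ^ (2 * K))⁻¹ := by
    refine (norm_sum_le _ _).trans (Finset.sum_le_sum fun i _ => ?_)
    refine (norm_sum_le _ _).trans (Finset.sum_le_sum fun j _ => ?_)
    rw [norm_mul]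
    refine (mul_le_of_le_one_right (norm_nonneg _) ?_).trans (norm_coeffInt_le μ κ Y ξ i j K f hM)
    exact entry_norm_bound_of_unitary (ξ.toHom x).2 i j
  calc _ ≤ (ξ.dim : ℝ) * ∑ _i : Fin ξ.dim, ∑ _j : Fin ξ.dim, M * (bracket κ Y ξ ^ (2 * K))⁻¹ := by
        gcongr
    _ = _ := by
        simp only [Finset.sum_const, Finset.card_univ, Fintype.card_fin, nsmul_eq_mul]
        ring

theorem sum_dual_le {C : ℝ} {p : ℕ} (hC : ∀ S : Finset (UnitaryRep G),
    (∀ ξ ∈ S, ∀ η ∈ S, ξ.Equivalent η → ξ = η) →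
    ∑ ξ ∈ S, (ξ.dim : ℝ) ^ 2 * (bracket κ Y ξ ^ p)⁻¹ ≤ C) (S : Finset (UnitaryDual G)) :
    ∑ c ∈ S, (c.rep.dim : ℝ) ^ 2 * (bracket κ Y c.rep ^ p)⁻¹ ≤ C := by
  classical
  rw [← Finset.sum_image (f := fun ξ : UnitaryRep G =>
    (ξ.dim : ℝ) ^ 2 * (bracket κ Y ξ ^ p)⁻¹) (g := UnitaryDual.rep)
    (UnitaryDual.rep_injective.injOn)]
  refine hC _ fun ξ hξ η hη h => ?_
  obtain ⟨c, -, rfl⟩ := Finset.mem_image.1 hξ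
  obtain ⟨c', -, rfl⟩ := Finset.mem_image.1 hη
  rw [UnitaryDual.eq_of_equivalent h]

/-- The projection is at most `d³ M ⟨ξ⟩^{-2p}`. One factor `d ⟨ξ⟩^{-p}` is bounded, being below a
single term of the convergent series, and the other, `d² ⟨ξ⟩^{-p}`, is summable. -/
theorem exists_bound_proj (κ : BiInvariantMetric E G)
    {n : ℕ} (Y : Module.Basis (Fin n) ℝ (GroupLieAlgebra 𝓘(ℝ, E) G)) (f : SmoothFun E G) :
    ∃ u : UnitaryDual G → ℝ, Summable u ∧ ∀ c x, ‖proj μ c.rep f x‖ ≤ u c := by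
  obtain ⟨C, p, hC0, hC⟩ := exists_sum_dim_sq_div_le κ Y (G := G)
  obtain ⟨M, hM0, hM⟩ := SmoothFun.exists_bound ((bessel κ Y)^[p] f)
  refine ⟨fun c => C * M * ((c.rep.dim : ℝ) ^ 2 * (bracket κ Y c.rep ^ p)⁻¹), ?_, fun c x => ?_⟩
  · refine Summable.mul_left _ (summable_of_sum_le (c := C) (fun c => ?_) fun S => ?_)
    · have := bracket_pos κ Y c.rep
      positivity
    · exact sum_dual_le κ Y hC S
  · refine (norm_proj_le μ κ Y c.rep p f hM x).trans ?_
    have hb := pow_pos (bracket_pos κ Y c.rep) p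
    have h1 : (c.rep.dim : ℝ) ^ 2 * (bracket κ Y c.rep ^ p)⁻¹ ≤ C := by
      have := hC {c.rep} (by simp)
      simpa using this
    have hd : (1 : ℝ) ≤ c.rep.dim := by exact_mod_cast c.rep.dim_pos
    have h2 : (c.rep.dim : ℝ) * (bracket κ Y c.rep ^ p)⁻¹ ≤ C := by
      refine le_trans ?_ h1
      gcongr
      nlinarith
    calc (c.rep.dim : ℝ) ^ 3 * (M * (bracket κ Y c.rep ^ (2 * p))⁻¹)
        = ((c.rep.dim : ℝ) * (bracket κ Y c.rep ^ p)⁻¹) *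
            (M * ((c.rep.dim : ℝ) ^ 2 * (bracket κ Y c.rep ^ p)⁻¹)) := by
          rw [two_mul, pow_add, mul_inv]; ring
      _ ≤ C * (M * ((c.rep.dim : ℝ) ^ 2 * (bracket κ Y c.rep ^ p)⁻¹)) := by gcongr
      _ = _ := by ring

end Fourier

/-! ### Null families in the test function topology -/

section SmoothTopology

variable {E : Type*} [NormedAddCommGroup E] [NormedSpace ℝ E] [FiniteDimensional ℝ E]
  {G : Type*} [TopologicalSpace G] [ChartedSpace E G] [Group G] [LieGroup 𝓘(ℝ, E) ∞ G]
  [T2Space G]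

/-- The operator `D_{X₁} ⋯ D_{X_k}` on smooth functions. -/
def wordDerivOp : List (GroupLieAlgebra 𝓘(ℝ, E) G) → SmoothFun E G →ₗ[ℂ] SmoothFun E G
  | [] => LinearMap.id
  | X :: w => derivOp X ∘ₗ wordDerivOp w

theorem coe_wordDerivOp (w : List (GroupLieAlgebra 𝓘(ℝ, E) G)) (f : SmoothFun E G) :
    (wordDerivOp w f : G → ℂ) = wordDeriv w f := by
  induction w with
  | nil => rfl
  | cons X w ih =>
    change leftDeriv X (wordDerivOp w f : G → ℂ) = leftDeriv X (wordDeriv w f)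
    rw [ih]

theorem wordDerivOp_append (w w' : List (GroupLieAlgebra 𝓘(ℝ, E) G)) (f : SmoothFun E G) :
    wordDerivOp (w ++ w') f = wordDerivOp w (wordDerivOp w' f) := by
  induction w with
  | nil => rfl
  | cons X w ih =>
    change derivOp X (wordDerivOp (w ++ w') f) = derivOp X (wordDerivOp w (wordDerivOp w' f))
    rw [ih]

/-- The family `F` tends to zero uniformly with all derivatives. -/
def SmoothNull {ι : Type*} (F : ι → SmoothFun E G) (l : Filter ι) : Prop :=
  ∀ w : List (GroupLieAlgebra 𝓘(ℝ, E) G), ∀ ε : ℝ, 0 < ε → ∀ᶠ s in l, ∀ x,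
    ‖wordDerivOp w (F s) x‖ < ε

variable {ι : Type*} {F : ι → SmoothFun E G} {l : Filter ι}

theorem wordDerivOp_translate (w : List (GroupLieAlgebra 𝓘(ℝ, E) G)) (g : G)
    (f : SmoothFun E G) : wordDerivOp w (translate g f) = translate g (wordDerivOp w f) := by
  induction w with
  | nil => rfl
  | cons X w ih =>
    change derivOp X (wordDerivOp w (translate g f)) = translate g (derivOp X (wordDerivOp w f))
    rw [ih, derivOp_translate]

theorem SmoothNull.translate (h : SmoothNull F l) (g : G) :
    SmoothNull (fun s => LieSymbol.translate g (F s)) l := by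
  intro w ε hε
  filter_upwards [h w ε hε] with s hs x
  rw [wordDerivOp_translate]
  exact hs _

theorem SmoothNull.derivOp (h : SmoothNull F l) (X : GroupLieAlgebra 𝓘(ℝ, E) G) :
    SmoothNull (fun s => LieSymbol.derivOp X (F s)) l := by
  intro w ε hε
  filter_upwards [h (w ++ [X]) ε hε] with s hs x
  have := hs x
  rwa [wordDerivOp_append] at this

theorem SmoothNull.mul_left [CompactSpace G] (h : SmoothNull F l) (q : SmoothFun E G) :
    SmoothNull (fun s => q * F s) l := by
  intro w
  induction w using List.reverseRecOn generalizing F q with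
  | nil =>
    intro ε hε
    obtain ⟨M, hM0, hM⟩ := SmoothFun.exists_bound q
    filter_upwards [h [] (ε / (M + 1)) (by positivity)] with s hs x
    have h1 : ‖F s x‖ < ε / (M + 1) := hs x
    change ‖q x * F s x‖ < ε
    rw [norm_mul]
    calc ‖q x‖ * ‖F s x‖ ≤ M * ‖F s x‖ := by gcongr; exact hM x
      _ ≤ (M + 1) * ‖F s x‖ := by gcongr; linarith
      _ < (M + 1) * (ε / (M + 1)) := by gcongr
      _ = ε := by field_simp
  | append_singleton w X ih =>
    intro ε hε
    filter_upwards [ih h (LieSymbol.derivOp X q) (ε / 2) (by positivity),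
      ih (h.derivOp X) q (ε / 2) (by positivity)] with s h1 h2 x
    rw [wordDerivOp_append]
    change ‖wordDerivOp w (LieSymbol.derivOp X (q * F s)) x‖ < ε
    rw [derivOp_mul, map_add, SmoothFun.add_apply]
    refine (norm_add_le _ _).trans_lt ?_
    have := h1 x
    have := h2 x
    linarith

theorem SmoothNull.tendsto (h : SmoothNull F l) : Filter.Tendsto F l (𝓝 0) := by
  rw [nhds_induced, Filter.tendsto_comap_iff, tendsto_pi_nhds]
  intro w
  rw [UniformFun.tendsto_iff_tendstoUniformly, Metric.tendstoUniformly_iff]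
  intro ε hε
  filter_upwards [h w ε hε] with s hs x
  have h0 : wordDeriv w ((0 : SmoothFun E G) : G → ℂ) x = 0 := by
    rw [← coe_wordDerivOp, map_zero]
    rfl
  have h1 : wordDeriv w (F s : G → ℂ) x = wordDerivOp w (F s) x := by rw [← coe_wordDerivOp]
  change dist (wordDeriv w ((0 : SmoothFun E G) : G → ℂ) x) (wordDeriv w (F s : G → ℂ) x) < ε
  rw [h0, h1, dist_zero_left]
  exact hs x

theorem SmoothNull.tendsto_apply (h : SmoothNull F l) (A : SmoothFun E G →L[ℂ] SmoothFun E G)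
    (x : G) : Filter.Tendsto (fun s => A (F s) x) l (𝓝 0) := by
  have h1 : Filter.Tendsto (fun s => A (F s)) l (𝓝 0) := by
    have := (A.continuous.tendsto 0).comp h.tendsto
    rwa [map_zero] at this
  rw [nhds_induced, Filter.tendsto_comap_iff, tendsto_pi_nhds] at h1
  have h2 := h1 []
  rw [UniformFun.tendsto_iff_tendstoUniformly] at h2
  exact h2.tendsto_at x

end SmoothTopology

/-! ### Convergence of Fourier series with all derivatives -/

section FourierSeries

open MeasureTheory
open scoped Matrix Matrix.Norms.L2Operator

variable {E : Type*} [NormedAddCommGroup E] [NormedSpace ℝ E] [FiniteDimensional ℝ E]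
  {G : Type*} [TopologicalSpace G] [ChartedSpace E G] [Group G] [LieGroup 𝓘(ℝ, E) ∞ G]
  [T2Space G] [CompactSpace G] [IsTopologicalGroup G] [SecondCountableTopology G]
  [MeasurableSpace G] [BorelSpace G] (μ : Measure G) [IsProbabilityMeasure μ] [μ.IsHaarMeasure]

theorem integral_proj_mul (c c' : UnitaryDual G) [Decidable (c = c')] (f : SmoothFun E G)
    (k l : Fin c'.rep.dim) :
    ∫ x, proj μ c.rep f x * star (c'.rep.mat x k l) ∂μ =
      if c = c' then coeffInt μ c'.rep k l f else 0 := by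
  have h : ∀ x, proj μ c.rep f x * star (c'.rep.mat x k l) = ∑ i, ∑ j,
      (c.rep.dim * coeffInt μ c.rep i j f) * (c.rep.mat x i j * star (c'.rep.mat x k l)) := by
    intro x
    rw [proj_apply_apply, mul_assoc, Finset.sum_mul, Finset.mul_sum]
    refine Finset.sum_congr rfl fun i _ => ?_
    rw [Finset.sum_mul, Finset.mul_sum]
    exact Finset.sum_congr rfl fun j _ => by ring
  have hi : ∀ i j, Integrable (fun x => (c.rep.dim * coeffInt μ c.rep i j f) *
      (c.rep.mat x i j * star (c'.rep.mat x k l))) μ := fun i j =>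
    (UnitaryRep.integrable_coeff i j k l).const_mul _
  rw [integral_congr_ae (.of_forall h),
    integral_finsetSum _ fun i _ => integrable_finsetSum _ fun j _ => hi i j]
  simp only [integral_finsetSum _ fun j _ => hi _ j, integral_const_mul]
  split_ifs with hc
  · subst hc
    have hd : (c.rep.dim : ℂ) ≠ 0 := Nat.cast_ne_zero.2 c.rep.dim_pos.ne'
    simp only [UnitaryRep.integral_coeff_mul_self]
    rw [Finset.sum_eq_single k, Finset.sum_eq_single l]
    · rw [if_pos ⟨rfl, rfl⟩]
      field_simp
    · intro j _ hj
      rw [if_neg (fun h => hj h.2), mul_zero]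
    · simp
    · intro i _ hik
      exact Finset.sum_eq_zero fun j _ => by rw [if_neg (fun h => hik h.1), mul_zero]
    · simp
  · refine Finset.sum_eq_zero fun i _ => Finset.sum_eq_zero fun j _ => ?_
    rw [UnitaryRep.integral_coeff_mul_eq_zero
      (fun h => hc (UnitaryDual.eq_of_equivalent h)), mul_zero]

theorem integral_mul_star_eq_zero_of_equivalent {g : G → ℂ} (hg : Continuous g)
    {ξ η : UnitaryRep G} (h : ξ.Equivalent η)
    (hη : ∀ i j, ∫ x, g x * star (η.mat x i j) ∂μ = 0) (k l : Fin ξ.dim) :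
    ∫ x, g x * star (ξ.mat x k l) ∂μ = 0 := by
  obtain ⟨M, N, h1, -, h3⟩ := h
  have e : ∀ x, ξ.mat x = M * η.mat x * N := fun x => by
    rw [← h3, Matrix.mul_assoc, h1, Matrix.mul_one]
  have h4 : ∀ x, g x * star (ξ.mat x k l) = ∑ j, ∑ i, (star (M k i) * star (N j l)) *
      (g x * star (η.mat x i j)) := by
    intro x
    rw [e, Matrix.mul_apply, star_sum, Finset.mul_sum]
    refine Finset.sum_congr rfl fun j _ => ?_
    rw [star_mul', Matrix.mul_apply, star_sum, Finset.sum_mul, Finset.mul_sum]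
    refine Finset.sum_congr rfl fun i _ => ?_
    rw [star_mul']
    ring
  have hi : ∀ i j, Integrable (fun x => (star (M k i) * star (N j l)) *
      (g x * star (η.mat x i j))) μ := fun i j =>
    (integrable_of_continuous (hg.mul (η.continuous_mat_apply i j).star)).const_mul _
  rw [integral_congr_ae (.of_forall h4),
    integral_finsetSum _ fun j _ => integrable_finsetSum _ fun i _ => hi i j]
  refine Finset.sum_eq_zero fun j _ => ?_
  rw [integral_finsetSum _ fun i _ => hi i j]
  refine Finset.sum_eq_zero fun i _ => ?_
  rw [integral_const_mul, hη, mul_zero]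

/-- A summable family of positive numbers has a countable index set. Dominated convergence for the
Fourier series requires this. -/
theorem UnitaryDual.countable (κ : BiInvariantMetric E G)
    {n : ℕ} (Y : Module.Basis (Fin n) ℝ (GroupLieAlgebra 𝓘(ℝ, E) G)) :
    Countable (UnitaryDual G) := by
  obtain ⟨C, p, -, hC⟩ := exists_sum_dim_sq_div_le κ Y (G := G)
  have hpos : ∀ c : UnitaryDual G, 0 < (c.rep.dim : ℝ) ^ 2 * (bracket κ Y c.rep ^ p)⁻¹ := by
    intro c
    have := bracket_pos κ Y c.rep
    have h1 : (0 : ℝ) < c.rep.dim := Nat.cast_pos.2 c.rep.dim_pos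
    positivity
  have hs : Summable fun c : UnitaryDual G => (c.rep.dim : ℝ) ^ 2 * (bracket κ Y c.rep ^ p)⁻¹ :=
    summable_of_sum_le (fun c => (hpos c).le) fun S => sum_dual_le κ Y hC S
  have h := hs.countable_support
  rw [Function.support_eq_univ fun c => (hpos c).ne'] at h
  exact Set.countable_univ_iff.1 h

/-- The Fourier series of a smooth function converges uniformly. -/
theorem tendstoUniformly_proj (κ : BiInvariantMetric E G)
    {n : ℕ} (Y : Module.Basis (Fin n) ℝ (GroupLieAlgebra 𝓘(ℝ, E) G)) (f : SmoothFun E G) :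
    TendstoUniformly (fun (S : Finset (UnitaryDual G)) x => ∑ c ∈ S, proj μ c.rep f x) f
      Filter.atTop := by
  classical
  obtain ⟨u, hu, hfu⟩ := exists_bound_proj μ κ Y f
  have h := tendstoUniformly_tsum hu hfu
  have hcont : Continuous fun x => ∑' c : UnitaryDual G, proj μ c.rep f x :=
    continuous_tsum (fun c => (proj μ c.rep f).continuous) hu hfu
  -- The series converges uniformly to some continuous function. That function and `f` have the same
  -- Fourier coefficients, hence they agree.
  suffices hz : (fun x => (∑' c : UnitaryDual G, proj μ c.rep f x) - f x) = 0 by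
    have : (fun x => ∑' c : UnitaryDual G, proj μ c.rep f x) = f :=
      funext fun x => sub_eq_zero.1 (congrFun hz x)
    rwa [this] at h
  have hc2 : Continuous fun x => (∑' c : UnitaryDual G, proj μ c.rep f x) - f x :=
    hcont.sub f.continuous
  refine eq_zero_of_fourier_eq_zero μ hc2 fun ζ i j => ?_
  obtain ⟨c', hc'⟩ := UnitaryDual.exists_equivalent ζ
  refine integral_mul_star_eq_zero_of_equivalent μ hc2 hc' (fun k l => ?_) i j
  have h1 : HasSum (fun c : UnitaryDual G => ∫ x, proj μ c.rep f x * star (c'.rep.mat x k l) ∂μ)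
      (∫ x, ∑' c : UnitaryDual G, proj μ c.rep f x * star (c'.rep.mat x k l) ∂μ) := by
    have hb : ∀ (c : UnitaryDual G) x, ‖proj μ c.rep f x * star (c'.rep.mat x k l)‖ ≤ u c := by
      intro c x
      rw [norm_mul, norm_star]
      exact (mul_le_of_le_one_right (norm_nonneg _)
        (entry_norm_bound_of_unitary (c'.rep.toHom x).2 k l)).trans (hfu c x)
    have hi : ∀ c : UnitaryDual G,
        Integrable (fun x => proj μ c.rep f x * star (c'.rep.mat x k l)) μ := fun c =>
      integrable_of_continuous ((proj μ c.rep f).continuous.mul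
        (c'.rep.continuous_mat_apply k l).star)
    have := UnitaryDual.countable κ Y (G := G)
    refine hasSum_integral_of_dominated_convergence (fun c _ => u c)
      (fun c => (hi c).aestronglyMeasurable) (fun c => .of_forall (hb c)) (.of_forall fun _ => hu)
      (integrable_const _) (.of_forall fun x => ?_)
    exact (Summable.of_norm_bounded hu fun c => hb c x).hasSum
  have h2 : ∫ x, (∑' c : UnitaryDual G, proj μ c.rep f x) * star (c'.rep.mat x k l) ∂μ =
      coeffInt μ c'.rep k l f := by
    simp only [← tsum_mul_right]
    rw [← h1.tsum_eq, tsum_eq_single c' fun c hc => by rw [integral_proj_mul, if_neg hc],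
      integral_proj_mul, if_pos rfl]
  have h3 : ∀ x, ((∑' c : UnitaryDual G, proj μ c.rep f x) - f x) * star (c'.rep.mat x k l) =
    (∑' c : UnitaryDual G, proj μ c.rep f x) * star (c'.rep.mat x k l) -
      f x * star (c'.rep.mat x k l) := fun x => sub_mul _ _ _
  have i1 : Integrable (fun x => (∑' c : UnitaryDual G, proj μ c.rep f x) *
      star (c'.rep.mat x k l)) μ :=
    integrable_of_continuous (hcont.mul (c'.rep.continuous_mat_apply k l).star)
  have i2 : Integrable (fun x => f x * star (c'.rep.mat x k l)) μ :=
    integrable_of_continuous (f.continuous.mul (c'.rep.continuous_mat_apply k l).star)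
  rw [integral_congr_ae (.of_forall h3), integral_sub i1 i2, h2, coeffInt_apply, sub_self]

/-- The Fourier series of a smooth function converges with all derivatives. -/
theorem smoothNull_fourier (κ : BiInvariantMetric E G)
    {n : ℕ} (Y : Module.Basis (Fin n) ℝ (GroupLieAlgebra 𝓘(ℝ, E) G)) (f : SmoothFun E G) :
    SmoothNull (fun S : Finset (UnitaryDual G) => f - ∑ c ∈ S, proj μ c.rep f) Filter.atTop := by
  intro w ε hε
  have hw : ∀ ξ : UnitaryRep G, wordDerivOp w (proj μ ξ f) = proj μ ξ (wordDerivOp w f) := by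
    intro ξ
    induction w with
    | nil => rfl
    | cons X w ih =>
      change LieSymbol.derivOp X (wordDerivOp w (proj μ ξ f)) =
        proj μ ξ (LieSymbol.derivOp X (wordDerivOp w f))
      rw [ih, derivOp_proj]
  have h := tendstoUniformly_proj μ κ Y (wordDerivOp w f)
  rw [Metric.tendstoUniformly_iff] at h
  filter_upwards [h ε hε] with S hS x
  have := hS x
  rw [dist_eq_norm] at this
  rw [map_sub, map_sum, SmoothFun.sub_apply, SmoothFun.sum_apply]
  simp only [hw]
  exact this

end FourierSeries

/-! ### Derivative bounds of geometric growth -/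

section ScaledBounds

open scoped Matrix Matrix.Norms.L2Operator

variable {E : Type*} [NormedAddCommGroup E] [NormedSpace ℝ E] [FiniteDimensional ℝ E]
  {G : Type*} [TopologicalSpace G] [ChartedSpace E G] [Group G] [LieGroup 𝓘(ℝ, E) ∞ G]
  [T2Space G] (κ : BiInvariantMetric E G)
  {n : ℕ} (Y : Module.Basis (Fin n) ℝ (GroupLieAlgebra 𝓘(ℝ, E) G))

/-- Every derivative of `f` of order `j ≤ k` is bounded by `M s ^ j`. -/
def ScaledBound (s : ℝ) (k : ℕ) (f : SmoothFun E G) (M : ℝ) : Prop :=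
  ∀ w : List (Fin n), w.length ≤ k → ∀ x, ‖wordOp Y w f x‖ ≤ M * s ^ w.length

variable {Y}

theorem ScaledBound.wordOp {s M : ℝ} {k l : ℕ} {f : SmoothFun E G} (h : ScaledBound Y s l f M)
    (w : List (Fin n)) (hk : k + w.length ≤ l) :
    ScaledBound Y s k (wordOp Y w f) (M * s ^ w.length) := by
  intro w' hw' x
  rw [← wordOp_append]
  refine (h _ (by simp; omega) x).trans_eq ?_
  rw [List.length_append, pow_add]
  ring

/-- Leibniz' rule and the binomial theorem: the scales add, with no constant depending on the number
of derivatives. -/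
theorem ScaledBound.mul {s₁ s₂ M₁ M₂ : ℝ} {k : ℕ} {f g : SmoothFun E G}
    (hf : ScaledBound Y s₁ k f M₁) (hg : ScaledBound Y s₂ k g M₂) :
    ScaledBound Y (s₁ + s₂) k (f * g) (M₁ * M₂) := by
  intro w hw
  induction w using List.reverseRecOn generalizing f g M₁ M₂ k with
  | nil =>
    intro x
    have h1 := hf [] (by simp) x
    have h2 := hg [] (by simp) x
    simp only [List.length_nil, pow_zero, mul_one] at h1 h2 ⊢
    change ‖f x * g x‖ ≤ _
    rw [norm_mul]
    exact mul_le_mul h1 h2 (norm_nonneg _) ((norm_nonneg _).trans h1)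
  | append_singleton w j ih =>
    intro x
    rw [List.length_append, List.length_singleton] at hw ⊢
    rw [wordOp_append]
    change ‖LieSymbol.wordOp Y w (derivOp (Y j) (f * g)) x‖ ≤ _
    rw [derivOp_mul, map_add, SmoothFun.add_apply]
    obtain ⟨k, rfl⟩ : ∃ k', k = k' + 1 := ⟨k - 1, by omega⟩
    have h1 := ih (k := k) (hf.wordOp (k := k) [j] (by simp))
      (fun w hw => hg w (by omega)) (by omega) x
    have h2 := ih (k := k) (f := f) (fun w hw => hf w (by omega))
      (hg.wordOp (k := k) [j] (by simp)) (by omega) x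
    refine (norm_add_le _ _).trans ((add_le_add h1 h2).trans_eq ?_)
    rw [List.length_singleton]
    ring

variable (Y)

theorem exists_scaledBound_bessel : ∃ C : ℝ, 0 ≤ C ∧ ∀ (s M : ℝ) (k : ℕ) (f : SmoothFun E G),
    1 ≤ s → ScaledBound Y s (k + 2) f M → ScaledBound Y s k (bessel κ Y f) (C * s ^ 2 * M) := by
  refine ⟨1 + ∑ i, ∑ j, |(gramMatrix κ Y)⁻¹ i j|, by positivity, fun s M k f hs h w hw x => ?_⟩
  have hM : 0 ≤ M := by simpa using (norm_nonneg _).trans (h [] (by simp) x)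
  have h1 : wordOp Y w (bessel κ Y f) x = wordOp Y w f x - ∑ i, ∑ j,
      (((gramMatrix κ Y)⁻¹ i j : ℝ) : ℂ) * wordOp Y (w ++ [i, j]) f x := by
    have : bessel κ Y f = f - ∑ i, ∑ j, (((gramMatrix κ Y)⁻¹ i j : ℝ) : ℂ) •
        wordOp Y [i, j] f := by
      simp only [bessel, lapOp, LinearMap.sub_apply, LinearMap.sum_apply, LinearMap.smul_apply]
      rfl
    rw [this, map_sub, SmoothFun.sub_apply]
    simp only [map_sum, map_smul, SmoothFun.sum_apply, SmoothFun.smul_apply, wordOp_append]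
  have h2 : ∀ i j, ‖(((gramMatrix κ Y)⁻¹ i j : ℝ) : ℂ) * wordOp Y (w ++ [i, j]) f x‖ ≤
      |(gramMatrix κ Y)⁻¹ i j| * (M * s ^ (w.length + 2)) := by
    intro i j
    rw [norm_mul, Complex.norm_real, Real.norm_eq_abs]
    refine mul_le_mul_of_nonneg_left ?_ (abs_nonneg _)
    have := h (w ++ [i, j]) (by simp; omega) x
    simpa using this
  have h3 : ‖wordOp Y w f x‖ ≤ M * s ^ (w.length + 2) := by
    refine (h w (by omega) x).trans ?_
    gcongr
    omega
  rw [h1]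
  calc _ ≤ M * s ^ (w.length + 2) +
        ∑ i, ∑ j, |(gramMatrix κ Y)⁻¹ i j| * (M * s ^ (w.length + 2)) := by
        refine (norm_sub_le _ _).trans (add_le_add h3 ?_)
        refine (norm_sum_le _ _).trans (Finset.sum_le_sum fun i _ => ?_)
        exact (norm_sum_le _ _).trans (Finset.sum_le_sum fun j _ => h2 i j)
    _ = _ := by
        simp only [← Finset.sum_mul]
        ring

theorem exists_norm_bessel_pow_le (K : ℕ) : ∃ C : ℝ, 0 ≤ C ∧
    ∀ (s M : ℝ) (f : SmoothFun E G), 1 ≤ s → ScaledBound Y s (2 * K) f M →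
      ∀ x, ‖((bessel κ Y)^[K] f) x‖ ≤ C * s ^ (2 * K) * M := by
  obtain ⟨C, hC0, hC⟩ := exists_scaledBound_bessel κ Y
  refine ⟨C ^ K, by positivity, fun s M f hs hf => ?_⟩
  induction K generalizing f M with
  | zero =>
    intro x
    simpa using hf [] (by simp) x
  | succ K ih =>
    intro x
    rw [Function.iterate_succ_apply]
    refine (ih (C * s ^ 2 * M) (bessel κ Y f) (hC s M (2 * K) f hs (by rwa [mul_add] at hf))
      x).trans_eq ?_
    ring

theorem wordOp_conjFun (w : List (Fin n)) (f : SmoothFun E G) :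
    wordOp Y w (conjFun f) = conjFun (wordOp Y w f) := by
  induction w with
  | nil => rfl
  | cons j w ih =>
    change derivOp (Y j) (wordOp Y w (conjFun f)) = conjFun (derivOp (Y j) (wordOp Y w f))
    rw [ih, derivOp_conjFun]

end ScaledBounds

/-- Cauchy–Schwarz for the Hilbert–Schmidt product; each Hilbert–Schmidt norm is at most `√d` times
the operator norm. -/
theorem norm_sum_mul_star_le {d : ℕ} (M N : Matrix (Fin d) (Fin d) ℂ) :
    ‖∑ i, ∑ j, M i j * star (N i j)‖ ≤ d * (opNorm M * opNorm N) := by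
  open scoped Matrix.Norms.L2Operator in
  have hs : ∀ M : Matrix (Fin d) (Fin d) ℂ, ∑ p : Fin d × Fin d, ‖M p.1 p.2‖ ^ 2 ≤
      d * opNorm M ^ 2 := by
    intro M
    rw [Fintype.sum_prod_type, opNorm_eq_norm]
    exact sum_sq_norm_le M
  rw [← Fintype.sum_prod_type' (f := fun i j => M i j * star (N i j))]
  have h1 : ‖∑ p : Fin d × Fin d, M p.1 p.2 * star (N p.1 p.2)‖ ≤
      ∑ p : Fin d × Fin d, ‖M p.1 p.2‖ * ‖N p.1 p.2‖ :=
    (norm_sum_le _ _).trans_eq (Finset.sum_congr rfl fun p _ => by rw [norm_mul, norm_star])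
  have h2 := Finset.sum_mul_sq_le_sq_mul_sq Finset.univ (fun p : Fin d × Fin d => ‖M p.1 p.2‖)
    (fun p => ‖N p.1 p.2‖)
  have hM0 : 0 ≤ opNorm M := norm_nonneg _
  have hN0 : 0 ≤ opNorm N := norm_nonneg _
  refine h1.trans (abs_le_of_sq_le_sq' ?_ (by positivity)).2
  calc _ ≤ _ := h2
    _ ≤ (d * opNorm M ^ 2) * (d * opNorm N ^ 2) :=
        mul_le_mul (hs M) (hs N) (by positivity) (by positivity)
    _ = _ := by ring

/-! ### Densities of isotypic parts and integration by parts -/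

section FunctionalEstimate

open MeasureTheory

variable {E : Type*} [NormedAddCommGroup E] [NormedSpace ℝ E] [FiniteDimensional ℝ E]
  {G : Type*} [TopologicalSpace G] [ChartedSpace E G] [Group G] [LieGroup 𝓘(ℝ, E) ∞ G]
  [T2Space G] [CompactSpace G]

/-- The values of a functional on the matrix coefficients of a representation. -/
def repMat (τ : SmoothFun E G →ₗ[ℂ] ℂ) (ζ : UnitaryRep G) : Matrix (Fin ζ.dim) (Fin ζ.dim) ℂ :=
  Matrix.of fun i j => τ (ζ.coeffFun E i j)

/-- The smooth density of the `ζ`-isotypic part of a functional. -/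
def density (τ : SmoothFun E G →ₗ[ℂ] ℂ) (ζ : UnitaryRep G) : SmoothFun E G :=
  (ζ.dim : ℂ) • ∑ i, ∑ j, repMat τ ζ i j • conjFun (ζ.coeffFun E i j)

theorem density_apply (τ : SmoothFun E G →ₗ[ℂ] ℂ) (ζ : UnitaryRep G) (x : G) :
    density τ ζ x = ζ.dim * ∑ i, ∑ j, repMat τ ζ i j * star (ζ.mat x i j) := by
  simp only [density, SmoothFun.smul_apply, SmoothFun.sum_apply, conjFun_apply,
    UnitaryRep.coeffFun_apply]

theorem wordOp_density {n : ℕ} (Y : Module.Basis (Fin n) ℝ (GroupLieAlgebra 𝓘(ℝ, E) G))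
    (w : List (Fin n)) (τ : SmoothFun E G →ₗ[ℂ] ℂ) (ζ : UnitaryRep G) (x : G) :
    wordOp Y w (density τ ζ) x =
      ζ.dim * ∑ i, ∑ j, repMat τ ζ i j * star ((ζ.mat x * ζ.wordMat Y w) i j) := by
  simp only [density, map_smul, map_sum, SmoothFun.smul_apply, SmoothFun.sum_apply, wordOp_conjFun,
    conjFun_apply, UnitaryRep.wordOp_coeffFun_apply]

open scoped Matrix.Norms.L2Operator in
theorem norm_wordOp_density_le (κ : BiInvariantMetric E G) {n : ℕ}
    (Y : Module.Basis (Fin n) ℝ (GroupLieAlgebra 𝓘(ℝ, E) G)) {C : ℝ} (hC : 1 ≤ C)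
    {ζ : UnitaryRep G} (h : ∀ j : Fin n, ‖ζ.deriv (Y j)‖ ≤ C * bracket κ Y ζ)
    (w : List (Fin n)) (τ : SmoothFun E G →ₗ[ℂ] ℂ) (x : G) :
    ‖wordOp Y w (density τ ζ) x‖ ≤
      (ζ.dim : ℝ) ^ 2 * opNorm (repMat τ ζ) * (C * bracket κ Y ζ) ^ w.length := by
  rw [wordOp_density, norm_mul, Complex.norm_natCast]
  have h1 : opNorm (ζ.mat x * ζ.wordMat Y w) ≤ (C * bracket κ Y ζ) ^ w.length := by
    rw [opNorm_eq_norm]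
    calc _ ≤ ‖ζ.mat x‖ * ‖ζ.wordMat Y w‖ := norm_mul_le _ _
      _ ≤ 1 * ‖ζ.wordMat Y w‖ := by gcongr; exact ζ.norm_mat_le x
      _ ≤ _ := by rw [one_mul]; exact UnitaryRep.norm_wordMat_le κ Y hC h w
  have h0 : 0 ≤ opNorm (repMat τ ζ) := norm_nonneg _
  calc _ ≤ (ζ.dim : ℝ) * (ζ.dim * (opNorm (repMat τ ζ) * opNorm (ζ.mat x * ζ.wordMat Y w))) := by
        gcongr
        exact norm_sum_mul_star_le _ _
    _ ≤ (ζ.dim : ℝ) * (ζ.dim * (opNorm (repMat τ ζ) * (C * bracket κ Y ζ) ^ w.length)) := by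
        gcongr
    _ = _ := by ring

variable [IsTopologicalGroup G] [SecondCountableTopology G]
  [MeasurableSpace G] [BorelSpace G] (μ : Measure G) [IsProbabilityMeasure μ] [μ.IsHaarMeasure]

theorem apply_proj (τ : SmoothFun E G →ₗ[ℂ] ℂ) (ζ : UnitaryRep G) (g : SmoothFun E G) :
    τ (proj μ ζ g) = ∫ x, density τ ζ x * g x ∂μ := by
  have h : ∀ x, density τ ζ x * g x = ∑ i, ∑ j, (ζ.dim * repMat τ ζ i j) *
      (g x * star (ζ.mat x i j)) := by
    intro x
    rw [density_apply, mul_assoc, Finset.sum_mul, Finset.mul_sum]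
    refine Finset.sum_congr rfl fun i _ => ?_
    rw [Finset.sum_mul, Finset.mul_sum]
    exact Finset.sum_congr rfl fun j _ => by ring
  have hi : ∀ i j, Integrable (fun x => (ζ.dim * repMat τ ζ i j) *
      (g x * star (ζ.mat x i j))) μ := fun i j =>
    (integrable_of_continuous (g.continuous.mul (ζ.continuous_mat_apply i j).star)).const_mul _
  rw [integral_congr_ae (.of_forall h),
    integral_finsetSum _ fun i _ => integrable_finsetSum _ fun j _ => hi i j, proj_apply]
  simp only [map_smul, map_sum, smul_eq_mul, Finset.mul_sum]
  refine Finset.sum_congr rfl fun i _ => ?_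
  rw [integral_finsetSum _ fun j _ => hi i j]
  refine Finset.sum_congr rfl fun j _ => ?_
  rw [integral_const_mul, ← coeffInt_apply]
  simp only [repMat, Matrix.of_apply]
  ring

theorem norm_integral_le_of_bound {f : G → ℂ} {M : ℝ} (h : ∀ x, ‖f x‖ ≤ M) :
    ‖∫ x, f x ∂μ‖ ≤ M := by
  simpa using norm_integral_le_of_norm_le_const (μ := μ) (f := f) (.of_forall h)

/-- A functional against an oscillating sum, after integration by parts. -/
theorem norm_integral_mul_sum_le (κ : BiInvariantMetric E G) {n : ℕ}
    (Y : Module.Basis (Fin n) ℝ (GroupLieAlgebra 𝓘(ℝ, E) G)) (ξ : UnitaryRep G) {ι : Type*}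
    [Fintype ι] {e h : ι → SmoothFun E G}
    (he : ∀ k, lapOp κ Y (e k) = (-lapEigenvalue κ Y ξ : ℂ) • e k) (t : SmoothFun E G) (K : ℕ)
    {B : ℝ} (hB : ∀ z, ‖((bessel κ Y)^[K] (t * ∑ k, e k z • h k)) z‖ ≤ B) :
    ‖∫ x, t x * (∑ k, e k * h k) x ∂μ‖ ≤ B * (bracket κ Y ξ ^ (2 * K))⁻¹ := by
  have hb : 0 < bracket κ Y ξ ^ (2 * K) := pow_pos (bracket_pos κ Y ξ) _
  have h1 : ∀ x, t x * (∑ k, e k * h k) x = ∑ k, e k x * (t * h k) x := by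
    intro x
    rw [SmoothFun.sum_apply, Finset.mul_sum]
    refine Finset.sum_congr rfl fun k _ => ?_
    rw [SmoothFun.mul_apply, SmoothFun.mul_apply]
    ring
  have i1 : ∀ k, Integrable (fun x => e k x * (t * h k) x) μ := fun k =>
    SmoothFun.integrable (e k * (t * h k))
  have i2 : ∀ k, Integrable (fun x => e k x * ((bessel κ Y)^[K] (t * h k)) x) μ := fun k =>
    SmoothFun.integrable (e k * (bessel κ Y)^[K] (t * h k))
  have h2 : ((bracket κ Y ξ ^ (2 * K) : ℝ) : ℂ) * ∫ x, t x * (∑ k, e k * h k) x ∂μ =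
      ∫ x, ∑ k, e k x * ((bessel κ Y)^[K] (t * h k)) x ∂μ := by
    rw [integral_congr_ae (.of_forall h1), integral_finsetSum _ fun k _ => i1 k,
      integral_finsetSum _ fun k _ => i2 k, Finset.mul_sum]
    exact Finset.sum_congr rfl fun k _ => (integral_mul_bessel_pow μ κ Y ξ (he k) K _).symm
  -- With the values of `e_k` frozen at `z`, the operator `(1 - 𝓛)^K` acts only on the slowly
  -- varying factors. Keeping the sum over `k` inside avoids a loss in the dimension.
  have h3 : ∀ z, ∑ k, e k z * ((bessel κ Y)^[K] (t * h k)) z =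
      ((bessel κ Y)^[K] (t * ∑ k, e k z • h k)) z := by
    intro z
    rw [← Module.End.coe_pow, Finset.mul_sum, map_sum, SmoothFun.sum_apply]
    refine Finset.sum_congr rfl fun k _ => ?_
    rw [mul_smul_comm, map_smul, SmoothFun.smul_apply]
  have h4 : ‖∫ x, ∑ k, e k x * ((bessel κ Y)^[K] (t * h k)) x ∂μ‖ ≤ B :=
    norm_integral_le_of_bound μ fun z => by rw [h3]; exact hB z
  rw [← h2, norm_mul, Complex.norm_real, Real.norm_of_nonneg hb.le] at h4
  rwa [← div_eq_mul_inv, le_div_iff₀ hb, mul_comm]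

end FunctionalEstimate

/-! ### Splitting into low and high frequencies -/

section OscillatoryEstimate

open MeasureTheory

variable {E : Type*} [NormedAddCommGroup E] [NormedSpace ℝ E] [FiniteDimensional ℝ E]
  {G : Type*} [TopologicalSpace G] [ChartedSpace E G] [Group G] [LieGroup 𝓘(ℝ, E) ∞ G]
  [T2Space G] [CompactSpace G] [IsTopologicalGroup G] [SecondCountableTopology G]
  [MeasurableSpace G] [BorelSpace G] (μ : Measure G) [IsProbabilityMeasure μ] [μ.IsHaarMeasure]

/-- A functional whose Fourier coefficients decay, evaluated at a product of matrix coefficients of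
`ξ` and slowly varying functions: low frequencies are treated by integration by parts, high
frequencies by absolute convergence. -/
theorem exists_norm_functional_le (κ : BiInvariantMetric E G) {n : ℕ}
    (Y : Module.Basis (Fin n) ℝ (GroupLieAlgebra 𝓘(ℝ, E) G)) : ∃ p : ℕ, ∀ K : ℕ, ∃ C : ℝ, 0 ≤ C ∧
    ∀ (τ : SmoothFun E G →ₗ[ℂ] ℂ),
      (∀ f, Filter.Tendsto (fun S : Finset (UnitaryDual G) => τ (f - ∑ c ∈ S, proj μ c.rep f))
        Filter.atTop (𝓝 0)) →
    ∀ (ξ : UnitaryRep G) (d : ℕ) (e h : Fin d → SmoothFun E G) (A₀ σ M s R : ℝ),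
      (p : ℝ) ≤ σ → 0 ≤ A₀ → 1 ≤ s → 1 ≤ R →
      (∀ k, lapOp κ Y (e k) = (-lapEigenvalue κ Y ξ : ℂ) • e k) →
      (∀ ζ, opNorm (repMat τ ζ) ≤ A₀ * bracket κ Y ζ ^ (-σ)) →
      (∀ z, ScaledBound Y s (2 * K) (∑ k, e k z • h k) M) →
      ‖τ (∑ k, e k * h k)‖ ≤
        C * A₀ * M * (R ^ (p - σ) + ((R + s) / bracket κ Y ξ) ^ (2 * K)) := by
  classical
  obtain ⟨Cp, p, hCp0, hCp⟩ := exists_sum_dim_sq_div_le κ Y (G := G)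
  obtain ⟨C₁, hC₁, hd⟩ := exists_norm_deriv_le κ Y (G := G)
  refine ⟨p, fun K => ?_⟩
  obtain ⟨CK, hCK0, hCK⟩ := exists_norm_bessel_pow_le κ Y K
  refine ⟨Cp + CK * C₁ ^ (2 * K) * Cp, by positivity, ?_⟩
  intro τ hτ ξ d e h A₀ σ M s R hpσ hA₀ hs hR he hT hh
  set g := ∑ k, e k * h k with hg
  have hM : 0 ≤ M := by simpa using (norm_nonneg _).trans (hh 1 [] (by simp) 1)
  have hgM : ∀ z, ‖g z‖ ≤ M := by
    intro z
    have h1 := hh z [] (by simp) z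
    have h2 : g z = (∑ k, e k z • h k) z := by
      simp only [hg, SmoothFun.sum_apply, SmoothFun.mul_apply, SmoothFun.smul_apply]
    rw [h2]
    simpa using h1
  have hbr : ∀ ζ : UnitaryRep G, bracket κ Y ζ ^ (-σ) ≤ (bracket κ Y ζ ^ p)⁻¹ := by
    intro ζ
    rw [← Real.rpow_natCast, ← Real.rpow_neg (bracket_pos κ Y ζ).le]
    exact Real.rpow_le_rpow_of_exponent_le (one_le_bracket κ Y ζ) (by linarith)
  have hden : ∀ (c : UnitaryDual G) (w : List (Fin n)) (x : G),
      ‖wordOp Y w (density τ c.rep) x‖ ≤ (c.rep.dim : ℝ) ^ 2 * (A₀ * bracket κ Y c.rep ^ (-σ)) *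
        (C₁ * bracket κ Y c.rep) ^ w.length := by
    intro c w x
    refine (norm_wordOp_density_le κ Y hC₁ (hd c.rep) w τ x).trans ?_
    have := bracket_pos κ Y c.rep
    gcongr
    exact hT _
  have hpart : ∀ S : Finset (UnitaryDual G), ‖τ (∑ c ∈ S, proj μ c.rep g)‖ ≤
      (Cp + CK * C₁ ^ (2 * K) * Cp) * A₀ * M *
        (R ^ (p - σ) + ((R + s) / bracket κ Y ξ) ^ (2 * K)) := by
    intro S
    rw [← Finset.sum_filter_add_sum_filter_not S (fun c => bracket κ Y c.rep ≤ R), map_add]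
    -- Below `R` the functional has a smooth density whose derivatives grow like powers of `C₁ R`.
    -- Multiplied by factors of scale `s`, it has scale at most `C₁ (R + s)`, and `K` integrations
    -- by parts against `ξ` divide by `⟨ξ⟩^{2K}`.
    have hlow : ‖τ (∑ c ∈ S with bracket κ Y c.rep ≤ R, proj μ c.rep g)‖ ≤
        CK * (C₁ * (R + s)) ^ (2 * K) * (Cp * A₀ * M) * (bracket κ Y ξ ^ (2 * K))⁻¹ := by
      set t := ∑ c ∈ S with bracket κ Y c.rep ≤ R, density τ c.rep with ht
      have h1 : τ (∑ c ∈ S with bracket κ Y c.rep ≤ R, proj μ c.rep g) = ∫ x, t x * g x ∂μ := by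
        have h2 : ∀ x, t x * g x = ∑ c ∈ S with bracket κ Y c.rep ≤ R, density τ c.rep x * g x :=
          fun x => by rw [ht, SmoothFun.sum_apply, Finset.sum_mul]
        have i1 : ∀ c : UnitaryDual G, Integrable (fun x => density τ c.rep x * g x) μ := fun c =>
          SmoothFun.integrable (density τ c.rep * g)
        rw [integral_congr_ae (.of_forall h2), integral_finsetSum _ fun c _ => i1 c, map_sum]
        exact Finset.sum_congr rfl fun c _ => apply_proj μ τ c.rep g
      have h2 : ScaledBound Y (C₁ * R) (2 * K) t (Cp * A₀) := by
        intro w _ x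
        rw [ht, map_sum, SmoothFun.sum_apply]
        calc _ ≤ ∑ c ∈ S with bracket κ Y c.rep ≤ R,
              (c.rep.dim : ℝ) ^ 2 * (bracket κ Y c.rep ^ p)⁻¹ * (A₀ * (C₁ * R) ^ w.length) := by
              refine (norm_sum_le _ _).trans (Finset.sum_le_sum fun c hc => ?_)
              refine (hden c w x).trans ?_
              have hb := bracket_pos κ Y c.rep
              have hR' := (Finset.mem_filter.1 hc).2
              calc _ ≤ (c.rep.dim : ℝ) ^ 2 * (A₀ * (bracket κ Y c.rep ^ p)⁻¹) *
                    (C₁ * R) ^ w.length := by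
                    gcongr
                    exact hbr _
                _ = _ := by ring
          _ ≤ Cp * (A₀ * (C₁ * R) ^ w.length) := by
              rw [← Finset.sum_mul]
              gcongr
              exact sum_dual_le κ Y hCp _
          _ = _ := by ring
      rw [h1]
      refine norm_integral_mul_sum_le μ κ Y ξ he t K fun z => ?_
      have h3 := (hCK _ _ _ (by nlinarith) (h2.mul (hh z)) z)
      refine h3.trans ?_
      have : C₁ * R + s ≤ C₁ * (R + s) := by nlinarith
      gcongr
    have hhigh : ‖τ (∑ c ∈ S with ¬ bracket κ Y c.rep ≤ R, proj μ c.rep g)‖ ≤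
        Cp * (A₀ * R ^ (p - σ) * M) := by
      rw [map_sum]
      calc _ ≤ ∑ c ∈ S with ¬ bracket κ Y c.rep ≤ R,
            (c.rep.dim : ℝ) ^ 2 * (bracket κ Y c.rep ^ p)⁻¹ * (A₀ * R ^ (p - σ) * M) := by
            refine (norm_sum_le _ _).trans (Finset.sum_le_sum fun c hc => ?_)
            have hR' := not_le.1 (Finset.mem_filter.1 hc).2
            have hb := bracket_pos κ Y c.rep
            -- Above `R` the weight is split as `⟨ζ⟩^{-p} ⟨ζ⟩^{p - σ}`: the first factor makes the
            -- series converge, the second is at most `R^{p - σ}` because `p ≤ σ`.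
            have h1 : bracket κ Y c.rep ^ (-σ) ≤ (bracket κ Y c.rep ^ p)⁻¹ * R ^ (p - σ) := by
              have : bracket κ Y c.rep ^ (-σ) =
                  (bracket κ Y c.rep ^ p)⁻¹ * bracket κ Y c.rep ^ (p - σ) := by
                rw [← Real.rpow_natCast, ← Real.rpow_neg hb.le, ← Real.rpow_add hb]
                congr 1
                ring
              rw [this]
              gcongr ?_ * ?_
              exact Real.rpow_le_rpow_of_nonpos (by linarith) hR'.le (by linarith)
            rw [apply_proj μ]
            refine norm_integral_le_of_bound μ fun x => ?_
            rw [norm_mul]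
            have h2 := hden c [] x
            simp only [List.length_nil, pow_zero, mul_one] at h2
            calc _ ≤ (c.rep.dim : ℝ) ^ 2 * (A₀ * ((bracket κ Y c.rep ^ p)⁻¹ * R ^ (p - σ))) * M := by
                  refine mul_le_mul (h2.trans ?_) (hgM x) (norm_nonneg _) (by positivity)
                  gcongr
              _ = _ := by ring
        _ ≤ _ := by
            rw [← Finset.sum_mul]
            gcongr
            exact sum_dual_le κ Y hCp _
    refine (norm_add_le _ _).trans ((add_le_add hlow hhigh).trans ?_)
    have hb := bracket_pos κ Y ξ
    have hx : 0 ≤ ((R + s) / bracket κ Y ξ) ^ (2 * K) := by positivity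
    have hy : 0 ≤ R ^ ((p : ℝ) - σ) := by positivity
    have e1 : CK * (C₁ * (R + s)) ^ (2 * K) * (Cp * A₀ * M) * (bracket κ Y ξ ^ (2 * K))⁻¹ =
        CK * C₁ ^ (2 * K) * Cp * A₀ * M * ((R + s) / bracket κ Y ξ) ^ (2 * K) := by
      rw [mul_pow, div_pow]
      ring
    rw [e1]
    have h3 : 0 ≤ Cp * A₀ * M * ((R + s) / bracket κ Y ξ) ^ (2 * K) := by positivity
    have h4 : 0 ≤ CK * C₁ ^ (2 * K) * Cp * A₀ * M * R ^ ((p : ℝ) - σ) := by positivity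
    linarith
  -- The bound on partial sums is independent of `S`, so it passes to the limit.
  have hlim : Filter.Tendsto (fun S : Finset (UnitaryDual G) => τ (∑ c ∈ S, proj μ c.rep g))
      Filter.atTop (𝓝 (τ g)) := by
    have h1 := (tendsto_const_nhds (x := τ g)).sub (hτ g)
    rw [sub_zero] at h1
    refine h1.congr fun S => ?_
    rw [map_sub, sub_sub_cancel]
  exact le_of_tendsto hlim.norm (.of_forall hpart)

end OscillatoryEstimate

/-! ### The exact expansion of the symbol of a product -/

section SymbolCalculus

variable {E : Type*} [NormedAddCommGroup E] [NormedSpace ℝ E] [FiniteDimensional ℝ E]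
  {G : Type*} [TopologicalSpace G] [ChartedSpace E G] [Group G] [LieGroup 𝓘(ℝ, E) ∞ G]
  [T2Space G] [CompactSpace G]

theorem UnitaryRep.adjCoeff_eq_invOp (ξ : UnitaryRep G) (i j : Fin ξ.dim) :
    ξ.adjCoeff E i j = invOp (ξ.coeffFun E i j) := by
  refine SmoothFun.ext fun x => ?_
  rw [adjCoeff_apply, ← ξ.mat_inv]
  rfl

/-- The functional `g ↦ ⟨q R_A(x, ·), g(·⁻¹)⟩`. -/
def kernelInv (A : SmoothFun E G →L[ℂ] SmoothFun E G) (x : G) (q : SmoothFun E G) :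
    SmoothFun E G →ₗ[ℂ] ℂ :=
  mulDist q (kernel A x) ∘ₗ invOp.toLinearMap

theorem kernelInv_apply (A : SmoothFun E G →L[ℂ] SmoothFun E G) (x : G) (q g : SmoothFun E G) :
    kernelInv A x q g = A (reflect x q * translate x⁻¹ g) x := by
  have h : reflect x (q * invOp g) = reflect x q * translate x⁻¹ g := by
    refine SmoothFun.ext fun z => ?_
    change q (z⁻¹ * x) * g (z⁻¹ * x)⁻¹ = q (z⁻¹ * x) * g (x⁻¹ * z)
    rw [mul_inv_rev, inv_inv]
  rw [← h]
  rfl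

/-- A Taylor factor `q(y⁻¹)` in the test function is moved onto the kernel. This is how difference
operators appear. -/
theorem kernelInv_mul (A : SmoothFun E G →L[ℂ] SmoothFun E G) (x : G) (q g : SmoothFun E G) :
    kernelInv A x 1 (invOp q * g) = kernelInv A x q g := by
  have h : reflect x 1 * translate x⁻¹ (invOp q * g) = reflect x q * translate x⁻¹ g := by
    refine SmoothFun.ext fun z => ?_
    change 1 * (q (x⁻¹ * z)⁻¹ * g (x⁻¹ * z)) = q (z⁻¹ * x) * g (x⁻¹ * z)
    rw [mul_inv_rev, inv_inv, one_mul]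
  rw [kernelInv_apply, kernelInv_apply, h]

theorem repMat_kernelInv (A : SmoothFun E G →L[ℂ] SmoothFun E G) (x : G) (q : SmoothFun E G)
    (ζ : UnitaryRep G) :
    repMat (kernelInv A x q) ζ = fourierCoeff (mulDist q (kernel A x)) ζ := by
  ext i j
  simp only [repMat, fourierCoeff, Matrix.of_apply, UnitaryRep.adjCoeff_eq_invOp]
  rfl

/-- The matrix entries of the symbol as smooth functions. -/
def symFun (B : SmoothFun E G →L[ℂ] SmoothFun E G) (ξ : UnitaryRep G) (i j : Fin ξ.dim) :
    SmoothFun E G := ∑ k, ξ.adjCoeff E i k * B (ξ.coeffFun E k j)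

theorem reflect_adjCoeff (ξ : UnitaryRep G) (x : G) (i j : Fin ξ.dim) :
    reflect x (ξ.adjCoeff E i j) = ∑ k, ξ.adjCoeff E i k x • ξ.coeffFun E k j := by
  refine SmoothFun.ext fun z => ?_
  change ξ.adjCoeff E i j (z⁻¹ * x) = _
  rw [UnitaryRep.adjCoeff_apply, ← ξ.mat_inv, mul_inv_rev, inv_inv, ξ.mat_mul, Matrix.mul_apply,
    SmoothFun.sum_apply]
  refine Finset.sum_congr rfl fun k _ => ?_
  rw [SmoothFun.smul_apply, UnitaryRep.coeffFun_apply, UnitaryRep.adjCoeff_apply, ← ξ.mat_inv]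

theorem symbol_apply (B : SmoothFun E G →L[ℂ] SmoothFun E G) (x : G) (ξ : UnitaryRep G)
    (i j : Fin ξ.dim) : symbol B x ξ i j = symFun B ξ i j x := by
  change B (reflect x (ξ.adjCoeff E i j)) x = _
  rw [reflect_adjCoeff, map_sum, symFun, SmoothFun.sum_apply, SmoothFun.sum_apply]
  refine Finset.sum_congr rfl fun k _ => ?_
  rw [map_smul]
  rfl

/-- From `σ_B = ξ^* (B ξ)` and unitarity, `B ξ = ξ σ_B`. -/
theorem sum_coeffFun_mul_symFun (B : SmoothFun E G →L[ℂ] SmoothFun E G) (ξ : UnitaryRep G)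
    (i j : Fin ξ.dim) : ∑ k, ξ.coeffFun E i k * symFun B ξ k j = B (ξ.coeffFun E i j) := by
  refine SmoothFun.ext fun z => ?_
  simp only [symFun, SmoothFun.sum_apply, SmoothFun.mul_apply, UnitaryRep.coeffFun_apply,
    UnitaryRep.adjCoeff_apply]
  have h : ∑ k, ξ.mat z i k * ∑ l, (ξ.mat z).conjTranspose k l * B (ξ.coeffFun E l j) z =
      ∑ l, (ξ.mat z * (ξ.mat z).conjTranspose) i l * B (ξ.coeffFun E l j) z := by
    simp only [Matrix.mul_apply, Finset.mul_sum, Finset.sum_mul]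
    rw [Finset.sum_comm]
    exact Finset.sum_congr rfl fun l _ => Finset.sum_congr rfl fun k _ => by ring
  rw [h, ξ.mat_mul_conjTranspose]
  simp [Matrix.one_apply]

/-- In the variable `y = x⁻¹ z` the test function is `ξ(y) σ_B(x y, ξ)`: an oscillating factor times
a function ready for Taylor expansion at the identity. -/
theorem symbol_comp_apply (A B : SmoothFun E G →L[ℂ] SmoothFun E G) (x : G) (ξ : UnitaryRep G)
    (i j : Fin ξ.dim) : symbol (A.comp B) x ξ i j =
      kernelInv A x 1 (∑ l, ξ.coeffFun E i l * translate x (symFun B ξ l j)) := by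
  have h : reflect x 1 * translate x⁻¹ (∑ l, ξ.coeffFun E i l * translate x (symFun B ξ l j)) =
      B (reflect x (ξ.adjCoeff E i j)) := by
    have h1 : ∀ k, B (ξ.adjCoeff E i k x • ξ.coeffFun E k j) =
        ξ.adjCoeff E i k x • ∑ l, ξ.coeffFun E k l * symFun B ξ l j := fun k => by
      rw [map_smul, sum_coeffFun_mul_symFun B ξ k j]
    rw [reflect_adjCoeff, map_sum B, Finset.sum_congr rfl fun k _ => h1 k]
    refine SmoothFun.ext fun z => ?_
    change 1 * (∑ l, ξ.coeffFun E i l * translate x (symFun B ξ l j)) (x⁻¹ * z) = _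
    rw [one_mul]
    simp only [SmoothFun.sum_apply, SmoothFun.smul_apply, SmoothFun.mul_apply, Finset.mul_sum]
    rw [Finset.sum_comm]
    refine Finset.sum_congr rfl fun l _ => ?_
    change ξ.mat (x⁻¹ * z) i l * symFun B ξ l j (x * (x⁻¹ * z)) = _
    rw [mul_inv_cancel_left, ξ.mat_mul, Matrix.mul_apply, Finset.sum_mul]
    refine Finset.sum_congr rfl fun k _ => ?_
    rw [UnitaryRep.adjCoeff_apply, ← ξ.mat_inv, UnitaryRep.coeffFun_apply]
    ring
  rw [kernelInv_apply, h]
  rfl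

variable {n : ℕ} (Y : Module.Basis (Fin n) ℝ (GroupLieAlgebra 𝓘(ℝ, E) G))

theorem leftInvOp_translate (k : ℕ) (c : (Fin n → ℕ) → ℂ) (x : G) (f : SmoothFun E G) :
    leftInvOp Y k c (translate x f) 1 = leftInvOp Y k c f x := by
  simp only [leftInvOp, partialDeriv_eq_wordOp, wordOp_translate]
  refine Finset.sum_congr rfl fun i _ => Finset.sum_congr rfl fun β _ => ?_
  change c β * wordOp Y (ordWord β) f (x * 1) = _
  rw [mul_one]

theorem derivSymbol_apply (D : (G → ℂ) → G → ℂ) (B : SmoothFun E G →L[ℂ] SmoothFun E G) (x : G)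
    (ξ : UnitaryRep G) (i j : Fin ξ.dim) : derivSymbol D B x ξ i j = D (symFun B ξ i j) x := by
  have : (fun x' => symbol B x' ξ i j) = symFun B ξ i j := funext fun x' => symbol_apply B x' ξ i j
  rw [derivSymbol, Matrix.of_apply, this]

/-- The remainder in the expansion of the symbol of a product. -/
def symbolRemainder (V : SmoothFun E G →ₗ[ℂ] SmoothFun E G) (q : SmoothFun E G)
    (A B : SmoothFun E G →L[ℂ] SmoothFun E G) (x : G) (ξ : UnitaryRep G) :
    Matrix (Fin ξ.dim) (Fin ξ.dim) ℂ :=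
  Matrix.of fun i j => kernelInv A x q (∑ l, ξ.coeffFun E i l * V (translate x (symFun B ξ l j)))

variable {Y}

/-- The exact expansion of the symbol of a product. -/
theorem symbol_comp_eq {r N : ℕ} {q : Fin r → SmoothFun E G} {c : (Fin r → ℕ) → (Fin n → ℕ) → ℂ}
    {V : (Fin r → ℕ) → SmoothFun E G →ₗ[ℂ] SmoothFun E G}
    (hV : ∀ (u : SmoothFun E G) (x : G), u x = ∑ k ∈ Finset.range (N + 1), ∑ α ∈ multiIdx r k,
        (multiFact α : ℂ)⁻¹ * qPow q α x⁻¹ * leftInvOp Y k (c α) u 1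
      + ∑ α ∈ multiIdx r (N + 1), qPow q α x⁻¹ * V α u x)
    (A B : SmoothFun E G →L[ℂ] SmoothFun E G) (x : G) (ξ : UnitaryRep G) :
    symbol (A.comp B) x ξ = ∑ k ∈ Finset.range (N + 1), ∑ α ∈ multiIdx r k,
        ((multiFact α : ℂ)⁻¹) • (diffSymbol q α A x ξ * derivSymbol (leftInvOp Y k (c α)) B x ξ) +
      ∑ α ∈ multiIdx r (N + 1), symbolRemainder (V α) (qPow q α) A B x ξ := by
  ext i j
  have hu : ∀ u : SmoothFun E G, u = ∑ k ∈ Finset.range (N + 1), ∑ α ∈ multiIdx r k,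
        ((multiFact α : ℂ)⁻¹ * leftInvOp Y k (c α) u 1) • invOp (qPow q α)
      + ∑ α ∈ multiIdx r (N + 1), invOp (qPow q α) * V α u := by
    intro u
    refine SmoothFun.ext fun z => ?_
    rw [hV u z]
    simp only [SmoothFun.add_apply, SmoothFun.sum_apply, SmoothFun.smul_apply]
    congr 1
    refine Finset.sum_congr rfl fun k _ => Finset.sum_congr rfl fun α _ => ?_
    change _ = _ * qPow q α z⁻¹
    ring
  have hl : ∀ l, kernelInv A x 1 (ξ.coeffFun E i l * translate x (symFun B ξ l j)) =
      ∑ k ∈ Finset.range (N + 1), ∑ α ∈ multiIdx r k, (multiFact α : ℂ)⁻¹ *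
        (diffSymbol q α A x ξ i l * derivSymbol (leftInvOp Y k (c α)) B x ξ l j) +
      ∑ α ∈ multiIdx r (N + 1), kernelInv A x (qPow q α)
        (ξ.coeffFun E i l * V α (translate x (symFun B ξ l j))) := by
    intro l
    conv_lhs => rw [hu (translate x (symFun B ξ l j))]
    rw [mul_add, map_add]
    simp only [Finset.mul_sum, map_sum, mul_smul_comm, map_smul, smul_eq_mul]
    congr 1
    · refine Finset.sum_congr rfl fun k _ => Finset.sum_congr rfl fun α _ => ?_
      rw [mul_comm (ξ.coeffFun E i l), kernelInv_mul, leftInvOp_translate, derivSymbol_apply,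
        diffSymbol, ← repMat_kernelInv, repMat, Matrix.of_apply]
      ring
    · refine Finset.sum_congr rfl fun α _ => ?_
      rw [mul_left_comm, kernelInv_mul]
  rw [symbol_comp_apply, map_sum, Finset.sum_congr rfl fun l _ => hl l, Finset.sum_add_distrib,
    Matrix.add_apply]
  simp only [Matrix.sum_apply, Matrix.smul_apply, Matrix.mul_apply, symbolRemainder,
    Matrix.of_apply, map_sum, smul_eq_mul, Finset.mul_sum]
  rw [Finset.sum_comm, Finset.sum_comm (s := Finset.univ)]
  congr 1
  refine Finset.sum_congr rfl fun k _ => ?_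
  rw [Finset.sum_comm]

end SymbolCalculus

/-! ### Orders of symbols and derivative bounds for `σ_B` -/

section SymbolOrder

open scoped Matrix.Norms.L2Operator

variable {E : Type*} [NormedAddCommGroup E] [NormedSpace ℝ E] [FiniteDimensional ℝ E]
  {G : Type*} [TopologicalSpace G] [ChartedSpace E G] [Group G] [LieGroup 𝓘(ℝ, E) ∞ G]
  [T2Space G] [CompactSpace G] (κ : BiInvariantMetric E G)
  {n : ℕ} (Y : Module.Basis (Fin n) ℝ (GroupLieAlgebra 𝓘(ℝ, E) G))

/-- The matrix-valued function `F` is `O(⟨ξ⟩^m)`. -/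
def HasOrder (F : G → (ξ : UnitaryRep G) → Matrix (Fin ξ.dim) (Fin ξ.dim) ℂ) (m : ℝ) : Prop :=
  ∃ C : ℝ, 0 ≤ C ∧ ∀ x ξ, opNorm (F x ξ) ≤ C * bracket κ Y ξ ^ m

variable {κ Y} {F F' : G → (ξ : UnitaryRep G) → Matrix (Fin ξ.dim) (Fin ξ.dim) ℂ} {m m' : ℝ}

theorem HasOrder.of_le {C : ℝ} (h : ∀ x ξ, opNorm (F x ξ) ≤ C * bracket κ Y ξ ^ m) :
    HasOrder κ Y F m := by
  refine ⟨|C|, abs_nonneg C, fun x ξ => (h x ξ).trans ?_⟩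
  have := bracket_pos κ Y ξ
  gcongr
  exact le_abs_self C

theorem HasOrder.mono (h : HasOrder κ Y F m) (hm : m ≤ m') : HasOrder κ Y F m' := by
  obtain ⟨C, hC0, hC⟩ := h
  refine ⟨C, hC0, fun x ξ => (hC x ξ).trans ?_⟩
  gcongr
  exact one_le_bracket κ Y ξ

theorem HasOrder.add (h : HasOrder κ Y F m) (h' : HasOrder κ Y F' m) :
    HasOrder κ Y (fun x ξ => F x ξ + F' x ξ) m := by
  obtain ⟨C, hC0, hC⟩ := h
  obtain ⟨C', hC'0, hC'⟩ := h'
  refine ⟨C + C', by positivity, fun x ξ => ?_⟩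
  have h1 := hC x ξ
  have h2 := hC' x ξ
  simp only [opNorm_eq_norm] at *
  rw [add_mul]
  exact (norm_add_le _ _).trans (add_le_add h1 h2)

theorem HasOrder.sum {ι : Type*} (s : Finset ι)
    {F : ι → G → (ξ : UnitaryRep G) → Matrix (Fin ξ.dim) (Fin ξ.dim) ℂ}
    (h : ∀ i ∈ s, HasOrder κ Y (F i) m) : HasOrder κ Y (fun x ξ => ∑ i ∈ s, F i x ξ) m := by
  classical
  induction s using Finset.induction_on with
  | empty => exact ⟨0, le_rfl, fun x ξ => by simp [opNorm_eq_norm]⟩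
  | insert i s hi ih =>
    simp only [Finset.sum_insert hi]
    exact (h i (by simp)).add (ih fun j hj => h j (by simp [hj]))

theorem HasOrder.smul (h : HasOrder κ Y F m) (a : ℂ) :
    HasOrder κ Y (fun x ξ => a • F x ξ) m := by
  obtain ⟨C, hC0, hC⟩ := h
  refine ⟨‖a‖ * C, by positivity, fun x ξ => ?_⟩
  have h1 := hC x ξ
  simp only [opNorm_eq_norm] at *
  rw [norm_smul, mul_assoc]
  gcongr

theorem HasOrder.mul (h : HasOrder κ Y F m) (h' : HasOrder κ Y F' m') :
    HasOrder κ Y (fun x ξ => F x ξ * F' x ξ) (m + m') := by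
  obtain ⟨C, hC0, hC⟩ := h
  obtain ⟨C', hC'0, hC'⟩ := h'
  refine ⟨C * C', by positivity, fun x ξ => ?_⟩
  have hb := bracket_pos κ Y ξ
  have h1 := hC x ξ
  have h2 := hC' x ξ
  simp only [opNorm_eq_norm] at *
  calc _ ≤ ‖F x ξ‖ * ‖F' x ξ‖ := norm_mul_le _ _
    _ ≤ (C * bracket κ Y ξ ^ m) * (C' * bracket κ Y ξ ^ m') := by gcongr
    _ = _ := by rw [Real.rpow_add hb]; ring

theorem HasOrder.leftInvOp {m δ : ℝ} (hδ : 0 ≤ δ) {B : SmoothFun E G →L[ℂ] SmoothFun E G}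
    (hB : ∀ β : Fin n → ℕ,
      HasOrder κ Y (derivSymbol (partialDeriv Y β) B) (m + δ * (∑ j, β j : ℕ)))
    (k : ℕ) (c : (Fin n → ℕ) → ℂ) :
    HasOrder κ Y (derivSymbol (leftInvOp Y k c) B) (m + δ * k) := by
  have h : derivSymbol (LieSymbol.leftInvOp Y k c) B = fun x ξ => ∑ i ∈ Finset.range (k + 1),
      ∑ β ∈ multiIdx n i, c β • derivSymbol (partialDeriv Y β) B x ξ := by
    funext x ξ
    ext i j
    simp only [derivSymbol, LieSymbol.leftInvOp, Matrix.of_apply, Matrix.sum_apply,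
      Matrix.smul_apply, smul_eq_mul]
  rw [h]
  refine HasOrder.sum _ fun i hi => HasOrder.sum _ fun β hβ => HasOrder.smul ?_ _
  refine (hB β).mono ?_
  rw [mem_multiIdx.1 hβ]
  have : (i : ℝ) ≤ k := by
    have := Finset.mem_range.1 hi
    exact_mod_cast (by omega : i ≤ k)
  gcongr

variable (B : SmoothFun E G →L[ℂ] SmoothFun E G)

/-- The sesquilinear form of the symbol as a smooth function. -/
def symSesq (ξ : UnitaryRep G) (a b : EuclideanSpace ℂ (Fin ξ.dim)) : SmoothFun E G :=
  ∑ l, ∑ j, (star (a l) * b j) • symFun B ξ l j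

theorem wordOp_ordWord_symSesq (β : Fin n → ℕ) (ξ : UnitaryRep G)
    (a b : EuclideanSpace ℂ (Fin ξ.dim)) (x : G) :
    wordOp Y (ordWord β) (symSesq B ξ a b) x =
      sesq (derivSymbol (partialDeriv Y β) B x ξ) a b := by
  simp only [symSesq, map_sum, map_smul, SmoothFun.sum_apply, SmoothFun.smul_apply, sesq,
    derivSymbol_apply, partialDeriv_eq_wordOp]

variable {B}

/-- The hypothesis concerns ordered monomials only. Other words are combinations of ordered
monomials of no greater order, and lower orders do no harm as `δ ≥ 0`. -/
theorem exists_norm_wordOp_symSesq_le {m δ : ℝ} (hδ : 0 ≤ δ)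
    (hB : ∀ β : Fin n → ℕ,
      HasOrder κ Y (derivSymbol (partialDeriv Y β) B) (m + δ * (∑ j, β j : ℕ)))
    (w : List (Fin n)) : ∃ C : ℝ, 0 ≤ C ∧ ∀ (ξ : UnitaryRep G)
      (a b : EuclideanSpace ℂ (Fin ξ.dim)) (x : G),
      ‖wordOp Y w (symSesq B ξ a b) x‖ ≤
        C * bracket κ Y ξ ^ (m + δ * w.length) * ‖a‖ * ‖b‖ := by
  have h := wordOp_mem_span_ordWord Y (E := E) (G := G) w
  generalize wordOp Y w = T at h
  induction h using Submodule.span_induction with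
  | mem T hT =>
    obtain ⟨β, hβ, rfl⟩ := hT
    obtain ⟨C, hC0, hC⟩ := hB β
    refine ⟨C, hC0, fun ξ a b x => ?_⟩
    rw [wordOp_ordWord_symSesq]
    refine (norm_sesq_le _ a b).trans ?_
    have h1 := hC x ξ
    rw [opNorm_eq_norm] at h1
    have h2 : bracket κ Y ξ ^ (m + δ * (∑ j, β j : ℕ)) ≤ bracket κ Y ξ ^ (m + δ * w.length) := by
      refine Real.rpow_le_rpow_of_exponent_le (one_le_bracket κ Y ξ) ?_
      have : ((∑ j, β j : ℕ) : ℝ) ≤ w.length := by exact_mod_cast hβ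
      gcongr
    have h3 := h1.trans (mul_le_mul_of_nonneg_left h2 hC0)
    gcongr
  | zero => exact ⟨0, le_rfl, fun ξ a b x => by simp⟩
  | add S T _ _ hS hT =>
    obtain ⟨C, hC0, hC⟩ := hS
    obtain ⟨C', hC'0, hC'⟩ := hT
    refine ⟨C + C', by positivity, fun ξ a b x => ?_⟩
    have h1 := hC ξ a b x
    have h2 := hC' ξ a b x
    rw [LinearMap.add_apply, SmoothFun.add_apply]
    refine (norm_add_le _ _).trans ((add_le_add h1 h2).trans_eq ?_)
    ring
  | smul r T _ hT =>
    obtain ⟨C, hC0, hC⟩ := hT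
    refine ⟨‖r‖ * C, by positivity, fun ξ a b x => ?_⟩
    rw [LinearMap.smul_apply, SmoothFun.smul_apply, norm_mul]
    refine (mul_le_mul_of_nonneg_left (hC ξ a b x) (norm_nonneg r)).trans_eq ?_
    ring

theorem exists_boundedBy_symSesq {m δ : ℝ} (hδ : 0 ≤ δ)
    (hB : ∀ β : Fin n → ℕ,
      HasOrder κ Y (derivSymbol (partialDeriv Y β) B) (m + δ * (∑ j, β j : ℕ)))
    (k : ℕ) : ∃ C : ℝ, 0 ≤ C ∧ ∀ (ξ : UnitaryRep G) (a b : EuclideanSpace ℂ (Fin ξ.dim)),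
      BoundedBy Y k (symSesq B ξ a b) (C * bracket κ Y ξ ^ (m + δ * k) * ‖a‖ * ‖b‖) := by
  choose C hC0 hC using exists_norm_wordOp_symSesq_le hδ hB
  have hfin : Set.Finite {w : List (Fin n) | w.length ≤ k} := List.finite_length_le (Fin n) k
  refine ⟨∑ w ∈ hfin.toFinset, C w, Finset.sum_nonneg fun w _ => hC0 w, fun ξ a b w hw x => ?_⟩
  refine (hC w ξ a b x).trans ?_
  have h1 : C w ≤ ∑ w ∈ hfin.toFinset, C w :=
    Finset.single_le_sum (fun w _ => hC0 w) (hfin.mem_toFinset.2 hw)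
  have h2 : bracket κ Y ξ ^ (m + δ * w.length) ≤ bracket κ Y ξ ^ (m + δ * k) := by
    refine Real.rpow_le_rpow_of_exponent_le (one_le_bracket κ Y ξ) ?_
    gcongr
  have := bracket_pos κ Y ξ
  have := (hC0 w).trans h1
  gcongr

/-- `V` costs `l` derivatives once, hence the factor `⟨ξ⟩^{δ l}`; each further derivative costs
`⟨ξ⟩^δ`, which becomes the scale. The constants of the finitely many words are added up. -/
theorem exists_scaledBound_symSesq {m δ : ℝ} (hδ : 0 ≤ δ)
    (hB : ∀ β : Fin n → ℕ,
      HasOrder κ Y (derivSymbol (partialDeriv Y β) B) (m + δ * (∑ j, β j : ℕ)))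
    {V : SmoothFun E G →ₗ[ℂ] SmoothFun E G} {l : ℕ} (hV : OrderLE Y V l) (k : ℕ) :
    ∃ C : ℝ, 0 ≤ C ∧ ∀ (ξ : UnitaryRep G) (a b : EuclideanSpace ℂ (Fin ξ.dim)) (x : G),
      ScaledBound Y (bracket κ Y ξ ^ δ) k (V (translate x (symSesq B ξ a b)))
        (C * bracket κ Y ξ ^ (m + δ * l) * ‖a‖ * ‖b‖) := by
  choose C hC0 hC using exists_boundedBy_symSesq hδ hB
  choose D hD0 hD using hV
  have hfin : Set.Finite {w : List (Fin n) | w.length ≤ k} := List.finite_length_le (Fin n) k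
  have hpos : ∀ w : List (Fin n), 0 ≤ D w * C (w.length + l) := fun w =>
    mul_nonneg (hD0 w) (hC0 _)
  refine ⟨∑ w ∈ hfin.toFinset, D w * C (w.length + l), Finset.sum_nonneg fun w _ => hpos w,
    fun ξ a b x w hw y => ?_⟩
  have hb := bracket_pos κ Y ξ
  refine (hD w _ _ ((hC (w.length + l) ξ a b).translate x) y).trans ?_
  have h1 : D w * C (w.length + l) ≤ ∑ w ∈ hfin.toFinset, D w * C (w.length + l) :=
    Finset.single_le_sum (fun w _ => hpos w) (hfin.mem_toFinset.2 hw)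
  have h2 : bracket κ Y ξ ^ (m + δ * (w.length + l : ℕ)) =
      bracket κ Y ξ ^ (m + δ * l) * (bracket κ Y ξ ^ δ) ^ w.length := by
    rw [← Real.rpow_natCast (bracket κ Y ξ ^ δ), ← Real.rpow_mul hb.le, ← Real.rpow_add hb]
    congr 1
    push_cast
    ring
  rw [h2]
  calc _ = D w * C (w.length + l) * (bracket κ Y ξ ^ (m + δ * l) * ‖a‖ * ‖b‖ *
        (bracket κ Y ξ ^ δ) ^ w.length) := by ring
    _ ≤ (∑ w ∈ hfin.toFinset, D w * C (w.length + l)) * (bracket κ Y ξ ^ (m + δ * l) * ‖a‖ * ‖b‖ *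
        (bracket κ Y ξ ^ δ) ^ w.length) := by gcongr
    _ = _ := by ring

end SymbolOrder

/-! ### The estimate of the remainder -/

section Remainder

open MeasureTheory
open scoped Matrix Matrix.Norms.L2Operator

variable {E : Type*} [NormedAddCommGroup E] [NormedSpace ℝ E] [FiniteDimensional ℝ E]
  {G : Type*} [TopologicalSpace G] [ChartedSpace E G] [Group G] [LieGroup 𝓘(ℝ, E) ∞ G]
  [T2Space G] [CompactSpace G]

/-- The functions `x ↦ (ξ(x)ᵀ \bar a)_l`. -/
def rowFun (ξ : UnitaryRep G) (a : EuclideanSpace ℂ (Fin ξ.dim)) (l : Fin ξ.dim) :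
    SmoothFun E G := ∑ i, star (a i) • ξ.coeffFun E i l

theorem lapOp_rowFun (κ : BiInvariantMetric E G) {n : ℕ}
    (Y : Module.Basis (Fin n) ℝ (GroupLieAlgebra 𝓘(ℝ, E) G)) (ξ : UnitaryRep G)
    (a : EuclideanSpace ℂ (Fin ξ.dim)) (l : Fin ξ.dim) :
    lapOp κ Y (rowFun (E := E) ξ a l) = (-lapEigenvalue κ Y ξ : ℂ) • rowFun ξ a l := by
  rw [rowFun, map_sum, Finset.smul_sum]
  refine Finset.sum_congr rfl fun i _ => ?_
  rw [map_smul, ξ.lapOp_coeffFun, smul_comm]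

/-- The witness is `ξ(z⁻¹) a`. By unitarity, freezing the oscillating factor at any `z` only
replaces the test vector by one that is no longer, so the constants do not depend on the dimension.
-/
theorem exists_star_eq_rowFun (ξ : UnitaryRep G) (a : EuclideanSpace ℂ (Fin ξ.dim)) (z : G) :
    ∃ a' : EuclideanSpace ℂ (Fin ξ.dim), ‖a'‖ ≤ ‖a‖ ∧
      ∀ l, rowFun (E := E) ξ a l z = star (a' l) := by
  refine ⟨Matrix.toEuclideanCLM (n := Fin ξ.dim) (𝕜 := ℂ) (ξ.mat z⁻¹) a, ?_, fun l => ?_⟩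
  · have h1 : ‖ξ.mat z⁻¹‖ ≤ 1 := ξ.norm_mat_le _
    calc _ ≤ ‖ξ.mat z⁻¹‖ * ‖a‖ := ContinuousLinearMap.le_opNorm
          (Matrix.toEuclideanCLM (n := Fin ξ.dim) (𝕜 := ℂ) (ξ.mat z⁻¹)) a
      _ ≤ 1 * ‖a‖ := by gcongr
      _ = ‖a‖ := one_mul _
  · change _ = star ((ξ.mat z⁻¹ *ᵥ a.ofLp) l)
    simp only [rowFun, SmoothFun.sum_apply, SmoothFun.smul_apply, UnitaryRep.coeffFun_apply,
      Matrix.mulVec, dotProduct, star_sum, star_mul', ξ.mat_inv, Matrix.conjTranspose_apply,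
      star_star]
    exact Finset.sum_congr rfl fun i _ => mul_comm _ _

/-- Testing the matrix against vectors reduces the operator norm to one scalar pairing, in the form
required by `exists_norm_functional_le`. -/
theorem sesq_symbolRemainder (V : SmoothFun E G →ₗ[ℂ] SmoothFun E G) (q : SmoothFun E G)
    (A B : SmoothFun E G →L[ℂ] SmoothFun E G) (x : G) (ξ : UnitaryRep G)
    (a b : EuclideanSpace ℂ (Fin ξ.dim)) :
    sesq (symbolRemainder V q A B x ξ) a b = kernelInv A x q
      (∑ l, rowFun ξ a l * ∑ j, b j • V (translate x (symFun B ξ l j))) := by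
  have h : ∑ l, rowFun ξ a l * ∑ j, b j • V (translate x (symFun B ξ l j)) =
      ∑ i, ∑ j, (star (a i) * b j) •
        ∑ l, ξ.coeffFun E i l * V (translate x (symFun B ξ l j)) := by
    simp only [rowFun, Finset.sum_mul, Finset.mul_sum, smul_mul_smul_comm, Finset.smul_sum]
    rw [Finset.sum_comm, Finset.sum_congr rfl fun j _ => Finset.sum_comm]
    exact Finset.sum_comm
  rw [h]
  simp only [sesq, symbolRemainder, Matrix.of_apply, map_sum, map_smul, smul_eq_mul]

theorem sum_rowFun_smul (V : SmoothFun E G →ₗ[ℂ] SmoothFun E G)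
    (B : SmoothFun E G →L[ℂ] SmoothFun E G) (x z : G) (ξ : UnitaryRep G)
    {a a' : EuclideanSpace ℂ (Fin ξ.dim)} (b : EuclideanSpace ℂ (Fin ξ.dim))
    (h : ∀ l, rowFun (E := E) ξ a l z = star (a' l)) :
    ∑ l, rowFun (E := E) ξ a l z • ∑ j, b j • V (translate x (symFun B ξ l j)) =
      V (translate x (symSesq B ξ a' b)) := by
  simp only [h, symSesq, map_sum, map_smul, Finset.smul_sum, smul_smul]

/-- Continuity of `A` in the test function topology enters here, through the smooth convergence of
Fourier series. -/
theorem tendsto_kernelInv_fourier [IsTopologicalGroup G] [SecondCountableTopology G]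
    [MeasurableSpace G] [BorelSpace G] (μ : Measure G) [IsProbabilityMeasure μ] [μ.IsHaarMeasure]
    (κ : BiInvariantMetric E G) {n : ℕ}
    (Y : Module.Basis (Fin n) ℝ (GroupLieAlgebra 𝓘(ℝ, E) G))
    (A : SmoothFun E G →L[ℂ] SmoothFun E G) (x : G) (q f : SmoothFun E G) :
    Filter.Tendsto (fun S : Finset (UnitaryDual G) =>
      kernelInv A x q (f - ∑ c ∈ S, proj μ c.rep f)) Filter.atTop (𝓝 0) := by
  simp only [kernelInv_apply]
  exact (((smoothNull_fourier μ κ Y f).translate x⁻¹).mul_left (reflect x q)).tendsto_apply A x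

/-- The splitting is used with `R = ⟨ξ⟩^θ` and `s = ⟨ξ⟩^δ ≤ R`. The two inequalities for `m` are the
high and the low frequency contributions. -/
theorem exists_hasOrder_symbolRemainder (κ : BiInvariantMetric E G) {n : ℕ}
    (Y : Module.Basis (Fin n) ℝ (GroupLieAlgebra 𝓘(ℝ, E) G)) :
    ∃ p : ℕ, ∀ (A B : SmoothFun E G →L[ℂ] SmoothFun E G) (q : SmoothFun E G)
      (V : SmoothFun E G →ₗ[ℂ] SmoothFun E G) (l K : ℕ) (m₂ δ θ σ m : ℝ),
      0 ≤ δ → δ ≤ θ → p ≤ σ →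
      m₂ + δ * l + θ * (p - σ) ≤ m → m₂ + δ * l - (1 - θ) * (2 * K) ≤ m →
      HasOrder κ Y (fun x ξ => fourierCoeff (mulDist q (kernel A x)) ξ) (-σ) →
      (∀ β : Fin n → ℕ,
        HasOrder κ Y (derivSymbol (partialDeriv Y β) B) (m₂ + δ * (∑ j, β j : ℕ))) →
      OrderLE Y V l → HasOrder κ Y (symbolRemainder V q A B) m := by
  have : IsTopologicalGroup G := topologicalGroup_of_lieGroup 𝓘(ℝ, E) ∞
  have : SecondCountableTopology G := ChartedSpace.secondCountable_of_sigmaCompact E G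
  borelize G
  let μ : Measure G := Measure.haarMeasure ⊤
  have hμ : IsProbabilityMeasure μ := ⟨by
    have := Measure.haarMeasure_self (K₀ := (⊤ : TopologicalSpace.PositiveCompacts G))
    simpa using this⟩
  obtain ⟨p, hp⟩ := exists_norm_functional_le μ κ Y
  refine ⟨p, fun A B q V l K m₂ δ θ σ m hδ hδθ hpσ hm1 hm2 hA hB hV => ?_⟩
  obtain ⟨C, hC0, hC⟩ := hp K
  obtain ⟨A₀, hA₀, hA⟩ := hA
  obtain ⟨D, hD0, hD⟩ := exists_scaledBound_symSesq hδ hB hV (2 * K)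
  refine ⟨C * A₀ * D * (1 + 2 ^ (2 * K)), by positivity, fun x ξ => ?_⟩
  have hb := bracket_pos κ Y ξ
  have hb1 := one_le_bracket κ Y ξ
  set t := bracket κ Y ξ with ht
  rw [opNorm_eq_norm]
  refine norm_le_of_sesq (by positivity) fun a b => ?_
  rw [sesq_symbolRemainder]
  have hs : 1 ≤ t ^ δ := Real.one_le_rpow hb1 hδ
  have hR : 1 ≤ t ^ θ := Real.one_le_rpow hb1 (hδ.trans hδθ)
  have h := hC (kernelInv A x q) (tendsto_kernelInv_fourier μ κ Y A x q) ξ ξ.dim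
    (fun l => rowFun ξ a l) (fun l => ∑ j, b j • V (translate x (symFun B ξ l j)))
    A₀ σ (D * t ^ (m₂ + δ * l) * ‖a‖ * ‖b‖) (t ^ δ) (t ^ θ) hpσ hA₀ hs hR
    (lapOp_rowFun κ Y ξ a) (fun ζ => by rw [repMat_kernelInv]; exact hA x ζ) (fun z => by
      obtain ⟨a', ha', h1⟩ := exists_star_eq_rowFun (E := E) ξ a z
      rw [sum_rowFun_smul V B x z ξ b h1]
      intro w hw y
      refine (hD ξ a' b x w hw y).trans ?_
      rw [← ht]
      gcongr)
  refine h.trans ?_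
  have e1 : (t ^ θ) ^ ((p : ℝ) - σ) = t ^ (θ * (p - σ)) := (Real.rpow_mul hb.le _ _).symm
  have e2 : ((t ^ θ + t ^ δ) / t) ^ (2 * K) ≤ 2 ^ (2 * K) * t ^ (-((1 - θ) * (2 * K))) := by
    have h1 : (t ^ θ + t ^ δ) / t ≤ 2 * t ^ (θ - 1) := by
      rw [Real.rpow_sub hb, Real.rpow_one]
      have : t ^ δ ≤ t ^ θ := Real.rpow_le_rpow_of_exponent_le hb1 hδθ
      rw [← mul_div_assoc]
      gcongr
      linarith
    calc _ ≤ (2 * t ^ (θ - 1)) ^ (2 * K) := by gcongr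
      _ = _ := by
        rw [mul_pow, ← Real.rpow_natCast (t ^ (θ - 1)), ← Real.rpow_mul hb.le]
        congr 2
        push_cast
        ring
  have e3 : t ^ (m₂ + δ * l) * t ^ (θ * (p - σ)) ≤ t ^ m := by
    rw [← Real.rpow_add hb]
    exact Real.rpow_le_rpow_of_exponent_le hb1 hm1
  have e4 : t ^ (m₂ + δ * l) * t ^ (-((1 - θ) * (2 * K))) ≤ t ^ m := by
    rw [← Real.rpow_add hb]
    exact Real.rpow_le_rpow_of_exponent_le hb1 (by linarith)
  rw [e1]
  calc _ ≤ C * A₀ * (D * t ^ (m₂ + δ * l) * ‖a‖ * ‖b‖) *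
        (t ^ (θ * (p - σ)) + 2 ^ (2 * K) * t ^ (-((1 - θ) * (2 * K)))) := by gcongr
    _ = C * A₀ * D * (t ^ (m₂ + δ * l) * t ^ (θ * (p - σ)) +
        2 ^ (2 * K) * (t ^ (m₂ + δ * l) * t ^ (-((1 - θ) * (2 * K))))) * ‖a‖ * ‖b‖ := by ring
    _ ≤ C * A₀ * D * (t ^ m + 2 ^ (2 * K) * t ^ m) * ‖a‖ * ‖b‖ := by gcongr
    _ = _ := by ring

end Remainder

end LieSymbol

end

/-! ### The composition formula -/

open scoped Manifold ContDiff in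
open LieSymbol in
theorem mainTheorem6 {E : Type*} [NormedAddCommGroup E] [NormedSpace ℝ E] [FiniteDimensional ℝ E]
    {G : Type*} [TopologicalSpace G] [ChartedSpace E G] [Group G] [LieGroup 𝓘(ℝ, E) ∞ G]
    [CompactSpace G] [T2Space G]
    {n : ℕ} (Y : Module.Basis (Fin n) ℝ (GroupLieAlgebra 𝓘(ℝ, E) G))
    (κ : BiInvariantMetric E G) :
    (∃ (r : ℕ) (q : Fin r → SmoothFun E G) (c : (Fin r → ℕ) → (Fin n → ℕ) → ℂ),
      IsTaylorSystem Y q c) ∧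
    ∀ (r : ℕ) (q : Fin r → SmoothFun E G) (c : (Fin r → ℕ) → (Fin n → ℕ) → ℂ),
      IsTaylorSystem Y q c →
      ∀ (m₁ m₂ ρ δ : ℝ), 0 ≤ δ → δ < ρ → δ < 1 →
      ∀ A B : SmoothFun E G →L[ℂ] SmoothFun E G,
      (∀ α : Fin r → ℕ, ∃ C : ℝ, ∀ (x : G) (ξ : UnitaryRep G),
        opNorm (diffSymbol q α A x ξ) ≤ C * bracket κ Y ξ ^ (m₁ - ρ * (∑ i, α i : ℕ))) →
      (∀ β : Fin n → ℕ, ∃ C : ℝ, ∀ (x : G) (ξ : UnitaryRep G),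
        opNorm (derivSymbol (partialDeriv Y β) B x ξ) ≤
          C * bracket κ Y ξ ^ (m₂ + δ * (∑ j, β j : ℕ))) →
      ∀ N : ℕ, ∃ C : ℝ, ∀ (x : G) (ξ : UnitaryRep G),
        opNorm (symbol (A.comp B) x ξ -
          ∑ k ∈ Finset.range N, ∑ α ∈ multiIdx r k,
            ((multiFact α : ℂ)⁻¹) •
              (diffSymbol q α A x ξ * derivSymbol (leftInvOp Y k (c α)) B x ξ))
          ≤ C * bracket κ Y ξ ^ (m₁ + m₂ - (ρ - δ) * N) := by
  refine ⟨exists_taylorSystem Y, ?_⟩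
  intro r q c hT m₁ m₂ ρ δ hδ hδρ hδ1 A B hA hB N
  have hA' : ∀ α : Fin r → ℕ,
      HasOrder κ Y (diffSymbol q α A) (m₁ - ρ * (∑ i, α i : ℕ)) := fun α =>
    HasOrder.of_le (hA α).choose_spec
  have hB' : ∀ β : Fin n → ℕ,
      HasOrder κ Y (derivSymbol (partialDeriv Y β) B) (m₂ + δ * (∑ j, β j : ℕ)) := fun β =>
    HasOrder.of_le (hB β).choose_spec
  obtain ⟨p, hp⟩ := exists_hasOrder_symbolRemainder κ Y (G := G)
  have hρ : 0 < ρ := hδ.trans_lt hδρ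
  -- `θ < 1` makes integration by parts gain, `θ > δ` puts the cut above the scale of `σ_B`, and `θ
  -- ρ > δ` lets the decay of high frequencies beat the loss in the Taylor remainder.
  obtain ⟨θ, hθ, hθ1⟩ := exists_between (max_lt hδ1 ((div_lt_one hρ).2 hδρ))
  have hδθ : δ < θ := (le_max_left _ _).trans_lt hθ
  have hθρ : δ < θ * ρ := (div_lt_iff₀ hρ).1 ((le_max_right _ _).trans_lt hθ)
  -- The expansion is carried further than `N`. In the last inequality the coefficient of `L + 1` on
  -- the left is `δ - θ ρ < 0`, so a large `L` works.
  obtain ⟨L, hL1, hL2, hL3⟩ : ∃ L : ℕ, N ≤ L ∧ (p : ℝ) ≤ ρ * (L + 1) - m₁ ∧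
      m₂ + δ * (L + 1) + θ * (p - (ρ * (L + 1) - m₁)) ≤ m₁ + m₂ - (ρ - δ) * N := by
    have t : Filter.Tendsto (fun L : ℕ => (L : ℝ) + 1) Filter.atTop Filter.atTop :=
      Filter.tendsto_atTop_add_const_right _ _ tendsto_natCast_atTop_atTop
    have h1 := (t.const_mul_atTop hρ).eventually_ge_atTop (p + m₁)
    have h2 := (t.const_mul_atTop (sub_pos.2 hθρ)).eventually_ge_atTop
      (θ * (p + m₁) - m₁ + (ρ - δ) * N)
    obtain ⟨L, h1, h2, h3⟩ := (h1.and (h2.and (Filter.eventually_ge_atTop N))).exists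
    exact ⟨L, h3, by linarith, by linarith⟩
  -- `K` is chosen after `L`, as it has to outweigh `δ (L + 1)`.
  obtain ⟨K, hK⟩ : ∃ K : ℕ,
      m₂ + δ * (L + 1) - (1 - θ) * (2 * K) ≤ m₁ + m₂ - (ρ - δ) * N := by
    have h1 : 0 < (1 - θ) * 2 := by linarith
    obtain ⟨K, hK⟩ := exists_nat_ge ((δ * (L + 1) - m₁ + (ρ - δ) * N) / ((1 - θ) * 2))
    rw [div_le_iff₀ h1] at hK
    exact ⟨K, by linarith⟩
  obtain ⟨V, hV, hVeq⟩ := hT.exists_remainder L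
  -- The terms of the longer expansion beyond `N` have order `m₁ + m₂ - (ρ - δ) k` and go into the
  -- error.
  have hterm : ∀ k, N ≤ k → ∀ α ∈ multiIdx r k, HasOrder κ Y (fun x ξ => ((multiFact α : ℂ)⁻¹) •
      (diffSymbol q α A x ξ * derivSymbol (leftInvOp Y k (c α)) B x ξ))
      (m₁ + m₂ - (ρ - δ) * N) := by
    intro k hk α hα
    refine (((hA' α).mul (HasOrder.leftInvOp hδ hB' k (c α))).mono ?_).smul _
    rw [mem_multiIdx.1 hα]
    have : (N : ℝ) ≤ k := by exact_mod_cast hk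
    nlinarith
  have hrem : ∀ α ∈ multiIdx r (L + 1),
      HasOrder κ Y (symbolRemainder (V α) (qPow q α) A B) (m₁ + m₂ - (ρ - δ) * N) := by
    intro α hα
    refine hp A B (qPow q α) (V α) (L + 1) K m₂ δ θ (ρ * (L + 1) - m₁) _ hδ hδθ.le hL2
      (by push_cast; exact hL3) (by push_cast; exact hK) ?_ hB' (hV α)
    refine HasOrder.mono (hA' α) ?_
    rw [mem_multiIdx.1 hα]
    push_cast
    linarith
  obtain ⟨C, -, hC⟩ := (HasOrder.sum (Finset.Ico N (L + 1)) fun k hk =>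
    HasOrder.sum (multiIdx r k) (hterm k (Finset.mem_Ico.1 hk).1)).add
      (HasOrder.sum (multiIdx r (L + 1)) hrem)
  refine ⟨C, fun x ξ => ?_⟩
  rw [symbol_comp_eq hVeq A B x ξ, ← Finset.sum_range_add_sum_Ico _ (by omega : N ≤ L + 1),
    add_assoc, add_sub_cancel_left]
  exact hC x ξ
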